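/- Let $p\ge 0$ and $s\ge 1$ be integers, $\mu=1/\sqrt s$, $d=s+1$. Let $\mathfrak u_0=\mathfrak u_0(p,s)$ be the real Lie algebra with Euclidean scalar product $\langle\cdot,\cdot\rangle$ and orthogonal complex structure $J$ which is the orthogonal sum of $\mathrm{span}\{H_1,G_1,H_2,G_2\}$ ($G_i=JH_i$; $H_i,G_i$ orthonormal), a Euclidean space $\mathfrak x^-$ of dimension $p$ and $\mathfrak x^+=J\mathfrak x^-$, with the brackets (all others being zero) $$[H_1,G_1]=G_1,\quad [H_2,G_2]=\mu G_2,\quad [H_1,X]=\tfrac12X\ (X\in\mathfrak x^\pm),\quad [H_2,X]=\pm\tfrac\mu2X\ (X\in\mathfrak x^\pm),$$ $$[X,Y]=\langle JX,Y\rangle G_1\ (X,Y\in\mathfrak x^-+\mathfrak x^+),\qquad [G_2,X]=-\mu JX\ (X\in\mathfrak x^-);$$ that is, $\mathfrak u_0$ is the semidirect sum of the elementary Kählerian algebra $\mathfrak e(p+1,1)=\mathrm{span}\{H_1,G_1\}+\mathfrak x^-+\mathfrak x^+$ and the key algebra $\mathfrak e(1,\mu)=\mathrm{span}\{H_2,G_2\}$.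 Put $\mathfrak b=\mathrm{span}\{H_1,H_2\}+\mathfrak x^-$, $B_0=H_1+\frac1\mu H_2$, and let $\mathfrak b_0$ be the orthogonal complement of $B_0$ in $\mathfrak b$. Terminology. A hypersurface of degree $d$ with basic polynomial $h$ (homogeneous of degree $d$, not a power of a polynomial of lower degree) is a smooth, relatively open, connected subset $\mathcal H\subset\{h=1\}\subset\mathbb R^n$; its canonical metric is $-\frac1d\partial^2h$ on tangent vectors, and $\mathcal H$ is called Riemannian if this metric is positive definite, and homogeneous if the identity component of $\mathrm{Aut}(h)=\{A\in GL(n,\mathbb R): h\circ A=h\}$ acts transitively on $\mathcal H$. The associated tube domain is $U=\mathbb R^n+i\mathcal V$, $\mathcal V=\mathbb R^+\mathcal H$, with the Kähler potential $-\frac4d\log h(\mathrm{Im}\,z)$. A normal J-algebra is a splittable solvable (solvable, all $\mathrm{ad}_X$ with real eigenvalues only) Kähler Lie algebra (the left-invariant $J$ is orthogonal and parallel) whose Kähler form is exact, $\langle X,JY\rangle=-\omega([X,Y])$ for a linear form $\omega$; it is of degree $d$ if the corresponding Lie group with left-invariant metric and complex structure is, up to scaling the metric, isomorphic to the Kählerian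 tube domain of a homogeneous Riemannian hypersurface of degree $d$. Then the following hold. 1. $\mathfrak u_0=\mathfrak b+J\mathfrak b$ and $\mathfrak b=\mathbb RB_0\oplus\mathfrak b_0$ are orthogonal decompositions, $J\mathfrak b$ is an Abelian ideal, $B_0$ is central in $\mathfrak b$, $\mathrm{ad}_{B_0}JX=\mathrm{ad}_XJB_0=JX$ for $X\in\mathfrak b$, and $\mathfrak u_0$ is a normal J-algebra of degree $d=s+1$. 2. The polynomial $h(\eta)=a_1(\mu a_2)^s-\frac12(\mu a_2)^{s-1}\langle X,X\rangle$, $\eta=a_1G_1+a_2G_2+X\in J\mathfrak b$, $X\in\mathfrak x^+$, is invariant under the adjoint action of $\mathfrak b_0$ on $J\mathfrak b$. Let $\mathcal B_0$ be the connected linear group on $J\mathfrak b$ with Lie algebra $\mathrm{ad}\,\mathfrak b_0|_{J\mathfrak b}$. The orbit $\mathcal H=\mathcal B_0(JB_0)\subset J\mathfrak b$ is a homogeneous Riemannian hypersurface of degree $d$ with basic polynomial $h$, and it has constant negative curvature. 3. $\mathfrak b_0$ is isomorphic to the Iwasawa algebra $\mathfrak a+\mathfrak n$ of $\mathfrak{so}(1,p+1)$,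 and through such an isomorphism the Iwasawa subgroup of $SO_0(1,p+1)$ acts simply transitively on $\mathcal H$ by linear transformations which preserve $h$. 4. The tube domain $U$ associated to $\mathcal H$ is a Siegel domain of type I ($\mathcal V$ is open, convex and contains no line), and, up to scaling the metric, $\mathfrak u_0$ is the Kähler Lie algebra for $U$. If $p\ge1$, then $U$ is a Riemannian symmetric space only if $d=2$. If $d=2$ (and $p\ge 0$), then $U$ is isometric to the Hermitian symmetric space $SO_0(2,p+2)/(SO(2)\times SO(p+2))$, with the invariant metric given by a positive multiple of the trace form. 5. If $d=3$, then $U$ is special Kähler, i.e. up to a constant factor (which is negative, as the special metric of the cone is negative definite) it is locally isometric to the projectivization of a Lagrangian cone $\mathcal C\subset T^*\mathbb C^{n+1}$ with the special metric $\frac{\gamma(v,v)}{\gamma(u,u)}-\left|\frac{\gamma(u,v)}{\gamma(u,u)}\right|^2$, where $n=p+2$ and $\gamma=i\omega(\cdot,\bar\cdot)$ for the standard symplectic form $\omega$. In fact $U$ is, up to scaling, the special Kähler submanifold of the Alekseevsky space $\mathcal T(p)$: $\mathfrak u_0$ is the special Kähler subalgebra of an Alekseevskian Lie algebra $\mathfrak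 l$, i.e. there is a splittable solvable metric Lie algebra $\mathfrak l=\mathfrak u+\tilde{\mathfrak u}$ with a quaternionic structure $\mathrm{span}\{J_1,J_2,J_3\}$ preserved by the Levi-Civita connection, such that $\mathfrak u=\mathfrak f_0\oplus\mathfrak u_0$ (orthogonal direct sum) is a subalgebra, $\mathfrak f_0$ is a key algebra with root $1$, $J_1|_{\mathfrak u_0}=J$, $\tilde{\mathfrak u}=J_2\mathfrak u\perp\mathfrak u$, $[\mathfrak u,\tilde{\mathfrak u}]\subset\tilde{\mathfrak u}$ and $[\tilde{\mathfrak u},\tilde{\mathfrak u}]\subset\mathfrak u$. -/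

import Mathlib

open scoped Manifold ContDiff Matrix

noncomputable section

namespace SpecialGeometry

/-! ## Metric Lie algebras -/

section MetricLieAlgebra

variable {L : Type*} [LieRing L] [LieAlgebra ℝ L]

/-- The Levi-Civita connection of the left-invariant metric `B`, restricted to left-invariant
vector fields: the (unique) torsion-free product for which every `nabla x` is skew for `B`. -/
structure IsLeviCivita (B : LinearMap.BilinForm ℝ L) (nabla : L →ₗ[ℝ] L →ₗ[ℝ] L) : Prop where
  torsion_free : ∀ x y, nabla x y - nabla y x = ⁅x, y⁆
  metric : ∀ x y z, B (nabla x y) z + B y (nabla x z) = 0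

/-- A Kähler Lie algebra: Euclidean scalar product, orthogonal parallel complex structure. -/
structure IsKahlerLieAlgebra (B : LinearMap.BilinForm ℝ L) (J : L →ₗ[ℝ] L) : Prop where
  symm : ∀ x y, B x y = B y x
  pos : ∀ x, x ≠ 0 → 0 < B x x
  sq : ∀ x, J (J x) = -x
  orth : ∀ x y, B (J x) (J y) = B x y
  parallel : ∃ nabla : L →ₗ[ℝ] L →ₗ[ℝ] L, IsLeviCivita B nabla ∧
    ∀ x y, nabla x (J y) = J (nabla x y)

variable (L) in
/-- Splittable solvable Lie algebras: solvable, and all `ad x` have only real eigenvalues. -/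
def IsSplittableSolvable [Module.Finite ℝ L] : Prop :=
  LieAlgebra.IsSolvable L ∧ ∀ x : L, (LieAlgebra.ad ℝ L x).charpoly.Splits

/-- A normal J-algebra: a splittable solvable Kähler Lie algebra with exact Kähler form. -/
structure IsNormalJAlgebra [Module.Finite ℝ L] (B : LinearMap.BilinForm ℝ L) (J : L →ₗ[ℝ] L) :
    Prop where
  kahler : IsKahlerLieAlgebra B J
  splittable : IsSplittableSolvable L
  exact_form : ∃ θ : L →ₗ[ℝ] ℝ, ∀ x y, θ ⁅x, y⁆ = -B x (J y)

/-- `span {H, J H} + x` is an elementary Kählerian Lie algebra with root `μ` and key algebra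
`span {H, J H}`. -/
structure IsElementaryKahler (B : LinearMap.BilinForm ℝ L) (J : L →ₗ[ℝ] L) (μ : ℝ) (H : L)
    (x : Submodule ℝ L) : Prop where
  root_pos : 0 < μ
  unit : B H H = 1
  orth : ∀ v ∈ x, B H v = 0 ∧ B (J H) v = 0
  invariant : ∀ v ∈ x, J v ∈ x
  key : ⁅H, J H⁆ = μ • J H
  ad_H : ∀ v ∈ x, ⁅H, v⁆ = (μ / 2) • v
  ad_G : ∀ v ∈ x, ⁅J H, v⁆ = 0
  bracket : ∀ v ∈ x, ∀ w ∈ x, ⁅v, w⁆ = (μ * B (J v) w) • J H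

/-- The whole algebra is the semidirect orthogonal sum `(f₁ + x₁) + f₂` of the elementary
algebra `e(p + 1, μ₁) = f₁ + x₁` and the key algebra `f₂ = e(1, μ₂)`, where `f_i` is spanned by
`H_i` and `G_i = J H_i`, and `x₁ = xm + J xm` is the weight decomposition for `f₂`. -/
structure IsRankTwoSum (B : LinearMap.BilinForm ℝ L) (J : L →ₗ[ℝ] L) (p : ℕ) (μ₁ μ₂ : ℝ)
    (H₁ H₂ : L) (xm : Submodule ℝ L) : Prop where
  elem₁ : IsElementaryKahler B J μ₁ H₁ (xm ⊔ xm.map J)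
  elem₂ : IsElementaryKahler B J μ₂ H₂ ⊥
  dim : Module.finrank ℝ xm = p
  span : Submodule.span ℝ {H₁, J H₁, H₂, J H₂} ⊔ xm ⊔ xm.map J = ⊤
  orth_x : ∀ v ∈ xm, ∀ w ∈ xm, B v (J w) = 0
  orth_HH : B H₁ H₂ = 0 ∧ B (J H₁) H₂ = 0 ∧ B H₁ (J H₂) = 0 ∧ B (J H₁) (J H₂) = 0
  orth_Hx : ∀ v ∈ xm ⊔ xm.map J, B H₂ v = 0 ∧ B (J H₂) v = 0
  comm : ⁅H₁, H₂⁆ = 0 ∧ ⁅J H₁, H₂⁆ = 0 ∧ ⁅H₁, J H₂⁆ = 0 ∧ ⁅J H₁, J H₂⁆ = 0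
  ad_H₂ : ∀ v ∈ xm, ⁅H₂, v⁆ = -(μ₂ / 2) • v ∧ ⁅H₂, J v⁆ = (μ₂ / 2) • J v
  ad_G₂ : ∀ v ∈ xm, ⁅J H₂, v⁆ = -μ₂ • J v ∧ ⁅J H₂, J v⁆ = 0

/-- The orthogonal decompositions `u₀ = b + J b` and `b = ℝ B₀ ⊕ b₀` of a normal J-algebra of
type I: `J b` is an Abelian ideal and `B₀` is in the centre of `b`. -/
structure IsTypeIDecomposition (B : LinearMap.BilinForm ℝ L) (J : L →ₗ[ℝ] L)
    (b b₀ : LieSubalgebra ℝ L) (B₀ : L) : Prop where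
  isCompl : IsCompl b.toSubmodule (b.toSubmodule.map J)
  orth : ∀ x ∈ b, ∀ y ∈ b, B x (J y) = 0
  abelian : ∀ x ∈ b, ∀ y ∈ b, ⁅J x, J y⁆ = 0
  ideal : ∀ u : L, ∀ x ∈ b, ⁅u, J x⁆ ∈ b.toSubmodule.map J
  mem : B₀ ∈ b
  ne_zero : B₀ ≠ 0
  le : b₀ ≤ b
  sum : ∀ x ∈ b, ∃ t : ℝ, ∃ y ∈ b₀, x = t • B₀ + y
  orth₀ : ∀ y ∈ b₀, B B₀ y = 0
  central : ∀ x ∈ b, ⁅B₀, x⁆ = 0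
  ad_B₀ : ∀ x ∈ b, ⁅B₀, J x⁆ = J x ∧ ⁅x, J B₀⁆ = J x

/-- An Alekseevskian Lie algebra: the metric Lie algebra of a left-invariant quaternionic Kähler
structure on a non-Abelian splittable solvable group; the quaternionic structure
`span {J₁, J₂, J₃}` is preserved by the Levi-Civita connection. -/
structure IsAlekseevskian [Module.Finite ℝ L] (B : LinearMap.BilinForm ℝ L)
    (J₁ J₂ J₃ : L →ₗ[ℝ] L) : Prop where
  symm : ∀ x y, B x y = B y x
  pos : ∀ x, x ≠ 0 → 0 < B x x
  sq₁ : ∀ x, J₁ (J₁ x) = -x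
  sq₂ : ∀ x, J₂ (J₂ x) = -x
  mul₁₂ : ∀ x, J₁ (J₂ x) = J₃ x
  mul₂₁ : ∀ x, J₂ (J₁ x) = -J₃ x
  orth₁ : ∀ x y, B (J₁ x) (J₁ y) = B x y
  orth₂ : ∀ x y, B (J₂ x) (J₂ y) = B x y
  parallel : ∃ nabla : L →ₗ[ℝ] L →ₗ[ℝ] L, IsLeviCivita B nabla ∧
    ∀ x, ∀ K ∈ ({J₁, J₂, J₃} : Set (L →ₗ[ℝ] L)),
      nabla x ∘ₗ K - K ∘ₗ nabla x ∈ Submodule.span ℝ {J₁, J₂, J₃}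
  splittable : IsSplittableSolvable L
  nonabelian : ∃ x y : L, ⁅x, y⁆ ≠ 0

/-- `(L, B, J)` is the special Kähler subalgebra `u₀` of an Alekseevskian Lie algebra
`l = u + ũ`, `u = f₀ ⊕ u₀`, `ũ = J₂ u`, where `f₀ = span {H₀, J₁ H₀}` is a key algebra with
root `1`, `u` is a subalgebra that is Kähler for `J₁`, `[u, ũ] ⊆ ũ` and `[ũ, ũ] ⊆ u`. -/
def IsSpecialKahlerSubalgebra (B : LinearMap.BilinForm ℝ L) (J : L →ₗ[ℝ] L) : Prop :=
  ∃ (l : Type) (_ : LieRing l) (_ : LieAlgebra ℝ l) (_ : Module.Finite ℝ l)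
    (Bl : LinearMap.BilinForm ℝ l) (J₁ J₂ J₃ : l →ₗ[ℝ] l) (i : L →ₗ⁅ℝ⁆ l) (H₀ : l)
    (u : Submodule ℝ l),
    IsAlekseevskian Bl J₁ J₂ J₃ ∧
    IsElementaryKahler Bl J₁ 1 H₀ ⊥ ∧
    (∀ x, Bl H₀ (i x) = 0 ∧ Bl (J₁ H₀) (i x) = 0 ∧ ⁅H₀, i x⁆ = 0 ∧ ⁅J₁ H₀, i x⁆ = 0) ∧
    (∀ x y, Bl (i x) (i y) = B x y) ∧
    (∀ x, J₁ (i x) = i (J x)) ∧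
    u = Submodule.span ℝ ({H₀, J₁ H₀} ∪ Set.range i) ∧
    u ⊔ u.map J₂ = ⊤ ∧
    (∀ x ∈ u, ∀ y ∈ u, Bl x (J₂ y) = 0) ∧
    (∀ x ∈ u, ∀ y ∈ u, ⁅x, J₂ y⁆ ∈ u.map J₂) ∧
    (∀ x ∈ u, ∀ y ∈ u, ⁅J₂ x, J₂ y⁆ ∈ u)

end MetricLieAlgebra

/-! ## Hypersurfaces defined by homogeneous polynomials -/

section Hypersurface

variable {ι : Type} [Fintype ι]

/-- A (real) hypersurface of degree `d` with basic polynomial `h`: a smooth, relatively open,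
connected subset of the level set `{h = 1}`, where `h` is homogeneous of degree `d` and not a
power of a polynomial of lower degree. -/
structure IsHypersurface (h : MvPolynomial ι ℝ) (d : ℕ) (H : Set (ι → ℝ)) : Prop where
  homogeneous : h.IsHomogeneous d
  not_pow : ¬ ∃ (q : MvPolynomial ι ℝ) (k : ℕ), q.totalDegree < d ∧ h = q ^ k
  relOpen : ∃ O : Set (ι → ℝ), IsOpen O ∧ H = O ∩ {x | MvPolynomial.eval x h = 1}
  connected : IsConnected H
  smooth : ∀ x ∈ H, ∃ i, MvPolynomial.eval x (MvPolynomial.pderiv i h) ≠ 0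

/-- The canonical metric `-(1/d) ∂²h` of a hypersurface of degree `d`, as a bilinear form on the
ambient space (to be evaluated on tangent vectors). -/
def canonicalMetric (h : MvPolynomial ι ℝ) (d : ℕ) (x v w : ι → ℝ) : ℝ :=
  -(1 / (d : ℝ)) *
    ∑ i, ∑ j, MvPolynomial.eval x (MvPolynomial.pderiv i (MvPolynomial.pderiv j h)) * v i * w j

/-- The differential of `h` at `x`. -/
def polyDeriv (h : MvPolynomial ι ℝ) (x v : ι → ℝ) : ℝ :=
  ∑ i, MvPolynomial.eval x (MvPolynomial.pderiv i h) * v i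

/-- A hypersurface of degree `d` whose canonical metric is positive definite on all tangent
spaces. -/
structure IsRiemannianHypersurface (h : MvPolynomial ι ℝ) (d : ℕ) (H : Set (ι → ℝ)) : Prop
    extends IsHypersurface h d H where
  pos : ∀ x ∈ H, ∀ v, v ≠ 0 → polyDeriv h x v = 0 → 0 < canonicalMetric h d x v v

/-- The linear group `Aut(h)` of invertible matrices preserving `h`. -/
def autGroup [DecidableEq ι] (h : MvPolynomial ι ℝ) : Set (Matrix ι ι ℝ) :=
  {A | IsUnit A.det ∧ ∀ x, MvPolynomial.eval (A *ᵥ x) h = MvPolynomial.eval x h}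

/-- The identity component of `Aut(h)` acts transitively on `H`. -/
def IsHomogeneousHypersurface [DecidableEq ι] (h : MvPolynomial ι ℝ) (H : Set (ι → ℝ)) : Prop :=
  (∀ A ∈ connectedComponentIn (autGroup h) 1, ∀ x ∈ H, A *ᵥ x ∈ H) ∧
  ∀ x ∈ H, ∀ y ∈ H, ∃ A ∈ connectedComponentIn (autGroup h) 1, A *ᵥ x = y

/-- Partial derivative of a function on `ℝ^m`. -/
def partialDeriv {m : ℕ} (i : Fin m) (f : (Fin m → ℝ) → ℝ) (x : Fin m → ℝ) : ℝ :=
  fderiv ℝ f x (Pi.single i 1)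

/-- Christoffel symbols `Γ^k_{ij}` of a metric `G` in coordinates. -/
def christoffel {m : ℕ} (G : (Fin m → ℝ) → Matrix (Fin m) (Fin m) ℝ) (k i j : Fin m)
    (x : Fin m → ℝ) : ℝ :=
  (1 / 2) * ∑ l, (G x)⁻¹ k l * (partialDeriv i (fun y => G y j l) x +
    partialDeriv j (fun y => G y i l) x - partialDeriv l (fun y => G y i j) x)

/-- The component `R^l_{kij}` of the curvature tensor, `R(∂_i, ∂_j) ∂_k = ∑ R^l_{kij} ∂_l`. -/
def curvature {m : ℕ} (G : (Fin m → ℝ) → Matrix (Fin m) (Fin m) ℝ) (l k i j : Fin m)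
    (x : Fin m → ℝ) : ℝ :=
  partialDeriv i (christoffel G l j k) x - partialDeriv j (christoffel G l i k) x +
    ∑ a, (christoffel G l i a x * christoffel G a j k x -
      christoffel G l j a x * christoffel G a i k x)

/-- The metric `G` has constant sectional curvature `κ` on `O`:
`R(X, Y) Z = κ (⟨Y, Z⟩ X - ⟨X, Z⟩ Y)`. -/
def HasConstantCurvatureOn {m : ℕ} (G : (Fin m → ℝ) → Matrix (Fin m) (Fin m) ℝ)
    (O : Set (Fin m → ℝ)) (κ : ℝ) : Prop :=
  ∀ x ∈ O, ∀ l k i j, curvature G l k i j x =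
    κ * ((if l = i then G x j k else 0) - (if l = j then G x i k else 0))

/-- The canonical metric of the hypersurface `H` has constant curvature `κ`: every point lies in
the image of a local parametrization in which this holds. -/
def HypersurfaceHasConstantCurvature (h : MvPolynomial ι ℝ) (d : ℕ) (H : Set (ι → ℝ))
    (κ : ℝ) : Prop :=
  ∀ x ∈ H, ∃ (O : Set (Fin (Fintype.card ι - 1) → ℝ))
    (σ : (Fin (Fintype.card ι - 1) → ℝ) → (ι → ℝ)),
    IsOpen O ∧ ContDiffOn ℝ ∞ σ O ∧ Set.InjOn σ O ∧ Set.MapsTo σ O H ∧ x ∈ σ '' O ∧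
    (∀ y ∈ O, Function.Injective (fderiv ℝ σ y)) ∧
    HasConstantCurvatureOn (fun y => Matrix.of fun i j =>
      canonicalMetric h d (σ y) (fderiv ℝ σ y (Pi.single i 1)) (fderiv ℝ σ y (Pi.single j 1))) O κ

/-! ## The tube domain of a hypersurface -/

/-- The cone `ℝ⁺ · H`. -/
def cone (H : Set (ι → ℝ)) : Set (ι → ℝ) := {y | ∃ t : ℝ, 0 < t ∧ ∃ x ∈ H, y = t • x}

/-- The tube domain `ℝ^n + i ℝ⁺ H`. -/
def tube (H : Set (ι → ℝ)) : Set (ι → ℂ) := {z | (fun i => (z i).im) ∈ cone H}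

/-- The tube domain over a convex open cone which contains no line is a Siegel domain of type I. -/
def IsSiegelDomainTypeI (V : Set (ι → ℝ)) : Prop :=
  IsOpen V ∧ V.Nonempty ∧ Convex ℝ V ∧ ∀ x v : ι → ℝ, v ≠ 0 → ¬ ∀ t : ℝ, x + t • v ∈ V

/-- The Riemannian metric `Re ∑ ∂²K/∂z_i∂z̄_j dz_i ⊗ dz̄_j` with Kähler potential `K`, written
through the real Hessian of `K`. -/
def metricOfPotential (K : (ι → ℂ) → ℝ) (z v w : ι → ℂ) : ℝ :=
  (1 / 4) * (iteratedFDeriv ℝ 2 K z ![v, w] +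
    iteratedFDeriv ℝ 2 K z ![Complex.I • v, Complex.I • w])

/-- The canonical metric of the tube domain, with Kähler potential `-(4/d) log h(Im z)`. -/
def tubeMetric (h : MvPolynomial ι ℝ) (d : ℕ) : (ι → ℂ) → (ι → ℂ) → (ι → ℂ) → ℝ :=
  metricOfPotential fun z => -(4 / (d : ℝ)) * Real.log (MvPolynomial.eval (fun i => (z i).im) h)

/-- The open subset `U` with Riemannian metric `g` is a Riemannian symmetric space: every point
is fixed by an involutive isometry with differential `-1` there. -/
def IsRiemannianSymmetric (U : Set (ι → ℂ)) (g : (ι → ℂ) → (ι → ℂ) → (ι → ℂ) → ℝ) : Prop :=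
  ∀ z ∈ U, ∃ σ : (ι → ℂ) → (ι → ℂ), Set.MapsTo σ U U ∧ ContDiffOn ℝ ∞ σ U ∧
    (∀ x ∈ U, σ (σ x) = x) ∧
    (∀ x ∈ U, ∀ v w, g (σ x) (fderiv ℝ σ x v) (fderiv ℝ σ x w) = g x v w) ∧
    σ z = z ∧ ∀ v, fderiv ℝ σ z v = -v

/-- The differential of `F : G → ℂ^n` at `x`, applied to the left-invariant vector field `v`. -/
def derivLeftInvariant {E : Type} [NormedAddCommGroup E] [NormedSpace ℝ E]
    {G : Type} [Group G] [TopologicalSpace G] [ChartedSpace E G] (F : G → (ι → ℂ)) (x : G)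
    (v : GroupLieAlgebra 𝓘(ℝ, E) G) : ι → ℂ :=
  mfderiv 𝓘(ℝ, E) 𝓘(ℝ, ι → ℂ) F x (mulInvariantVectorField v x)

/-- `(L, B, J)` is Kähler Lie algebra for the domain `U` with the Kähler metric `g`: there is a
Lie group `G` with Lie algebra `L`, such that `G` with the left-invariant metric and complex
structure defined by `B` and `J` is mapped onto `U` by a holomorphic isometric diffeomorphism
`F`. -/
def IsKahlerLieAlgebraFor {L : Type*} [LieRing L] [LieAlgebra ℝ L]
    (B : LinearMap.BilinForm ℝ L) (J : L →ₗ[ℝ] L) (U : Set (ι → ℂ))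
    (g : (ι → ℂ) → (ι → ℂ) → (ι → ℂ) → ℝ) : Prop :=
  ∃ (E : Type) (_ : NormedAddCommGroup E) (_ : NormedSpace ℝ E)
    (G : Type) (_ : Group G) (_ : TopologicalSpace G) (_ : ChartedSpace E G)
    (_ : LieGroup 𝓘(ℝ, E) ∞ G)
    (φ : GroupLieAlgebra 𝓘(ℝ, E) G ≃ₗ[ℝ] L) (F : G → (ι → ℂ)) (F' : (ι → ℂ) → G),
    (∀ v w : GroupLieAlgebra 𝓘(ℝ, E) G, φ ⁅v, w⁆ = ⁅φ v, φ w⁆) ∧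
    ContMDiff 𝓘(ℝ, E) 𝓘(ℝ, ι → ℂ) ∞ F ∧ ContMDiffOn 𝓘(ℝ, ι → ℂ) 𝓘(ℝ, E) ∞ F' U ∧
    Set.range F = U ∧ (∀ x, F' (F x) = x) ∧
    (∀ (x : G) (v w : GroupLieAlgebra 𝓘(ℝ, E) G),
      g (F x) (derivLeftInvariant F x v) (derivLeftInvariant F x w) = B (φ v) (φ w)) ∧
    ∀ (x : G) (v : GroupLieAlgebra 𝓘(ℝ, E) G),
      derivLeftInvariant F x (φ.symm (J (φ v))) = Complex.I • derivLeftInvariant F x v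

/-- `(L, B, J)` is of degree `d`: up to scaling the metric, it is Kähler Lie algebra for the
Kählerian tube domain associated to a homogeneous Riemannian hypersurface of degree `d`. -/
def IsOfDegree {L : Type*} [LieRing L] [LieAlgebra ℝ L]
    (B : LinearMap.BilinForm ℝ L) (J : L →ₗ[ℝ] L) (d : ℕ) : Prop :=
  ∃ (κ : Type) (_ : Fintype κ) (_ : DecidableEq κ) (h : MvPolynomial κ ℝ) (H : Set (κ → ℝ))
    (c : ℝ), 0 < c ∧ IsRiemannianHypersurface h d H ∧ IsHomogeneousHypersurface h H ∧
    IsKahlerLieAlgebraFor B J (tube H) fun z v w => c * tubeMetric h d z v w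

end Hypersurface

/-! ## Special Kähler domains -/

section Special

/-- The standard complex symplectic vector space `T*ℂ^κ`. -/
abbrev CotangentSpace (κ : Type) : Type := (κ → ℂ) × (κ → ℂ)

variable {κ : Type} [Fintype κ]

/-- The standard symplectic form on `T*ℂ^κ`. -/
def symp (x y : CotangentSpace κ) : ℂ := ∑ k, (x.1 k * y.2 k - x.2 k * y.1 k)

/-- The Hermitian form `γ(x, y) = i ω(x, τ y)`, with `τ` the complex conjugation. -/
def gam (x y : CotangentSpace κ) : ℂ := Complex.I * symp x (star y)

/-- Lagrangian (that is, maximally isotropic) subspaces. -/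
def IsLagrangian (Λ : Submodule ℂ (CotangentSpace κ)) : Prop :=
  ∀ x, x ∈ Λ ↔ ∀ y ∈ Λ, symp x y = 0

/-- A properly nondegenerate Lagrangian cone: a connected complex submanifold, invariant under
positive scalings, whose tangent spaces are Lagrangian and nondegenerate for `γ`, and on which
`γ(v, v)` does not vanish. -/
structure IsLagrangianCone (C : Set (CotangentSpace κ)) : Prop where
  connected : IsConnected C
  conic : ∀ t : ℝ, 0 < t → ∀ v ∈ C, (t : ℂ) • v ∈ C
  chart : ∀ v ∈ C, ∃ (O : Set (κ → ℂ)) (W : Set (CotangentSpace κ))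
    (σ : (κ → ℂ) → CotangentSpace κ) (τ : CotangentSpace κ → (κ → ℂ)),
    IsOpen O ∧ IsOpen W ∧ v ∈ W ∧ DifferentiableOn ℂ σ O ∧ σ '' O = C ∩ W ∧
    ContinuousOn τ (C ∩ W) ∧ (∀ x ∈ O, τ (σ x) = x) ∧
    ∀ x ∈ O, Function.Injective (fderiv ℂ σ x) ∧
      IsLagrangian (LinearMap.range (fderiv ℂ σ x : (κ → ℂ) →ₗ[ℂ] CotangentSpace κ)) ∧
      ∀ a, (∀ b, gam (fderiv ℂ σ x a) (fderiv ℂ σ x b) = 0) → a = 0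
  proper : ∀ v ∈ C, gam v v ≠ 0

/-- The special metric of the projectivized cone at the point represented by `u`, evaluated on
the image of the vector `v`. -/
def specialMetric (u v : CotangentSpace κ) : ℝ :=
  (gam v v / gam u u).re - ‖gam u v / gam u u‖ ^ 2

/-- The domain `U` with Kähler metric `g` is special Kähler: up to a common factor `-c < 0` it is
locally holomorphically isometric to projectivized Lagrangian cones with their special metrics;
the local isometries are given through holomorphic lifts `f` to the cone. -/
def IsSpecialKahler {ι : Type} [Fintype ι] (U : Set (ι → ℂ))
    (g : (ι → ℂ) → (ι → ℂ) → (ι → ℂ) → ℝ) : Prop :=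
  ∃ c : ℝ, 0 < c ∧ ∀ z₀ ∈ U, ∃ (C : Set (CotangentSpace (Option ι))) (O : Set (ι → ℂ))
    (f : (ι → ℂ) → CotangentSpace (Option ι)),
    IsLagrangianCone C ∧ IsOpen O ∧ z₀ ∈ O ∧ O ⊆ U ∧ DifferentiableOn ℂ f O ∧
    Set.MapsTo f O C ∧ (∀ z ∈ O, ∀ w ∈ O, ∀ a : ℂ, f z = a • f w → z = w) ∧
    ∀ z ∈ O, ∀ v, g z v v = -c * specialMetric (f z) (fderiv ℂ f z v)

end Special

/-! ## Matrix groups -/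

section Groups

attribute [local instance] Matrix.normedAddCommGroup Matrix.normedSpace
attribute [local instance 100] LieRing.ofAssociativeRing

/-- The group `SO(k, l)`. -/
def SO (k l : ℕ) : Set (Matrix (Fin k ⊕ Fin l) (Fin k ⊕ Fin l) ℝ) :=
  {g | gᵀ * LieAlgebra.Orthogonal.indefiniteDiagonal (Fin k) (Fin l) ℝ * g =
    LieAlgebra.Orthogonal.indefiniteDiagonal (Fin k) (Fin l) ℝ ∧ g.det = 1}

/-- The identity component `SO₀(k, l)`. -/
def SO₀ (k l : ℕ) : Set (Matrix (Fin k ⊕ Fin l) (Fin k ⊕ Fin l) ℝ) :=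
  connectedComponentIn (SO k l) 1

/-- The Riemannian domain `(U, g)` is isometric to the symmetric space
`SO₀(k, l) / (SO(k) × SO(l))`: there is a smooth map `F` from `SO₀(k, l)` onto `U` whose fibres
are the cosets of `SO(k) × SO(l)`, such that the induced bijection is an isometry for the
invariant metric that is given by `c` times the trace form on the symmetric matrices in
`so(k, l)`. -/
def IsIsometricToSymmetricSpace {ι : Type} [Fintype ι] (k l : ℕ) (U : Set (ι → ℂ))
    (g : (ι → ℂ) → (ι → ℂ) → (ι → ℂ) → ℝ) : Prop :=
  ∃ (c : ℝ) (O : Set (Matrix (Fin k ⊕ Fin l) (Fin k ⊕ Fin l) ℝ))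
    (F : Matrix (Fin k ⊕ Fin l) (Fin k ⊕ Fin l) ℝ → (ι → ℂ)),
    0 < c ∧ IsOpen O ∧ SO₀ k l ⊆ O ∧ ContDiffOn ℝ ∞ F O ∧ F '' SO₀ k l = U ∧
    (∀ a ∈ SO₀ k l, ∀ b ∈ SO₀ k l, F a = F b ↔
      ∃ A ∈ Matrix.specialOrthogonalGroup (Fin k) ℝ,
        ∃ D ∈ Matrix.specialOrthogonalGroup (Fin l) ℝ, b = a * Matrix.fromBlocks A 0 0 D) ∧
    ∀ a ∈ SO₀ k l, ∀ ξ ∈ LieAlgebra.Orthogonal.so' (Fin k) (Fin l) ℝ,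
      ∀ η ∈ LieAlgebra.Orthogonal.so' (Fin k) (Fin l) ℝ, ξᵀ = ξ → ηᵀ = η →
        g (F a) (fderiv ℝ F a (a * ξ)) (fderiv ℝ F a (a * η)) = c * (ξ * η).trace

/-- The subgroup generated by the exponentials of the elements of `S`; for a Lie algebra `S` of
matrices this is the connected matrix group with Lie algebra `S`. -/
def expGroup {n : Type} [Fintype n] [DecidableEq n] (S : Set (Matrix n n ℝ)) :
    Subgroup (Matrix n n ℝ)ˣ :=
  Subgroup.closure {g | ∃ X ∈ S, (g : Matrix n n ℝ) = NormedSpace.exp X}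

/-- The generator of the one-dimensional maximal Abelian subspace `𝔞` of symmetric matrices in
`so(1, p + 1)`. -/
def boost (p : ℕ) : Matrix (Fin 1 ⊕ Fin (p + 1)) (Fin 1 ⊕ Fin (p + 1)) ℝ :=
  Matrix.single (Sum.inl 0) (Sum.inr 0) 1 + Matrix.single (Sum.inr 0) (Sum.inl 0) 1

/-- The Iwasawa algebra `𝔞 + 𝔫` of `so(1, p + 1)`: the subalgebra generated by `𝔞` and by the
root spaces of the positive restricted roots. -/
def iwasawaAlgebra (p : ℕ) :
    LieSubalgebra ℝ (Matrix (Fin 1 ⊕ Fin (p + 1)) (Fin 1 ⊕ Fin (p + 1)) ℝ) :=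
  LieSubalgebra.lieSpan ℝ _ ({boost p} ∪
    {N | N ∈ LieAlgebra.Orthogonal.so' (Fin 1) (Fin (p + 1)) ℝ ∧
      ∃ r : ℝ, 0 < r ∧ ⁅boost p, N⁆ = r • N})

/-- The Iwasawa subgroup of `SO₀(1, p + 1)`. -/
def iwasawaGroup (p : ℕ) :
    Subgroup (Matrix (Fin 1 ⊕ Fin (p + 1)) (Fin 1 ⊕ Fin (p + 1)) ℝ)ˣ :=
  expGroup (iwasawaAlgebra p : Set (Matrix (Fin 1 ⊕ Fin (p + 1)) (Fin 1 ⊕ Fin (p + 1)) ℝ))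

end Groups

/-! ## The algebras `u₀(p, s)` -/

section U0

/-- Index set of the coordinates `(a₁, a₂, X)` with `X ∈ ℝ^p`. -/
abbrev Idx (p : ℕ) : Type := Fin 2 ⊕ Fin p

/-- The root `μ = 1/√s`. -/
def mu (s : ℕ) : ℝ := 1 / Real.sqrt s

/-- The underlying space of `u₀(p, s) = b + J b`. The pair `(x, y)` stands for
`x₁ H₁ + x₂ H₂ + X + y₁ G₁ + y₂ G₂ + J Y`, where `X, Y ∈ ℝ^p = x₁₂⁻`, `G_i = J H_i`, and where
`x₁, x₂, X` (`y₁, y₂, Y`) are the components of `x` (of `y`). -/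
def U0 (p _s : ℕ) : Type := (Idx p → ℝ) × (Idx p → ℝ)

variable (p s : ℕ)

instance : AddCommGroup (U0 p s) := inferInstanceAs (AddCommGroup ((Idx p → ℝ) × (Idx p → ℝ)))
instance : Module ℝ (U0 p s) := inferInstanceAs (Module ℝ ((Idx p → ℝ) × (Idx p → ℝ)))
instance : Module.Finite ℝ (U0 p s) :=
  inferInstanceAs (Module.Finite ℝ ((Idx p → ℝ) × (Idx p → ℝ)))

variable {p}

/-- The bracket on `b = span {H₁, H₂} + x₁₂⁻`:
`[H₁, X] = (1/2) X`, `[H₂, X] = -(μ/2) X`, `[H₁, H₂] = 0`, `[X, Y] = 0`. -/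
def bracketB (x y : Idx p → ℝ) : Idx p → ℝ :=
  Sum.elim 0 fun i =>
    (x (Sum.inl 0) - mu s * x (Sum.inl 1)) / 2 * y (Sum.inr i) -
      (y (Sum.inl 0) - mu s * y (Sum.inl 1)) / 2 * x (Sum.inr i)

/-- The bracket of an element of `b` with an element of `J b = span {G₁, G₂} + x₁₂⁺`:
`[H₁, G₁] = G₁`, `[H₂, G₂] = μ G₂`, `[H₁, J Y] = (1/2) J Y`, `[H₂, J Y] = (μ/2) J Y`,
`[X, J Y] = ⟨X, Y⟩ G₁`, `[X, G₂] = μ J X`, and `[H₁, G₂] = [H₂, G₁] = [X, G₁] = 0`. -/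
def rho (x y : Idx p → ℝ) : Idx p → ℝ :=
  Sum.elim
    ![x (Sum.inl 0) * y (Sum.inl 0) + ∑ i, x (Sum.inr i) * y (Sum.inr i),
      mu s * x (Sum.inl 1) * y (Sum.inl 1)]
    fun i => (x (Sum.inl 0) + mu s * x (Sum.inl 1)) / 2 * y (Sum.inr i) +
      mu s * y (Sum.inl 1) * x (Sum.inr i)

variable (p)

/-- The Lie bracket of `u₀(p, s)`; `J b` is Abelian. -/
instance : Bracket (U0 p s) (U0 p s) where
  bracket u v := ((bracketB s u.1 v.1, rho s u.1 v.2 - rho s v.1 u.2) :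
    (Idx p → ℝ) × (Idx p → ℝ))

theorem U0.bracket_def (u v : U0 p s) :
    ⁅u, v⁆ = ((bracketB s u.1 v.1, rho s u.1 v.2 - rho s v.1 u.2) :
      (Idx p → ℝ) × (Idx p → ℝ)) := rfl

theorem rho_bracketB (x y z : Idx p → ℝ) :
    rho s (bracketB s x y) z = rho s x (rho s y z) - rho s y (rho s x z) := by
  funext i
  rcases i with i | i
  · fin_cases i
    · simp only [rho, bracketB, Sum.elim_inl, Sum.elim_inr, Pi.sub_apply, Pi.zero_apply,
        Fin.zero_eta, Matrix.cons_val_zero, Matrix.cons_val_one, zero_mul, zero_add,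
        sub_mul, mul_add, Finset.sum_add_distrib, Finset.sum_sub_distrib]
      have e1 : ∀ a b : ℝ, ∑ i, x (Sum.inr i) * (a * b * y (Sum.inr i)) =
          ∑ i, y (Sum.inr i) * (a * b * x (Sum.inr i)) := fun a b =>
        Finset.sum_congr rfl fun i _ => by ring
      have e2 : ∀ a : ℝ, ∑ i, a * y (Sum.inr i) * z (Sum.inr i) =
          a * ∑ i, y (Sum.inr i) * z (Sum.inr i) := fun a => by
        rw [Finset.mul_sum]; exact Finset.sum_congr rfl fun i _ => by ring
      have e3 : ∀ a : ℝ, ∑ i, a * x (Sum.inr i) * z (Sum.inr i) =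
          a * ∑ i, x (Sum.inr i) * z (Sum.inr i) := fun a => by
        rw [Finset.mul_sum]; exact Finset.sum_congr rfl fun i _ => by ring
      have e4 : ∀ a : ℝ, ∑ i, x (Sum.inr i) * (a * z (Sum.inr i)) =
          a * ∑ i, x (Sum.inr i) * z (Sum.inr i) := fun a => by
        rw [Finset.mul_sum]; exact Finset.sum_congr rfl fun i _ => by ring
      have e5 : ∀ a : ℝ, ∑ i, y (Sum.inr i) * (a * z (Sum.inr i)) =
          a * ∑ i, y (Sum.inr i) * z (Sum.inr i) := fun a => by
        rw [Finset.mul_sum]; exact Finset.sum_congr rfl fun i _ => by ring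
      rw [e1, e2, e3, e4, e5]
      ring
    · simp [rho, bracketB]
      ring
  · simp [rho, bracketB]
    ring

theorem bracketB_jacobi (x y z : Idx p → ℝ) :
    bracketB s x (bracketB s y z) =
      bracketB s (bracketB s x y) z + bracketB s y (bracketB s x z) := by
  funext i
  rcases i with i | i
  · simp [bracketB]
  · simp [bracketB]
    ring

theorem bracketB_add (x y z : Idx p → ℝ) :
    bracketB s x (y + z) = bracketB s x y + bracketB s x z := by
  funext i
  rcases i with i | i
  · simp [bracketB]
  · simp [bracketB]
    ring

theorem bracketB_smul (t : ℝ) (x y : Idx p → ℝ) :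
    bracketB s x (t • y) = t • bracketB s x y := by
  funext i
  rcases i with i | i
  · simp [bracketB]
  · simp [bracketB]
    ring

theorem bracketB_self (x : Idx p → ℝ) : bracketB s x x = 0 := by
  funext i
  rcases i with i | i <;> simp [bracketB]

theorem bracketB_swap (x y : Idx p → ℝ) : bracketB s x y = -bracketB s y x := by
  funext i
  rcases i with i | i <;> simp [bracketB]

theorem rho_add (x y z : Idx p → ℝ) : rho s x (y + z) = rho s x y + rho s x z := by
  funext i
  rcases i with i | i
  · fin_cases i
    · simp [rho, mul_add, Finset.sum_add_distrib]
      ring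
    · simp [rho]
      ring
  · simp [rho]
    ring

theorem rho_smul (t : ℝ) (x y : Idx p → ℝ) : rho s x (t • y) = t • rho s x y := by
  funext i
  rcases i with i | i
  · fin_cases i
    · simp [rho, mul_add, Finset.mul_sum, mul_left_comm]
    · simp [rho]
      ring
  · simp [rho]
    ring

theorem add_rho (x y z : Idx p → ℝ) : rho s (x + y) z = rho s x z + rho s y z := by
  funext i
  rcases i with i | i
  · fin_cases i
    · simp [rho, add_mul, Finset.sum_add_distrib]
      ring
    · simp [rho]
      ring
  · simp [rho]
    ring

theorem smul_rho (t : ℝ) (x y : Idx p → ℝ) : rho s (t • x) y = t • rho s x y := by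
  funext i
  rcases i with i | i
  · fin_cases i
    · simp [rho, mul_add, Finset.mul_sum, mul_assoc]
    · simp [rho]
      ring
  · simp [rho]
    ring

instance : LieRing (U0 p s) where
  add_lie u v w := by
    refine Prod.ext ?_ ?_
    · change bracketB s (u.1 + v.1) w.1 = bracketB s u.1 w.1 + bracketB s v.1 w.1
      rw [bracketB_swap, bracketB_add, neg_add, ← bracketB_swap, ← bracketB_swap]
    · change rho s (u.1 + v.1) w.2 - rho s w.1 (u.2 + v.2) =
        (rho s u.1 w.2 - rho s w.1 u.2) + (rho s v.1 w.2 - rho s w.1 v.2)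
      rw [add_rho, rho_add]
      abel
  lie_add u v w := by
    refine Prod.ext ?_ ?_
    · exact bracketB_add p s _ _ _
    · change rho s u.1 (v.2 + w.2) - rho s (v.1 + w.1) u.2 =
        (rho s u.1 v.2 - rho s v.1 u.2) + (rho s u.1 w.2 - rho s w.1 u.2)
      rw [add_rho, rho_add]
      abel
  lie_self u := by
    refine Prod.ext ?_ ?_
    · exact bracketB_self p s _
    · exact sub_self _
  leibniz_lie u v w := by
    refine Prod.ext ?_ ?_
    · exact bracketB_jacobi p s _ _ _
    · change rho s u.1 (rho s v.1 w.2 - rho s w.1 v.2) - rho s (bracketB s v.1 w.1) u.2 =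
        (rho s (bracketB s u.1 v.1) w.2 - rho s w.1 (rho s u.1 v.2 - rho s v.1 u.2)) +
        (rho s v.1 (rho s u.1 w.2 - rho s w.1 u.2) - rho s (bracketB s u.1 w.1) v.2)
      have rho_sub : ∀ x y z : Idx p → ℝ, rho s x (y - z) = rho s x y - rho s x z := by
        intro x y z
        rw [sub_eq_add_neg, rho_add, ← neg_one_smul ℝ z, rho_smul, neg_one_smul,
          ← sub_eq_add_neg]
      rw [rho_bracketB, rho_bracketB, rho_bracketB, rho_sub, rho_sub, rho_sub]
      abel

instance : LieAlgebra ℝ (U0 p s) where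
  lie_smul t u v := by
    refine Prod.ext ?_ ?_
    · exact bracketB_smul p s _ _ _
    · change rho s u.1 (t • v.2) - rho s (t • v.1) u.2 = t • (rho s u.1 v.2 - rho s v.1 u.2)
      rw [rho_smul, smul_rho, smul_sub]

/-- The Euclidean scalar product of `u₀(p, s)`; the basis of the `H_i`, `G_i` and of the standard
bases of `x₁₂⁻` and `x₁₂⁺ = J x₁₂⁻` is orthonormal. -/
def metric : LinearMap.BilinForm ℝ (U0 p s) :=
  LinearMap.mk₂ ℝ (fun u v => u.1 ⬝ᵥ v.1 + u.2 ⬝ᵥ v.2)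
    (fun u v w => by
      change (u.1 + v.1) ⬝ᵥ w.1 + (u.2 + v.2) ⬝ᵥ w.2 = _
      rw [add_dotProduct, add_dotProduct]
      ring)
    (fun t u v => by
      change (t • u.1) ⬝ᵥ v.1 + (t • u.2) ⬝ᵥ v.2 = _
      rw [smul_dotProduct, smul_dotProduct, smul_add])
    (fun u v w => by
      change u.1 ⬝ᵥ (v.1 + w.1) + u.2 ⬝ᵥ (v.2 + w.2) = _
      rw [dotProduct_add, dotProduct_add]
      ring)
    (fun t u v => by
      change u.1 ⬝ᵥ (t • v.1) + u.2 ⬝ᵥ (t • v.2) = _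
      rw [dotProduct_smul, dotProduct_smul, smul_add])

/-- The complex structure of `u₀(p, s)`. -/
def complexStructure : U0 p s →ₗ[ℝ] U0 p s where
  toFun u := ((-u.2, u.1) : (Idx p → ℝ) × (Idx p → ℝ))
  map_add' u v := by
    refine Prod.ext ?_ rfl
    exact neg_add u.2 v.2
  map_smul' t u := by
    refine Prod.ext ?_ rfl
    exact (smul_neg t u.2).symm

/-- The element of `b` with the given coordinates. -/
def inB (x : Idx p → ℝ) : U0 p s := ((x, 0) : (Idx p → ℝ) × (Idx p → ℝ))

/-- The element `a₁ G₁ + a₂ G₂ + X` of `J b` with the given coordinates. -/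
def inJB (y : Idx p → ℝ) : U0 p s := ((0, y) : (Idx p → ℝ) × (Idx p → ℝ))

/-- The generators `H₁`, `H₂` of the Cartan subalgebra. -/
def genH (i : Fin 2) : U0 p s := inB p s (Pi.single (Sum.inl i) 1)

/-- The subspace `x₁₂⁻`. -/
def xMinus : Submodule ℝ (U0 p s) :=
  Submodule.span ℝ (Set.range fun i : Fin p => inB p s (Pi.single (Sum.inr i) 1))

/-- The vector `B₀ = H₁ + (1/μ) H₂`. -/
def vecB₀ : U0 p s := genH p s 0 + (1 / mu s) • genH p s 1

/-- The subalgebra `b = span {H₁, H₂} + x₁₂⁻`. -/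
def algB : LieSubalgebra ℝ (U0 p s) where
  carrier := {u | u.2 = 0}
  add_mem' {u v} hu hv := by
    change u.2 + v.2 = 0
    rw [show u.2 = 0 from hu, show v.2 = 0 from hv, add_zero]
  zero_mem' := rfl
  smul_mem' t u hu := by
    change t • u.2 = 0
    rw [show u.2 = 0 from hu, smul_zero]
  lie_mem' {u v} hu hv := by
    change rho s u.1 v.2 - rho s v.1 u.2 = 0
    have h0 : ∀ x : Idx p → ℝ, rho s x 0 = 0 := fun x => by
      have := rho_smul p s 0 x 0
      simpa using this
    rw [show u.2 = 0 from hu, show v.2 = 0 from hv, h0, h0, sub_zero]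

/-- The subalgebra `b₀`, the orthogonal complement of `B₀` in `b`. -/
def algB₀ : LieSubalgebra ℝ (U0 p s) where
  carrier := {u | u ∈ algB p s ∧ metric p s (vecB₀ p s) u = 0}
  add_mem' {u v} hu hv := ⟨add_mem hu.1 hv.1, by rw [map_add, hu.2, hv.2, add_zero]⟩
  zero_mem' := ⟨zero_mem _, map_zero _⟩
  smul_mem' t u hu := ⟨(algB p s).smul_mem t hu.1, by rw [map_smul, hu.2, smul_zero]⟩
  lie_mem' {u v} hu hv := by
    refine ⟨(algB p s).lie_mem hu.1 hv.1, ?_⟩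
    have hx : ∀ i : Fin p, (vecB₀ p s).1 (Sum.inr i) = 0 := fun i => by
      change (Pi.single (Sum.inl 0) 1 : Idx p → ℝ) (Sum.inr i) +
        (1 / mu s) • (Pi.single (Sum.inl 1) 1 : Idx p → ℝ) (Sum.inr i) = 0
      simp
    have hy : (vecB₀ p s).2 = 0 := by
      change (0 : Idx p → ℝ) + (1 / mu s) • (0 : Idx p → ℝ) = 0
      simp
    change (vecB₀ p s).1 ⬝ᵥ bracketB s u.1 v.1 + (vecB₀ p s).2 ⬝ᵥ _ = 0
    rw [hy, zero_dotProduct, add_zero]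
    simp [dotProduct, Fintype.sum_sum_type, hx, bracketB]

/-- The matrix of `ad u` restricted to the ideal `J b`, in the coordinates `(a₁, a₂, X)`. -/
def adJB (u : U0 p s) : Matrix (Idx p) (Idx p) ℝ :=
  Matrix.of fun i j => (⁅u, inJB p s (Pi.single j 1)⁆ : U0 p s).2 i

/-- The group `B₀` acting on `J b`, the connected linear group with Lie algebra `ad b₀`. -/
def groupB₀ : Subgroup (Matrix (Idx p) (Idx p) ℝ)ˣ := expGroup (adJB p s '' algB₀ p s)

/-- The coordinates of the vector `J B₀ ∈ J b`. -/
def vecJB₀ : Idx p → ℝ := (complexStructure p s (vecB₀ p s)).2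

/-- The orbit `B₀ (J B₀) ⊆ J b`. -/
def orbit : Set (Idx p → ℝ) :=
  {y | ∃ g ∈ groupB₀ p s, y = (g : Matrix (Idx p) (Idx p) ℝ) *ᵥ vecJB₀ p s}

/-- The polynomial `h(η) = a₁ (μ a₂)^s - (1/2) (μ a₂)^(s-1) ⟨X, X⟩`. -/
def basicPoly : MvPolynomial (Idx p) ℝ :=
  MvPolynomial.X (Sum.inl 0) * (MvPolynomial.C (mu s) * MvPolynomial.X (Sum.inl 1)) ^ s -
    MvPolynomial.C (1 / 2) * (MvPolynomial.C (mu s) * MvPolynomial.X (Sum.inl 1)) ^ (s - 1) *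
      ∑ i : Fin p, MvPolynomial.X (Sum.inr i) ^ 2

/-- The Iwasawa subgroup of `SO₀(1, p + 1)` acts simply transitively on the orbit `B₀ (J B₀)`, by
linear transformations preserving `h`, through a representation `R` whose differential is an
isomorphism `φ` of the Iwasawa algebra with `b₀`, followed by the adjoint action on `J b`. -/
def IwasawaActsSimplyTransitively
    (φ : iwasawaAlgebra p ≃ₗ⁅ℝ⁆ algB₀ p s) : Prop :=
  ∃ R : iwasawaGroup p →* (Matrix (Idx p) (Idx p) ℝ)ˣ,
    (∀ (g : iwasawaGroup p) (X : iwasawaAlgebra p),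
      ((g : (Matrix (Fin 1 ⊕ Fin (p + 1)) (Fin 1 ⊕ Fin (p + 1)) ℝ)ˣ) :
        Matrix (Fin 1 ⊕ Fin (p + 1)) (Fin 1 ⊕ Fin (p + 1)) ℝ) = NormedSpace.exp X.1 →
      (R g : Matrix (Idx p) (Idx p) ℝ) = NormedSpace.exp (adJB p s (φ X))) ∧
    (∀ g y, MvPolynomial.eval ((R g : Matrix (Idx p) (Idx p) ℝ) *ᵥ y) (basicPoly p s) =
      MvPolynomial.eval y (basicPoly p s)) ∧
    (∀ g, ∀ y ∈ orbit p s, (R g : Matrix (Idx p) (Idx p) ℝ) *ᵥ y ∈ orbit p s) ∧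
    ∀ y ∈ orbit p s, ∀ z ∈ orbit p s, ∃! g, (R g : Matrix (Idx p) (Idx p) ℝ) *ᵥ y = z

end U0

end SpecialGeometry

end

open SpecialGeometry

noncomputable section

namespace SpecialGeometry

/-! ## Splittable solvable Lie algebras -/

section Splittable

open Polynomial

/-! Everything is governed by one simply transitive linear action. In the coordinates (a₁, a₂, X) of
J𝔟 the operators ad x, x ∈ 𝔟, are the maps `rho`, and `rho x (JB₀) = x`. Hence the group of 𝔟,
written out as `act`, moves JB₀ through an open cone on which its elements serve as coordinates. The
polynomial factors as h = (μa₂)^(s-1) q with q = a₁μa₂ - |X|²/2, and `act x` multiplies μa₂ by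
exp(μx₂) and q by exp(x₁ + μx₂). So h is multiplied by exp(x₁ + sμx₂); as sμ = 1/μ, the kernel of
this character has Lie algebra 𝔟₀. This yields the invariance of h, and it identifies the orbit with
the sheet a₂ > 0 of {h = 1} (`mem_orbit_iff`). The cone over the orbit is the forward light cone a₂
> 0, q > 0 (`mem_cone_orbit_iff`), convex by the reversed Cauchy-Schwarz inequality.

The form -∂² log h, called `logHess`, is invariant under `act` because log h only changes by a
constant, and at JB₀ it is the Euclidean product (`logHess_act`, `logHess_vecJB₀`). Together with
the real translations the group acts simply transitively on the tube domain, and its orbit map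
`tubeMap` is holomorphic and, up to the factor s + 1, isometric. In the chosen coordinates left
translations are affine, which makes the Lie algebra of this group computable; it is 𝔲₀.

With τ = log(μa₂) and W = X/(μa₂) the canonical metric of the orbit becomes s dτ² +
e^((s+1)τ)|dW|²/(s+1), hyperbolic space in horospherical coordinates, of curvature -(s+1)²/(4s). The
group 𝓑₀ and the Iwasawa group of SO₀(1, p+1) are both images of ℝ ⋉ ℝ^p (`IwaParam`), and in both
the exponential sends (t, W) to (t, `expInt t` W), so the isomorphism of the algebras integrates.

A symmetric tube domain has parallel curvature. Isometries are treated in a left-invariant frame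
(`LeftFrame`), and one component of ∇R = 0, evaluated on X ∈ 𝔵⁻ and JX, reads μ(μ² - 1) = 0, so s =
1. Conversely, for s = 1 the first two columns of a matrix in SO₀(2, p+2), paired to a complex
vector, form an isotropic vector on which the Hermitian form is positive. Its affine coordinates in
a light-cone frame give the map `symMap` onto the tube; `lform_lift` compares the metrics, and the
group of the tube, embedded by `tubeMat`, gives surjectivity.

For s = 2 let C be the symmetric trilinear form of h. The graph of the differential of F(X⁰, X) =
C(X, X, X)/X⁰ is a Lagrangian cone, containing the lift `specialLift` of the tube, and on this lift
γ equals 8h(Im z) (`gam_coneTangent`); hence the special metric and the tube metric agree up to the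
factor -4/3. The Alekseevskian algebra `AlekT` is the extension of 𝔲₀ by the key algebra 𝔣₀ and by a
symplectic representation whose raising operators are built from C. Its quaternionic structure is
verified through the explicit covariant derivatives `nabla_J₁` and `nabla_J₂`. -/

theorem splits_charpoly_of_aeval_eq_zero {V : Type*} [AddCommGroup V] [Module ℝ V]
    [Module.Finite ℝ V] (f : Module.End ℝ V) (P : ℝ[X]) (hP : P.Splits) (hP0 : P ≠ 0)
    (h : aeval f P = 0) : f.charpoly.Splits := by
  let b := Module.finBasis ℝ V
  let M := LinearMap.toMatrix b b f
  have hM : M.charpoly = f.charpoly := LinearMap.charpoly_toMatrix f b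
  have hMP : aeval M P = 0 := by
    have : aeval (LinearMap.toMatrixAlgEquiv b f) P = LinearMap.toMatrixAlgEquiv b (aeval f P) :=
      aeval_algHom_apply (LinearMap.toMatrixAlgEquiv b).toAlgHom f P
    rw [h, map_zero] at this
    exact this
  rw [← hM]
  -- It suffices that all complex eigenvalues are real. By spectral mapping, `P a` lies in the
  -- spectrum of `P(M) = 0` for each eigenvalue `a`, so `a` is a root of `P`, and these roots are
  -- real.
  refine Splits.of_splits_map (algebraMap ℝ ℂ) (IsAlgClosed.splits _) fun a ha => ?_
  have hr : IsRoot (M.charpoly.map (algebraMap ℝ ℂ)) a := isRoot_of_mem_roots ha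
  rw [← Matrix.charpoly_map, ← Matrix.mem_spectrum_iff_isRoot_charpoly] at hr
  have h2 : eval a (P.map (algebraMap ℝ ℂ)) ∈
      spectrum ℂ (aeval (M.map (algebraMap ℝ ℂ)) (P.map (algebraMap ℝ ℂ))) :=
    spectrum.subset_polynomial_aeval _ _ ⟨a, hr, rfl⟩
  have h3 : aeval (M.map (algebraMap ℝ ℂ)) (P.map (algebraMap ℝ ℂ)) = 0 := by
    rw [aeval_map_algebraMap]
    have : aeval ((Algebra.ofId ℝ ℂ).mapMatrix M) P = (Algebra.ofId ℝ ℂ).mapMatrix (aeval M P) :=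
      aeval_algHom_apply _ _ _
    rw [hMP, map_zero] at this
    exact this
  rw [h3] at h2
  have h4 : eval a (P.map (algebraMap ℝ ℂ)) = 0 := by
    by_contra hne
    refine h2 ?_
    rw [spectrum.mem_resolventSet_iff, sub_zero]
    exact (IsUnit.mk0 _ hne).map (algebraMap ℂ _)
  exact hP.mem_range_of_isRoot hP0 h4

/-- An endomorphism for which a finite composition of operators `f - c` vanishes has only real
eigenvalues. -/
theorem splits_charpoly_of_list {V : Type*} [AddCommGroup V] [Module ℝ V]
    [Module.Finite ℝ V] (f : Module.End ℝ V) (l : List ℝ)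
    (h : ∀ v, l.foldl (fun v c => f v - c • v) v = 0) : f.charpoly.Splits := by
  refine splits_charpoly_of_aeval_eq_zero f (l.map fun c => X - C c).prod ?_ ?_ ?_
  · refine Splits.listProd fun q hq => ?_
    obtain ⟨c, -, rfl⟩ := List.mem_map.1 hq
    exact Splits.X_sub_C c
  · refine List.prod_ne_zero fun hq => ?_
    obtain ⟨c, -, hc⟩ := List.mem_map.1 hq
    exact X_sub_C_ne_zero c hc
  · have key : ∀ (l : List ℝ) (v : V), aeval f (l.map fun c => X - C c).prod v =
        l.foldl (fun v c => f v - c • v) v := by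
      intro l
      induction l with
      | nil => intro v; simp
      | cons c l ih =>
        intro v
        rw [List.map_cons, List.prod_cons, mul_comm, map_mul, Module.End.mul_apply, ih]
        simp
    ext v
    rw [key, h]
    rfl

/-- By induction the derived series stays below the chain. The members of the chain need not be
ideals, or even be known to be subalgebras, which keeps the verification to coordinate conditions.
-/
theorem isSolvable_of_chain {L : Type*} [LieRing L] [LieAlgebra ℝ L] (S : ℕ → Submodule ℝ L)
    (h0 : S 0 = ⊤) (hS : ∀ k, ∀ x ∈ S k, ∀ y ∈ S k, ⁅x, y⁆ ∈ S (k + 1)) (n : ℕ) (hn : S n = ⊥) :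
    LieAlgebra.IsSolvable L := by
  have key : ∀ k, (LieAlgebra.derivedSeries ℝ L k).toSubmodule ≤ S k := by
    intro k
    induction k with
    | zero => rw [h0]; exact le_top
    | succ k ih =>
      rw [LieAlgebra.derivedSeries_def, LieAlgebra.derivedSeriesOfIdeal_succ,
        LieSubmodule.lieIdeal_oper_eq_linear_span', Submodule.span_le]
      rintro _ ⟨x, hx, y, hy, rfl⟩
      exact hS k x (ih hx) y (ih hy)
  refine LieAlgebra.IsSolvable.mk (R := ℝ) (k := n) ?_
  rw [← LieSubmodule.toSubmodule_eq_bot, ← le_bot_iff, ← hn]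
  exact key n

end Splittable

/-! ## Coordinates on `b` -/

section Coordinates

variable {p : ℕ}

/-- The component of a vector of `b` (or `J b`) in `ℝ^p`. -/
def tail (x : Idx p → ℝ) : Fin p → ℝ := fun i => x (Sum.inr i)

/-- The vector with coordinates `(a₁, a₂, X)`. -/
def vec (a b : ℝ) (X : Fin p → ℝ) : Idx p → ℝ := Sum.elim ![a, b] X

@[simp] theorem vec_inl_zero (a b : ℝ) (X : Fin p → ℝ) : vec a b X (Sum.inl 0) = a := rfl
@[simp] theorem vec_inl_one (a b : ℝ) (X : Fin p → ℝ) : vec a b X (Sum.inl 1) = b := rfl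
@[simp] theorem vec_inr (a b : ℝ) (X : Fin p → ℝ) (i : Fin p) : vec a b X (Sum.inr i) = X i := rfl
@[simp] theorem tail_vec (a b : ℝ) (X : Fin p → ℝ) : tail (vec a b X) = X := rfl
@[simp] theorem tail_add (x y : Idx p → ℝ) : tail (x + y) = tail x + tail y := rfl
@[simp] theorem tail_sub (x y : Idx p → ℝ) : tail (x - y) = tail x - tail y := rfl
@[simp] theorem tail_neg (x : Idx p → ℝ) : tail (-x) = -tail x := rfl
@[simp] theorem tail_zero : tail (0 : Idx p → ℝ) = 0 := rfl
@[simp] theorem tail_smul (t : ℝ) (x : Idx p → ℝ) : tail (t • x) = t • tail x := rfl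
theorem tail_apply (x : Idx p → ℝ) (i : Fin p) : tail x i = x (Sum.inr i) := rfl

@[simp] theorem tail_single_inl (i : Fin 2) (t : ℝ) :
    tail (Pi.single (Sum.inl i) t : Idx p → ℝ) = 0 := by
  funext j; simp [tail]

theorem idx_ext {x y : Idx p → ℝ} (h0 : x (Sum.inl 0) = y (Sum.inl 0))
    (h1 : x (Sum.inl 1) = y (Sum.inl 1)) (h2 : tail x = tail y) : x = y := by
  funext i
  rcases i with i | i
  · fin_cases i
    · exact h0
    · exact h1
  · exact congrFun h2 i

@[simp] theorem vec_eta (x : Idx p → ℝ) : vec (x (Sum.inl 0)) (x (Sum.inl 1)) (tail x) = x :=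
  idx_ext rfl rfl rfl

theorem dotProduct_idx (x y : Idx p → ℝ) : x ⬝ᵥ y =
    x (Sum.inl 0) * y (Sum.inl 0) + x (Sum.inl 1) * y (Sum.inl 1) + tail x ⬝ᵥ tail y := by
  simp [dotProduct, Fintype.sum_sum_type, tail]

variable (s : ℕ)

@[simp] theorem rho_inl_zero (x y : Idx p → ℝ) :
    rho s x y (Sum.inl 0) = x (Sum.inl 0) * y (Sum.inl 0) + tail x ⬝ᵥ tail y := rfl
@[simp] theorem rho_inl_one (x y : Idx p → ℝ) :
    rho s x y (Sum.inl 1) = mu s * x (Sum.inl 1) * y (Sum.inl 1) := rfl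
@[simp] theorem tail_rho (x y : Idx p → ℝ) : tail (rho s x y) =
    ((x (Sum.inl 0) + mu s * x (Sum.inl 1)) / 2) • tail y + (mu s * y (Sum.inl 1)) • tail x := rfl
@[simp] theorem bracketB_inl (x y : Idx p → ℝ) (i : Fin 2) :
    bracketB s x y (Sum.inl i) = 0 := rfl
@[simp] theorem tail_bracketB (x y : Idx p → ℝ) : tail (bracketB s x y) =
    ((x (Sum.inl 0) - mu s * x (Sum.inl 1)) / 2) • tail y -
      ((y (Sum.inl 0) - mu s * y (Sum.inl 1)) / 2) • tail x := rfl

theorem mu_pos {s : ℕ} (hs : 1 ≤ s) : 0 < mu s := by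
  have : (0 : ℝ) < s := by exact_mod_cast hs
  unfold mu
  positivity

theorem mu_sq {s : ℕ} : (s : ℝ) * mu s ^ 2 = if s = 0 then 0 else 1 := by
  split_ifs with h
  · simp [h]
  · have : (0 : ℝ) < s := by positivity
    rw [mu, div_pow, Real.sq_sqrt this.le]
    field_simp

/-- This normalization ties the root of the second key algebra to the exponent of a₂ in h. It enters
the invariance of h and makes the metric at the base point Euclidean. -/
theorem mul_mu_sq {s : ℕ} (hs : 1 ≤ s) : (s : ℝ) * mu s ^ 2 = 1 := by
  rw [mu_sq, if_neg (by omega)]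

variable (p)

theorem U0.ext' {u v : U0 p s} (h1 : u.1 = v.1) (h2 : u.2 = v.2) : u = v := Prod.ext h1 h2

/-- The element of `u₀` with the given components in `b` and in `J b`. -/
def mkU0 (x y : Idx p → ℝ) : U0 p s := ((x, y) : (Idx p → ℝ) × (Idx p → ℝ))

@[simp] theorem mkU0_fst (x y : Idx p → ℝ) : (mkU0 p s x y).1 = x := rfl
@[simp] theorem mkU0_snd (x y : Idx p → ℝ) : (mkU0 p s x y).2 = y := rfl
@[simp] theorem U0.add_fst (u v : U0 p s) : (u + v).1 = u.1 + v.1 := rfl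
@[simp] theorem U0.add_snd (u v : U0 p s) : (u + v).2 = u.2 + v.2 := rfl
@[simp] theorem U0.sub_fst (u v : U0 p s) : (u - v).1 = u.1 - v.1 := rfl
@[simp] theorem U0.sub_snd (u v : U0 p s) : (u - v).2 = u.2 - v.2 := rfl
@[simp] theorem U0.neg_fst (u : U0 p s) : (-u).1 = -u.1 := rfl
@[simp] theorem U0.neg_snd (u : U0 p s) : (-u).2 = -u.2 := rfl
@[simp] theorem U0.zero_fst : (0 : U0 p s).1 = 0 := rfl
@[simp] theorem U0.zero_snd : (0 : U0 p s).2 = 0 := rfl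
@[simp] theorem U0.smul_fst (t : ℝ) (u : U0 p s) : (t • u).1 = t • u.1 := rfl
@[simp] theorem U0.smul_snd (t : ℝ) (u : U0 p s) : (t • u).2 = t • u.2 := rfl
@[simp] theorem U0.lie_fst (u v : U0 p s) : (⁅u, v⁆ : U0 p s).1 = bracketB s u.1 v.1 := rfl
@[simp] theorem U0.lie_snd (u v : U0 p s) :
    (⁅u, v⁆ : U0 p s).2 = rho s u.1 v.2 - rho s v.1 u.2 := rfl
@[simp] theorem complexStructure_fst (u : U0 p s) : (complexStructure p s u).1 = -u.2 := rfl
@[simp] theorem complexStructure_snd (u : U0 p s) : (complexStructure p s u).2 = u.1 := rfl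
@[simp] theorem inB_fst (x : Idx p → ℝ) : (inB p s x).1 = x := rfl
@[simp] theorem inB_snd (x : Idx p → ℝ) : (inB p s x).2 = 0 := rfl
@[simp] theorem inJB_fst (x : Idx p → ℝ) : (inJB p s x).1 = 0 := rfl
@[simp] theorem inJB_snd (x : Idx p → ℝ) : (inJB p s x).2 = x := rfl
@[simp] theorem genH_fst (i : Fin 2) : (genH p s i).1 = Pi.single (Sum.inl i) 1 := rfl
@[simp] theorem genH_snd (i : Fin 2) : (genH p s i).2 = 0 := rfl

theorem metric_apply (u v : U0 p s) : metric p s u v = u.1 ⬝ᵥ v.1 + u.2 ⬝ᵥ v.2 := rfl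

theorem vecB₀_fst : (vecB₀ p s).1 = vec 1 (1 / mu s) 0 := by
  refine idx_ext ?_ ?_ ?_ <;> simp [vecB₀]

@[simp] theorem vecB₀_snd : (vecB₀ p s).2 = 0 := by simp [vecB₀]

theorem vecJB₀_eq : vecJB₀ p s = vec 1 (1 / mu s) 0 := vecB₀_fst p s

theorem mem_algB (u : U0 p s) : u ∈ algB p s ↔ u.2 = 0 := Iff.rfl

theorem mem_algB₀ (u : U0 p s) : u ∈ algB₀ p s ↔
    u.2 = 0 ∧ u.1 (Sum.inl 0) + 1 / mu s * u.1 (Sum.inl 1) = 0 := by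
  change (u.2 = 0 ∧ metric p s (vecB₀ p s) u = 0) ↔ _
  refine and_congr_right fun h => ?_
  rw [metric_apply, vecB₀_fst, h, dotProduct_idx]
  simp

theorem mem_xMinus (u : U0 p s) : u ∈ xMinus p s ↔
    u.2 = 0 ∧ u.1 (Sum.inl 0) = 0 ∧ u.1 (Sum.inl 1) = 0 := by
  constructor
  · intro h
    refine Submodule.span_induction (p := fun u _ => u.2 = 0 ∧ u.1 (Sum.inl 0) = 0 ∧
      u.1 (Sum.inl 1) = 0) ?_ (by simp) ?_ ?_ h
    · rintro _ ⟨i, rfl⟩; simp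
    · intro x y _ _ hx hy; simp [hx, hy]
    · intro t x _ hx; simp [hx]
  · rintro ⟨h, h0, h1⟩
    have : u = ∑ i : Fin p, u.1 (Sum.inr i) • inB p s (Pi.single (Sum.inr i) 1) := by
      have hB : ∀ f : Fin p → (Idx p → ℝ),
          ∑ i, inB p s (f i) = inB p s (∑ i, f i) := by
        intro f
        let g : (Idx p → ℝ) →+ U0 p s :=
          { toFun := inB p s, map_zero' := rfl, map_add' := fun x y => by
              refine U0.ext' p s rfl ?_
              simp }
        exact (map_sum g f Finset.univ).symm
      have hs : ∀ i : Fin p, u.1 (Sum.inr i) • inB p s (Pi.single (Sum.inr i) 1) =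
          inB p s (u.1 (Sum.inr i) • Pi.single (Sum.inr i) 1) := by
        intro i
        refine U0.ext' p s rfl ?_
        simp
      simp_rw [hs, hB]
      refine U0.ext' p s ?_ h
      funext j
      rcases j with j | j
      · fin_cases j
        · simpa using h0
        · simpa using h1
      · simp [Pi.single_apply]
    rw [this]
    exact Submodule.sum_mem _ fun i _ => Submodule.smul_mem _ _ (Submodule.subset_span ⟨i, rfl⟩)

end Coordinates

/-! ### The structure of 𝔲₀: decompositions, Levi-Civita connection, solvability -/

section LieAlgebraU0

variable (p s : ℕ)

theorem complexStructure_sq (u : U0 p s) :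
    complexStructure p s (complexStructure p s u) = -u :=
  U0.ext' p s (by simp) (by simp)

theorem mem_xMinus_sup (u : U0 p s) :
    u ∈ xMinus p s ⊔ (xMinus p s).map (complexStructure p s) ↔
      u.1 (Sum.inl 0) = 0 ∧ u.1 (Sum.inl 1) = 0 ∧ u.2 (Sum.inl 0) = 0 ∧ u.2 (Sum.inl 1) = 0 := by
  rw [Submodule.mem_sup]
  constructor
  · rintro ⟨y, hy, _, ⟨z, hz, rfl⟩, rfl⟩
    have hy' := (mem_xMinus p s y).1 hy
    have hz' := (mem_xMinus p s z).1 hz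
    simp [hy', hz']
  · rintro ⟨h1, h2, h3, h4⟩
    refine ⟨inB p s u.1, (mem_xMinus p s _).2 ⟨rfl, h1, h2⟩, inJB p s u.2,
      ⟨inB p s u.2, (mem_xMinus p s _).2 ⟨rfl, h3, h4⟩, ?_⟩, ?_⟩
    · exact U0.ext' p s (by simp) (by simp)
    · exact U0.ext' p s (by simp) (by simp)

theorem finrank_xMinus : Module.finrank ℝ (xMinus p s) = p := by
  have hli : LinearIndependent ℝ fun i : Fin p => inB p s (Pi.single (Sum.inr i) 1) := by
    rw [Fintype.linearIndependent_iff]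
    intro g hg i
    let f : U0 p s →ₗ[ℝ] ℝ :=
      { toFun := fun u => u.1 (Sum.inr i), map_add' := fun _ _ => rfl, map_smul' := fun _ _ => rfl }
    have hf : ∀ u : U0 p s, f u = u.1 (Sum.inr i) := fun _ => rfl
    have := congrArg f hg
    rw [map_sum] at this
    simpa [hf, Pi.single_apply] using this
  rw [xMinus, finrank_span_eq_card hli, Fintype.card_fin]

theorem isRankTwoSum (hs : 1 ≤ s) : IsRankTwoSum (metric p s) (complexStructure p s) p 1
    (1 / Real.sqrt s) (genH p s 0) (genH p s 1) (xMinus p s) where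
  elem₁ :=
    { root_pos := one_pos
      unit := by simp [metric_apply]
      orth := fun v hv => by
        have := (mem_xMinus_sup p s v).1 hv
        simp [metric_apply, this]
      invariant := fun v hv => by
        have := (mem_xMinus_sup p s v).1 hv
        rw [mem_xMinus_sup]
        simp [this]
      key := by
        refine U0.ext' p s (idx_ext ?_ ?_ ?_) (idx_ext ?_ ?_ ?_) <;> simp
      ad_H := fun v hv => by
        have := (mem_xMinus_sup p s v).1 hv
        refine U0.ext' p s (idx_ext ?_ ?_ ?_) (idx_ext ?_ ?_ ?_) <;> simp [this]
      ad_G := fun v hv => by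
        have := (mem_xMinus_sup p s v).1 hv
        refine U0.ext' p s (idx_ext ?_ ?_ ?_) (idx_ext ?_ ?_ ?_) <;> simp [this]
      bracket := fun v hv w hw => by
        have h1 := (mem_xMinus_sup p s v).1 hv
        have h2 := (mem_xMinus_sup p s w).1 hw
        refine U0.ext' p s (idx_ext ?_ ?_ ?_) (idx_ext ?_ ?_ ?_) <;>
          simp [h1, h2, metric_apply, dotProduct_idx, dotProduct_comm (tail w.1)]
        ring }
  elem₂ :=
    { root_pos := mu_pos hs
      unit := by simp [metric_apply]
      orth := fun v hv => by simp [(Submodule.mem_bot ℝ).1 hv]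
      invariant := fun v hv => by simp [(Submodule.mem_bot ℝ).1 hv]
      key := by
        refine U0.ext' p s (idx_ext ?_ ?_ ?_) (idx_ext ?_ ?_ ?_) <;> simp [mu]
      ad_H := fun v hv => by simp [(Submodule.mem_bot ℝ).1 hv]
      ad_G := fun v hv => by simp [(Submodule.mem_bot ℝ).1 hv]
      bracket := fun v hv w hw => by simp [(Submodule.mem_bot ℝ).1 hv] }
  dim := finrank_xMinus p s
  span := by
    rw [eq_top_iff]
    intro u _
    rw [sup_assoc, Submodule.mem_sup]
    refine ⟨u.1 (Sum.inl 0) • genH p s 0 +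
      u.2 (Sum.inl 0) • complexStructure p s (genH p s 0) +
      u.1 (Sum.inl 1) • genH p s 1 + u.2 (Sum.inl 1) • complexStructure p s (genH p s 1), ?_,
      mkU0 p s (vec 0 0 (tail u.1)) (vec 0 0 (tail u.2)), ?_, ?_⟩
    · refine add_mem (add_mem (add_mem ?_ ?_) ?_) ?_ <;>
        exact Submodule.smul_mem _ _ (Submodule.subset_span (by simp))
    · rw [mem_xMinus_sup]
      exact ⟨rfl, rfl, rfl, rfl⟩
    · refine U0.ext' p s (idx_ext ?_ ?_ ?_) (idx_ext ?_ ?_ ?_) <;> simp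
  orth_x := fun v hv w hw => by
    have h1 := (mem_xMinus p s v).1 hv
    have h2 := (mem_xMinus p s w).1 hw
    simp [metric_apply, h1, h2]
  orth_HH := by simp [metric_apply]
  orth_Hx := fun v hv => by
    have := (mem_xMinus_sup p s v).1 hv
    simp [metric_apply, this]
  comm := by
    refine ⟨?_, ?_, ?_, ?_⟩ <;>
      refine U0.ext' p s (idx_ext ?_ ?_ ?_) (idx_ext ?_ ?_ ?_) <;> simp
  ad_H₂ := fun v hv => by
    have h1 := (mem_xMinus p s v).1 hv
    refine ⟨?_, ?_⟩ <;>
      refine U0.ext' p s (idx_ext ?_ ?_ ?_) (idx_ext ?_ ?_ ?_) <;> simp [h1, mu, neg_div]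
  ad_G₂ := fun v hv => by
    have h1 := (mem_xMinus p s v).1 hv
    refine ⟨?_, ?_⟩ <;>
      refine U0.ext' p s (idx_ext ?_ ?_ ?_) (idx_ext ?_ ?_ ?_) <;> simp [h1, mu]

theorem mem_map_algB (u : U0 p s) :
    u ∈ (algB p s).toSubmodule.map (complexStructure p s) ↔ u.1 = 0 := by
  constructor
  · rintro ⟨v, hv, rfl⟩
    have hv' : v.2 = 0 := hv
    simp [hv']
  · intro h
    exact ⟨inB p s u.2, rfl, U0.ext' p s (by simp [h]) (by simp)⟩

theorem isTypeIDecomposition (hs : 1 ≤ s) : IsTypeIDecomposition (metric p s)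
    (complexStructure p s) (algB p s) (algB₀ p s) (vecB₀ p s) where
  isCompl := by
    refine IsCompl.of_eq ?_ ?_
    · rw [eq_bot_iff]
      rintro u ⟨h1, h2⟩
      exact U0.ext' p s ((mem_map_algB p s u).1 h2) h1
    · rw [eq_top_iff]
      intro u _
      refine Submodule.mem_sup.2 ⟨inB p s u.1, rfl, inJB p s u.2, (mem_map_algB p s _).2 rfl, ?_⟩
      exact U0.ext' p s (by simp) (by simp)
  orth := fun x hx y hy => by
    simp [metric_apply, (mem_algB p s x).1 hx, (mem_algB p s y).1 hy]
  abelian := fun x hx y hy => by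
    refine U0.ext' p s (idx_ext ?_ ?_ ?_) (idx_ext ?_ ?_ ?_) <;>
      simp [(mem_algB p s x).1 hx, (mem_algB p s y).1 hy]
  ideal := fun u x hx => by
    rw [mem_map_algB]
    refine idx_ext ?_ ?_ ?_ <;> simp [(mem_algB p s x).1 hx]
  mem := vecB₀_snd p s
  ne_zero := fun h => by
    have := congrArg (fun u : U0 p s => u.1 (Sum.inl 0)) h
    rw [vecB₀_fst] at this
    simp at this
  le := fun u hu => hu.1
  sum := fun x hx => by
    have hm := mu_pos hs
    have hx' := (mem_algB p s x).1 hx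
    let t := (x.1 (Sum.inl 0) + 1 / mu s * x.1 (Sum.inl 1)) / (1 + 1 / mu s ^ 2)
    refine ⟨t, x - t • vecB₀ p s, ?_, by abel⟩
    rw [mem_algB₀]
    refine ⟨by simp [hx'], ?_⟩
    rw [U0.sub_fst, U0.smul_fst, vecB₀_fst]
    simp only [Pi.sub_apply, Pi.smul_apply, vec_inl_zero, vec_inl_one, smul_eq_mul, t]
    field_simp
    ring
  orth₀ := fun y hy => hy.2
  central := fun x hx => by
    have hm := mu_pos hs
    have hx' := (mem_algB p s x).1 hx
    refine U0.ext' p s (idx_ext ?_ ?_ ?_) (idx_ext ?_ ?_ ?_) <;> simp [vecB₀_fst, hx', hm.ne']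
  ad_B₀ := fun x hx => by
    have hm := mu_pos hs
    have hx' := (mem_algB p s x).1 hx
    refine ⟨?_, ?_⟩ <;>
      refine U0.ext' p s (idx_ext ?_ ?_ ?_) (idx_ext ?_ ?_ ?_) <;>
        simp [vecB₀_fst, hx', hm.ne'] <;> field_simp

variable {p}

/-- The symmetric part of the operators `rho s x`. -/
def symPart (x y : Idx p → ℝ) : Idx p → ℝ :=
  vec (x (Sum.inl 0) * y (Sum.inl 0) + (tail x ⬝ᵥ tail y) / 2)
    (mu s * (x (Sum.inl 1) * y (Sum.inl 1) + (tail x ⬝ᵥ tail y) / 2))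
    (((x (Sum.inl 0) + mu s * x (Sum.inl 1)) / 2) • tail y +
      ((y (Sum.inl 0) + mu s * y (Sum.inl 1)) / 2) • tail x)

variable (p)

/-- The Levi-Civita connection of `u₀(p, s)`. -/
def nablaU0 : U0 p s →ₗ[ℝ] U0 p s →ₗ[ℝ] U0 p s :=
  LinearMap.mk₂ ℝ (fun u v => mkU0 p s (rho s u.1 v.1 - symPart s u.1 v.1 + symPart s u.2 v.2)
      (rho s u.1 v.2 - symPart s u.1 v.2 - symPart s u.2 v.1))
    (fun u v w => by
      refine U0.ext' p s (idx_ext ?_ ?_ ?_) (idx_ext ?_ ?_ ?_) <;>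
        simp [symPart] <;> first | ring1 | module)
    (fun t u v => by
      refine U0.ext' p s (idx_ext ?_ ?_ ?_) (idx_ext ?_ ?_ ?_) <;>
        simp [symPart] <;> first | ring1 | module)
    (fun u v w => by
      refine U0.ext' p s (idx_ext ?_ ?_ ?_) (idx_ext ?_ ?_ ?_) <;>
        simp [symPart] <;> first | ring1 | module)
    (fun t u v => by
      refine U0.ext' p s (idx_ext ?_ ?_ ?_) (idx_ext ?_ ?_ ?_) <;>
        simp [symPart] <;> first | ring1 | module)

@[simp] theorem nablaU0_fst (u v : U0 p s) : (nablaU0 p s u v).1 =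
    rho s u.1 v.1 - symPart s u.1 v.1 + symPart s u.2 v.2 := rfl
@[simp] theorem nablaU0_snd (u v : U0 p s) : (nablaU0 p s u v).2 =
    rho s u.1 v.2 - symPart s u.1 v.2 - symPart s u.2 v.1 := rfl

/-- On 𝔟 the connection is the skew part of `rho`, and on J𝔟 it is the symmetric part, exchanging
the two summands with opposite signs; both are skew. The trilinear form ⟨`symPart x y`, z⟩ is
totally symmetric, and `rho x y - rho y x` is the bracket of 𝔟, so the symmetric parts cancel in the
torsion. -/
theorem isLeviCivita_nablaU0 : IsLeviCivita (metric p s) (nablaU0 p s) where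
  torsion_free x y := by
    refine U0.ext' p s (idx_ext ?_ ?_ ?_) (idx_ext ?_ ?_ ?_) <;>
      simp [symPart, dotProduct_comm (tail y.1), dotProduct_comm (tail y.2)] <;>
      first | ring1 | module
  metric x y z := by
    simp [symPart, metric_apply, dotProduct_idx, dotProduct_comm (tail y.1) (tail x.1),
      dotProduct_comm (tail y.2) (tail x.1), dotProduct_comm (tail y.1) (tail x.2),
      dotProduct_comm (tail y.2) (tail x.2)]
    ring

theorem isKahlerLieAlgebra : IsKahlerLieAlgebra (metric p s) (complexStructure p s) where
  symm x y := by simp [metric_apply, dotProduct_comm]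
  pos x hx := by
    rw [metric_apply]
    have h1 : 0 ≤ x.1 ⬝ᵥ x.1 := Finset.sum_nonneg fun i _ => mul_self_nonneg _
    have h2 : 0 ≤ x.2 ⬝ᵥ x.2 := Finset.sum_nonneg fun i _ => mul_self_nonneg _
    refine (add_nonneg h1 h2).lt_of_ne fun h => hx ?_
    exact U0.ext' p s (dotProduct_self_eq_zero.1 (by linarith))
      (dotProduct_self_eq_zero.1 (by linarith))
  sq := complexStructure_sq p s
  orth x y := by simp [metric_apply]; ring
  parallel := by
    refine ⟨nablaU0 p s, isLeviCivita_nablaU0 p s, fun x y => ?_⟩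
    refine U0.ext' p s (idx_ext ?_ ?_ ?_) (idx_ext ?_ ?_ ?_) <;>
      simp [symPart] <;> first | ring1 | module

theorem isSplittableSolvable : IsSplittableSolvable (U0 p s) := by
  refine ⟨?_, fun x => ?_⟩
  -- The chain is 𝔲₀ ⊃ 𝔵⁻ + J𝔟 ⊃ J𝔟 ⊃ 0: no bracket has a component along H₁ or H₂, the space 𝔵⁻ is
  -- Abelian, and J𝔟 is an Abelian ideal.
  · let S : ℕ → Submodule ℝ (U0 p s) := fun k =>
      match k with
      | 0 => ⊤
      | 1 =>
        { carrier := {u | u.1 (Sum.inl 0) = 0 ∧ u.1 (Sum.inl 1) = 0}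
          add_mem' := fun {u v} hu hv => by simp [hu.1, hu.2, hv.1, hv.2]
          zero_mem' := by simp
          smul_mem' := fun t u hu => by simp [hu.1, hu.2] }
      | 2 =>
        { carrier := {u | u.1 = 0}
          add_mem' := fun {u v} hu hv => by
            simp only [Set.mem_ofPred_eq] at hu hv ⊢
            simp [hu, hv]
          zero_mem' := by simp
          smul_mem' := fun t u hu => by
            simp only [Set.mem_ofPred_eq] at hu ⊢
            simp [hu] }
      | _ => ⊥
    refine isSolvable_of_chain S rfl ?_ 3 rfl
    rintro (_ | _ | _ | k) x hx y hy
    · exact ⟨rfl, rfl⟩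
    · refine idx_ext rfl rfl ?_
      simp [hx.1, hx.2, hy.1, hy.2]
    · have hx' : x.1 = 0 := hx
      have hy' : y.1 = 0 := hy
      refine U0.ext' p s (idx_ext ?_ ?_ ?_) (idx_ext ?_ ?_ ?_) <;> simp [hx', hy']
    · have hx' : x = 0 := hx
      rw [hx', zero_lie]
      exact zero_mem _
  · let a := x.1 (Sum.inl 0)
    let b := mu s * x.1 (Sum.inl 1)
    -- These are the weights on span {H₁, H₂}, 𝔵⁻, G₂, 𝔵⁺ and G₁, in this order. Each factor
    -- annihilates the next group of coordinates while keeping the earlier ones zero.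
    refine splits_charpoly_of_list _ [0, (a - b) / 2, b, (a + b) / 2, a] fun v => ?_
    simp only [List.foldl_cons, List.foldl_nil, LieAlgebra.ad_apply]
    have h1 : ∀ v : U0 p s, (⁅x, v⁆ - (0 : ℝ) • v).1 (Sum.inl 0) = 0 ∧
        (⁅x, v⁆ - (0 : ℝ) • v).1 (Sum.inl 1) = 0 := fun v => by simp
    have h2 : ∀ v : U0 p s, v.1 (Sum.inl 0) = 0 ∧ v.1 (Sum.inl 1) = 0 →
        (⁅x, v⁆ - ((a - b) / 2) • v).1 = 0 := fun v hv => by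
      refine idx_ext ?_ ?_ ?_ <;> simp [hv, a, b]
    have h3 : ∀ v : U0 p s, v.1 = 0 → (⁅x, v⁆ - b • v).1 = 0 ∧
        (⁅x, v⁆ - b • v).2 (Sum.inl 1) = 0 := fun v hv => by
      refine ⟨idx_ext ?_ ?_ ?_, ?_⟩ <;> simp [hv, b]
    have h4 : ∀ v : U0 p s, v.1 = 0 ∧ v.2 (Sum.inl 1) = 0 →
        (⁅x, v⁆ - ((a + b) / 2) • v).1 = 0 ∧ (⁅x, v⁆ - ((a + b) / 2) • v).2 (Sum.inl 1) = 0 ∧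
        tail (⁅x, v⁆ - ((a + b) / 2) • v).2 = 0 := fun v hv => by
      refine ⟨idx_ext ?_ ?_ ?_, ?_, ?_⟩ <;> simp [hv, a, b]
    have h5 : ∀ v : U0 p s, v.1 = 0 ∧ v.2 (Sum.inl 1) = 0 ∧ tail v.2 = 0 →
        ⁅x, v⁆ - a • v = 0 := fun v hv => by
      refine U0.ext' p s (idx_ext ?_ ?_ ?_) (idx_ext ?_ ?_ ?_) <;> simp [hv, a]
    exact h5 _ (h4 _ (h3 _ (h2 _ (h1 _))))

theorem isNormalJAlgebra (hs : 1 ≤ s) : IsNormalJAlgebra (metric p s) (complexStructure p s) where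
  kahler := isKahlerLieAlgebra p s
  splittable := isSplittableSolvable p s
  exact_form := by
    have hm := mu_pos hs
    -- The primitive is the scalar product with JB₀. It works because ⟨`rho x y`, B₀⟩ = ⟨x, y⟩.
    let θ : U0 p s →ₗ[ℝ] ℝ :=
      { toFun := fun u => u.2 (Sum.inl 0) + 1 / mu s * u.2 (Sum.inl 1)
        map_add' := fun u v => by simp; ring
        map_smul' := fun t u => by simp; ring }
    refine ⟨θ, fun x y => ?_⟩
    change (⁅x, y⁆ : U0 p s).2 (Sum.inl 0) + 1 / mu s * (⁅x, y⁆ : U0 p s).2 (Sum.inl 1) = _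
    simp [metric_apply, dotProduct_idx, dotProduct_comm (tail y.1)]
    field_simp
    ring

theorem adJB_mulVec (u : U0 p s) (y : Idx p → ℝ) : adJB p s u *ᵥ y = rho s u.1 y := by
  let f : (Idx p → ℝ) →ₗ[ℝ] (Idx p → ℝ) :=
    { toFun := rho s u.1, map_add' := rho_add p s u.1, map_smul' := fun t => rho_smul p s t u.1 }
  have h : adJB p s u = LinearMap.toMatrix' f := by
    ext i j
    have : rho s 0 u.2 = 0 := by simpa using smul_rho p s 0 0 u.2
    simp [adJB, LinearMap.toMatrix'_apply, f, this]
  rw [h, LinearMap.toMatrix'_mulVec]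
  rfl

end LieAlgebraU0

/-! ## The polynomial -/

section Polynomial

open MvPolynomial

section General

variable {ι : Type}

/-- The derivative of polynomials in the direction `v`. -/
def dirDeriv (v : ι → ℝ) : Derivation ℝ (MvPolynomial ι ℝ) (MvPolynomial ι ℝ) :=
  mkDerivation ℝ fun i => C (v i)

@[simp] theorem dirDeriv_X (v : ι → ℝ) (i : ι) : dirDeriv v (X i) = C (v i) :=
  mkDerivation_X _ _ _

@[simp] theorem dirDeriv_C (v : ι → ℝ) (t : ℝ) : dirDeriv v (C t) = 0 :=
  derivation_C _ _

theorem dirDeriv_eq_sum [Fintype ι] [DecidableEq ι] (v : ι → ℝ) (h : MvPolynomial ι ℝ) :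
    dirDeriv v h = ∑ i, C (v i) * pderiv i h := by
  have hsum : ∀ q : MvPolynomial ι ℝ, (∑ i, (C (v i) : MvPolynomial ι ℝ) •
      pderiv (R := ℝ) i) q = ∑ i, ((C (v i) : MvPolynomial ι ℝ) • pderiv (R := ℝ) i) q := fun q =>
    congrFun (map_sum (Derivation.coeFnAddMonoidHom (R := ℝ) (A := MvPolynomial ι ℝ)
      (M := MvPolynomial ι ℝ)) _ _) q |>.trans (Finset.sum_apply _ _ _)
  have : dirDeriv v = ∑ i, (C (v i) : MvPolynomial ι ℝ) • pderiv (R := ℝ) i := by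
    refine derivation_ext fun j => ?_
    rw [hsum]
    simp [pderiv_X, Pi.single_apply]
  rw [this, hsum]
  simp

/-- Coordinate sums are traded for derivations in constant directions, so that the Leibniz rule
applies directly to the factorization of the basic polynomial. -/
theorem polyDeriv_eq [Fintype ι] (h : MvPolynomial ι ℝ) (x v : ι → ℝ) :
    polyDeriv h x v = eval x (dirDeriv v h) := by
  classical
  simp [polyDeriv, dirDeriv_eq_sum, mul_comm]

theorem canonicalMetric_eq [Fintype ι] (h : MvPolynomial ι ℝ) (d : ℕ) (x v w : ι → ℝ) :
    canonicalMetric h d x v w = -(1 / (d : ℝ)) * eval x (dirDeriv v (dirDeriv w h)) := by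
  classical
  rw [canonicalMetric, dirDeriv_eq_sum, map_sum]
  congr 1
  refine Finset.sum_congr rfl fun i _ => ?_
  rw [dirDeriv_eq_sum, map_sum, map_mul, map_sum, Finset.mul_sum]
  refine Finset.sum_congr rfl fun j _ => ?_
  simp [Derivation.leibniz]
  ring

end General

variable {p : ℕ} (s : ℕ)

/-- The polar form of the quadratic form `a₁ (μ a₂) - (1/2) ⟨X, X⟩`. -/
def qform (x y : Idx p → ℝ) : ℝ :=
  (x (Sum.inl 0) * (mu s * y (Sum.inl 1)) + y (Sum.inl 0) * (mu s * x (Sum.inl 1)) -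
    tail x ⬝ᵥ tail y) / 2

theorem qform_comm (x y : Idx p → ℝ) : qform s x y = qform s y x := by
  rw [qform, qform, dotProduct_comm]; ring

theorem qform_self (y : Idx p → ℝ) : qform s y y =
    y (Sum.inl 0) * (mu s * y (Sum.inl 1)) - (tail y ⬝ᵥ tail y) / 2 := by
  rw [qform]; ring

theorem qform_add_right (x y z : Idx p → ℝ) :
    qform s x (y + z) = qform s x y + qform s x z := by
  simp [qform]; ring

theorem qform_smul_right (t : ℝ) (x y : Idx p → ℝ) :
    qform s x (t • y) = t * qform s x y := by
  simp [qform]; ring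

theorem qform_add_left (x y z : Idx p → ℝ) :
    qform s (x + y) z = qform s x z + qform s y z := by
  simp [qform]; ring

theorem qform_smul_left (t : ℝ) (x y : Idx p → ℝ) :
    qform s (t • x) y = t * qform s x y := by
  simp [qform]; ring

variable (p)

/-- The linear factor `μ a₂` of the basic polynomial. -/
def linPoly : MvPolynomial (Idx p) ℝ := C (mu s) * X (Sum.inl 1)

/-- The quadratic factor of the basic polynomial. -/
def quadPoly : MvPolynomial (Idx p) ℝ :=
  X (Sum.inl 0) * linPoly p s - C (1 / 2) * ∑ i : Fin p, X (Sum.inr i) ^ 2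

theorem basicPoly_eq {s : ℕ} (hs : 1 ≤ s) :
    basicPoly p s = linPoly p s ^ (s - 1) * quadPoly p s := by
  obtain ⟨n, rfl⟩ : ∃ n, s = n + 1 := ⟨s - 1, by omega⟩
  simp only [basicPoly, quadPoly, linPoly, Nat.add_sub_cancel]
  ring

variable {p}

@[simp] theorem eval_linPoly (y : Idx p → ℝ) :
    eval y (linPoly p s) = mu s * y (Sum.inl 1) := by simp [linPoly]

@[simp] theorem eval_quadPoly (y : Idx p → ℝ) : eval y (quadPoly p s) = qform s y y := by
  simp [quadPoly, qform_self, dotProduct, tail, ← pow_two]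
  ring

@[simp] theorem dirDeriv_linPoly (v : Idx p → ℝ) :
    dirDeriv v (linPoly p s) = C (mu s * v (Sum.inl 1)) := by
  simp [linPoly, Derivation.leibniz]

/-- The linear polynomial `2 q(v, ·)`. -/
def polarPoly (v : Idx p → ℝ) : MvPolynomial (Idx p) ℝ :=
  X (Sum.inl 0) * C (mu s * v (Sum.inl 1)) + C (v (Sum.inl 0)) * linPoly p s -
    ∑ i : Fin p, C (v (Sum.inr i)) * X (Sum.inr i)

theorem dirDeriv_quadPoly (v : Idx p → ℝ) : dirDeriv v (quadPoly p s) = polarPoly s v := by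
  simp only [quadPoly, polarPoly, map_sub, Derivation.leibniz, dirDeriv_linPoly, dirDeriv_X,
    dirDeriv_C, map_sum, Derivation.leibniz_pow, smul_eq_mul, mul_zero, add_zero]
  rw [Finset.mul_sum]
  have : ∀ i : Fin p, C (1 / 2) * (2 • (X (Sum.inr i) ^ (2 - 1) * C (v (Sum.inr i)))) =
      (C (v (Sum.inr i)) * X (Sum.inr i) : MvPolynomial (Idx p) ℝ) := fun i => by
    have h2 : (C (1 / 2) * 2 : MvPolynomial (Idx p) ℝ) = 1 := by
      rw [show (2 : MvPolynomial (Idx p) ℝ) = C 2 from (map_ofNat C 2).symm, ← C_mul]; norm_num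
    linear_combination (X (Sum.inr i) * C (v (Sum.inr i))) * h2
  rw [Finset.sum_congr rfl fun i _ => this i]
  ring

theorem eval_polarPoly (y v : Idx p → ℝ) : eval y (polarPoly s v) = 2 * qform s y v := by
  simp [polarPoly, qform, dotProduct, tail, mul_comm]
  ring

theorem dirDeriv_polarPoly (v w : Idx p → ℝ) :
    dirDeriv w (polarPoly s v) = C (2 * qform s w v) := by
  simp only [polarPoly, map_sub, map_add, Derivation.leibniz, dirDeriv_linPoly, dirDeriv_X,
    dirDeriv_C, map_sum, smul_eq_mul, mul_zero, add_zero, zero_add, qform, dotProduct, tail]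
  simp only [← C_mul, ← C_add, ← C_sub, ← map_sum]
  congr 1
  have : ∑ i, v (Sum.inr i) * w (Sum.inr i) = ∑ i, w (Sum.inr i) * v (Sum.inr i) :=
    Finset.sum_congr rfl fun i _ => mul_comm _ _
  rw [this]
  ring

variable {s}

theorem eval_basicPoly (hs : 1 ≤ s) (y : Idx p → ℝ) :
    eval y (basicPoly p s) = (mu s * y (Sum.inl 1)) ^ (s - 1) * qform s y y := by
  rw [basicPoly_eq p hs]; simp

theorem polyDeriv_basicPoly (hs : 1 ≤ s) (y v : Idx p → ℝ) :
    polyDeriv (basicPoly p s) y v =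
      ((s - 1 : ℕ) : ℝ) * (mu s * y (Sum.inl 1)) ^ (s - 1 - 1) * (mu s * v (Sum.inl 1)) *
        qform s y y + (mu s * y (Sum.inl 1)) ^ (s - 1) * (2 * qform s y v) := by
  rw [polyDeriv_eq, basicPoly_eq p hs, Derivation.leibniz, Derivation.leibniz_pow,
    dirDeriv_quadPoly]
  simp [eval_polarPoly]
  ring

/-- Removes the truncated exponent produced by differentiating a power; for `n = 0` both sides
vanish, so the case s = 1 needs no separate treatment. -/
theorem natCast_mul_pow_pred (n : ℕ) {b : ℝ} (hb : b ≠ 0) :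
    (n : ℝ) * b ^ (n - 1) = n * b ^ n / b := by
  rcases n with _ | n
  · simp
  · rw [Nat.add_sub_cancel, pow_succ]; field_simp

theorem polyDeriv_basicPoly_of_ne (hs : 1 ≤ s) (y v : Idx p → ℝ)
    (hb : mu s * y (Sum.inl 1) ≠ 0) :
    polyDeriv (basicPoly p s) y v = (mu s * y (Sum.inl 1)) ^ (s - 1) *
      (((s : ℝ) - 1) * (mu s * v (Sum.inl 1)) * qform s y y / (mu s * y (Sum.inl 1)) +
        2 * qform s y v) := by
  rw [polyDeriv_basicPoly hs, natCast_mul_pow_pred _ hb, Nat.cast_sub hs, Nat.cast_one]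
  ring

theorem canonicalMetric_basicPoly (hs : 1 ≤ s) (y v w : Idx p → ℝ)
    (hb : mu s * y (Sum.inl 1) ≠ 0) (d : ℕ) :
    canonicalMetric (basicPoly p s) d y v w = -(1 / (d : ℝ)) *
      ((mu s * y (Sum.inl 1)) ^ (s - 1) *
        (((s : ℝ) - 1) * ((s : ℝ) - 2) * (mu s * v (Sum.inl 1)) * (mu s * w (Sum.inl 1)) *
            qform s y y / (mu s * y (Sum.inl 1)) ^ 2 +
          2 * ((s : ℝ) - 1) * ((mu s * v (Sum.inl 1)) * qform s y w +
            (mu s * w (Sum.inl 1)) * qform s y v) / (mu s * y (Sum.inl 1)) +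
          2 * qform s v w)) := by
  rw [canonicalMetric_eq, basicPoly_eq p hs]
  congr 1
  obtain ⟨n, rfl⟩ : ∃ n, s = n + 1 := ⟨s - 1, by omega⟩
  have e : eval y (dirDeriv v (dirDeriv w (linPoly p (n + 1) ^ n * quadPoly p (n + 1)))) =
      ((n : ℝ) * ((n - 1 : ℕ) * (mu (n + 1) * y (Sum.inl 1)) ^ (n - 1 - 1))) *
        (mu (n + 1) * v (Sum.inl 1)) * (mu (n + 1) * w (Sum.inl 1)) * qform (n + 1) y y +
      ((n : ℝ) * (mu (n + 1) * y (Sum.inl 1)) ^ (n - 1)) *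
        ((mu (n + 1) * v (Sum.inl 1)) * (2 * qform (n + 1) y w) +
          (mu (n + 1) * w (Sum.inl 1)) * (2 * qform (n + 1) y v)) +
      (mu (n + 1) * y (Sum.inl 1)) ^ n * (2 * qform (n + 1) v w) := by
    simp only [Derivation.leibniz, Derivation.leibniz_pow, dirDeriv_quadPoly, dirDeriv_linPoly,
      dirDeriv_polarPoly, map_add, smul_eq_mul, dirDeriv_C, map_mul, nsmul_eq_mul,
      Derivation.map_natCast]
    simp [eval_polarPoly]
    ring
  rw [Nat.add_sub_cancel, e]
  have e2 : ((n : ℝ) * ((n - 1 : ℕ) * (mu (n + 1) * y (Sum.inl 1)) ^ (n - 1 - 1))) =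
      n * (n - 1) * (mu (n + 1) * y (Sum.inl 1)) ^ n / (mu (n + 1) * y (Sum.inl 1)) ^ 2 := by
    rw [natCast_mul_pow_pred _ hb]
    rcases n with _ | n
    · simp
    · rw [Nat.add_sub_cancel, pow_succ]
      push_cast
      field_simp
      ring
  rw [e2, natCast_mul_pow_pred _ hb]
  push_cast
  field_simp
  ring

/-- The canonical metric on tangent vectors of `{h = 1}`. -/
theorem canonicalMetric_basicPoly_tangent (hs : 1 ≤ s) (y v w : Idx p → ℝ)
    (hb : 0 < mu s * y (Sum.inl 1)) (hy : eval y (basicPoly p s) = 1)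
    (hv : polyDeriv (basicPoly p s) y v = 0) (hw : polyDeriv (basicPoly p s) y w = 0) :
    canonicalMetric (basicPoly p s) (s + 1) y v w = (1 / ((s : ℝ) + 1)) *
      (s * (s + 1) * ((mu s * v (Sum.inl 1)) * (mu s * w (Sum.inl 1))) /
          (mu s * y (Sum.inl 1)) ^ 2 +
        (mu s * y (Sum.inl 1)) ^ (s - 1) *
        ((tail v - ((mu s * v (Sum.inl 1)) / (mu s * y (Sum.inl 1))) • tail y) ⬝ᵥ
          (tail w - ((mu s * w (Sum.inl 1)) / (mu s * y (Sum.inl 1))) • tail y))) := by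
  rw [canonicalMetric_basicPoly hs _ _ _ hb.ne']
  have hbn : (0 : ℝ) < (mu s * y (Sum.inl 1)) ^ (s - 1) := by positivity
  rw [polyDeriv_basicPoly_of_ne hs _ _ hb.ne'] at hv hw
  have hv' := (mul_eq_zero.1 hv).resolve_left hbn.ne'
  have hw' := (mul_eq_zero.1 hw).resolve_left hbn.ne'
  rw [eval_basicPoly hs] at hy
  rw [qform_self] at hy hv' hw'
  rw [qform_self]
  simp only [qform] at hv' hw' ⊢
  simp only [dotProduct_sub, sub_dotProduct, dotProduct_smul, smul_dotProduct, smul_eq_mul,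
    dotProduct_comm (tail v) (tail y)]
  set b := mu s * y (Sum.inl 1)
  set β := mu s * v (Sum.inl 1)
  set β' := mu s * w (Sum.inl 1)
  set a := y (Sum.inl 0)
  set α := v (Sum.inl 0)
  set α' := w (Sum.inl 0)
  set YY := tail y ⬝ᵥ tail y
  set YV := tail y ⬝ᵥ tail v
  set YW := tail y ⬝ᵥ tail w
  set VW := tail v ⬝ᵥ tail w
  set c := b ^ (s - 1)
  have hb' := hb.ne'
  have hQ : a * b - YY / 2 ≠ 0 := fun h => by rw [h] at hy; simp at hy
  -- Let `Q` be the value of the quadratic factor. Then h = 1 says `c = 1 / Q`, and the tangency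
  -- conditions are linear in the a₁-coordinates of `v` and `w`. Eliminating `a`, `α`, `α'` and `c`
  -- leaves a rational identity.
  obtain ⟨Q, hQd⟩ : ∃ Q, Q = a * b - YY / 2 := ⟨_, rfl⟩
  rw [← hQd] at hQ hy hv' hw' ⊢
  have ha : a = (Q + YY / 2) / b := by rw [hQd]; field_simp; ring
  have hα : α = (YV - a * β - ((s : ℝ) - 1) * β * Q / b) / b := by
    field_simp at hv' ⊢
    linarith
  have hα' : α' = (YW - a * β' - ((s : ℝ) - 1) * β' * Q / b) / b := by
    field_simp at hw' ⊢
    linarith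
  have hc : c = 1 / Q := by
    field_simp
    linarith
  rw [hα, hα', hc, ha]
  push_cast
  field_simp
  ring

/-- Infinitesimally the linear factor is scaled by μx₂ and the quadratic factor by x₁ + μx₂, so h is
scaled by x₁ + sμx₂. On 𝔟₀ one has x₂ = -μx₁, and the factor vanishes since sμ² = 1. -/
theorem polyDeriv_basicPoly_adJB (hs : 1 ≤ s) (u : U0 p s) (hu : u ∈ algB₀ p s)
    (y : Idx p → ℝ) : polyDeriv (basicPoly p s) y (adJB p s u *ᵥ y) = 0 := by
  have hm := mu_pos hs
  have hms := mul_mu_sq hs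
  have h0 : u.1 (Sum.inl 1) = -(mu s * u.1 (Sum.inl 0)) := by
    have := ((mem_algB₀ p s u).1 hu).2
    field_simp at this
    linarith
  rw [adJB_mulVec, polyDeriv_basicPoly hs]
  have hq : 2 * qform s y (rho s u.1 y) =
      (u.1 (Sum.inl 0) + mu s * u.1 (Sum.inl 1)) * qform s y y := by
    simp [qform, dotProduct_comm (tail y) (tail u.1)]
    ring
  rw [hq, rho_inl_one, h0]
  obtain ⟨n, rfl⟩ : ∃ n, s = n + 1 := ⟨s - 1, by omega⟩
  rw [Nat.add_sub_cancel]
  have hn : (n : ℝ) * (mu (n + 1) * y (Sum.inl 1)) ^ (n - 1) * (mu (n + 1) * y (Sum.inl 1)) =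
      n * (mu (n + 1) * y (Sum.inl 1)) ^ n := by
    rcases n with _ | n
    · simp
    · rw [Nat.add_sub_cancel, pow_succ]; ring
  push_cast at hms
  linear_combination (-(mu (n + 1)) ^ 2 * u.1 (Sum.inl 0) * qform (n + 1) y y) * hn -
    ((mu (n + 1) * y (Sum.inl 1)) ^ n * u.1 (Sum.inl 0) * qform (n + 1) y y) * hms

end Polynomial

/-! ## Exponentials -/

section Exponential

section Banach

variable {𝔸 : Type*} [NormedRing 𝔸] [NormedAlgebra ℝ 𝔸] [CompleteSpace 𝔸]

/-- Uniqueness for the linear equation c' = Xc: the curve exp(-τX)c(τ) has derivative zero. -/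
theorem exp_eq_of_hasDerivAt (X : 𝔸) (c : ℝ → 𝔸) (h0 : c 0 = 1)
    (hc : ∀ τ, HasDerivAt c (X * c τ) τ) : c 1 = NormedSpace.exp X := by
  let _ : NormedAlgebra ℚ 𝔸 := NormedAlgebra.restrictScalars ℚ ℝ 𝔸
  have hd : ∀ τ : ℝ, HasDerivAt (fun τ : ℝ => NormedSpace.exp (τ • (-X)) * c τ) 0 τ := fun τ => by
    have h1 := (hasDerivAt_exp_smul_const (𝕂 := ℝ) (-X) τ).mul (hc τ)
    have h2 : NormedSpace.exp (τ • -X) * -X * c τ + NormedSpace.exp (τ • -X) * (X * c τ) = 0 := by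
      noncomm_ring
    rw [h2] at h1
    exact h1
  have hconst := is_const_of_deriv_eq_zero (fun τ => (hd τ).differentiableAt)
    (fun τ => (hd τ).deriv) 1 0
  simp only [one_smul, zero_smul, NormedSpace.exp_zero, h0, mul_one] at hconst
  have h3 : NormedSpace.exp X * NormedSpace.exp (-X) = 1 := by
    rw [← NormedSpace.exp_add_of_commute (Commute.neg_right (Commute.refl X)), add_neg_cancel,
      NormedSpace.exp_zero]
  calc c 1 = NormedSpace.exp X * NormedSpace.exp (-X) * c 1 := by rw [h3, one_mul]
    _ = NormedSpace.exp X := by rw [mul_assoc, hconst, mul_one]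

/-- The function `(exp κ - 1) / κ`, continuously extended to `κ = 0`. -/
def expInt (κ : ℝ) : ℝ := ∫ σ in (0 : ℝ)..1, Real.exp (κ * σ)

/-- Positivity for every `κ` allows division by `expInt κ`. Consequently every element of the
solvable groups considered below is a single exponential. -/
theorem expInt_pos (κ : ℝ) : 0 < expInt κ := by
  refine intervalIntegral.intervalIntegral_pos_of_pos ?_ (fun σ => Real.exp_pos _) one_pos
  exact (by fun_prop : Continuous fun σ : ℝ => Real.exp (κ * σ)).intervalIntegrable _ _

/-- The curve exp(φ(τ)N) exp(τA) solves c' = (A + N)c as soon as φ' = κφ + 1 and φ(0) = 0. The first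
factor is a quadratic polynomial in N because N³ = 0. -/
theorem exp_add_eq_of_commutator (A N : 𝔸) (κ : ℝ) (h : A * N - N * A = κ • N)
    (h3 : N * N * N = 0) : NormedSpace.exp (A + N) =
      (1 + expInt κ • N + (expInt κ ^ 2 / 2) • (N * N)) * NormedSpace.exp A := by
  let _ : NormedAlgebra ℚ 𝔸 := NormedAlgebra.restrictScalars ℚ ℝ 𝔸
  let φ : ℝ → ℝ := fun τ => ∫ σ in (0 : ℝ)..τ, Real.exp (κ * σ)
  have hcont : Continuous fun σ : ℝ => Real.exp (κ * σ) := by fun_prop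
  have hφ : ∀ τ, HasDerivAt φ (Real.exp (κ * τ)) τ := fun τ =>
    (hcont.integral_hasStrictDerivAt 0 τ).hasDerivAt
  have hφ0 : φ 0 = 0 := intervalIntegral.integral_same
  -- This is φ' = κφ + 1, stated without dividing by `κ`, so that `κ = 0` is included.
  have hrel : ∀ τ, Real.exp (κ * τ) = κ * φ τ + 1 := fun τ => by
    have hd : ∀ τ, HasDerivAt (fun τ => Real.exp (κ * τ) - κ * φ τ) 0 τ := fun τ => by
      have := (((hasDerivAt_id τ).const_mul κ).exp).fun_sub ((hφ τ).const_mul κ)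
      simpa [mul_comm] using this
    have := is_const_of_deriv_eq_zero (fun τ => (hd τ).differentiableAt)
      (fun τ => (hd τ).deriv) τ 0
    simp only [hφ0, mul_zero, Real.exp_zero, sub_zero] at this
    linarith
  have key := exp_eq_of_hasDerivAt (A + N)
    (fun τ => (1 + φ τ • N + (φ τ ^ 2 / 2) • (N * N)) * NormedSpace.exp (τ • A))
    (by simp [hφ0]) (fun τ => by
      have h1 := ((hφ τ).smul_const N).const_add 1
      have h2 := (((hφ τ).fun_pow 2).div_const 2).smul_const (N * N)
      have h4 := (h1.fun_add h2).fun_mul (hasDerivAt_exp_smul_const' (𝕂 := ℝ) A τ)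
      convert h4 using 1
      have hAN : A * N = N * A + κ • N := by rw [← h]; abel
      have hNAN : N * A * N = N * N * A + κ • (N * N) := by
        rw [mul_assoc, hAN, mul_add, mul_smul_comm, mul_assoc]
      rw [hrel τ, ← mul_assoc, ← mul_assoc, ← add_mul]
      congr 1
      simp only [mul_add, add_mul, mul_smul_comm, hAN, hNAN, smul_mul_assoc, mul_one, one_mul,
        smul_add, ← mul_assoc, h3, smul_zero]
      simp only [Nat.cast_ofNat, pow_one, Nat.add_one_sub_one]
      module)
  rw [← key]
  simp [expInt, φ]

end Banach

section Matrix

variable {n : Type} [Fintype n] [DecidableEq n]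

open scoped Matrix.Norms.Operator in
-- The operator norm is chosen only locally, to have a Banach algebra; the hypothesis is entrywise
-- and does not mention a norm.
theorem matrix_exp_eq_of_hasDerivAt (X : Matrix n n ℝ) (c : ℝ → Matrix n n ℝ) (h0 : c 0 = 1)
    (hc : ∀ τ i j, HasDerivAt (fun τ => c τ i j) ((X * c τ) i j) τ) :
    c 1 = NormedSpace.exp X := by
  refine exp_eq_of_hasDerivAt X c h0 fun τ => ?_
  exact hasDerivAt_pi.2 fun i => hasDerivAt_pi.2 fun j => hc τ i j

open scoped Matrix.Norms.Operator in
theorem matrix_exp_add_eq_of_commutator (A N : Matrix n n ℝ) (κ : ℝ)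
    (h : A * N - N * A = κ • N) (h3 : N * N * N = 0) : NormedSpace.exp (A + N) =
      (1 + expInt κ • N + (expInt κ ^ 2 / 2) • (N * N)) * NormedSpace.exp A :=
  exp_add_eq_of_commutator A N κ h h3

end Matrix

end Exponential

/-! ## The group acting on the cone -/

section GroupB

variable {p : ℕ} (s : ℕ)

/-- The linear transformation `exp(X) exp(x₁ H₁ + x₂ H₂)` of `J b`, for `x = (x₁, x₂, X)`. -/
def act (x y : Idx p → ℝ) : Idx p → ℝ :=
  vec (Real.exp (x (Sum.inl 0)) * y (Sum.inl 0) +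
      Real.exp ((x (Sum.inl 0) + mu s * x (Sum.inl 1)) / 2) * (tail x ⬝ᵥ tail y) +
      Real.exp (mu s * x (Sum.inl 1)) * (mu s * y (Sum.inl 1)) * (tail x ⬝ᵥ tail x) / 2)
    (Real.exp (mu s * x (Sum.inl 1)) * y (Sum.inl 1))
    (Real.exp ((x (Sum.inl 0) + mu s * x (Sum.inl 1)) / 2) • tail y +
      (Real.exp (mu s * x (Sum.inl 1)) * (mu s * y (Sum.inl 1))) • tail x)

/-- The product in the coordinates `(x₁, x₂, X)` of `exp(X) exp(x₁ H₁ + x₂ H₂)`. -/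
def mulB (x y : Idx p → ℝ) : Idx p → ℝ :=
  vec (x (Sum.inl 0) + y (Sum.inl 0)) (x (Sum.inl 1) + y (Sum.inl 1))
    (tail x + Real.exp ((x (Sum.inl 0) - mu s * x (Sum.inl 1)) / 2) • tail y)

/-- The inverse in the coordinates `(x₁, x₂, X)`. -/
def invB (x : Idx p → ℝ) : Idx p → ℝ :=
  vec (-x (Sum.inl 0)) (-x (Sum.inl 1))
    (-(Real.exp (-((x (Sum.inl 0) - mu s * x (Sum.inl 1)) / 2)) • tail x))

theorem act_mulB (x x' y : Idx p → ℝ) : act s (mulB s x x') y = act s x (act s x' y) := by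
  -- The exponentials depending on `x` are all expressed through exp((x₁ - μx₂)/2) and exp(μx₂);
  -- after this the claim is a polynomial identity.
  have e1 : Real.exp ((x (Sum.inl 0) + x' (Sum.inl 0) + mu s * (x (Sum.inl 1) + x' (Sum.inl 1))) / 2)
      = Real.exp ((x (Sum.inl 0) - mu s * x (Sum.inl 1)) / 2) * Real.exp (mu s * x (Sum.inl 1)) *
        Real.exp ((x' (Sum.inl 0) + mu s * x' (Sum.inl 1)) / 2) := by
    rw [← Real.exp_add, ← Real.exp_add]; congr 1; ring
  have e2 : Real.exp (mu s * (x (Sum.inl 1) + x' (Sum.inl 1))) =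
      Real.exp (mu s * x (Sum.inl 1)) * Real.exp (mu s * x' (Sum.inl 1)) := by
    rw [← Real.exp_add]; congr 1; ring
  have e3 : Real.exp ((x (Sum.inl 0) + mu s * x (Sum.inl 1)) / 2) =
      Real.exp ((x (Sum.inl 0) - mu s * x (Sum.inl 1)) / 2) * Real.exp (mu s * x (Sum.inl 1)) := by
    rw [← Real.exp_add]; congr 1; ring
  have e4 : Real.exp (x (Sum.inl 0)) =
      Real.exp ((x (Sum.inl 0) - mu s * x (Sum.inl 1)) / 2) ^ 2 *
        Real.exp (mu s * x (Sum.inl 1)) := by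
    rw [← Real.exp_nat_mul, ← Real.exp_add]; congr 1; push_cast; ring
  refine idx_ext ?_ ?_ ?_
  · simp only [act, mulB, vec_inl_zero, vec_inl_one, tail_vec, Real.exp_add, e1, e2, e3, e4,
      add_dotProduct, dotProduct_add, smul_dotProduct, dotProduct_smul, smul_eq_mul,
      dotProduct_comm (tail x') (tail x)]
    ring
  · simp only [act, mulB, vec_inl_one, e2]
    ring
  · simp only [act, mulB, vec_inl_zero, vec_inl_one, tail_vec, e1, e2, e3]
    module

theorem mulB_assoc (x y z : Idx p → ℝ) : mulB s (mulB s x y) z = mulB s x (mulB s y z) := by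
  have e1 : Real.exp ((x (Sum.inl 0) + y (Sum.inl 0) - mu s * (x (Sum.inl 1) + y (Sum.inl 1))) / 2)
      = Real.exp ((x (Sum.inl 0) - mu s * x (Sum.inl 1)) / 2) *
        Real.exp ((y (Sum.inl 0) - mu s * y (Sum.inl 1)) / 2) := by
    rw [← Real.exp_add]; congr 1; ring
  refine idx_ext ?_ ?_ ?_
  · simp only [mulB, vec_inl_zero]; ring
  · simp only [mulB, vec_inl_one]; ring
  · simp only [mulB, vec_inl_zero, vec_inl_one, tail_vec, e1]
    module

theorem zero_mulB (x : Idx p → ℝ) : mulB s 0 x = x := by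
  refine idx_ext ?_ ?_ ?_ <;> simp [mulB]

theorem mulB_zero (x : Idx p → ℝ) : mulB s x 0 = x := by
  refine idx_ext ?_ ?_ ?_ <;> simp [mulB]

theorem invB_mulB (x : Idx p → ℝ) : mulB s (invB s x) x = 0 := by
  refine idx_ext ?_ ?_ ?_
  · simp [mulB, invB]
  · simp [mulB, invB]
  · simp only [mulB, invB, vec_inl_zero, vec_inl_one, tail_vec, tail_zero]
    rw [show (-x (Sum.inl 0) - mu s * -x (Sum.inl 1)) / 2 =
      -((x (Sum.inl 0) - mu s * x (Sum.inl 1)) / 2) by ring]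
    module

theorem mulB_invB (x : Idx p → ℝ) : mulB s x (invB s x) = 0 := by
  refine idx_ext ?_ ?_ ?_
  · simp [mulB, invB]
  · simp [mulB, invB]
  · simp only [mulB, invB, vec_inl_zero, vec_inl_one, tail_vec, tail_zero, smul_neg, smul_smul,
      ← Real.exp_add, add_neg_cancel, Real.exp_zero, one_smul]

theorem act_zero_left (y : Idx p → ℝ) : act s 0 y = y := by
  refine idx_ext ?_ ?_ ?_ <;> simp [act]

theorem act_add (x y z : Idx p → ℝ) : act s x (y + z) = act s x y + act s x z := by
  refine idx_ext ?_ ?_ ?_ <;> simp [act] <;> first | ring1 | module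

theorem act_smul (x : Idx p → ℝ) (t : ℝ) (y : Idx p → ℝ) :
    act s x (t • y) = t • act s x y := by
  refine idx_ext ?_ ?_ ?_ <;> simp [act] <;> first | ring1 | module

/-- The linear map `act s x`. -/
def actLin (x : Idx p → ℝ) : (Idx p → ℝ) →ₗ[ℝ] (Idx p → ℝ) where
  toFun := act s x
  map_add' := act_add s x
  map_smul' := act_smul s x

/-- The unipotent factor exp(ad X) preserves the quadratic form. The diagonal factor scales a₁ by
exp(x₁), a₂ by exp(μx₂), and 𝔵⁺ by the geometric mean of the two, hence it is conformal. -/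
theorem qform_act (x y z : Idx p → ℝ) : qform s (act s x y) (act s x z) =
    Real.exp (x (Sum.inl 0) + mu s * x (Sum.inl 1)) * qform s y z := by
  have e1 : Real.exp (x (Sum.inl 0) + mu s * x (Sum.inl 1)) =
      Real.exp (x (Sum.inl 0)) * Real.exp (mu s * x (Sum.inl 1)) := Real.exp_add _ _
  have e2 : Real.exp ((x (Sum.inl 0) + mu s * x (Sum.inl 1)) / 2) ^ 2 =
      Real.exp (x (Sum.inl 0)) * Real.exp (mu s * x (Sum.inl 1)) := by
    rw [← Real.exp_nat_mul, ← Real.exp_add]; congr 1; push_cast; ring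
  simp only [qform, act, vec_inl_zero, vec_inl_one, tail_vec, add_dotProduct, dotProduct_add,
    smul_dotProduct, dotProduct_smul, smul_eq_mul, dotProduct_comm (tail y) (tail x), e1]
  linear_combination (-(tail y ⬝ᵥ tail z) / 2) * e2

variable {s}

theorem act_vecJB₀ (hs : 1 ≤ s) (x : Idx p → ℝ) : act s x (vecJB₀ p s) =
    vec (Real.exp (x (Sum.inl 0)) + Real.exp (mu s * x (Sum.inl 1)) * (tail x ⬝ᵥ tail x) / 2)
      (Real.exp (mu s * x (Sum.inl 1)) / mu s) (Real.exp (mu s * x (Sum.inl 1)) • tail x) := by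
  have hm := (mu_pos hs).ne'
  rw [vecJB₀_eq]
  refine idx_ext ?_ ?_ ?_ <;> simp [act, hm]
  field_simp

end GroupB

/-! ## The group `ℝ ⋉ ℝ^p` and its representation on `J b` -/

section Representation

variable {p : ℕ}

theorem matrix_ext_mulVec {n : Type*} [Fintype n] [DecidableEq n] {M M' : Matrix n n ℝ}
    (h : ∀ v, M *ᵥ v = M' *ᵥ v) : M = M' :=
  Matrix.toLin'.injective (LinearMap.ext fun v => by simpa using h v)

variable (p) in
/-- The group `ℝ ⋉ ℝ^p`, where `t ∈ ℝ` acts by `exp t`. -/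
@[ext] structure IwaParam : Type where
  /-- the component in `ℝ` -/
  t : ℝ
  /-- the component in `ℝ^p` -/
  W : Fin p → ℝ

instance : Group (IwaParam p) where
  mul x y := ⟨x.t + y.t, x.W + Real.exp x.t • y.W⟩
  one := ⟨0, 0⟩
  inv x := ⟨-x.t, -(Real.exp (-x.t) • x.W)⟩
  mul_assoc x y z := by
    refine IwaParam.ext (add_assoc _ _ _) ?_
    change x.W + Real.exp x.t • y.W + Real.exp (x.t + y.t) • z.W =
      x.W + Real.exp x.t • (y.W + Real.exp y.t • z.W)
    rw [Real.exp_add]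
    module
  one_mul x := by
    refine IwaParam.ext (zero_add _) ?_
    change 0 + Real.exp 0 • x.W = x.W
    simp
  mul_one x := by
    refine IwaParam.ext (add_zero _) ?_
    change x.W + Real.exp x.t • 0 = x.W
    simp
  inv_mul_cancel x := by
    refine IwaParam.ext (neg_add_cancel _) ?_
    change -(Real.exp (-x.t) • x.W) + Real.exp (-x.t) • x.W = 0
    simp

@[simp] theorem IwaParam.mul_t (x y : IwaParam p) : (x * y).t = x.t + y.t := rfl
@[simp] theorem IwaParam.mul_W (x y : IwaParam p) : (x * y).W = x.W + Real.exp x.t • y.W := rfl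
@[simp] theorem IwaParam.one_t : (1 : IwaParam p).t = 0 := rfl
@[simp] theorem IwaParam.one_W : (1 : IwaParam p).W = 0 := rfl

variable (s : ℕ)

/-- The coefficient `2 / (1 + μ²)`, for which `c (H₁ - μ H₂)` acts on `x⁻` as the identity. -/
def boostCoeff : ℝ := 2 / (1 + mu s ^ 2)

theorem boostCoeff_pos : 0 < boostCoeff s := by unfold boostCoeff; positivity

theorem boostCoeff_mul : boostCoeff s * (1 + mu s ^ 2) = 2 := by
  unfold boostCoeff; field_simp

/-- The embedding of `ℝ ⋉ ℝ^p` into the group acting on the cone; the image has Lie algebra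
`b₀`. -/
def emb (t : ℝ) (W : Fin p → ℝ) : Idx p → ℝ :=
  vec (boostCoeff s * t) (-(mu s * (boostCoeff s * t))) W

/-- The parameter t is normalized to be the weight on 𝔵⁻; with this choice the group law of ℝ ⋉ ℝ^p
needs no constants. -/
theorem emb_weight (t : ℝ) (W : Fin p → ℝ) :
    (emb s t W (Sum.inl 0) - mu s * emb s t W (Sum.inl 1)) / 2 = t := by
  simp only [emb, vec_inl_zero, vec_inl_one]
  linear_combination (t / 2) * boostCoeff_mul s

theorem mulB_emb (x y : IwaParam p) :
    mulB s (emb s x.t x.W) (emb s y.t y.W) = emb s (x * y).t (x * y).W := by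
  refine idx_ext ?_ ?_ ?_
  · simp [mulB, emb]; ring
  · simp [mulB, emb]; ring
  · simp only [mulB, emb_weight, tail_vec]
    rfl

/-- The matrix of `act s x`. -/
def actMat (x : Idx p → ℝ) : Matrix (Idx p) (Idx p) ℝ := LinearMap.toMatrix' (actLin s x)

theorem actMat_mulVec (x y : Idx p → ℝ) : actMat s x *ᵥ y = act s x y := by
  rw [actMat, LinearMap.toMatrix'_mulVec]; rfl

theorem actMat_mulB (x y : Idx p → ℝ) : actMat s (mulB s x y) = actMat s x * actMat s y :=
  matrix_ext_mulVec fun v => by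
    rw [← Matrix.mulVec_mulVec, actMat_mulVec, actMat_mulVec, actMat_mulVec, act_mulB]

theorem actMat_zero : actMat s (0 : Idx p → ℝ) = 1 :=
  matrix_ext_mulVec fun v => by rw [actMat_mulVec, act_zero_left, Matrix.one_mulVec]

/-- `act s x` as an invertible matrix. -/
def actUnit (x : Idx p → ℝ) : (Matrix (Idx p) (Idx p) ℝ)ˣ where
  val := actMat s x
  inv := actMat s (invB s x)
  val_inv := by rw [← actMat_mulB, mulB_invB, actMat_zero]
  inv_val := by rw [← actMat_mulB, invB_mulB, actMat_zero]

/-- The representation of `ℝ ⋉ ℝ^p` on `J b`. -/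
def actHom : IwaParam p →* (Matrix (Idx p) (Idx p) ℝ)ˣ where
  toFun x := actUnit s (emb s x.t x.W)
  map_one' := Units.ext <| by
    change actMat s (emb s 0 0) = 1
    rw [← actMat_zero]
    congr 1
    refine idx_ext ?_ ?_ ?_ <;> simp [emb]
  map_mul' x y := Units.ext <| by
    change actMat s (emb s (x * y).t (x * y).W) = actMat s _ * actMat s _
    rw [← mulB_emb, actMat_mulB]

theorem actHom_mulVec (x : IwaParam p) (y : Idx p → ℝ) :
    (actHom s x : Matrix (Idx p) (Idx p) ℝ) *ᵥ y = act s (emb s x.t x.W) y :=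
  actMat_mulVec s _ y

/-- The operator is the sum of a diagonal part A coming from H₁, H₂ and a nilpotent part N coming
from 𝔵⁻. Here [A, N] is the multiple of N by the weight of 𝔵⁻, and N³ = 0, so the exponential of the
sum is explicit and differs from the parameters only by the factor `expInt` on 𝔵⁻. -/
theorem exp_adJB (x : Idx p → ℝ) : NormedSpace.exp (adJB p s (inB p s x)) =
    actMat s (vec (x (Sum.inl 0)) (x (Sum.inl 1))
      (expInt ((x (Sum.inl 0) - mu s * x (Sum.inl 1)) / 2) • tail x)) := by
  let A := adJB p s (inB p s (vec (x (Sum.inl 0)) (x (Sum.inl 1)) 0))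
  let N := adJB p s (inB p s (vec 0 0 (tail x)))
  have hA : ∀ v, A *ᵥ v = vec (x (Sum.inl 0) * v (Sum.inl 0))
      (mu s * x (Sum.inl 1) * v (Sum.inl 1))
      (((x (Sum.inl 0) + mu s * x (Sum.inl 1)) / 2) • tail v) := fun v => by
    rw [adJB_mulVec]
    refine idx_ext ?_ ?_ ?_ <;> simp
  have hN : ∀ v, N *ᵥ v = vec (tail x ⬝ᵥ tail v) 0 ((mu s * v (Sum.inl 1)) • tail x) := fun v => by
    rw [adJB_mulVec]
    refine idx_ext ?_ ?_ ?_ <;> simp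
  have hsum : adJB p s (inB p s x) = A + N := matrix_ext_mulVec fun v => by
    rw [Matrix.add_mulVec, hA, hN, adJB_mulVec]
    refine idx_ext ?_ ?_ ?_ <;> simp
  have hcomm : A * N - N * A = ((x (Sum.inl 0) - mu s * x (Sum.inl 1)) / 2) • N :=
    matrix_ext_mulVec fun v => by
      rw [Matrix.sub_mulVec, Matrix.smul_mulVec, ← Matrix.mulVec_mulVec, ← Matrix.mulVec_mulVec,
        hA, hN, hN, hA]
      refine idx_ext ?_ ?_ ?_ <;> simp <;> first | ring1 | module
  have h3 : N * N * N = 0 := matrix_ext_mulVec fun v => by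
    rw [← Matrix.mulVec_mulVec, ← Matrix.mulVec_mulVec, hN, hN, hN, Matrix.zero_mulVec]
    refine idx_ext ?_ ?_ ?_ <;> simp
  have hexp : ∀ v, NormedSpace.exp A *ᵥ v = vec (Real.exp (x (Sum.inl 0)) * v (Sum.inl 0))
      (Real.exp (mu s * x (Sum.inl 1)) * v (Sum.inl 1))
      (Real.exp ((x (Sum.inl 0) + mu s * x (Sum.inl 1)) / 2) • tail v) := fun v => by
    have hd : A = Matrix.diagonal (vec (x (Sum.inl 0)) (mu s * x (Sum.inl 1))
        fun _ => (x (Sum.inl 0) + mu s * x (Sum.inl 1)) / 2) := matrix_ext_mulVec fun v => by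
      rw [hA]
      refine idx_ext ?_ ?_ ?_
      · simp [Matrix.mulVec_diagonal]
      · simp [Matrix.mulVec_diagonal]
      · funext i
        simp [tail, Matrix.mulVec_diagonal]
    rw [hd, Matrix.exp_diagonal]
    refine idx_ext ?_ ?_ ?_
    · simp [Matrix.mulVec_diagonal, Pi.coe_exp, Real.exp_eq_exp_ℝ]
    · simp [Matrix.mulVec_diagonal, Pi.coe_exp, Real.exp_eq_exp_ℝ]
    · funext i
      simp [tail, Matrix.mulVec_diagonal, Pi.coe_exp, Real.exp_eq_exp_ℝ]
  rw [hsum, matrix_exp_add_eq_of_commutator A N _ hcomm h3]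
  refine matrix_ext_mulVec fun v => ?_
  rw [actMat_mulVec, ← Matrix.mulVec_mulVec, hexp, Matrix.add_mulVec, Matrix.add_mulVec,
    Matrix.one_mulVec, Matrix.smul_mulVec, Matrix.smul_mulVec, ← Matrix.mulVec_mulVec, hN, hN]
  refine idx_ext ?_ ?_ ?_ <;> simp [act] <;> first | ring1 | module

variable {s}

theorem mem_algB₀_iff (hs : 1 ≤ s) (u : U0 p s) :
    u ∈ algB₀ p s ↔ ∃ t W, u = inB p s (emb s t W) := by
  have hm := mu_pos hs
  have hc := boostCoeff_pos s
  rw [mem_algB₀]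
  constructor
  · rintro ⟨h2, h0⟩
    refine ⟨u.1 (Sum.inl 0) / boostCoeff s, tail u.1, U0.ext' p s (idx_ext ?_ ?_ ?_) h2⟩
    · simp only [inB_fst, emb, vec_inl_zero]; field_simp
    · simp only [inB_fst, emb, vec_inl_one]
      field_simp at h0 ⊢
      linarith
    · simp [emb]
  · rintro ⟨t, W, rfl⟩
    refine ⟨rfl, ?_⟩
    simp only [inB_fst, emb, vec_inl_zero, vec_inl_one]
    field_simp
    ring

theorem exp_adJB_emb (t : ℝ) (W : Fin p → ℝ) : NormedSpace.exp (adJB p s (inB p s (emb s t W))) =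
    actMat s (emb s t (expInt t • W)) := by
  rw [exp_adJB, emb_weight]
  rfl

/-- The exponentials alone already fill the image of ℝ ⋉ ℝ^p, since the rescaling by `expInt t` can
be undone. As this image is a subgroup, generating adds nothing. -/
theorem groupB₀_eq (hs : 1 ≤ s) : groupB₀ p s = (actHom s (p := p)).range := by
  apply le_antisymm
  · rw [groupB₀, expGroup, Subgroup.closure_le]
    rintro g ⟨_, ⟨u, hu, rfl⟩, hg⟩
    obtain ⟨t, W, rfl⟩ := (mem_algB₀_iff hs u).1 hu
    exact ⟨⟨t, expInt t • W⟩, Units.ext (by rw [hg, exp_adJB_emb]; rfl)⟩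
  · rintro _ ⟨⟨t, W⟩, rfl⟩
    refine Subgroup.subset_closure ⟨_, ⟨_, (mem_algB₀_iff hs _).2 ⟨t, (expInt t)⁻¹ • W, rfl⟩, rfl⟩, ?_⟩
    rw [exp_adJB_emb, smul_inv_smul₀ (expInt_pos t).ne']
    rfl

/-- The group form of the invariance: h is multiplied by exp(x₁ + sμx₂), and on the image of `emb`
this exponent is zero because sμ² = 1. -/
theorem eval_basicPoly_act_emb (hs : 1 ≤ s) (t : ℝ) (W : Fin p → ℝ) (y : Idx p → ℝ) :
    MvPolynomial.eval (act s (emb s t W) y) (basicPoly p s) =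
      MvPolynomial.eval y (basicPoly p s) := by
  rw [eval_basicPoly hs, eval_basicPoly hs, qform_act]
  have h1 : act s (emb s t W) y (Sum.inl 1) =
      Real.exp (-(mu s ^ 2 * (boostCoeff s * t))) * y (Sum.inl 1) := by
    simp only [act, emb, vec_inl_one]
    congr 2
    ring
  have h2 : Real.exp (-(mu s ^ 2 * (boostCoeff s * t))) ^ (s - 1) *
      Real.exp (emb s t W (Sum.inl 0) + mu s * emb s t W (Sum.inl 1)) = 1 := by
    rw [← Real.exp_nat_mul, ← Real.exp_add, Real.exp_eq_one_iff, Nat.cast_sub hs]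
    simp only [emb, vec_inl_zero, vec_inl_one, Nat.cast_one]
    linear_combination (-(boostCoeff s * t)) * mul_mu_sq hs
  rw [h1]
  have : (mu s * (Real.exp (-(mu s ^ 2 * (boostCoeff s * t))) * y (Sum.inl 1))) ^ (s - 1) =
      Real.exp (-(mu s ^ 2 * (boostCoeff s * t))) ^ (s - 1) *
        (mu s * y (Sum.inl 1)) ^ (s - 1) := by
    rw [← mul_pow]; ring
  rw [this]
  linear_combination ((mu s * y (Sum.inl 1)) ^ (s - 1) * qform s y y) * h2

theorem eval_basicPoly_vecJB₀ (hs : 1 ≤ s) : MvPolynomial.eval (vecJB₀ p s) (basicPoly p s) = 1 := by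
  have hm := mu_pos hs
  rw [eval_basicPoly hs, vecJB₀_eq, qform_self]
  simp [hm.ne']

/-- The a₂-coordinate of a point determines the diagonal part of the group element that reaches it
from JB₀, the component in 𝔵⁺ determines the unipotent part, and the equation h = 1 makes the
a₁-coordinates agree. -/
theorem mem_orbit_iff (hs : 1 ≤ s) (y : Idx p → ℝ) : y ∈ orbit p s ↔
    0 < y (Sum.inl 1) ∧ MvPolynomial.eval y (basicPoly p s) = 1 := by
  have hm := mu_pos hs
  have hc := boostCoeff_pos s
  constructor
  · rintro ⟨g, hg, rfl⟩
    rw [groupB₀_eq hs] at hg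
    obtain ⟨x, rfl⟩ := hg
    rw [actHom_mulVec, eval_basicPoly_act_emb hs, eval_basicPoly_vecJB₀ hs, act_vecJB₀ hs]
    refine ⟨?_, rfl⟩
    simp only [vec_inl_one]
    positivity
  · rintro ⟨hb, hy⟩
    set b := mu s * y (Sum.inl 1) with hbd
    have hb' : 0 < b := by positivity
    -- The value of μa₂ forces μx₂ = log b, and membership in 𝔟₀ forces x₁ = -x₂/μ, which equals -s
    -- log b.
    let x0 : ℝ := -(s * Real.log b)
    refine ⟨actHom s ⟨x0 / boostCoeff s, b⁻¹ • tail y⟩, by rw [groupB₀_eq hs]; exact ⟨_, rfl⟩, ?_⟩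
    rw [actHom_mulVec, act_vecJB₀ hs]
    have e0 : emb s (x0 / boostCoeff s) (b⁻¹ • tail y) (Sum.inl 0) = x0 := by
      simp only [emb, vec_inl_zero]; field_simp
    have e1 : mu s * emb s (x0 / boostCoeff s) (b⁻¹ • tail y) (Sum.inl 1) = Real.log b := by
      simp only [emb, vec_inl_one]
      rw [mul_div_cancel₀ _ hc.ne']
      linear_combination Real.log b * mul_mu_sq hs
    have e2 : tail (emb s (x0 / boostCoeff s) (b⁻¹ • tail y)) = b⁻¹ • tail y := rfl
    have e3 : Real.exp x0 * b ^ s = 1 := by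
      have : b ^ s = Real.exp (s * Real.log b) := by rw [Real.exp_nat_mul, Real.exp_log hb']
      rw [this, ← Real.exp_add, neg_add_cancel, Real.exp_zero]
    have hQ : b ^ s * (y (Sum.inl 0) - (tail y ⬝ᵥ tail y) / 2 / b) = 1 := by
      rw [eval_basicPoly hs, ← hbd, qform_self, ← hbd] at hy
      obtain ⟨n, rfl⟩ : ∃ n, s = n + 1 := ⟨s - 1, by omega⟩
      rw [Nat.add_sub_cancel] at hy
      rw [pow_succ, ← hy]
      field_simp
    have hbs : (0 : ℝ) < b ^ s := by positivity
    have e4 : Real.exp x0 = y (Sum.inl 0) - (tail y ⬝ᵥ tail y) / 2 / b :=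
      mul_left_cancel₀ hbs.ne' (by rw [hQ, mul_comm, e3])
    simp only [e0, e1, e2]
    rw [Real.exp_log hb', e4]
    refine idx_ext ?_ ?_ ?_
    · simp only [vec_inl_zero, smul_dotProduct, dotProduct_smul, smul_eq_mul]
      field_simp
      ring
    · simp only [vec_inl_one, hbd]; field_simp
    · simp [smul_smul, hb'.ne']

end Representation

/-! ## The Iwasawa algebra and the Iwasawa group -/

section Iwasawa

attribute [local instance 100] LieRing.ofAssociativeRing

variable {p : ℕ}

/-- Index set of the coordinates of `ℝ^(1, p + 1)`. -/
abbrev LIdx (p : ℕ) : Type := Fin 1 ⊕ Fin (p + 1)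

/-- The components in `ℝ^p` of a vector in `ℝ^(1, p + 1)`. -/
def ltail (v : LIdx p → ℝ) : Fin p → ℝ := fun i => v (Sum.inr i.succ)

/-- The vector with the given components in `ℝ^(1, p + 1)`. -/
def lvec (a b : ℝ) (V : Fin p → ℝ) : LIdx p → ℝ := Sum.elim (fun _ => a) (Fin.cons b V)

@[simp] theorem lvec_inl (a b : ℝ) (V : Fin p → ℝ) (i : Fin 1) : lvec a b V (Sum.inl i) = a := rfl
@[simp] theorem lvec_inr_zero (a b : ℝ) (V : Fin p → ℝ) : lvec a b V (Sum.inr 0) = b := rfl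
@[simp] theorem lvec_inr_succ (a b : ℝ) (V : Fin p → ℝ) (i : Fin p) :
    lvec a b V (Sum.inr i.succ) = V i := rfl
@[simp] theorem ltail_lvec (a b : ℝ) (V : Fin p → ℝ) : ltail (lvec a b V) = V := rfl
@[simp] theorem ltail_add (x y : LIdx p → ℝ) : ltail (x + y) = ltail x + ltail y := rfl
@[simp] theorem ltail_sub (x y : LIdx p → ℝ) : ltail (x - y) = ltail x - ltail y := rfl
@[simp] theorem ltail_zero : ltail (0 : LIdx p → ℝ) = 0 := rfl
@[simp] theorem ltail_smul (t : ℝ) (x : LIdx p → ℝ) : ltail (t • x) = t • ltail x := rfl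

theorem lidx_ext {x y : LIdx p → ℝ} (h0 : x (Sum.inl 0) = y (Sum.inl 0))
    (h1 : x (Sum.inr 0) = y (Sum.inr 0)) (h2 : ltail x = ltail y) : x = y := by
  funext i
  rcases i with i | i
  · rw [Subsingleton.elim i 0]; exact h0
  · refine Fin.cases h1 (fun j => ?_) i
    exact congrFun h2 j

theorem boost_mulVec (v : LIdx p → ℝ) :
    boost p *ᵥ v = lvec (v (Sum.inr 0)) (v (Sum.inl 0)) 0 := by
  rw [boost, Matrix.add_mulVec, Matrix.single_mulVec, Matrix.single_mulVec]
  refine lidx_ext ?_ ?_ ?_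
  · simp
  · simp
  · funext i
    simp [ltail, (Fin.succ_ne_zero i)]

/-- The element of the root space of `so(1, p + 1)` defined by `W ∈ ℝ^p`, as a linear map. -/
def nilLin (W : Fin p → ℝ) : (LIdx p → ℝ) →ₗ[ℝ] (LIdx p → ℝ) where
  toFun v := lvec (W ⬝ᵥ ltail v) (W ⬝ᵥ ltail v) ((v (Sum.inl 0) - v (Sum.inr 0)) • W)
  map_add' x y := by
    refine lidx_ext ?_ ?_ ?_ <;> simp <;> first | ring1 | module
  map_smul' t x := by
    refine lidx_ext ?_ ?_ ?_ <;> simp <;> first | ring1 | module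

/-- The element of the root space of `so(1, p + 1)` defined by `W ∈ ℝ^p`. -/
def nilMat (W : Fin p → ℝ) : Matrix (LIdx p) (LIdx p) ℝ := LinearMap.toMatrix' (nilLin W)

theorem nilMat_mulVec (W : Fin p → ℝ) (v : LIdx p → ℝ) : nilMat W *ᵥ v =
    lvec (W ⬝ᵥ ltail v) (W ⬝ᵥ ltail v) ((v (Sum.inl 0) - v (Sum.inr 0)) • W) := by
  rw [nilMat, LinearMap.toMatrix'_mulVec]; rfl

theorem nilMat_apply (W : Fin p → ℝ) (i j : LIdx p) : nilMat W i j =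
    lvec (W ⬝ᵥ ltail (Pi.single j 1)) (W ⬝ᵥ ltail (Pi.single j 1))
      (((Pi.single j 1 : LIdx p → ℝ) (Sum.inl 0) -
        (Pi.single j 1 : LIdx p → ℝ) (Sum.inr 0)) • W) i := by
  rw [nilMat, LinearMap.toMatrix'_apply]; rfl

theorem ltail_single_succ (j : Fin p) :
    ltail (Pi.single (Sum.inr j.succ) 1 : LIdx p → ℝ) = Pi.single j 1 := by
  funext i
  simp [ltail, Pi.single_apply]

theorem ltail_single_inl (j : Fin 1) : ltail (Pi.single (Sum.inl j) 1 : LIdx p → ℝ) = 0 := by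
  funext i
  simp [ltail]

theorem ltail_single_zero : ltail (Pi.single (Sum.inr 0) 1 : LIdx p → ℝ) = 0 := by
  funext i
  simp [ltail]

theorem nilMat_add (W W' : Fin p → ℝ) : nilMat (W + W') = nilMat W + nilMat W' :=
  matrix_ext_mulVec fun v => by
    rw [Matrix.add_mulVec, nilMat_mulVec, nilMat_mulVec, nilMat_mulVec]
    refine lidx_ext ?_ ?_ ?_ <;> simp

theorem nilMat_smul (t : ℝ) (W : Fin p → ℝ) : nilMat (t • W) = t • nilMat W :=
  matrix_ext_mulVec fun v => by
    rw [Matrix.smul_mulVec, nilMat_mulVec, nilMat_mulVec]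
    refine lidx_ext ?_ ?_ ?_ <;> simp
    module

theorem boost_nilMat (W : Fin p → ℝ) : boost p * nilMat W - nilMat W * boost p = nilMat W :=
  matrix_ext_mulVec fun v => by
    rw [Matrix.sub_mulVec, ← Matrix.mulVec_mulVec, ← Matrix.mulVec_mulVec, boost_mulVec,
      nilMat_mulVec, nilMat_mulVec, boost_mulVec]
    refine lidx_ext ?_ ?_ ?_ <;> simp
    module

theorem nilMat_comm (W W' : Fin p → ℝ) : nilMat W * nilMat W' - nilMat W' * nilMat W = 0 :=
  matrix_ext_mulVec fun v => by
    rw [Matrix.sub_mulVec, ← Matrix.mulVec_mulVec, ← Matrix.mulVec_mulVec, nilMat_mulVec,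
      nilMat_mulVec, nilMat_mulVec, nilMat_mulVec, Matrix.zero_mulVec]
    refine lidx_ext ?_ ?_ ?_ <;> simp [dotProduct_comm W W']

theorem nilMat_mem_so (W : Fin p → ℝ) :
    nilMat W ∈ LieAlgebra.Orthogonal.so' (Fin 1) (Fin (p + 1)) ℝ := by
  rw [LieAlgebra.Orthogonal.so', mem_skewAdjointMatricesLieSubalgebra,
    mem_skewAdjointMatricesSubmodule, Matrix.IsSkewAdjoint, Matrix.IsAdjointPair,
    LieAlgebra.Orthogonal.indefiniteDiagonal]
  ext i j
  rw [Matrix.mul_diagonal, Matrix.diagonal_mul, Matrix.transpose_apply, Matrix.neg_apply,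
    nilMat_apply, nilMat_apply]
  rcases i with i | i <;> rcases j with j | j
  · simp [ltail_single_inl]
  · rw [Subsingleton.elim i 0]
    refine Fin.cases ?_ (fun j => ?_) j
    · simp [ltail_single_zero, ltail_single_inl]
    · simp [ltail_single_succ]
  · rw [Subsingleton.elim j 0]
    refine Fin.cases ?_ (fun i => ?_) i
    · simp [ltail_single_zero, ltail_single_inl]
    · simp [ltail_single_succ]
  · refine Fin.cases ?_ (fun i => ?_) i <;> refine Fin.cases ?_ (fun j => ?_) j <;>
      simp [ltail_single_zero, ltail_single_succ]

/-- Comparing entries in [A, N] = rN with the skewness of N leaves only the first row free and makes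
the second row equal to it. Only r > 0 is used, so no prior knowledge of the restricted roots is
needed. -/
theorem eq_nilMat_of_root (N : Matrix (LIdx p) (LIdx p) ℝ)
    (hN : N ∈ LieAlgebra.Orthogonal.so' (Fin 1) (Fin (p + 1)) ℝ) (r : ℝ) (hr : 0 < r)
    (h : boost p * N - N * boost p = r • N) :
    N = nilMat fun j => N (Sum.inl 0) (Sum.inr j.succ) := by
  rw [LieAlgebra.Orthogonal.so', mem_skewAdjointMatricesLieSubalgebra,
    mem_skewAdjointMatricesSubmodule, Matrix.IsSkewAdjoint, Matrix.IsAdjointPair,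
    LieAlgebra.Orthogonal.indefiniteDiagonal] at hN
  have hsk : ∀ i j, N j i * Sum.elim (fun _ => (1 : ℝ)) (fun _ => -1) j =
      Sum.elim (fun _ => (1 : ℝ)) (fun _ => -1) i * -N i j := fun i j => by
    have := congrFun (congrFun hN i) j
    rwa [Matrix.mul_diagonal, Matrix.diagonal_mul] at this
  -- Since `boost p` is symmetric, right multiplication by it acts on the rows of `N` as left
  -- multiplication acts on the columns; both are evaluated by `boost_mulVec`.
  have hbr : ∀ i j, (boost p *ᵥ (fun k => N k j)) i - (boost p *ᵥ (fun k => N i k)) j =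
      r * N i j := fun i j => by
    have := congrFun (congrFun h i) j
    rw [Matrix.sub_apply, Matrix.smul_apply, smul_eq_mul] at this
    rw [← this, Matrix.mul_apply, Matrix.mul_apply]
    congr 1
    simp only [Matrix.mulVec, dotProduct]
    refine Finset.sum_congr rfl fun k _ => ?_
    have hsymm : boost p j k = boost p k j := by
      simp only [boost, Matrix.add_apply, Matrix.single_apply]
      rw [add_comm]
      congr 1 <;> simp only [and_comm]
    rw [hsymm, mul_comm]
  simp only [boost_mulVec] at hbr
  have h01 : N (Sum.inl 0) (Sum.inr 0) = 0 := by
    have := hbr (Sum.inl 0) (Sum.inr 0)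
    have h1 := hsk (Sum.inl 0) (Sum.inl 0)
    have h2 := hsk (Sum.inr 0) (Sum.inr 0)
    simp only [lvec_inl, lvec_inr_zero, Sum.elim_inl, Sum.elim_inr] at this h1 h2
    have h3 : N (Sum.inl 0) (Sum.inl 0) = 0 := by linarith
    have h4 : N (Sum.inr 0) (Sum.inr 0) = 0 := by linarith
    rw [h3, h4, sub_zero] at this
    exact (mul_eq_zero.1 this.symm).resolve_left hr.ne'
  have h1j : ∀ j : Fin p, N (Sum.inr 0) (Sum.inr j.succ) = N (Sum.inl 0) (Sum.inr j.succ) := by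
    intro j
    have a := hbr (Sum.inl 0) (Sum.inr j.succ)
    have b := hbr (Sum.inr 0) (Sum.inr j.succ)
    simp only [lvec_inl, lvec_inr_zero, lvec_inr_succ, Pi.zero_apply, sub_zero] at a b
    have : (1 + r) * (N (Sum.inr 0) (Sum.inr j.succ) - N (Sum.inl 0) (Sum.inr j.succ)) = 0 := by
      linarith
    have := (mul_eq_zero.1 this).resolve_left (by positivity)
    linarith
  have hij : ∀ i j : Fin p, N (Sum.inr i.succ) (Sum.inr j.succ) = 0 := fun i j => by
    have a := hbr (Sum.inr i.succ) (Sum.inr j.succ)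
    simp only [lvec_inr_succ, Pi.zero_apply, sub_zero] at a
    exact (mul_eq_zero.1 a.symm).resolve_left hr.ne'
  have s1 := hsk (Sum.inl 0) (Sum.inl 0)
  have s2 := hsk (Sum.inr 0) (Sum.inr 0)
  have s3 := hsk (Sum.inr 0) (Sum.inl 0)
  have s4 := fun j : Fin p => hsk (Sum.inr j.succ) (Sum.inl 0)
  have s5 := fun j : Fin p => hsk (Sum.inr j.succ) (Sum.inr 0)
  simp only [Sum.elim_inl, Sum.elim_inr] at s1 s2 s3 s4 s5
  ext i j
  rw [nilMat_apply]
  rcases i with i | i <;> rcases j with j | j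
  · rw [Subsingleton.elim i 0, Subsingleton.elim j 0]
    simp only [lvec_inl, ltail_single_inl, dotProduct_zero]
    linarith
  · rw [Subsingleton.elim i 0]
    refine Fin.cases ?_ (fun j => ?_) j
    · simp [ltail_single_zero, h01]
    · simp [ltail_single_succ]
  · rw [Subsingleton.elim j 0]
    refine Fin.cases ?_ (fun i => ?_) i
    · simp only [lvec_inr_zero, ltail_single_inl, dotProduct_zero]
      linarith
    · simp
      linarith [s4 i]
  · refine Fin.cases ?_ (fun i => ?_) i <;> refine Fin.cases ?_ (fun j => ?_) j
    · simp only [lvec_inr_zero, ltail_single_zero, dotProduct_zero]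
      linarith
    · simp [ltail_single_succ, h1j]
    · simp
      linarith [s5 i, h1j i]
    · simp [hij]

theorem lie_boost_nilMat (t t' : ℝ) (W W' : Fin p → ℝ) :
    ⁅t • boost p + nilMat W, t' • boost p + nilMat W'⁆ = nilMat (t • W' - t' • W) := by
  rw [Ring.lie_def]
  have h1 := boost_nilMat W
  have h2 := boost_nilMat W'
  have h3 := nilMat_comm W W'
  have h4 : nilMat (t • W' - t' • W) = t • nilMat W' - t' • nilMat W := by
    rw [sub_eq_add_neg, nilMat_add, ← neg_smul, nilMat_smul, nilMat_smul, neg_smul, sub_eq_add_neg]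
  rw [h4]
  calc _ = t • (boost p * nilMat W' - nilMat W' * boost p) -
        t' • (boost p * nilMat W - nilMat W * boost p) +
        (nilMat W * nilMat W' - nilMat W' * nilMat W) := by
          simp only [mul_add, add_mul, smul_mul_assoc, mul_smul_comm]
          module
    _ = _ := by rw [h1, h2, h3, add_zero]

variable (p) in
/-- The explicit description of the Iwasawa algebra. -/
def iwasawaModel : LieSubalgebra ℝ (Matrix (LIdx p) (LIdx p) ℝ) where
  carrier := {M | ∃ (t : ℝ) (W : Fin p → ℝ), M = t • boost p + nilMat W}
  add_mem' := by
    rintro _ _ ⟨t, W, rfl⟩ ⟨t', W', rfl⟩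
    exact ⟨t + t', W + W', by rw [nilMat_add]; module⟩
  zero_mem' := ⟨0, 0, by
    have := nilMat_smul 0 (0 : Fin p → ℝ)
    simp only [zero_smul, smul_zero] at this
    rw [this]; simp⟩
  smul_mem' := by
    rintro r _ ⟨t, W, rfl⟩
    exact ⟨r * t, r • W, by rw [nilMat_smul]; module⟩
  lie_mem' := by
    rintro _ _ ⟨t, W, rfl⟩ ⟨t', W', rfl⟩
    exact ⟨0, t • W' - t' • W, by rw [lie_boost_nilMat]; simp⟩

/-- The generators already span a subalgebra linearly: the root vectors commute with each other and
the boost acts on them as the identity. -/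
theorem iwasawaAlgebra_eq : iwasawaAlgebra p = iwasawaModel p := by
  apply le_antisymm
  · rw [iwasawaAlgebra, LieSubalgebra.lieSpan_le]
    rintro N (rfl | ⟨hN, r, hr, h⟩)
    · exact ⟨1, 0, by
        have := nilMat_smul 0 (0 : Fin p → ℝ)
        simp only [zero_smul, smul_zero] at this
        rw [this]; simp⟩
    · rw [Ring.lie_def] at h
      exact ⟨0, _, by rw [zero_smul, zero_add]; exact eq_nilMat_of_root N hN r hr h⟩
  · rintro _ ⟨t, W, rfl⟩
    refine add_mem (LieSubalgebra.smul_mem _ _ (LieSubalgebra.subset_lieSpan (Or.inl rfl)))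
      (LieSubalgebra.subset_lieSpan (Or.inr ⟨nilMat_mem_so W, 1, one_pos, ?_⟩))
    rw [Ring.lie_def, one_smul, boost_nilMat]

/-- The parameters can be read off the first row, which makes `iwasawaHom` a definition by matrix
entries instead of by choice. -/
theorem iwasawa_entries (t : ℝ) (W : Fin p → ℝ) :
    (t • boost p + nilMat W) (Sum.inl 0) (Sum.inr 0) = t ∧
      (fun j : Fin p => (t • boost p + nilMat W) (Sum.inl 0) (Sum.inr j.succ)) = W := by
  refine ⟨?_, funext fun j => ?_⟩
  · rw [Matrix.add_apply, Matrix.smul_apply, nilMat_apply]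
    simp [boost, ltail_single_zero]
  · rw [Matrix.add_apply, Matrix.smul_apply, nilMat_apply]
    simp [boost, ltail_single_succ, (Fin.succ_ne_zero j).symm]

variable {s : ℕ}

/-- The isomorphism of the Iwasawa algebra with `b₀`. -/
def iwasawaHom (hs : 1 ≤ s) : iwasawaAlgebra p →ₗ⁅ℝ⁆ algB₀ p s where
  toFun M := ⟨inB p s (emb s (M.1 (Sum.inl 0) (Sum.inr 0))
    fun j => M.1 (Sum.inl 0) (Sum.inr j.succ)), (mem_algB₀_iff hs _).2 ⟨_, _, rfl⟩⟩
  map_add' M M' := by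
    refine Subtype.ext (U0.ext' p s (idx_ext ?_ ?_ ?_) ?_)
    · simp [emb]; ring
    · simp [emb]; ring
    · rfl
    · simp
  map_smul' t M := by
    refine Subtype.ext (U0.ext' p s (idx_ext ?_ ?_ ?_) ?_)
    · simp [emb]; ring
    · simp [emb]; ring
    · rfl
    · simp
  map_lie' {M M'} := by
    obtain ⟨M, hM⟩ := M
    obtain ⟨M', hM'⟩ := M'
    have hM0 := hM
    have hM0' := hM'
    rw [iwasawaAlgebra_eq] at hM0 hM0'
    obtain ⟨t, W, rfl⟩ := hM0
    obtain ⟨t', W', rfl⟩ := hM0'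
    refine Subtype.ext ?_
    change inB p s (emb s (⁅t • boost p + nilMat W, t' • boost p + nilMat W'⁆ (Sum.inl 0) (Sum.inr 0))
      fun j => ⁅t • boost p + nilMat W, t' • boost p + nilMat W'⁆ (Sum.inl 0) (Sum.inr j.succ)) =
      ⁅inB p s (emb s ((t • boost p + nilMat W) (Sum.inl 0) (Sum.inr 0))
        fun j => (t • boost p + nilMat W) (Sum.inl 0) (Sum.inr j.succ)),
      inB p s (emb s ((t' • boost p + nilMat W') (Sum.inl 0) (Sum.inr 0))
        fun j => (t' • boost p + nilMat W') (Sum.inl 0) (Sum.inr j.succ))⁆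
    rw [lie_boost_nilMat, (iwasawa_entries t W).1, (iwasawa_entries t W).2,
      (iwasawa_entries t' W').1, (iwasawa_entries t' W').2]
    have h := iwasawa_entries 0 (t • W' - t' • W)
    rw [zero_smul, zero_add] at h
    rw [h.1, h.2]
    refine U0.ext' p s (idx_ext ?_ ?_ ?_) (idx_ext ?_ ?_ ?_)
    · simp [emb]
    · simp [emb]
    · rw [U0.lie_fst, inB_fst, inB_fst, inB_fst, tail_bracketB, emb_weight, emb_weight]
      rfl
    all_goals simp

theorem iwasawaHom_apply (hs : 1 ≤ s) (M : iwasawaAlgebra p) : (iwasawaHom hs M : U0 p s) =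
    inB p s (emb s (M.1 (Sum.inl 0) (Sum.inr 0)) fun j => M.1 (Sum.inl 0) (Sum.inr j.succ)) := rfl

theorem emb_injective {t t' : ℝ} {W W' : Fin p → ℝ} (h : emb s t W = emb s t' W') :
    t = t' ∧ W = W' := by
  constructor
  · have := congrFun h (Sum.inl 0)
    exact mul_left_cancel₀ (boostCoeff_pos s).ne' this
  · exact congrArg tail h

theorem iwasawaHom_bijective (hs : 1 ≤ s) : Function.Bijective (iwasawaHom (p := p) hs) := by
  constructor
  · rintro ⟨M, hM⟩ ⟨M', hM'⟩ h
    have h' := congrArg (fun u => (Subtype.val u).1) h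
    simp only [iwasawaHom_apply, inB_fst] at h'
    rw [iwasawaAlgebra_eq] at hM hM'
    obtain ⟨t, W, rfl⟩ := hM
    obtain ⟨t', W', rfl⟩ := hM'
    rw [(iwasawa_entries t W).1, (iwasawa_entries t W).2,
      (iwasawa_entries t' W').1, (iwasawa_entries t' W').2] at h'
    obtain ⟨rfl, rfl⟩ := emb_injective h'
    rfl
  · rintro ⟨u, hu⟩
    obtain ⟨t, W, rfl⟩ := (mem_algB₀_iff hs u).1 hu
    have hM : t • boost p + nilMat W ∈ iwasawaAlgebra p := by
      rw [iwasawaAlgebra_eq]; exact ⟨t, W, rfl⟩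
    refine ⟨⟨t • boost p + nilMat W, hM⟩, Subtype.ext ?_⟩
    change inB p s (emb s ((t • boost p + nilMat W) (Sum.inl 0) (Sum.inr 0))
      fun j => (t • boost p + nilMat W) (Sum.inl 0) (Sum.inr j.succ)) = inB p s (emb s t W)
    rw [ (iwasawa_entries t W).1, (iwasawa_entries t W).2]

/-- The isomorphism of the Iwasawa algebra with `b₀`. -/
def iwasawaEquiv (hs : 1 ≤ s) : iwasawaAlgebra p ≃ₗ⁅ℝ⁆ algB₀ p s :=
  LieEquiv.ofBijective (iwasawaHom hs) (iwasawaHom_bijective hs)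

end Iwasawa

/-! ### The Iwasawa group and its simply transitive action on the orbit -/

section IwasawaGroup

attribute [local instance 100] LieRing.ofAssociativeRing

variable {p : ℕ}

/-- The product of the boost `exp (t A)` and of the unipotent transformation `exp (nilMat W)`. -/
def iwLin (x : IwaParam p) : (LIdx p → ℝ) →ₗ[ℝ] (LIdx p → ℝ) where
  toFun v :=
    -- `P` and `M` are the two null coordinates after the boost; the unipotent factor shifts the
    -- vector along the first null direction by `q`.
    let P := Real.exp x.t * (v (Sum.inl 0) + v (Sum.inr 0))
    let M := Real.exp (-x.t) * (v (Sum.inl 0) - v (Sum.inr 0))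
    let q := x.W ⬝ᵥ ltail v + M * (x.W ⬝ᵥ x.W) / 2
    lvec ((P + M) / 2 + q) ((P - M) / 2 + q) (ltail v + M • x.W)
  map_add' v w := by
    refine lidx_ext ?_ ?_ ?_ <;> simp <;> first | ring1 | module
  map_smul' r v := by
    refine lidx_ext ?_ ?_ ?_ <;> simp <;> first | ring1 | module

/-- The matrix of `iwLin`. -/
def iwMat (x : IwaParam p) : Matrix (LIdx p) (LIdx p) ℝ := LinearMap.toMatrix' (iwLin x)

theorem iwMat_mulVec (x : IwaParam p) (v : LIdx p → ℝ) : iwMat x *ᵥ v = iwLin x v := by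
  rw [iwMat, LinearMap.toMatrix'_mulVec]

theorem iwMat_mul (x y : IwaParam p) : iwMat (x * y) = iwMat x * iwMat y :=
  matrix_ext_mulVec fun v => by
    rw [← Matrix.mulVec_mulVec, iwMat_mulVec, iwMat_mulVec, iwMat_mulVec]
    have h : Real.exp x.t * Real.exp (-x.t) = 1 := by rw [← Real.exp_add]; simp
    simp only [iwLin, LinearMap.coe_mk, AddHom.coe_mk, IwaParam.mul_t, IwaParam.mul_W, neg_add,
      Real.exp_add]
    set a := Real.exp x.t
    set a' := Real.exp (-x.t)
    set b := Real.exp y.t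
    set b' := Real.exp (-y.t)
    refine lidx_ext ?_ ?_ ?_
    · simp only [lvec_inl, lvec_inr_zero, ltail_lvec, add_dotProduct, dotProduct_add,
        smul_dotProduct, dotProduct_smul, smul_eq_mul, dotProduct_comm y.W x.W]
      linear_combination (b' * (v (Sum.inl 0) - v (Sum.inr 0))) *
        (x.W ⬝ᵥ y.W + a * (y.W ⬝ᵥ y.W) / 2) * h
    · simp only [lvec_inl, lvec_inr_zero, ltail_lvec, add_dotProduct, dotProduct_add,
        smul_dotProduct, dotProduct_smul, smul_eq_mul, dotProduct_comm y.W x.W]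
      linear_combination (b' * (v (Sum.inl 0) - v (Sum.inr 0))) *
        (x.W ⬝ᵥ y.W + a * (y.W ⬝ᵥ y.W) / 2) * h
    · funext i
      simp only [lvec_inl, lvec_inr_zero, ltail_lvec, Pi.add_apply, Pi.smul_apply, smul_eq_mul]
      linear_combination (b' * (v (Sum.inl 0) - v (Sum.inr 0))) * y.W i * h

theorem iwMat_one : iwMat (1 : IwaParam p) = 1 :=
  matrix_ext_mulVec fun v => by
    rw [iwMat_mulVec, Matrix.one_mulVec]
    refine lidx_ext ?_ ?_ ?_ <;> simp [iwLin]

/-- The boost is not diagonal in the given coordinates, so its exponential is found as the solution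
of the linear differential equation. -/
theorem exp_boost (t : ℝ) : NormedSpace.exp (t • boost p) = iwMat ⟨t, 0⟩ := by
  have := matrix_exp_eq_of_hasDerivAt (t • boost p) (fun τ => iwMat ⟨τ * t, 0⟩)
    (by rw [zero_mul]; exact iwMat_one) (fun τ i j => ?_)
  · simpa using this.symm
  · suffices h : HasDerivAt (fun τ => (iwMat (p := p) ⟨τ * t, 0⟩ *ᵥ Pi.single j 1) i)
        (((t • boost p * iwMat ⟨τ * t, 0⟩) *ᵥ Pi.single j 1) i) τ by
      simpa only [Matrix.mulVec_single_one, Matrix.col_apply] using h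
    rw [← Matrix.mulVec_mulVec, Matrix.smul_mulVec, boost_mulVec]
    simp only [iwMat_mulVec]
    generalize (Pi.single j 1 : LIdx p → ℝ) = v
    have h1 : HasDerivAt (fun τ : ℝ => Real.exp (τ * t)) (Real.exp (τ * t) * t) τ := by
      simpa using ((hasDerivAt_id τ).mul_const t).exp
    have h2 : HasDerivAt (fun τ : ℝ => Real.exp (-(τ * t))) (Real.exp (-(τ * t)) * -t) τ := by
      simpa using ((hasDerivAt_id τ).mul_const t).fun_neg.exp
    have h3 := h1.mul_const (v (Sum.inl 0) + v (Sum.inr 0))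
    have h4 := h2.mul_const (v (Sum.inl 0) - v (Sum.inr 0))
    rcases i with i | i
    · rw [Subsingleton.elim i 0]
      simp only [iwLin, LinearMap.coe_mk, AddHom.coe_mk, lvec_inl, lvec_inr_zero, Pi.smul_apply,
        zero_dotProduct, mul_zero, zero_div, add_zero]
      refine ((h3.fun_add h4).div_const 2).congr_deriv ?_
      rw [smul_eq_mul]; ring
    · refine Fin.cases ?_ (fun i => ?_) i
      · simp only [iwLin, LinearMap.coe_mk, AddHom.coe_mk, lvec_inl, lvec_inr_zero, Pi.smul_apply,
          zero_dotProduct, mul_zero, zero_div, add_zero]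
        refine ((h3.fun_sub h4).div_const 2).congr_deriv ?_
        rw [smul_eq_mul]; ring
      · simp only [iwLin, LinearMap.coe_mk, AddHom.coe_mk, lvec_inr_succ, Pi.smul_apply,
          smul_zero, add_zero, Pi.zero_apply]
        exact hasDerivAt_const _ _

/-- The commutator relation is that of `exp_adJB` with the same weight t, so W is rescaled by the
same factor `expInt t`. This coincidence is what makes the homomorphism of groups integrate the
isomorphism of Lie algebras. -/
theorem exp_boost_add_nilMat (t : ℝ) (W : Fin p → ℝ) :
    NormedSpace.exp (t • boost p + nilMat W) = iwMat ⟨t, expInt t • W⟩ := by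
  have hc : t • boost p * nilMat W - nilMat W * t • boost p = t • nilMat W := by
    rw [smul_mul_assoc, mul_smul_comm, ← smul_sub, boost_nilMat]
  have h3 : nilMat W * nilMat W * nilMat W = 0 := matrix_ext_mulVec fun v => by
    rw [← Matrix.mulVec_mulVec, ← Matrix.mulVec_mulVec, nilMat_mulVec, nilMat_mulVec,
      nilMat_mulVec, Matrix.zero_mulVec]
    refine lidx_ext ?_ ?_ ?_ <;> simp
  rw [matrix_exp_add_eq_of_commutator _ _ t hc h3, exp_boost]
  refine matrix_ext_mulVec fun v => ?_
  rw [← Matrix.mulVec_mulVec, Matrix.add_mulVec, Matrix.add_mulVec, Matrix.one_mulVec,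
    Matrix.smul_mulVec, Matrix.smul_mulVec, ← Matrix.mulVec_mulVec, nilMat_mulVec, nilMat_mulVec,
    iwMat_mulVec, iwMat_mulVec]
  refine lidx_ext ?_ ?_ ?_ <;> simp [iwLin] <;> first | ring1 | module

/-- The isomorphism of `ℝ ⋉ ℝ^p` onto the Iwasawa group. -/
def iwHom : IwaParam p →* (Matrix (LIdx p) (LIdx p) ℝ)ˣ where
  toFun x := ⟨iwMat x, iwMat x⁻¹, by rw [← iwMat_mul, mul_inv_cancel, iwMat_one],
    by rw [← iwMat_mul, inv_mul_cancel, iwMat_one]⟩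
  map_one' := Units.ext iwMat_one
  map_mul' x y := Units.ext (iwMat_mul x y)

theorem iwHom_injective : Function.Injective (iwHom (p := p)) := by
  intro x y h
  have hv : ∀ v, iwLin x v = iwLin y v := fun v => by
    rw [← iwMat_mulVec, ← iwMat_mulVec]
    exact congrArg (fun g : (Matrix (LIdx p) (LIdx p) ℝ)ˣ =>
      (g : Matrix (LIdx p) (LIdx p) ℝ) *ᵥ v) h
  have h1 := hv (lvec 1 1 0)
  have h2 := hv (lvec 1 0 0)
  have ht : x.t = y.t := by
    have := congrFun h1 (Sum.inl 0)
    simp [iwLin] at this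
    exact this
  refine IwaParam.ext ht ?_
  have := congrArg ltail h2
  simp only [iwLin, LinearMap.coe_mk, AddHom.coe_mk, ltail_lvec, lvec_inl, lvec_inr_zero,
    zero_add, ht] at this
  exact smul_right_injective _ (by simp) this

theorem iwasawaGroup_eq : iwasawaGroup p = (iwHom (p := p)).range := by
  apply le_antisymm
  · rw [iwasawaGroup, expGroup, Subgroup.closure_le]
    rintro g ⟨X, hX, hg⟩
    rw [iwasawaAlgebra_eq] at hX
    obtain ⟨t, W, rfl⟩ := hX
    exact ⟨⟨t, expInt t • W⟩, Units.ext (by rw [hg, exp_boost_add_nilMat]; rfl)⟩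
  · rintro _ ⟨⟨t, W⟩, rfl⟩
    refine Subgroup.subset_closure ⟨t • boost p + nilMat ((expInt t)⁻¹ • W), ?_, ?_⟩
    · rw [iwasawaAlgebra_eq]; exact ⟨t, _, rfl⟩
    · rw [exp_boost_add_nilMat, smul_inv_smul₀ (expInt_pos t).ne']
      rfl

variable {s : ℕ}

/-- The action is free at JB₀: the a₂-coordinate of the image returns t, and then its component in
𝔵⁺ returns W. -/
theorem act_emb_vecJB₀_injective (hs : 1 ≤ s) {x y : IwaParam p}
    (h : act s (emb s x.t x.W) (vecJB₀ p s) = act s (emb s y.t y.W) (vecJB₀ p s)) : x = y := by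
  have hm := mu_pos hs
  have hc := boostCoeff_pos s
  rw [act_vecJB₀ hs, act_vecJB₀ hs] at h
  have h1 := congrFun h (Sum.inl 1)
  have h2 := congrArg tail h
  simp only [vec_inl_one, tail_vec] at h1 h2
  have h3 : Real.exp (mu s * emb s x.t x.W (Sum.inl 1)) =
      Real.exp (mu s * emb s y.t y.W (Sum.inl 1)) := by
    field_simp at h1
    exact h1
  have ht : x.t = y.t := by
    have := Real.exp_injective h3
    simp only [emb, vec_inl_one] at this
    field_simp at this
    linarith
  refine IwaParam.ext ht ?_
  rw [h3] at h2
  exact smul_right_injective _ (Real.exp_pos _).ne' h2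

/-- Both groups are images of ℝ ⋉ ℝ^p, and `iwHom` is injective, so the representation is `actHom`
composed with the inverse of `iwHom`. Points of the orbit correspond to elements of ℝ ⋉ ℝ^p and the
action to left multiplication, which is simply transitive. -/
theorem iwasawaActs (hs : 1 ≤ s) : IwasawaActsSimplyTransitively p s (iwasawaEquiv hs) := by
  let e : iwasawaGroup p ≃* IwaParam p :=
    (MulEquiv.subgroupCongr iwasawaGroup_eq).trans (MonoidHom.ofInjective iwHom_injective).symm
  have he : ∀ x : IwaParam p, ((e.symm x : iwasawaGroup p) : (Matrix (LIdx p) (LIdx p) ℝ)ˣ) =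
      iwHom x := fun x => rfl
  have horb : ∀ y ∈ orbit p s, ∃ x : IwaParam p, y = act s (emb s x.t x.W) (vecJB₀ p s) := by
    rintro y ⟨g, hg, rfl⟩
    rw [groupB₀_eq hs] at hg
    obtain ⟨x, rfl⟩ := hg
    exact ⟨x, actHom_mulVec s x _⟩
  have hmul : ∀ x y : IwaParam p, ∀ v, act s (emb s x.t x.W) (act s (emb s y.t y.W) v) =
      act s (emb s (x * y).t (x * y).W) v := fun x y v => by rw [← mulB_emb, act_mulB]
  refine ⟨(actHom s).comp e.toMonoidHom, ?_, ?_, ?_, ?_⟩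
  · rintro g ⟨X, hX⟩ hg
    have hX' := hX
    rw [iwasawaAlgebra_eq] at hX'
    obtain ⟨t, W, rfl⟩ := hX'
    have hg' : g = e.symm ⟨t, expInt t • W⟩ := by
      refine Subtype.ext (Units.ext ?_)
      rw [hg, he, exp_boost_add_nilMat]
      rfl
    have h1 : e g = ⟨t, expInt t • W⟩ := by rw [hg', e.apply_symm_apply]
    have h2 : ((iwasawaEquiv hs ⟨t • boost p + nilMat W, hX⟩ : algB₀ p s) : U0 p s) =
        inB p s (emb s t W) := by
      change inB p s (emb s ((t • boost p + nilMat W) (Sum.inl 0) (Sum.inr 0))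
        fun j => (t • boost p + nilMat W) (Sum.inl 0) (Sum.inr j.succ)) = inB p s (emb s t W)
      rw [(iwasawa_entries t W).1, (iwasawa_entries t W).2]
    rw [h2, exp_adJB_emb]
    change ((actHom s (e g) : (Matrix (Idx p) (Idx p) ℝ)ˣ) : Matrix (Idx p) (Idx p) ℝ) = _
    rw [h1]
    rfl
  · intro g y
    change MvPolynomial.eval ((actHom s (e g) : Matrix (Idx p) (Idx p) ℝ) *ᵥ y) _ = _
    rw [actHom_mulVec, eval_basicPoly_act_emb hs]
  · rintro g y ⟨a, ha, rfl⟩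
    refine ⟨actHom s (e g) * a, mul_mem ?_ ha, ?_⟩
    · rw [groupB₀_eq hs]; exact ⟨_, rfl⟩
    · rw [Units.val_mul, ← Matrix.mulVec_mulVec]
      rfl
  · intro y hy z hz
    obtain ⟨a, rfl⟩ := horb y hy
    obtain ⟨b, rfl⟩ := horb z hz
    have hR : ∀ g, (((actHom s).comp e.toMonoidHom g : (Matrix (Idx p) (Idx p) ℝ)ˣ) :
        Matrix (Idx p) (Idx p) ℝ) *ᵥ act s (emb s a.t a.W) (vecJB₀ p s) =
        act s (emb s (e g * a).t (e g * a).W) (vecJB₀ p s) := fun g => by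
      change (actHom s (e g) : Matrix (Idx p) (Idx p) ℝ) *ᵥ _ = _
      rw [actHom_mulVec, hmul]
    refine ⟨e.symm (b * a⁻¹), ?_, fun g hg => ?_⟩
    · simp only [hR]
      rw [e.apply_symm_apply, inv_mul_cancel_right]
    · simp only [hR] at hg
      have := act_emb_vecJB₀_injective hs hg
      rw [e.eq_symm_apply, ← this, mul_inv_cancel_right]

end IwasawaGroup

/-! ## The orbit as a homogeneous Riemannian hypersurface -/

section OrbitHypersurface

variable {p : ℕ}

theorem contDiff_vec {E : Type*} [NormedAddCommGroup E] [NormedSpace ℝ E] {n : WithTop ℕ∞}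
    {a b : E → ℝ} {X : E → Fin p → ℝ} (ha : ContDiff ℝ n a) (hb : ContDiff ℝ n b)
    (hX : ContDiff ℝ n X) : ContDiff ℝ n fun z => vec (a z) (b z) (X z) := by
  refine contDiff_pi.2 fun i => ?_
  rcases i with i | i
  · fin_cases i
    · exact ha
    · exact hb
  · exact contDiff_pi.1 hX i

theorem contDiff_tail {E : Type*} [NormedAddCommGroup E] [NormedSpace ℝ E] {n : WithTop ℕ∞}
    {x : E → Idx p → ℝ} (hx : ContDiff ℝ n x) : ContDiff ℝ n fun z => tail (x z) :=
  contDiff_pi.2 fun i => contDiff_pi.1 hx (Sum.inr i)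

theorem contDiff_dotProduct {E : Type*} [NormedAddCommGroup E] [NormedSpace ℝ E]
    {n : WithTop ℕ∞} {x y : E → Fin p → ℝ} (hx : ContDiff ℝ n x) (hy : ContDiff ℝ n y) :
    ContDiff ℝ n fun z => x z ⬝ᵥ y z :=
  ContDiff.sum fun i _ => (contDiff_pi.1 hx i).mul (contDiff_pi.1 hy i)

theorem contDiff_act (s : ℕ) {E : Type*} [NormedAddCommGroup E] [NormedSpace ℝ E]
    {n : WithTop ℕ∞} {x y : E → Idx p → ℝ} (hx : ContDiff ℝ n x) (hy : ContDiff ℝ n y) :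
    ContDiff ℝ n fun z => act s (x z) (y z) := by
  have hx' := contDiff_pi.1 hx
  have hy' := contDiff_pi.1 hy
  have hxt := contDiff_tail hx
  have hyt := contDiff_tail hy
  have h1 := contDiff_dotProduct hxt hyt
  have h2 := contDiff_dotProduct hxt hxt
  have x0 := hx' (Sum.inl 0)
  have x1 := hx' (Sum.inl 1)
  have y0 := hy' (Sum.inl 0)
  have y1 := hy' (Sum.inl 1)
  refine contDiff_vec ?_ ?_ ?_ <;> fun_prop

theorem contDiff_emb (s : ℕ) : ContDiff ℝ ∞ fun z : ℝ × (Fin p → ℝ) => emb s z.1 z.2 := by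
  refine contDiff_vec ?_ ?_ ?_ <;> fun_prop

theorem continuous_qform (s : ℕ) : Continuous fun y : Idx p → ℝ => qform s y y := by
  simp only [qform_self]
  have := (contDiff_dotProduct (n := 0) (contDiff_tail (p := p) contDiff_id)
    (contDiff_tail contDiff_id)).continuous
  simp only [id] at this
  fun_prop

variable {s : ℕ}

theorem isHomogeneous_basicPoly (hs : 1 ≤ s) : (basicPoly p s).IsHomogeneous (s + 1) := by
  have h1 : (linPoly p s).IsHomogeneous 1 := MvPolynomial.isHomogeneous_C_mul_X _ _
  have h2 : (quadPoly p s).IsHomogeneous 2 := by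
    refine MvPolynomial.IsHomogeneous.sub ((MvPolynomial.isHomogeneous_X ℝ _).mul h1) ?_
    exact (MvPolynomial.IsHomogeneous.sum _ _ _ fun i _ =>
      (MvPolynomial.isHomogeneous_X ℝ _).pow 2).C_mul _
  have := (h1.pow (s - 1)).mul h2
  rw [basicPoly_eq p hs]
  convert this using 1
  omega

/-- Restricted to the affine line μa₂ = 1, X = 0, the polynomial becomes the variable a₁. A k-th
power of degree one has k = 1, and then the degree of the root is s + 1. -/
theorem basicPoly_not_pow (hs : 1 ≤ s) : ¬ ∃ (q : MvPolynomial (Idx p) ℝ) (k : ℕ),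
    q.totalDegree < s + 1 ∧ basicPoly p s = q ^ k := by
  rintro ⟨q, k, hq, hk⟩
  have hm := mu_pos hs
  let φ : MvPolynomial (Idx p) ℝ →ₐ[ℝ] Polynomial ℝ :=
    MvPolynomial.aeval (Sum.elim ![Polynomial.X, Polynomial.C (mu s)⁻¹] 0)
  have h1 : φ (linPoly p s) = 1 := by
    simp only [linPoly, φ, map_mul, MvPolynomial.aeval_X, MvPolynomial.algHom_C, Sum.elim_inl,
      Matrix.cons_val_one, Matrix.cons_val_zero, Polynomial.algebraMap_eq]
    rw [← Polynomial.C_mul, mul_inv_cancel₀ hm.ne', Polynomial.C_1]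
  have h2 : φ (quadPoly p s) = Polynomial.X := by
    rw [quadPoly, map_sub, map_mul, h1]
    simp [φ]
  have h3 : φ q ^ k = Polynomial.X := by
    rw [← map_pow, ← hk, basicPoly_eq p hs, map_mul, map_pow, h1, h2, one_pow, one_mul]
  have h4 : k * (φ q).natDegree = 1 := by
    rw [← Polynomial.natDegree_pow, h3, Polynomial.natDegree_X]
  obtain rfl : k = 1 := Nat.eq_one_of_mul_eq_one_right h4
  rw [pow_one] at hk
  rw [← hk, (isHomogeneous_basicPoly hs).totalDegree] at hq
  · exact lt_irrefl _ hq
  · intro h0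
    have := eval_basicPoly_vecJB₀ (p := p) hs
    rw [h0, map_zero] at this
    exact zero_ne_one this

theorem orbit_eq_range (hs : 1 ≤ s) : orbit p s =
    Set.range fun z : ℝ × (Fin p → ℝ) => act s (emb s z.1 z.2) (vecJB₀ p s) := by
  ext y
  constructor
  · rintro ⟨g, hg, rfl⟩
    rw [groupB₀_eq hs] at hg
    obtain ⟨x, rfl⟩ := hg
    exact ⟨(x.t, x.W), (actHom_mulVec s x _).symm⟩
  · rintro ⟨z, rfl⟩
    exact ⟨actHom s ⟨z.1, z.2⟩, by rw [groupB₀_eq hs]; exact ⟨_, rfl⟩,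
      (actHom_mulVec s ⟨z.1, z.2⟩ _).symm⟩

theorem orbit_coord_pos (hs : 1 ≤ s) {y : Idx p → ℝ} (hy : y ∈ orbit p s) :
    0 < mu s * y (Sum.inl 1) := mul_pos (mu_pos hs) ((mem_orbit_iff hs y).1 hy).1

theorem isRiemannianHypersurface_orbit (hs : 1 ≤ s) :
    IsRiemannianHypersurface (basicPoly p s) (s + 1) (orbit p s) where
  homogeneous := isHomogeneous_basicPoly hs
  not_pow := basicPoly_not_pow hs
  relOpen := ⟨{y | 0 < y (Sum.inl 1)}, isOpen_lt continuous_const (continuous_apply _), by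
    ext y
    exact mem_orbit_iff hs y⟩
  connected := by
    rw [orbit_eq_range hs]
    exact isConnected_range (contDiff_act s (contDiff_emb s) contDiff_const).continuous
  smooth y hy := by
    have hb := orbit_coord_pos hs hy
    have h1 := ((mem_orbit_iff hs y).1 hy).2
    -- Euler's identity: the radial derivative equals the degree at a point with h = 1, so some
    -- partial derivative is nonzero.
    have : polyDeriv (basicPoly p s) y y = s + 1 := by
      rw [polyDeriv_basicPoly_of_ne hs y y hb.ne']
      rw [eval_basicPoly hs] at h1
      rw [mul_assoc, mul_div_assoc, mul_div_cancel_left₀ _ hb.ne']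
      linear_combination (s + 1) * h1
    have h2 : polyDeriv (basicPoly p s) y y ≠ 0 := by rw [this]; positivity
    obtain ⟨i, _, hi⟩ := Finset.exists_ne_zero_of_sum_ne_zero h2
    exact ⟨i, left_ne_zero_of_mul hi⟩
  pos y hy v hv0 hv := by
    have hb := orbit_coord_pos hs hy
    have hm := mu_pos hs
    have hs' : (0 : ℝ) < s := by exact_mod_cast hs
    have h1 := ((mem_orbit_iff hs y).1 hy).2
    rw [canonicalMetric_basicPoly_tangent hs y v v hb h1 hv hv]
    have hnn : ∀ w : Fin p → ℝ, 0 ≤ w ⬝ᵥ w := fun w => Finset.sum_nonneg fun i _ =>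
      mul_self_nonneg _
    have hbn : (0 : ℝ) < (mu s * y (Sum.inl 1)) ^ (s - 1) := by positivity
    refine mul_pos (by positivity) ?_
    -- On tangent vectors the metric is a sum of two squares. If the first vanishes, then v₂ = 0; if
    -- the 𝔵⁺-component vanished as well, tangency would force v = 0.
    by_cases hv1 : v (Sum.inl 1) = 0
    · have hv' : tail v ≠ 0 := by
        intro hv2
        apply hv0
        refine idx_ext ?_ hv1 hv2
        rw [polyDeriv_basicPoly_of_ne hs y v hb.ne', hv1] at hv
        have := (mul_eq_zero.1 hv).resolve_left hbn.ne'
        simp only [qform, hv1, hv2, dotProduct_zero, mul_zero, zero_mul, zero_div, zero_add,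
          sub_zero] at this
        have : v (Sum.inl 0) * (mu s * y (Sum.inl 1)) = 0 := by linarith
        exact (mul_eq_zero.1 this).resolve_right hb.ne'
      simp only [hv1, mul_zero, zero_div, zero_smul, sub_zero, zero_add]
      refine mul_pos hbn (lt_of_le_of_ne (hnn _) (Ne.symm ?_))
      rwa [Ne, dotProduct_self_eq_zero]
    · refine add_pos_of_pos_of_nonneg ?_ (mul_nonneg hbn.le (hnn _))
      have : 0 < (mu s * v (Sum.inl 1)) * (mu s * v (Sum.inl 1)) :=
        mul_self_pos.2 (mul_ne_zero hm.ne' hv1)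
      positivity

/-- On the hyperplane a₂ = 0 the polynomial vanishes for s > 1 and equals -|X|²/2 for s = 1. So the
level {h = 1} avoids the hyperplane, and the sign of a₂ separates its sheets. -/
theorem coord_ne_zero_of_eval_eq_one (hs : 1 ≤ s) {y : Idx p → ℝ}
    (hy : MvPolynomial.eval y (basicPoly p s) = 1) : y (Sum.inl 1) ≠ 0 := by
  intro h0
  rw [eval_basicPoly hs, qform_self, h0] at hy
  have hnn : 0 ≤ tail y ⬝ᵥ tail y := Finset.sum_nonneg fun i _ => mul_self_nonneg _
  rcases Nat.eq_zero_or_pos (s - 1) with h | h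
  · rw [h] at hy
    simp only [mul_zero, pow_zero, zero_sub, one_mul] at hy
    linarith
  · rw [mul_zero, zero_pow h.ne', zero_mul] at hy
    exact zero_ne_one hy

theorem isHomogeneousHypersurface_orbit (hs : 1 ≤ s) :
    IsHomogeneousHypersurface (basicPoly p s) (orbit p s) := by
  have h1 : (1 : Matrix (Idx p) (Idx p) ℝ) ∈ autGroup (basicPoly p s) :=
    ⟨by simp, fun x => by rw [Matrix.one_mulVec]⟩
  constructor
  · intro A hA x hx
    have hx' := (mem_orbit_iff hs x).1 hx
    have hsub := connectedComponentIn_subset (autGroup (basicPoly p s)) 1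
    have hev : ∀ M ∈ connectedComponentIn (autGroup (basicPoly p s)) 1,
        MvPolynomial.eval (M *ᵥ x) (basicPoly p s) = 1 := fun M hM => by
      rw [(hsub hM).2 x, hx'.2]
    refine (mem_orbit_iff hs _).2 ⟨?_, hev A hA⟩
    -- The a₂-coordinate of `M *ᵥ x` is continuous on the connected identity component, positive at
    -- `M = 1` and never zero. Hence every element of the component keeps `x` on its sheet.
    have hcont : Continuous fun M : Matrix (Idx p) (Idx p) ℝ => (M *ᵥ x) (Sum.inl 1) :=
      continuous_pi_iff.1 (continuous_id.matrix_mulVec continuous_const) (Sum.inl 1)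
    have hconn := (isPreconnected_connectedComponentIn (x := (1 : Matrix (Idx p) (Idx p) ℝ))
      (F := autGroup (basicPoly p s))).image _ hcont.continuousOn
    by_contra hneg
    have hle := not_lt.1 hneg
    obtain ⟨M, hM, h0⟩ := hconn.Icc_subset (Set.mem_image_of_mem _ hA)
      (Set.mem_image_of_mem _ (mem_connectedComponentIn h1))
      (show (0 : ℝ) ∈ Set.Icc _ _ from ⟨hle, by rw [Matrix.one_mulVec]; exact hx'.1.le⟩)
    exact coord_ne_zero_of_eval_eq_one hs (hev M hM) h0
  · rintro _ ⟨a, ha, rfl⟩ _ ⟨b, hb, rfl⟩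
    rw [groupB₀_eq hs] at ha hb
    obtain ⟨x, hx⟩ : b * a⁻¹ ∈ (actHom s (p := p)).range := mul_mem hb (inv_mem ha)
    -- The orbit group is a continuous image of ℝ × ℝ^p inside Aut(h) and contains 1, so it lies in
    -- the identity component.
    have hS : Set.range (fun z : ℝ × (Fin p → ℝ) => actMat s (emb s z.1 z.2)) ⊆
        autGroup (basicPoly p s) := by
      rintro _ ⟨z, rfl⟩
      refine ⟨?_, fun x => ?_⟩
      · exact (Matrix.isUnit_iff_isUnit_det _).1 (actUnit s (emb s z.1 z.2)).isUnit
      · rw [actMat_mulVec, eval_basicPoly_act_emb hs]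
    have hc : Continuous fun z : ℝ × (Fin p → ℝ) => actMat s (emb s z.1 z.2) := by
      refine continuous_matrix fun i j => ?_
      have := (continuous_pi_iff.1 (contDiff_act s (contDiff_emb (p := p) s)
        (contDiff_const (c := Pi.single j 1))).continuous i)
      refine this.congr fun z => ?_
      rw [← actMat_mulVec, Matrix.mulVec_single_one]
      rfl
    have h10 : (1 : Matrix (Idx p) (Idx p) ℝ) ∈
        Set.range (fun z : ℝ × (Fin p → ℝ) => actMat s (emb s z.1 z.2)) :=
      ⟨(0, 0), congrArg Units.val (map_one (actHom s (p := p)))⟩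
    refine ⟨((b * a⁻¹ : (Matrix (Idx p) (Idx p) ℝ)ˣ) : Matrix (Idx p) (Idx p) ℝ), ?_, ?_⟩
    · refine (isPreconnected_range hc).subset_connectedComponentIn h10 hS ?_
      rw [← hx]
      exact ⟨(x.t, x.W), rfl⟩
    · rw [Matrix.mulVec_mulVec, ← Units.val_mul, inv_mul_cancel_right]

/-- On a₂ > 0 the signs of h and q agree, and by homogeneity a point with h > 0 can be rescaled to
the level h = 1. The cone therefore does not see the exponent s - 1. -/
theorem mem_cone_orbit_iff (hs : 1 ≤ s) (y : Idx p → ℝ) : y ∈ cone (orbit p s) ↔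
    0 < y (Sum.inl 1) ∧ 0 < qform s y y := by
  have hm := mu_pos hs
  constructor
  · rintro ⟨t, ht, x, hx, rfl⟩
    have hx' := (mem_orbit_iff hs x).1 hx
    have hb := orbit_coord_pos hs hx
    have hQ : 0 < qform s x x := by
      have h := hx'.2
      rw [eval_basicPoly hs] at h
      exact (pos_iff_pos_of_mul_pos (h ▸ one_pos)).1 (by positivity)
    refine ⟨mul_pos ht hx'.1, ?_⟩
    rw [qform_smul_left, qform_smul_right]
    positivity
  · rintro ⟨h1, hQ⟩
    set a := (mu s * y (Sum.inl 1)) ^ (s - 1) * qform s y y with ha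
    have ha0 : 0 < a := by positivity
    -- The scaling factor is the (s + 1)-st root of the value of h, the degree being s + 1.
    let t := a ^ (1 / ((s : ℝ) + 1))
    have ht : 0 < t := Real.rpow_pos_of_pos ha0 _
    have hta : t ^ (s + 1) = a := by
      rw [← Real.rpow_natCast, ← Real.rpow_mul ha0.le]
      push_cast
      rw [one_div_mul_cancel (by positivity), Real.rpow_one]
    refine ⟨t, ht, t⁻¹ • y, (mem_orbit_iff hs _).2 ⟨by simp; positivity, ?_⟩, ?_⟩
    · rw [eval_basicPoly hs, qform_smul_left, qform_smul_right]
      obtain ⟨n, rfl⟩ : ∃ n, s = n + 1 := ⟨s - 1, by omega⟩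
      rw [Nat.add_sub_cancel] at ha ⊢
      have : (mu (n + 1) * (t⁻¹ • y) (Sum.inl 1)) ^ n * (t⁻¹ * (t⁻¹ * qform (n + 1) y y)) =
          (t ^ (n + 1 + 1))⁻¹ * a := by
        rw [ha, Pi.smul_apply, smul_eq_mul]
        simp only [mul_pow, inv_pow]
        field_simp
        ring
      rw [this, hta, inv_mul_cancel₀ ha0.ne']
    · rw [smul_smul, mul_inv_cancel₀ ht.ne', one_smul]

/-- Reversed Cauchy-Schwarz for the Lorentzian form q: for y, z in the cone, with b, c their values
of μa₂, expand |c·tail y - b·tail z|² ≥ 0 and insert the positivity of q(y, y) and q(z, z). -/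
theorem qform_pos_of_pos (hs : 1 ≤ s) {y z : Idx p → ℝ} (hy : 0 < y (Sum.inl 1))
    (hy' : 0 < qform s y y) (hz : 0 < z (Sum.inl 1)) (hz' : 0 < qform s z z) :
    0 < qform s y z := by
  have hm := mu_pos hs
  have hb : 0 < mu s * y (Sum.inl 1) := mul_pos hm hy
  have hc : 0 < mu s * z (Sum.inl 1) := mul_pos hm hz
  rw [qform_self] at hy' hz'
  rw [qform]
  set b := mu s * y (Sum.inl 1)
  set c := mu s * z (Sum.inl 1)
  have hnn : 0 ≤ (c • tail y - b • tail z) ⬝ᵥ (c • tail y - b • tail z) :=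
    Finset.sum_nonneg fun i _ => mul_self_nonneg _
  simp only [sub_dotProduct, dotProduct_sub, smul_dotProduct, dotProduct_smul, smul_eq_mul,
    dotProduct_comm (tail z) (tail y)] at hnn
  have h1 := mul_pos (mul_pos hc hc) hy'
  have h2 := mul_pos (mul_pos hb hb) hz'
  have h3 : 0 < (b * c) * (y (Sum.inl 0) * c + z (Sum.inl 0) * b - tail y ⬝ᵥ tail z) := by
    linarith
  have := (pos_iff_pos_of_mul_pos h3).1 (mul_pos hb hc)
  linarith

theorem isSiegelDomainTypeI_cone_orbit (hs : 1 ≤ s) :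
    IsSiegelDomainTypeI (cone (orbit p s)) := by
  have hm := mu_pos hs
  have hV : cone (orbit p s) = {y | 0 < y (Sum.inl 1) ∧ 0 < qform s y y} :=
    Set.ext fun y => mem_cone_orbit_iff hs y
  refine ⟨?_, ⟨vecJB₀ p s, ?_⟩, ?_, ?_⟩
  · rw [hV]
    exact (isOpen_lt continuous_const (continuous_apply _)).inter
      (isOpen_lt continuous_const (continuous_qform s))
  · rw [mem_cone_orbit_iff hs, vecJB₀_eq, qform_self]
    simp [hm, hm.ne']
  · intro y hy z hz a b ha hb hab
    rw [mem_cone_orbit_iff hs] at hy hz ⊢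
    have hyz := qform_pos_of_pos hs hy.1 hy.2 hz.1 hz.2
    have e : qform s (a • y + b • z) (a • y + b • z) =
        a * a * qform s y y + 2 * (a * b) * qform s y z + b * b * qform s z z := by
      simp only [qform_add_left, qform_add_right, qform_smul_left, qform_smul_right,
        qform_comm s z y]
      ring
    rw [e]
    have hy1 := hy.1
    have hy2 := hy.2
    have hz1 := hz.1
    have hz2 := hz.2
    simp only [Pi.add_apply, Pi.smul_apply, smul_eq_mul]
    rcases ha.eq_or_lt with rfl | ha
    · obtain rfl : b = 1 := by linarith
      simpa using hz
    · constructor <;> positivity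
  · intro x v hv0 hall
    simp only [mem_cone_orbit_iff hs] at hall
    -- Along a line in the cone a₂ is affine and positive, so v₂ = 0. Then q is a polynomial in t
    -- with leading coefficient -|tail v|²/2, so tail v = 0. What remains is again affine and
    -- positive, hence q(x, v) = 0, and this forces v₁ = 0.
    have hv1 : v (Sum.inl 1) = 0 := by
      by_contra hne
      have := (hall (-(x (Sum.inl 1) / v (Sum.inl 1)))).1
      simp only [Pi.add_apply, Pi.smul_apply, smul_eq_mul] at this
      field_simp at this
      simp at this
    have hQ : ∀ t : ℝ, 0 < qform s x x + 2 * t * qform s x v - t ^ 2 * (tail v ⬝ᵥ tail v) / 2 :=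
      fun t => by
        have h := (hall t).2
        have e : qform s v v = -(tail v ⬝ᵥ tail v) / 2 := by rw [qform_self, hv1]; ring
        simp only [qform_add_left, qform_add_right, qform_smul_left, qform_smul_right,
          qform_comm s v x, e] at h
        linarith
    have hnn : 0 ≤ tail v ⬝ᵥ tail v := Finset.sum_nonneg fun i _ => mul_self_nonneg _
    have h0 := hQ 0
    have hvt : tail v ⬝ᵥ tail v = 0 := by
      by_contra hne
      have hpos : 0 < tail v ⬝ᵥ tail v := lt_of_le_of_ne hnn (Ne.symm hne)
      set n := tail v ⬝ᵥ tail v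
      set q := qform s x x
      have hq : 0 < q := by simpa using h0
      -- Adding the inequalities at t and -t removes the linear term and leaves 2q > t²n, which
      -- fails for t = 2q/n + 1.
      have a := hQ (2 * q / n + 1)
      have b := hQ (-(2 * q / n + 1))
      have c : (2 * q / n + 1) ^ 2 * n = 4 * q * (q / n) + 4 * q + n := by
        field_simp; ring
      have d : 0 < 4 * q * (q / n) := by positivity
      nlinarith
    have hxv : qform s x v = 0 := by
      by_contra hne
      have := hQ (-(qform s x x / (2 * qform s x v)))
      rw [hvt] at this
      field_simp at this
      simp at this
    apply hv0
    have hv2 := dotProduct_self_eq_zero.1 hvt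
    refine idx_ext ?_ hv1 hv2
    have hx1 : 0 < x (Sum.inl 1) := by simpa using (hall 0).1
    rw [qform, hv1, hv2] at hxv
    simp only [mul_zero, dotProduct_zero, zero_add, sub_zero] at hxv
    have : v (Sum.inl 0) * (mu s * x (Sum.inl 1)) = 0 := by linarith
    exact (mul_eq_zero.1 this).resolve_right (mul_pos hm hx1).ne'

end OrbitHypersurface

/-! ## The curvature of the orbit -/

section WarpedProduct

variable {n : ℕ}

/-- The warped product metric `c dτ² + A e^(kτ) |dW|²`. -/
def warpedMetric (n : ℕ) (c A k : ℝ) (y : Fin (n + 1) → ℝ) : Matrix (Fin (n + 1)) (Fin (n + 1)) ℝ :=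
  Matrix.diagonal (Fin.cons c fun _ => A * Real.exp (k * y 0))

theorem warpedMetric_inv {c A : ℝ} (hc : c ≠ 0) (hA : A ≠ 0) (k : ℝ) (y : Fin (n + 1) → ℝ) :
    (warpedMetric n c A k y)⁻¹ =
      Matrix.diagonal (Fin.cons c⁻¹ fun _ => (A * Real.exp (k * y 0))⁻¹) := by
  refine Matrix.inv_eq_right_inv ?_
  rw [warpedMetric, Matrix.diagonal_mul_diagonal, ← Matrix.diagonal_one]
  congr 1
  funext i
  refine Fin.cases ?_ (fun i => ?_) i
  · simp [hc]
  · simp only [Fin.cons_succ]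
    exact mul_inv_cancel₀ (mul_ne_zero hA (Real.exp_pos _).ne')

theorem partialDeriv_const (i : Fin (n + 1)) (a : ℝ) (y : Fin (n + 1) → ℝ) :
    partialDeriv i (fun _ => a) y = 0 := by
  simp [partialDeriv]

theorem partialDeriv_exp (i : Fin (n + 1)) (a k : ℝ) (y : Fin (n + 1) → ℝ) :
    partialDeriv i (fun y => a * Real.exp (k * y 0)) y =
      if i = 0 then k * (a * Real.exp (k * y 0)) else 0 := by
  have h : HasFDerivAt (fun y : Fin (n + 1) → ℝ => a * Real.exp (k * y 0)) _ y :=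
    (((hasFDerivAt_apply (𝕜 := ℝ) (0 : Fin (n + 1)) y).const_mul k).exp).const_mul a
  rw [partialDeriv, h.fderiv]
  by_cases hi : i = 0
  · subst hi
    simp
    ring
  · simp [hi, Ne.symm hi]

theorem partialDeriv_warpedMetric (c A k : ℝ) (i j l : Fin (n + 1)) (y : Fin (n + 1) → ℝ) :
    partialDeriv i (fun y => warpedMetric n c A k y j l) y =
      if i = 0 ∧ j = l ∧ j ≠ 0 then k * (A * Real.exp (k * y 0)) else 0 := by
  by_cases hjl : j = l
  · subst hjl
    refine Fin.cases ?_ (fun j => ?_) j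
    · simp [warpedMetric, partialDeriv_const]
    · simp [warpedMetric, partialDeriv_exp]
  · simp [warpedMetric, hjl, partialDeriv_const]

/-- The Christoffel symbols of `warpedMetric`. -/
def warpedSymbol (n : ℕ) (c A k : ℝ) (l i j : Fin (n + 1)) (y : Fin (n + 1) → ℝ) : ℝ :=
  if l = 0 then (if i = j ∧ i ≠ 0 then -(k / (2 * c) * A) * Real.exp (k * y 0) else 0)
  else if (i = 0 ∧ j = l) ∨ (j = 0 ∧ i = l) then k / 2 else 0

theorem christoffel_warpedMetric {c A : ℝ} (hc : c ≠ 0) (hA : A ≠ 0) (k : ℝ)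
    (l i j : Fin (n + 1)) :
    christoffel (warpedMetric n c A k) l i j = warpedSymbol n c A k l i j := by
  funext y
  have hE := (Real.exp_pos (k * y 0)).ne'
  rw [christoffel, warpedMetric_inv hc hA, Finset.sum_eq_single l
    (fun b _ hb => by rw [Matrix.diagonal_apply_ne _ (Ne.symm hb), zero_mul])
    (fun h => absurd (Finset.mem_univ l) h), Matrix.diagonal_apply_eq]
  simp only [partialDeriv_warpedMetric, warpedSymbol]
  refine Fin.cases ?_ (fun l => ?_) l <;> refine Fin.cases ?_ (fun i => ?_) i <;>
    refine Fin.cases ?_ (fun j => ?_) j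
  · simp
  · simp
  · simp
  · by_cases h : i = j
    · subst h
      simp
      field_simp
    · simp [h]
  · simp [(Fin.succ_ne_zero l).symm]
  · by_cases h : j = l
    · subst h
      simp
      field_simp
    · simp [h]
  · by_cases h : i = l
    · subst h
      simp
      field_simp
    · simp [h]
  · simp

/-- This is the hyperbolic metric in horospherical coordinates. Splitting every index into the
direction of τ and the flat directions reduces the curvature identity to finitely many scalar ones.
In dimension one both sides vanish. -/
theorem hasConstantCurvatureOn_warpedMetric {c A : ℝ} (hc : c ≠ 0) (hA : A ≠ 0) (k : ℝ)
    (O : Set (Fin (n + 1) → ℝ)) :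
    HasConstantCurvatureOn (warpedMetric n c A k) O (-(k ^ 2 / (4 * c))) := by
  intro y _ l m i j
  have hdΓ : ∀ a l i j : Fin (n + 1), partialDeriv a (warpedSymbol n c A k l i j) y =
      if a = 0 ∧ l = 0 ∧ i = j ∧ i ≠ 0 then k * (-(k / (2 * c) * A) * Real.exp (k * y 0))
      else 0 := by
    intro a l i j
    by_cases hl : l = 0
    · subst hl
      by_cases hij : i = j ∧ i ≠ 0
      · have : warpedSymbol n c A k 0 i j =
            fun y => -(k / (2 * c) * A) * Real.exp (k * y 0) := by
          funext y
          rw [warpedSymbol, if_pos rfl, if_pos hij]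
        rw [this, partialDeriv_exp]
        simp only [eq_true hij, and_true]
      · have : warpedSymbol n c A k 0 i j = fun _ => 0 := by
          funext y
          rw [warpedSymbol, if_pos rfl, if_neg hij]
        rw [this, partialDeriv_const, if_neg fun h => hij h.2.2]
    · have : warpedSymbol n c A k l i j =
          fun _ => if (i = 0 ∧ j = l) ∨ (j = 0 ∧ i = l) then k / 2 else 0 := by
        funext y
        rw [warpedSymbol, if_neg hl]
      rw [this, partialDeriv_const, if_neg fun h => hl h.2.1]
  simp only [curvature, christoffel_warpedMetric hc hA, hdΓ, Fin.sum_univ_succ]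
  refine Fin.cases ?_ (fun l => ?_) l <;> refine Fin.cases ?_ (fun m => ?_) m <;>
    refine Fin.cases ?_ (fun i => ?_) i <;> refine Fin.cases ?_ (fun j => ?_) j <;>
    simp [warpedSymbol, warpedMetric, Matrix.diagonal_apply, Fin.succ_ne_zero,
      (Fin.succ_ne_zero _).symm]
  all_goals
    split_ifs <;> first
      | (field_simp; ring1)
      | (field_simp; done)
      | (simp; done)
      | (exfalso; grind)

end WarpedProduct

/-! ### Horospherical coordinates on the orbit -/

section OrbitCurvature

variable {p s : ℕ}

/-- A global parametrization of the orbit. -/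
def orbitParam (p s : ℕ) (y : Fin (p + 1) → ℝ) : Idx p → ℝ :=
  vec (Real.exp (-(s * y 0)) + Real.exp (y 0) * (Fin.tail y ⬝ᵥ Fin.tail y) / 2)
    (Real.exp (y 0) / mu s) (Real.exp (y 0) • Fin.tail y)

/-- The differential of `orbitParam`. -/
def orbitParamDeriv (p s : ℕ) (y v : Fin (p + 1) → ℝ) : Idx p → ℝ :=
  vec (-(s * v 0 * Real.exp (-(s * y 0))) + v 0 * Real.exp (y 0) * (Fin.tail y ⬝ᵥ Fin.tail y) / 2 +
      Real.exp (y 0) * (Fin.tail y ⬝ᵥ Fin.tail v))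
    (v 0 * Real.exp (y 0) / mu s) ((v 0 * Real.exp (y 0)) • Fin.tail y + Real.exp (y 0) • Fin.tail v)

theorem contDiff_orbitParam : ContDiff ℝ ∞ (orbitParam p s) := by
  have h : ContDiff ℝ ∞ (fun y : Fin (p + 1) → ℝ => Fin.tail y) :=
    contDiff_pi.2 fun i => contDiff_apply ℝ ℝ i.succ
  have h0 : ContDiff ℝ ∞ (fun y : Fin (p + 1) → ℝ => y 0) := contDiff_apply ℝ ℝ 0
  have h2 := contDiff_dotProduct h h
  refine contDiff_vec ?_ ?_ ?_ <;> fun_prop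

theorem fderiv_orbitParam (y v : Fin (p + 1) → ℝ) :
    fderiv ℝ (orbitParam p s) y v = orbitParamDeriv p s y v := by
  have hd : DifferentiableAt ℝ (orbitParam p s) y :=
    contDiff_orbitParam.differentiable (by simp) y
  have hl : HasDerivAt (fun τ : ℝ => y + τ • v) v 0 := by
    simpa using ((hasDerivAt_id (0 : ℝ)).smul_const v).const_add y
  have h1 : HasDerivAt (fun τ : ℝ => orbitParam p s (y + τ • v))
      (fderiv ℝ (orbitParam p s) y v) 0 := by
    have hd' : HasFDerivAt (orbitParam p s) (fderiv ℝ (orbitParam p s) y) (y + (0 : ℝ) • v) := by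
      simpa using hd.hasFDerivAt
    exact hd'.comp_hasDerivAt (0 : ℝ) hl
  have c : ∀ i, HasDerivAt (fun τ : ℝ => y i + τ * v i) (v i) 0 := fun i => by
    simpa using ((hasDerivAt_id (0 : ℝ)).mul_const (v i)).const_add (y i)
  have e1 : HasDerivAt (fun τ : ℝ => Real.exp (y 0 + τ * v 0)) (Real.exp (y 0) * v 0) 0 := by
    simpa using (c 0).exp
  have e2 : HasDerivAt (fun τ : ℝ => Real.exp (-(s * (y 0 + τ * v 0))))
      (Real.exp (-(s * y 0)) * -(s * v 0)) 0 := by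
    simpa using ((c 0).const_mul (s : ℝ)).fun_neg.exp
  have e3 : HasDerivAt (fun τ : ℝ => ∑ i : Fin p, (y i.succ + τ * v i.succ) * (y i.succ + τ * v i.succ))
      (2 * (Fin.tail y ⬝ᵥ Fin.tail v)) 0 := by
    have := HasDerivAt.fun_sum (u := Finset.univ) fun (i : Fin p) _ =>
      (c i.succ).fun_mul (c i.succ)
    refine this.congr_deriv ?_
    rw [dotProduct, Finset.mul_sum]
    refine Finset.sum_congr rfl fun i _ => ?_
    simp only [zero_mul, add_zero, Fin.tail]
    ring
  have h2 : HasDerivAt (fun τ : ℝ => orbitParam p s (y + τ • v)) (orbitParamDeriv p s y v) 0 := by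
    refine hasDerivAt_pi.2 fun i => ?_
    rcases i with i | i
    · fin_cases i
      · refine (e2.fun_add ((e1.fun_mul e3).div_const 2)).congr_deriv ?_
        simp only [zero_mul, add_zero, orbitParamDeriv, Fin.zero_eta, vec_inl_zero]
        simp only [dotProduct, Fin.tail]
        ring
      · refine (e1.div_const (mu s)).congr_deriv ?_
        simp only [orbitParamDeriv, Fin.mk_one, vec_inl_one]
        ring
    · refine (e1.fun_mul (c i.succ)).congr_deriv ?_
      simp only [orbitParamDeriv, vec_inr, Pi.add_apply, Pi.smul_apply, smul_eq_mul, Fin.tail,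
        zero_mul, add_zero]
      ring
  exact h1.unique h2

theorem orbitParam_mem (hs : 1 ≤ s) (y : Fin (p + 1) → ℝ) : orbitParam p s y ∈ orbit p s := by
  have hm := mu_pos hs
  rw [mem_orbit_iff hs, eval_basicPoly hs, qform_self]
  simp only [orbitParam, vec_inl_zero, vec_inl_one, tail_vec, smul_dotProduct, dotProduct_smul,
    smul_eq_mul]
  refine ⟨by positivity, ?_⟩
  rw [mul_div_cancel₀ _ hm.ne']
  have : Real.exp (-(s * y 0)) = (Real.exp (y 0) ^ s)⁻¹ := by
    rw [Real.exp_neg, Real.exp_nat_mul]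
  have hE := (Real.exp_pos (y 0)).ne'
  obtain ⟨n, rfl⟩ : ∃ n, s = n + 1 := ⟨s - 1, by omega⟩
  rw [this, Nat.add_sub_cancel]
  field_simp
  ring

/-- The parameters are τ = log(μa₂) and W = X/(μa₂). In them the combination squared in
`canonicalMetric_basicPoly_tangent` is exp(τ) dW, and the remaining term is s dτ²; no mixed terms
survive. -/
theorem canonicalMetric_orbitParam (hs : 1 ≤ s) (y v w : Fin (p + 1) → ℝ) :
    canonicalMetric (basicPoly p s) (s + 1) (orbitParam p s y) (orbitParamDeriv p s y v)
      (orbitParamDeriv p s y w) = s * (v 0 * w 0) +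
        1 / ((s : ℝ) + 1) * Real.exp ((s + 1) * y 0) * (Fin.tail v ⬝ᵥ Fin.tail w) := by
  have hm := mu_pos hs
  have hmem := orbitParam_mem hs y
  have hb := orbit_coord_pos hs hmem
  have hb1 : mu s * orbitParam p s y (Sum.inl 1) = Real.exp (y 0) := by
    simp only [orbitParam, vec_inl_one]
    field_simp
  have hbv : ∀ v, mu s * orbitParamDeriv p s y v (Sum.inl 1) = v 0 * Real.exp (y 0) := fun v => by
    simp only [orbitParamDeriv, vec_inl_one]
    field_simp
  have hE := (Real.exp_pos (y 0)).ne'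
  have hy1 := ((mem_orbit_iff hs _).1 hmem).2
  have htan : ∀ v, polyDeriv (basicPoly p s) (orbitParam p s y) (orbitParamDeriv p s y v) = 0 := by
    intro v
    rw [polyDeriv_basicPoly_of_ne hs _ _ hb.ne', hb1, hbv, qform_self, qform, hbv, hb1]
    rw [eval_basicPoly hs, qform_self, hb1] at hy1
    simp only [orbitParam, orbitParamDeriv, vec_inl_zero, tail_vec, smul_dotProduct,
      dotProduct_smul, smul_eq_mul, dotProduct_add] at hy1 ⊢
    field_simp
    ring
  rw [canonicalMetric_basicPoly_tangent hs _ _ _ hb hy1 (htan v) (htan w)]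
  have ht : ∀ v, tail (orbitParamDeriv p s y v) - ((mu s * orbitParamDeriv p s y v (Sum.inl 1)) /
      (mu s * orbitParam p s y (Sum.inl 1))) • tail (orbitParam p s y) =
      Real.exp (y 0) • Fin.tail v := fun v => by
    rw [hbv, hb1, mul_div_cancel_right₀ _ hE]
    simp only [orbitParam, orbitParamDeriv, tail_vec]
    module
  rw [ht, ht, hbv, hbv, hb1, smul_dotProduct, dotProduct_smul]
  have he : Real.exp ((s + 1) * y 0) = Real.exp (y 0) ^ (s - 1) * Real.exp (y 0) ^ 2 := by
    rw [← pow_add, ← Real.exp_nat_mul]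
    congr 2
    rw [show s - 1 + 2 = s + 1 by omega]
    push_cast; ring
  rw [he]
  simp only [smul_eq_mul]
  field_simp

theorem orbitParam_injective (hs : 1 ≤ s) : Function.Injective (orbitParam p s) := by
  have hm := mu_pos hs
  intro y z h
  have h1 := congrFun h (Sum.inl 1)
  have h2 := congrArg tail h
  simp only [orbitParam, vec_inl_one, tail_vec] at h1 h2
  have h0 : y 0 = z 0 := by
    field_simp at h1
    exact Real.exp_injective h1
  rw [h0] at h2
  have h3 := smul_right_injective _ (Real.exp_pos (z 0)).ne' h2
  rw [← Fin.cons_self_tail y, ← Fin.cons_self_tail z, h0, h3]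

theorem mem_range_orbitParam (hs : 1 ≤ s) {x : Idx p → ℝ} (hx : x ∈ orbit p s) :
    ∃ y, orbitParam p s y = x := by
  have hm := mu_pos hs
  have hb := orbit_coord_pos hs hx
  have hx1 := ((mem_orbit_iff hs x).1 hx).2
  set b := mu s * x (Sum.inl 1) with hbd
  have hE : Real.exp (Real.log b) = b := Real.exp_log hb
  refine ⟨Fin.cons (Real.log b) (b⁻¹ • tail x), ?_⟩
  rw [eval_basicPoly hs, qform_self, ← hbd] at hx1
  have he : Real.exp (-(s * Real.log b)) = (b ^ s)⁻¹ := by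
    rw [Real.exp_neg, Real.exp_nat_mul, hE]
  refine idx_ext ?_ ?_ ?_
  · simp only [orbitParam, vec_inl_zero, Fin.cons_zero, Fin.tail_cons, he, hE, smul_dotProduct,
      dotProduct_smul, smul_eq_mul]
    obtain ⟨n, rfl⟩ : ∃ n, s = n + 1 := ⟨s - 1, by omega⟩
    rw [Nat.add_sub_cancel] at hx1
    rw [pow_succ]
    have hbn := pow_pos hb n
    field_simp
    linear_combination (-2) * hx1
  · simp only [orbitParam, vec_inl_one, Fin.cons_zero, hE]
    rw [hbd]
    field_simp
  · simp only [orbitParam, tail_vec, Fin.cons_zero, Fin.tail_cons, hE, smul_smul,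
      mul_inv_cancel₀ hb.ne', one_smul]

theorem hypersurfaceHasConstantCurvature_orbit (hs : 1 ≤ s) :
    HypersurfaceHasConstantCurvature (basicPoly p s) (s + 1) (orbit p s)
      (-(((s : ℝ) + 1) ^ 2 / (4 * s))) := by
  have hm := mu_pos hs
  have hs' : (0 : ℝ) < s := by exact_mod_cast hs
  -- The statement is first proved with charts on ℝ^(p+1), and the dimension is rewritten only at
  -- the end.
  have hcard : Fintype.card (Idx p) - 1 = p + 1 := by simp [Idx]; omega
  have key : ∀ x ∈ orbit p s, ∃ (O : Set (Fin (p + 1) → ℝ)) (σ : (Fin (p + 1) → ℝ) → (Idx p → ℝ)),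
      IsOpen O ∧ ContDiffOn ℝ ∞ σ O ∧ Set.InjOn σ O ∧ Set.MapsTo σ O (orbit p s) ∧ x ∈ σ '' O ∧
      (∀ y ∈ O, Function.Injective (fderiv ℝ σ y)) ∧
      HasConstantCurvatureOn (fun y => Matrix.of fun i j =>
        canonicalMetric (basicPoly p s) (s + 1) (σ y) (fderiv ℝ σ y (Pi.single i 1))
          (fderiv ℝ σ y (Pi.single j 1))) O (-(((s : ℝ) + 1) ^ 2 / (4 * s))) := by
    intro x hx
    refine ⟨Set.univ, orbitParam p s, isOpen_univ, contDiff_orbitParam.contDiffOn,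
      (orbitParam_injective hs).injOn, fun y _ => orbitParam_mem hs y, ?_, ?_, ?_⟩
    · obtain ⟨y, hy⟩ := mem_range_orbitParam hs hx
      exact ⟨y, trivial, hy⟩
    · intro y _
      rw [injective_iff_map_eq_zero]
      intro v hv
      rw [fderiv_orbitParam] at hv
      have h1 := congrFun hv (Sum.inl 1)
      have h2 := congrArg tail hv
      simp only [orbitParamDeriv, vec_inl_one, tail_vec, Pi.zero_apply, tail_zero] at h1 h2
      have h0 : v 0 = 0 := by
        have hE := (Real.exp_pos (y 0)).ne'
        simpa [hm.ne'] using h1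
      rw [h0, zero_mul, zero_smul, zero_add] at h2
      have h3 := (smul_eq_zero.1 h2).resolve_left (Real.exp_pos _).ne'
      rw [← Fin.cons_self_tail v, h0, h3]
      funext i
      refine Fin.cases rfl (fun i => rfl) i
    · have hG : (fun y => Matrix.of fun i j =>
          canonicalMetric (basicPoly p s) (s + 1) (orbitParam p s y)
            (fderiv ℝ (orbitParam p s) y (Pi.single i 1))
            (fderiv ℝ (orbitParam p s) y (Pi.single j 1))) =
          warpedMetric p s (1 / ((s : ℝ) + 1)) (s + 1) := by
        funext y
        ext i j
        rw [Matrix.of_apply, fderiv_orbitParam, fderiv_orbitParam, canonicalMetric_orbitParam hs,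
          warpedMetric]
        have ht : ∀ i : Fin p, Fin.tail (Pi.single i.succ 1 : Fin (p + 1) → ℝ) = Pi.single i 1 :=
          fun i => by
            funext k
            simp [Fin.tail, Pi.single_apply]
        have ht0 : Fin.tail (Pi.single 0 1 : Fin (p + 1) → ℝ) = 0 := by
          funext k
          simp [Fin.tail]
        refine Fin.cases ?_ (fun i => ?_) i <;> refine Fin.cases ?_ (fun j => ?_) j
        · simp [ht0]
        · simp [ht0, (Fin.succ_ne_zero j).symm]
        · simp [ht0]
        · by_cases hij : i = j
          · subst hij
            simp [ht]
          · simp [ht, hij]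
      rw [hG]
      exact hasConstantCurvatureOn_warpedMetric hs'.ne' (by positivity) _ _
  unfold HypersurfaceHasConstantCurvature
  rw [hcard]
  exact key

end OrbitCurvature

/-! ## The metric of the tube domain -/

section TubeMetric

section Parts

variable {ι : Type*}

/-- The real part of a vector in `ℂ^n`. -/
def reV (z : ι → ℂ) : ι → ℝ := fun i => (z i).re

/-- The imaginary part of a vector in `ℂ^n`. -/
def imV (z : ι → ℂ) : ι → ℝ := fun i => (z i).im

theorem imV_add (z w : ι → ℂ) : imV (z + w) = imV z + imV w := rfl

theorem imV_smul (t : ℝ) (z : ι → ℂ) : imV (t • z) = t • imV z := by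
  funext i; simp [imV]

theorem imV_I_smul (z : ι → ℂ) : imV (Complex.I • z) = reV z := by
  funext i; simp [imV, reV]

theorem contDiff_imV [Fintype ι] {n : WithTop ℕ∞} : ContDiff ℝ n (imV : (ι → ℂ) → ι → ℝ) :=
  contDiff_pi.2 fun i => Complex.imCLM.contDiff.comp (contDiff_apply ℝ ℂ i)

end Parts

theorem fderiv_apply_eq_of_hasDerivAt {𝕜 E F : Type*} [NontriviallyNormedField 𝕜]
    [NormedAddCommGroup E] [NormedSpace 𝕜 E] [NormedAddCommGroup F] [NormedSpace 𝕜 F]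
    {f : E → F} {z v : E} {l : F} (hf : DifferentiableAt 𝕜 f z)
    (h : HasDerivAt (fun τ : 𝕜 => f (z + τ • v)) l 0) : fderiv 𝕜 f z v = l := by
  have hl : HasDerivAt (fun τ : 𝕜 => z + τ • v) v 0 := by
    simpa using ((hasDerivAt_id (0 : 𝕜)).smul_const v).const_add z
  have hd' : HasFDerivAt f (fderiv 𝕜 f z) (z + (0 : 𝕜) • v) := by simpa using hf.hasFDerivAt
  exact (hd'.comp_hasDerivAt (0 : 𝕜) hl).unique h

variable {p s : ℕ}

/-- The bilinear form `-∂² log h` on `J b`. -/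
def logHess (s : ℕ) (y v w : Idx p → ℝ) : ℝ :=
  ((s : ℝ) - 1) * (mu s * v (Sum.inl 1)) * (mu s * w (Sum.inl 1)) / (mu s * y (Sum.inl 1)) ^ 2 +
    4 * qform s y v * qform s y w / qform s y y ^ 2 - 2 * qform s v w / qform s y y

theorem mem_tube_iff (hs : 1 ≤ s) (z : Idx p → ℂ) : z ∈ tube (orbit p s) ↔
    0 < imV z (Sum.inl 1) ∧ 0 < qform s (imV z) (imV z) :=
  mem_cone_orbit_iff hs (imV z)

theorem isOpen_tube (hs : 1 ≤ s) : IsOpen (tube (orbit p s)) :=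
  (isSiegelDomainTypeI_cone_orbit hs).1.preimage (contDiff_imV (n := 0)).continuous

/-- The Kähler potential of the tube domain. -/
def tubePotential (p s : ℕ) (z : Idx p → ℂ) : ℝ :=
  -(4 / ((s + 1 : ℕ) : ℝ)) * Real.log (MvPolynomial.eval (fun i => (z i).im) (basicPoly p s))

theorem contDiff_qform_imV : ContDiff ℝ ∞ fun z : Idx p → ℂ => qform s (imV z) (imV z) := by
  have h := contDiff_imV (ι := Idx p) (n := ∞)
  have h2 := contDiff_dotProduct (contDiff_tail h) (contDiff_tail h)
  have h0 := contDiff_pi.1 h (Sum.inl 0)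
  have h1 := contDiff_pi.1 h (Sum.inl 1)
  simp only [qform_self]
  fun_prop

theorem eval_pos_of_mem_tube (hs : 1 ≤ s) {z : Idx p → ℂ} (hz : z ∈ tube (orbit p s)) :
    0 < MvPolynomial.eval (fun i => (z i).im) (basicPoly p s) := by
  have h := (mem_tube_iff hs z).1 hz
  rw [eval_basicPoly hs]
  exact mul_pos (pow_pos (mul_pos (mu_pos hs) h.1) _) h.2

theorem contDiffAt_tubePotential (hs : 1 ≤ s) {z : Idx p → ℂ} (hz : z ∈ tube (orbit p s)) :
    ContDiffAt ℝ ∞ (tubePotential p s) z := by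
  have h1 := contDiff_pi.1 (contDiff_imV (ι := Idx p) (n := ∞)) (Sum.inl 1)
  have h2 : ContDiff ℝ ∞ fun z : Idx p → ℂ =>
      MvPolynomial.eval (fun i => (z i).im) (basicPoly p s) := by
    simp only [eval_basicPoly hs]
    exact ((contDiff_const.mul h1).pow _).mul contDiff_qform_imV
  exact contDiffAt_const.mul (h2.contDiffAt.log (eval_pos_of_mem_tube hs hz).ne')

theorem hasDerivAt_qform_line (s : ℕ) (y v : Idx p → ℝ) :
    HasDerivAt (fun τ : ℝ => qform s (y + τ • v) (y + τ • v)) (2 * qform s y v) 0 := by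
  have e : (fun τ : ℝ => qform s (y + τ • v) (y + τ • v)) =
      fun τ => qform s y y + τ * (2 * qform s y v) + τ * (τ * qform s v v) := by
    funext τ
    simp only [qform_add_left, qform_add_right, qform_smul_left, qform_smul_right,
      qform_comm s v y]
    ring
  rw [e]
  have h := hasDerivAt_id (0 : ℝ)
  exact ((h.mul_const _).const_add _ |>.fun_add (h.fun_mul (h.mul_const _))).congr_deriv (by simp)

theorem hasDerivAt_qform_line_left (s : ℕ) (y v w : Idx p → ℝ) :
    HasDerivAt (fun τ : ℝ => qform s (y + τ • v) w) (qform s v w) 0 := by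
  simp only [qform_add_left, qform_smul_left]
  exact (((hasDerivAt_id (0 : ℝ)).mul_const _).const_add _).congr_deriv (by simp)

theorem hasDerivAt_coord_line (s : ℕ) (y v : Idx p → ℝ) :
    HasDerivAt (fun τ : ℝ => mu s * (y + τ • v) (Sum.inl 1)) (mu s * v (Sum.inl 1)) 0 := by
  simp only [Pi.add_apply, Pi.smul_apply, smul_eq_mul]
  exact ((((hasDerivAt_id (0 : ℝ)).mul_const _).const_add _).const_mul _).congr_deriv (by simp)

theorem fderiv_tubePotential (hs : 1 ≤ s) {z : Idx p → ℂ} (hz : z ∈ tube (orbit p s))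
    (w : Idx p → ℂ) : fderiv ℝ (tubePotential p s) z w = -(4 / ((s : ℝ) + 1)) *
      (((s : ℝ) - 1) * (mu s * imV w (Sum.inl 1)) / (mu s * imV z (Sum.inl 1)) +
        2 * qform s (imV z) (imV w) / qform s (imV z) (imV z)) := by
  refine fderiv_apply_eq_of_hasDerivAt
    ((contDiffAt_tubePotential hs hz).differentiableAt (by simp)) ?_
  have h := (mem_tube_iff hs z).1 hz
  have hb : 0 < mu s * imV z (Sum.inl 1) := mul_pos (mu_pos hs) h.1
  have h1 := ((hasDerivAt_coord_line s (imV z) (imV w)).fun_pow (s - 1)).fun_mul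
    (hasDerivAt_qform_line s (imV z) (imV w))
  have h2 := (h1.log (by simpa using (mul_pos (pow_pos hb (s - 1)) h.2).ne')).const_mul
    (-(4 / ((s + 1 : ℕ) : ℝ)))
  have e : (fun τ : ℝ => tubePotential p s (z + τ • w)) = fun τ => -(4 / ((s + 1 : ℕ) : ℝ)) *
      Real.log ((mu s * (imV z + τ • imV w) (Sum.inl 1)) ^ (s - 1) *
        qform s (imV z + τ • imV w) (imV z + τ • imV w)) := by
    funext τ
    rw [tubePotential, eval_basicPoly hs]
    change _ * Real.log ((mu s * imV (z + τ • w) (Sum.inl 1)) ^ (s - 1) *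
      qform s (imV (z + τ • w)) (imV (z + τ • w))) = _
    rw [imV_add, imV_smul]
  rw [e]
  refine h2.congr_deriv ?_
  simp only [zero_smul, add_zero]
  rw [natCast_mul_pow_pred _ hb.ne', Nat.cast_sub hs]
  have hQ := h.2
  have hbn := pow_pos hb (s - 1)
  push_cast
  rw [mul_assoc]
  congr 1
  set b := mu s * imV z (Sum.inl 1)
  set B := b ^ (s - 1)
  set b' := mu s * imV w (Sum.inl 1)
  field_simp

theorem iteratedFDeriv_tubePotential (hs : 1 ≤ s) {z : Idx p → ℂ} (hz : z ∈ tube (orbit p s))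
    (v w : Idx p → ℂ) : iteratedFDeriv ℝ 2 (tubePotential p s) z ![v, w] =
      4 / ((s : ℝ) + 1) * logHess s (imV z) (imV v) (imV w) := by
  rw [iteratedFDeriv_two_apply]
  simp only [Matrix.cons_val_zero, Matrix.cons_val_one]
  have hd : DifferentiableAt ℝ (fderiv ℝ (tubePotential p s)) z :=
    ((contDiffAt_tubePotential hs hz).fderiv_right (m := 1) (by norm_cast)).differentiableAt
      (by simp)
  have e1 : fderiv ℝ (fun z => fderiv ℝ (tubePotential p s) z w) z v =
      fderiv ℝ (fderiv ℝ (tubePotential p s)) z v w := by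
    rw [fderiv_clm_apply hd (differentiableAt_const _)]
    simp
  rw [← e1]
  refine fderiv_apply_eq_of_hasDerivAt (hd.clm_apply (differentiableAt_const _)) ?_
  have h := (mem_tube_iff hs z).1 hz
  have hb : 0 < mu s * imV z (Sum.inl 1) := mul_pos (mu_pos hs) h.1
  have hQ := h.2
  -- The formula for the first derivative holds on the tube only, so the line has to remain in this
  -- open set for small τ.
  have hev : ∀ᶠ τ : ℝ in nhds 0, z + τ • v ∈ tube (orbit p s) := by
    have hc : Continuous fun τ : ℝ => z + τ • v := by fun_prop
    exact hc.continuousAt.eventually_mem ((isOpen_tube hs).mem_nhds (by simpa using hz))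
  have h1 := (((hasDerivAt_const (0 : ℝ) (((s : ℝ) - 1) * (mu s * imV w (Sum.inl 1)))).fun_div
      (hasDerivAt_coord_line s (imV z) (imV v)) (by simpa using hb.ne')).fun_add
    (((hasDerivAt_qform_line_left s (imV z) (imV v) (imV w)).const_mul 2).fun_div
      (hasDerivAt_qform_line s (imV z) (imV v)) (by simpa using hQ.ne'))).const_mul
    (-(4 / ((s : ℝ) + 1)))
  refine (h1.congr_of_eventuallyEq ?_).congr_deriv ?_
  · filter_upwards [hev] with τ hτ
    rw [fderiv_tubePotential hs hτ, imV_add, imV_smul]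
  · simp only [zero_smul, add_zero, logHess]
    field_simp
    ring

/-- The potential depends on Im z alone. Its Hessian on v sees Im v, and on iv it sees Re v, so the
Kähler metric is the sum of two copies of the Hessian metric of the cone. -/
theorem tubeMetric_eq (hs : 1 ≤ s) {z : Idx p → ℂ} (hz : z ∈ tube (orbit p s))
    (v w : Idx p → ℂ) : tubeMetric (basicPoly p s) (s + 1) z v w = 1 / ((s : ℝ) + 1) *
      (logHess s (imV z) (imV v) (imV w) + logHess s (imV z) (reV v) (reV w)) := by
  change (1 / 4) * (iteratedFDeriv ℝ 2 (tubePotential p s) z ![v, w] +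
    iteratedFDeriv ℝ 2 (tubePotential p s) z ![Complex.I • v, Complex.I • w]) = _
  rw [iteratedFDeriv_tubePotential hs hz, iteratedFDeriv_tubePotential hs hz, imV_I_smul,
    imV_I_smul]
  ring

/-- The transformation is linear and changes log h by an additive constant, so the second derivative
of log h is preserved. Here it is enough that each of the two factors of h is scaled. -/
theorem logHess_act (hs : 1 ≤ s) (x y v w : Idx p → ℝ) :
    logHess s (act s x y) (act s x v) (act s x w) = logHess s y v w := by
  have h1 : ∀ v, act s x v (Sum.inl 1) = Real.exp (mu s * x (Sum.inl 1)) * v (Sum.inl 1) :=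
    fun v => rfl
  have hE := (Real.exp_pos (mu s * x (Sum.inl 1))).ne'
  have hE' := (Real.exp_pos (x (Sum.inl 0) + mu s * x (Sum.inl 1))).ne'
  have hm := (mu_pos hs).ne'
  simp only [logHess, qform_act, h1]
  set a := Real.exp (mu s * x (Sum.inl 1))
  set b := Real.exp (x (Sum.inl 0) + mu s * x (Sum.inl 1))
  congr 1
  · congr 1
    · rw [show ((s : ℝ) - 1) * (mu s * (a * v (Sum.inl 1))) * (mu s * (a * w (Sum.inl 1))) =
        a ^ 2 * (((s : ℝ) - 1) * (mu s * v (Sum.inl 1)) * (mu s * w (Sum.inl 1))) by ring,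
        show (mu s * (a * y (Sum.inl 1))) ^ 2 = a ^ 2 * (mu s * y (Sum.inl 1)) ^ 2 by ring,
        mul_div_mul_left _ _ (pow_ne_zero 2 hE)]
    · rw [show 4 * (b * qform s y v) * (b * qform s y w) =
        b ^ 2 * (4 * qform s y v * qform s y w) by ring, mul_pow,
        mul_div_mul_left _ _ (pow_ne_zero 2 hE')]
  · rw [mul_left_comm, mul_div_mul_left _ _ hE']

/-- The normalization sμ² = 1 is exactly what gives the G₂-direction length 1; the values μa₂ = q =
1 at JB₀ take care of the others. -/
theorem logHess_vecJB₀ (hs : 1 ≤ s) (v w : Idx p → ℝ) :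
    logHess s (vecJB₀ p s) v w = v ⬝ᵥ w := by
  have hm := mu_pos hs
  have h := mul_mu_sq hs
  rw [logHess, vecJB₀_eq, qform_self, dotProduct_idx]
  simp only [qform, vec_inl_zero, vec_inl_one, tail_vec, zero_dotProduct, one_mul,
    mul_one_div_cancel hm.ne']
  linear_combination v (Sum.inl 1) * w (Sum.inl 1) * h

end TubeMetric

/-! ## The group acting simply transitively on the tube domain -/

section TubeGroup

/-- The vector space underlying the group acting on the tube domain. -/
abbrev TubeModel (p : ℕ) : Type := (Idx p → ℝ) × (Idx p → ℝ)

/-- The semidirect product of the group acting on the cone and of the translations. -/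
def TubeGroup (p _s : ℕ) : Type := TubeModel p

variable (p s : ℕ)

instance : TopologicalSpace (TubeGroup p s) := inferInstanceAs (TopologicalSpace (TubeModel p))
instance : ChartedSpace (TubeModel p) (TubeGroup p s) :=
  inferInstanceAs (ChartedSpace (TubeModel p) (TubeModel p))

/-- The product of the group acting on the tube domain. -/
def tubeMul (g h : TubeModel p) : TubeModel p := (mulB s g.1 h.1, g.2 + act s g.1 h.2)

/-- The inverse in the group acting on the tube domain. -/
def tubeInv (g : TubeModel p) : TubeModel p := (invB s g.1, -act s (invB s g.1) g.2)

theorem act_neg (x y : Idx p → ℝ) : act s x (-y) = -act s x y := by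
  rw [← neg_one_smul ℝ y, act_smul, neg_one_smul]

theorem act_zero_right (x : Idx p → ℝ) : act s x 0 = 0 := by
  simpa using act_smul s x 0 0

instance : Group (TubeGroup p s) where
  mul := tubeMul p s
  one := ((0, 0) : TubeModel p)
  inv := tubeInv p s
  mul_assoc g h k := Prod.ext (mulB_assoc s _ _ _) <| by
    change g.2 + act s g.1 h.2 + act s (mulB s g.1 h.1) k.2 = g.2 + act s g.1 (h.2 + act s h.1 k.2)
    rw [act_mulB, act_add, add_assoc]
  one_mul g := Prod.ext (zero_mulB s _) <| by
    change 0 + act s 0 g.2 = g.2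
    rw [act_zero_left, zero_add]
  mul_one g := Prod.ext (mulB_zero s _) <| by
    change g.2 + act s g.1 0 = g.2
    rw [act_zero_right, add_zero]
  inv_mul_cancel g := Prod.ext (invB_mulB s _) <| by
    change -act s (invB s g.1) g.2 + act s (invB s g.1) g.2 = 0
    rw [neg_add_cancel]

variable {p}

theorem contDiff_mulB {E : Type*} [NormedAddCommGroup E] [NormedSpace ℝ E]
    {n : WithTop ℕ∞} {x y : E → Idx p → ℝ} (hx : ContDiff ℝ n x) (hy : ContDiff ℝ n y) :
    ContDiff ℝ n fun z => mulB s (x z) (y z) := by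
  have hx' := contDiff_pi.1 hx
  have hy' := contDiff_pi.1 hy
  have hxt := contDiff_tail hx
  have hyt := contDiff_tail hy
  have x0 := hx' (Sum.inl 0)
  have x1 := hx' (Sum.inl 1)
  have y0 := hy' (Sum.inl 0)
  have y1 := hy' (Sum.inl 1)
  refine contDiff_vec ?_ ?_ ?_ <;> fun_prop

theorem contDiff_invB {E : Type*} [NormedAddCommGroup E] [NormedSpace ℝ E]
    {n : WithTop ℕ∞} {x : E → Idx p → ℝ} (hx : ContDiff ℝ n x) :
    ContDiff ℝ n fun z => invB s (x z) := by
  have hx' := contDiff_pi.1 hx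
  have hxt := contDiff_tail hx
  have x0 := hx' (Sum.inl 0)
  have x1 := hx' (Sum.inl 1)
  refine contDiff_vec ?_ ?_ ?_ <;> fun_prop

variable (p)

theorem contDiff_tubeMul : ContDiff ℝ ∞ fun z : TubeModel p × TubeModel p =>
    tubeMul p s z.1 z.2 :=
  ContDiff.prodMk (contDiff_mulB s (by fun_prop) (by fun_prop))
    ((by fun_prop : ContDiff ℝ ∞ fun z : TubeModel p × TubeModel p => z.1.2).add
      (contDiff_act s (by fun_prop) (by fun_prop)))

theorem contDiff_tubeInv : ContDiff ℝ ∞ (tubeInv p s) :=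
  ContDiff.prodMk (contDiff_invB s (by fun_prop))
    (contDiff_act s (contDiff_invB s (by fun_prop)) (by fun_prop)).neg

/-- The manifold structure on the product of two copies of the model space is that of the product
vector space, so ordinary smoothness suffices for the group multiplication. -/
theorem contMDiff_prod_self {E F : Type*} [NormedAddCommGroup E] [NormedSpace ℝ E]
    [NormedAddCommGroup F] [NormedSpace ℝ F] {n : WithTop ℕ∞} {f : E × E → F}
    (hf : ContDiff ℝ n f) : ContMDiff (𝓘(ℝ, E).prod 𝓘(ℝ, E)) 𝓘(ℝ, F) n f := by
  rw [← modelWithCornersSelf_prod, chartedSpaceSelf_prod]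
  exact hf.contMDiff

instance : LieGroup 𝓘(ℝ, TubeModel p) ∞ (TubeGroup p s) where
  compatible := (inferInstance : IsManifold 𝓘(ℝ, TubeModel p) ∞ (TubeModel p)).compatible
  contMDiff_mul := contMDiff_prod_self (contDiff_tubeMul p s)
  contMDiff_inv := (contDiff_tubeInv p s).contMDiff

/-- The linear part of the left multiplication by `g`. -/
def leftLin (g : TubeModel p) : TubeModel p →ₗ[ℝ] TubeModel p where
  toFun v := (vec (v.1 (Sum.inl 0)) (v.1 (Sum.inl 1))
    (Real.exp ((g.1 (Sum.inl 0) - mu s * g.1 (Sum.inl 1)) / 2) • tail v.1), act s g.1 v.2)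
  map_add' v w := by
    refine Prod.ext (idx_ext ?_ ?_ ?_) (act_add s _ _ _) <;> simp
  map_smul' t v := by
    refine Prod.ext (idx_ext ?_ ?_ ?_) (act_smul s _ _ _) <;> simp
    module

/-- Left translations are affine in these coordinates. Their differential is therefore the same
linear map at every point, and left-invariant vector fields are explicit. -/
theorem tubeMul_eq (g h : TubeModel p) : tubeMul p s g h = g + leftLin p s g h := by
  refine Prod.ext (idx_ext ?_ ?_ ?_) rfl <;> simp [tubeMul, mulB, leftLin]

theorem hasFDerivAt_tubeMul (g h : TubeModel p) :
    HasFDerivAt (tubeMul p s g) (leftLin p s g).toContinuousLinearMap h :=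
  ((leftLin p s g).toContinuousLinearMap.hasFDerivAt.const_add g).congr_of_eventuallyEq
    (Filter.Eventually.of_forall fun h => tubeMul_eq p s g h)

theorem mulInvariantVectorField_tubeGroup
    (v : GroupLieAlgebra 𝓘(ℝ, TubeModel p) (TubeGroup p s)) (g : TubeGroup p s) :
    mulInvariantVectorField v g = leftLin p s g v := by
  change mfderiv 𝓘(ℝ, TubeModel p) 𝓘(ℝ, TubeModel p) (tubeMul p s g) ((0, 0) : TubeModel p) v = _
  rw [mfderiv_eq_fderiv, (hasFDerivAt_tubeMul p s g _).fderiv]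
  rfl

variable {p}

/-- The coordinates are of the second kind, exp(X) exp(x₁H₁ + x₂H₂), but to first order at the
identity they agree with exponential coordinates, so the adjoint representation appears. -/
theorem hasDerivAt_act_line (x y : Idx p → ℝ) :
    HasDerivAt (fun τ : ℝ => act s (τ • x) y) (rho s x y) 0 := by
  have c : ∀ a : ℝ, HasDerivAt (fun τ : ℝ => τ * a) a 0 := fun a => by
    simpa using (hasDerivAt_id (0 : ℝ)).mul_const a
  have e : ∀ a : ℝ, HasDerivAt (fun τ : ℝ => Real.exp (τ * a)) a 0 := fun a => by
    simpa using (c a).exp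
  have heq : (fun τ : ℝ => act s (τ • x) y) = fun τ =>
      vec (Real.exp (τ * x (Sum.inl 0)) * y (Sum.inl 0) +
        Real.exp (τ * ((x (Sum.inl 0) + mu s * x (Sum.inl 1)) / 2)) * (τ * (tail x ⬝ᵥ tail y)) +
        Real.exp (τ * (mu s * x (Sum.inl 1))) * (mu s * y (Sum.inl 1)) *
          (τ * (τ * (tail x ⬝ᵥ tail x))) / 2)
      (Real.exp (τ * (mu s * x (Sum.inl 1))) * y (Sum.inl 1))
      (Real.exp (τ * ((x (Sum.inl 0) + mu s * x (Sum.inl 1)) / 2)) • tail y +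
        (Real.exp (τ * (mu s * x (Sum.inl 1))) * (mu s * y (Sum.inl 1))) • (τ • tail x)) := by
    funext τ
    have e1 : mu s * (τ * x (Sum.inl 1)) = τ * (mu s * x (Sum.inl 1)) := by ring
    have e2 : (τ * x (Sum.inl 0) + τ * (mu s * x (Sum.inl 1))) / 2 =
        τ * ((x (Sum.inl 0) + mu s * x (Sum.inl 1)) / 2) := by ring
    simp only [act, Pi.smul_apply, tail_smul, smul_eq_mul, smul_dotProduct, dotProduct_smul, e1, e2]
  rw [heq]
  refine hasDerivAt_pi.2 fun i => ?_
  rcases i with i | i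
  · fin_cases i
    · refine ((((e _).mul_const _).fun_add ((e _).fun_mul (c _))).fun_add
        ((((e _).mul_const _).fun_mul ((hasDerivAt_id (0 : ℝ)).fun_mul (c _))).div_const 2)).congr_deriv ?_
      simp
    · refine ((e _).mul_const _).congr_deriv ?_
      simp
  · refine (((e _).mul_const _).fun_add (((e _).mul_const _).fun_mul (c _))).congr_deriv ?_
    simp only [zero_mul, Real.exp_zero, one_mul, mul_zero, zero_add, rho, Sum.elim_inr, tail_apply]

theorem hasDerivAt_leftLin_line (v w : TubeModel p) :
    HasDerivAt (fun τ : ℝ => leftLin p s (τ • v) w)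
      ((vec 0 0 (((v.1 (Sum.inl 0) - mu s * v.1 (Sum.inl 1)) / 2) • tail w.1),
        rho s v.1 w.2) : TubeModel p) 0 := by
  refine HasDerivAt.prodMk ?_ (hasDerivAt_act_line s v.1 w.2)
  refine hasDerivAt_pi.2 fun i => ?_
  rcases i with i | i
  · fin_cases i
    · exact hasDerivAt_const _ _
    · exact hasDerivAt_const _ _
  · have h : HasDerivAt (fun τ : ℝ => Real.exp (τ * ((v.1 (Sum.inl 0) - mu s * v.1 (Sum.inl 1)) / 2)))
        ((v.1 (Sum.inl 0) - mu s * v.1 (Sum.inl 1)) / 2) 0 := by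
      simpa using ((hasDerivAt_id (0 : ℝ)).mul_const _).exp
    refine (h.mul_const (w.1 (Sum.inr i))).congr_of_eventuallyEq
      (Filter.Eventually.of_forall fun τ => ?_)
    simp only [vec_inr, Pi.smul_apply, smul_eq_mul, tail_apply, Prod.smul_fst]
    congr 2
    ring

theorem contDiff_leftLin (w : TubeModel p) : ContDiff ℝ ∞ fun g : TubeModel p => leftLin p s g w := by
  refine ContDiff.prodMk (contDiff_vec contDiff_const contDiff_const ?_)
    (contDiff_act s (by fun_prop) contDiff_const)
  have x0 : ContDiff ℝ ∞ fun g : TubeModel p => g.1 (Sum.inl 0) := by fun_prop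
  have x1 : ContDiff ℝ ∞ fun g : TubeModel p => g.1 (Sum.inl 1) := by fun_prop
  fun_prop

theorem leftLin_zero (v : TubeModel p) : leftLin p s 0 v = v := by
  refine Prod.ext (idx_ext ?_ ?_ ?_) (act_zero_left s _) <;> simp [leftLin]

theorem fderiv_leftLin (v w : TubeModel p) :
    fderiv ℝ (fun g : TubeModel p => leftLin p s g w) 0 v =
      ((vec 0 0 (((v.1 (Sum.inl 0) - mu s * v.1 (Sum.inl 1)) / 2) • tail w.1),
        rho s v.1 w.2) : TubeModel p) := by
  refine fderiv_apply_eq_of_hasDerivAt ((contDiff_leftLin s w).differentiable (by simp) _) ?_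
  simpa using hasDerivAt_leftLin_line s v w

variable (p) in
/-- The identification of the Lie algebra of `TubeGroup` with `u₀`. -/
def tubeLieEquiv : TubeModel p ≃ₗ[ℝ] U0 p s where
  toFun v := mkU0 p s v.1 v.2
  invFun u := (u.1, u.2)
  map_add' _ _ := rfl
  map_smul' _ _ := rfl
  left_inv _ := rfl
  right_inv _ := rfl

/-- On a vector space the bracket of fields is the difference of directional derivatives. At the
identity these are the derivatives of the linear parts of left translations, that is, the two
actions of 𝔟. -/
theorem mlieBracket_leftLin (v w : TubeModel p) :
    VectorField.mlieBracket 𝓘(ℝ, TubeModel p) (fun g : TubeModel p => leftLin p s g v)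
      (fun g : TubeModel p => leftLin p s g w) (0 : TubeModel p) =
      ((vec 0 0 (((v.1 (Sum.inl 0) - mu s * v.1 (Sum.inl 1)) / 2) • tail w.1),
        rho s v.1 w.2) : TubeModel p) -
      ((vec 0 0 (((w.1 (Sum.inl 0) - mu s * w.1 (Sum.inl 1)) / 2) • tail v.1),
        rho s w.1 v.2) : TubeModel p) := by
  have h : VectorField.mlieBracket 𝓘(ℝ, TubeModel p) (fun g : TubeModel p => leftLin p s g v)
      (fun g : TubeModel p => leftLin p s g w) = VectorField.lieBracket ℝ
      (fun g : TubeModel p => leftLin p s g v) (fun g : TubeModel p => leftLin p s g w) := by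
    rw [← VectorField.lieBracketWithin_univ]
    exact VectorField.mlieBracketWithin_eq_lieBracketWithin
  rw [h]
  change fderiv ℝ (fun g : TubeModel p => leftLin p s g w) 0 (leftLin p s 0 v) -
    fderiv ℝ (fun g : TubeModel p => leftLin p s g v) 0 (leftLin p s 0 w) = _
  rw [leftLin_zero, leftLin_zero, fderiv_leftLin, fderiv_leftLin]

theorem tubeLieEquiv_lie (v w : GroupLieAlgebra 𝓘(ℝ, TubeModel p) (TubeGroup p s)) :
    tubeLieEquiv p s (⁅v, w⁆ : GroupLieAlgebra 𝓘(ℝ, TubeModel p) (TubeGroup p s)) =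
      ⁅tubeLieEquiv p s v, tubeLieEquiv p s w⁆ := by
  have hfield : ∀ v : GroupLieAlgebra 𝓘(ℝ, TubeModel p) (TubeGroup p s),
      mulInvariantVectorField v = fun g => leftLin p s g v :=
    fun v => funext fun g => mulInvariantVectorField_tubeGroup p s v g
  rw [GroupLieAlgebra.bracket_def, hfield, hfield]
  refine (congrArg (tubeLieEquiv p s) (mlieBracket_leftLin s v w)).trans ?_
  refine U0.ext' p s (idx_ext ?_ ?_ ?_) rfl
  · change (0 : ℝ) - 0 = 0
    simp
  · change (0 : ℝ) - 0 = 0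
    simp
  · rfl

end TubeGroup

/-! ### The orbit map onto the tube domain -/

section TubeIsometry

variable {p s : ℕ}

/-- The orbit map of the group acting on the tube domain. -/
def tubeMap (p s : ℕ) (g : TubeModel p) : Idx p → ℂ :=
  -- The sign of the real part makes the map holomorphic: J sends (x, y) to (-y, x), and i(-y + ix)
  -- = -x + i(-y).
  fun i => ⟨-g.2 i, act s g.1 (vecJB₀ p s) i⟩

theorem reV_tubeMap (g : TubeModel p) : reV (tubeMap p s g) = -g.2 := rfl

theorem imV_tubeMap (g : TubeModel p) : imV (tubeMap p s g) = act s g.1 (vecJB₀ p s) := rfl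

theorem contDiff_mk {E : Type*} [NormedAddCommGroup E] [NormedSpace ℝ E]
    {ι : Type*} [Fintype ι] {n : WithTop ℕ∞} {a b : E → ι → ℝ}
    (ha : ContDiff ℝ n a) (hb : ContDiff ℝ n b) :
    ContDiff ℝ n fun z => (fun i => (⟨a z i, b z i⟩ : ℂ)) := by
  refine contDiff_pi.2 fun i => ?_
  have e : (fun z => (⟨a z i, b z i⟩ : ℂ)) =
      fun z => Complex.equivRealProdCLM.symm (a z i, b z i) := by
    funext z
    rfl
  rw [e]
  exact Complex.equivRealProdCLM.symm.contDiff.comp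
    ((contDiff_pi.1 ha i).prodMk (contDiff_pi.1 hb i))

theorem hasDerivAt_mk {ι : Type*} [Fintype ι] {a b : ℝ → ι → ℝ} {a' b' : ι → ℝ} {t : ℝ}
    (ha : HasDerivAt a a' t) (hb : HasDerivAt b b' t) :
    HasDerivAt (fun z => (fun i => (⟨a z i, b z i⟩ : ℂ))) (fun i => ⟨a' i, b' i⟩) t := by
  refine hasDerivAt_pi.2 fun i => ?_
  exact (Complex.equivRealProdCLM.symm : ℝ × ℝ →L[ℝ] ℂ).hasFDerivAt.comp_hasDerivAt t
    ((hasDerivAt_pi.1 ha i).prodMk (hasDerivAt_pi.1 hb i))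

theorem contDiff_tubeMap : ContDiff ℝ ∞ (tubeMap p s) :=
  contDiff_mk (a := fun g : TubeModel p => -g.2) (by fun_prop)
    (contDiff_act s (by fun_prop) contDiff_const)

/-- This is ad x (JB₀) = Jx. It makes the differential of the orbit map at the identity the standard
identification of 𝔲₀ with ℂⁿ. -/
theorem rho_vecJB₀ (hs : 1 ≤ s) (x : Idx p → ℝ) : rho s x (vecJB₀ p s) = x := by
  have hm := (mu_pos hs).ne'
  rw [vecJB₀_eq]
  refine idx_ext ?_ ?_ ?_ <;> simp [hm]
  field_simp

/-- By equivariance, a curve g·(τv) is mapped to the image of a curve through the base point under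
the linear action of g. Hence the differential at g is the one at the identity followed by `act`. -/
theorem fderiv_tubeMap (hs : 1 ≤ s) (g v : TubeModel p) :
    fderiv ℝ (tubeMap p s) g (leftLin p s g v) =
      fun i => (⟨-act s g.1 v.2 i, act s g.1 v.1 i⟩ : ℂ) := by
  refine fderiv_apply_eq_of_hasDerivAt (contDiff_tubeMap.differentiable (by simp) g) ?_
  have e : ∀ τ : ℝ, g + τ • leftLin p s g v = tubeMul p s g (τ • v) := fun τ => by
    rw [tubeMul_eq, map_smul]
  simp only [e]
  refine hasDerivAt_mk (a := fun τ : ℝ => -(g.2 + act s g.1 (τ • v.2)))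
    (b := fun τ : ℝ => act s (mulB s g.1 (τ • v.1)) (vecJB₀ p s))
    (a' := -act s g.1 v.2) ?_ ?_
  · simp only [act_smul]
    simpa using (((hasDerivAt_id (0 : ℝ)).smul_const (act s g.1 v.2)).const_add g.2).fun_neg
  · simp only [act_mulB]
    have h := (actLin s g.1).toContinuousLinearMap.hasFDerivAt.comp_hasDerivAt (0 : ℝ)
      (hasDerivAt_act_line s v.1 (vecJB₀ p s))
    rw [rho_vecJB₀ hs] at h
    exact h

theorem derivLeftInvariant_tubeMap (hs : 1 ≤ s) (g : TubeGroup p s)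
    (v : GroupLieAlgebra 𝓘(ℝ, TubeModel p) (TubeGroup p s)) :
    derivLeftInvariant (G := TubeGroup p s) (tubeMap p s) g v =
      fun i => (⟨-act s g.1 v.2 i, act s g.1 v.1 i⟩ : ℂ) := by
  have h : mfderiv 𝓘(ℝ, TubeModel p) 𝓘(ℝ, Idx p → ℂ) (tubeMap p s) g =
      fderiv ℝ (tubeMap p s) g := mfderiv_eq_fderiv
  exact ((congrArg _ (mulInvariantVectorField_tubeGroup p s v g)).trans
    (congrArg (fun L : TubeModel p →L[ℝ] Idx p → ℂ => L (leftLin p s g v)) h)).trans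
    (fderiv_tubeMap hs g v)

variable (p s) in
/-- The inverse of `tubeMap`. -/
def tubeMapInv (z : Idx p → ℂ) : TubeModel p :=
  (vec (Real.log (qform s (imV z) (imV z) / (mu s * imV z (Sum.inl 1))))
    (Real.log (mu s * imV z (Sum.inl 1)) / mu s)
    ((mu s * imV z (Sum.inl 1))⁻¹ • tail (imV z)), -reV z)

theorem tubeMap_mem (hs : 1 ≤ s) (g : TubeModel p) : tubeMap p s g ∈ tube (orbit p s) := by
  have hm := mu_pos hs
  rw [mem_tube_iff hs, imV_tubeMap, qform_act, vecJB₀_eq]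
  constructor
  · simp only [act, vec_inl_one]
    positivity
  · rw [qform_self]
    simp only [vec_inl_zero, vec_inl_one, tail_vec, dotProduct_zero]
    rw [mul_one_div_cancel hm.ne']
    simp [Real.exp_pos]

theorem tubeMapInv_tubeMap (hs : 1 ≤ s) (g : TubeModel p) :
    tubeMapInv p s (tubeMap p s g) = g := by
  have hm := mu_pos hs
  have h1 : mu s * act s g.1 (vecJB₀ p s) (Sum.inl 1) = Real.exp (mu s * g.1 (Sum.inl 1)) := by
    rw [act_vecJB₀ hs, vec_inl_one]
    field_simp
  have hQ : qform s (act s g.1 (vecJB₀ p s)) (act s g.1 (vecJB₀ p s)) =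
      Real.exp (g.1 (Sum.inl 0)) * Real.exp (mu s * g.1 (Sum.inl 1)) := by
    rw [qform_act, ← Real.exp_add, vecJB₀_eq, qform_self]
    simp [hm.ne']
  rw [tubeMapInv, reV_tubeMap, imV_tubeMap, h1, hQ,
    mul_div_cancel_right₀ _ (Real.exp_pos _).ne', Real.log_exp, Real.log_exp]
  refine Prod.ext (idx_ext rfl ?_ ?_) (neg_neg _)
  · simp [hm.ne']
  · rw [act_vecJB₀ hs]
    simp [smul_smul, (Real.exp_pos (mu s * g.1 (Sum.inl 1))).ne']

theorem tubeMap_tubeMapInv (hs : 1 ≤ s) {z : Idx p → ℂ} (hz : z ∈ tube (orbit p s)) :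
    tubeMap p s (tubeMapInv p s z) = z := by
  have hm := mu_pos hs
  obtain ⟨h1, hQ⟩ := (mem_tube_iff hs z).1 hz
  have hb : 0 < mu s * imV z (Sum.inl 1) := mul_pos hm h1
  have him : imV (tubeMap p s (tubeMapInv p s z)) = imV z := by
    rw [imV_tubeMap, act_vecJB₀ hs, tubeMapInv]
    simp only [vec_inl_zero, vec_inl_one, tail_vec]
    rw [Real.exp_log (div_pos hQ hb), mul_div_cancel₀ _ hm.ne', Real.exp_log hb]
    refine idx_ext ?_ ?_ ?_
    · rw [vec_inl_zero, qform_self]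
      simp only [smul_dotProduct, dotProduct_smul, smul_eq_mul]
      field_simp
      ring
    · rw [vec_inl_one]; field_simp
    · rw [tail_vec, smul_smul, mul_inv_cancel₀ hb.ne', one_smul]
  funext i
  refine Complex.ext ?_ (congrFun him i)
  change -(-(z i).re) = _
  rw [neg_neg]

theorem contDiffOn_tubeMapInv (hs : 1 ≤ s) :
    ContDiffOn ℝ ∞ (tubeMapInv p s) (tube (orbit p s)) := by
  intro z hz
  refine ContDiffAt.contDiffWithinAt ?_
  have hm := mu_pos hs
  obtain ⟨h1, hQ⟩ := (mem_tube_iff hs z).1 hz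
  have hb : 0 < mu s * imV z (Sum.inl 1) := mul_pos hm h1
  have cI := contDiff_imV (ι := Idx p) (n := ∞)
  have c1 : ContDiffAt ℝ ∞ (fun z : Idx p → ℂ => mu s * imV z (Sum.inl 1)) z :=
    (contDiff_const.mul (contDiff_pi.1 cI (Sum.inl 1))).contDiffAt
  have cQ : ContDiffAt ℝ ∞ (fun z : Idx p → ℂ => qform s (imV z) (imV z)) z :=
    contDiff_qform_imV.contDiffAt
  have cR : ContDiff ℝ ∞ (fun z : Idx p → ℂ => -reV z) :=
    (contDiff_pi.2 fun i => Complex.reCLM.contDiff.comp (contDiff_apply ℝ ℂ i)).neg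
  refine ContDiffAt.prodMk ?_ cR.contDiffAt
  refine contDiffAt_pi.2 fun i => ?_
  rcases i with i | i
  · fin_cases i
    · exact (cQ.div c1 hb.ne').log (div_pos hQ hb).ne'
    · exact (c1.log hb.ne').div_const _
  · exact (c1.inv hb.ne').mul (contDiff_pi.1 cI (Sum.inr i)).contDiffAt

theorem isKahlerLieAlgebraFor_tube (p : ℕ) (hs : 1 ≤ s) :
    ∃ c : ℝ, 0 < c ∧ IsKahlerLieAlgebraFor (metric p s) (complexStructure p s)
      (tube (orbit p s)) fun z v w => c * tubeMetric (basicPoly p s) (s + 1) z v w := by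
  -- The scale s + 1 cancels the factor 1/(s + 1) in `tubeMetric_eq`; invariance of `logHess` then
  -- reduces the isometry to the base point.
  refine ⟨s + 1, by positivity, TubeModel p, inferInstance, inferInstance, TubeGroup p s,
    inferInstance, inferInstance, inferInstance, inferInstance, tubeLieEquiv p s, tubeMap p s,
    tubeMapInv p s, tubeLieEquiv_lie s, contDiff_tubeMap.contMDiff,
    (contDiffOn_tubeMapInv hs).contMDiffOn, ?_, tubeMapInv_tubeMap hs, ?_, ?_⟩
  · ext z
    constructor
    · rintro ⟨g, rfl⟩
      exact tubeMap_mem hs g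
    · intro hz
      exact ⟨tubeMapInv p s z, tubeMap_tubeMapInv hs hz⟩
  · intro g v w
    rw [derivLeftInvariant_tubeMap hs, derivLeftInvariant_tubeMap hs]
    refine (congrArg (((s : ℝ) + 1) * ·) (tubeMetric_eq hs (tubeMap_mem hs g) _ _)).trans ?_
    change ((s : ℝ) + 1) * (1 / ((s : ℝ) + 1) *
      (logHess s (act s g.1 (vecJB₀ p s)) (act s g.1 v.1) (act s g.1 w.1) +
        logHess s (act s g.1 (vecJB₀ p s)) (-act s g.1 v.2) (-act s g.1 w.2))) =
      v.1 ⬝ᵥ w.1 + v.2 ⬝ᵥ w.2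
    rw [← act_neg, ← act_neg, logHess_act hs, logHess_act hs, logHess_vecJB₀ hs,
      logHess_vecJB₀ hs, neg_dotProduct_neg]
    field_simp
  · intro g v
    rw [derivLeftInvariant_tubeMap hs, derivLeftInvariant_tubeMap hs]
    funext i
    change (⟨-act s g.1 v.1 i, act s g.1 (-v.2) i⟩ : ℂ) =
      Complex.I * ⟨-act s g.1 v.2 i, act s g.1 v.1 i⟩
    rw [act_neg]
    refine Complex.ext ?_ ?_ <;> simp

end TubeIsometry

/-! ## The special Kähler structure defined by a cubic form -/

section Cubic

section Forms

variable {p : ℕ} {K : Type*} [Field K]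

/-- The quadratic factor of the cubic form, polarized. -/
def bil (m : K) (x y : Idx p → K) : K :=
  (x (Sum.inl 0) * (m * y (Sum.inl 1)) + y (Sum.inl 0) * (m * x (Sum.inl 1)) -
    ∑ i : Fin p, x (Sum.inr i) * y (Sum.inr i)) / 2

theorem bil_comm (m : K) (x y : Idx p → K) : bil m x y = bil m y x := by
  simp only [bil]
  rw [Finset.sum_congr rfl fun i _ => mul_comm (x (Sum.inr i)) (y (Sum.inr i))]
  ring

theorem bil_add_left (m : K) (x x' y : Idx p → K) :
    bil m (x + x') y = bil m x y + bil m x' y := by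
  simp only [bil, Pi.add_apply, add_mul, Finset.sum_add_distrib]
  ring

theorem bil_smul_left (m t : K) (x y : Idx p → K) : bil m (t • x) y = t * bil m x y := by
  simp only [bil, Pi.smul_apply, smul_eq_mul, mul_assoc, ← Finset.mul_sum]
  ring

/-- The symmetric trilinear form of the cubic polynomial `μ a₂ (a₁ μ a₂ - ⟨X, X⟩ / 2)`. -/
def cub (m : K) (x y z : Idx p → K) : K :=
  (m * x (Sum.inl 1) * bil m y z + m * y (Sum.inl 1) * bil m x z +
    m * z (Sum.inl 1) * bil m x y) / 3

theorem cub_comm (m : K) (x y z : Idx p → K) : cub m x y z = cub m y x z := by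
  simp only [cub, bil_comm m y x]
  ring

theorem cub_comm' (m : K) (x y z : Idx p → K) : cub m x y z = cub m x z y := by
  simp only [cub, bil_comm m z y]
  ring

theorem cub_add_left (m : K) (x x' y z : Idx p → K) :
    cub m (x + x') y z = cub m x y z + cub m x' y z := by
  simp only [cub, bil_add_left, Pi.add_apply]
  ring

theorem cub_smul_left (m t : K) (x y z : Idx p → K) :
    cub m (t • x) y z = t * cub m x y z := by
  simp only [cub, bil_smul_left, Pi.smul_apply, smul_eq_mul]
  ring

theorem cub_add_mid (m : K) (x y y' z : Idx p → K) :
    cub m x (y + y') z = cub m x y z + cub m x y' z := by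
  rw [cub_comm, cub_add_left, cub_comm m y, cub_comm m y']

theorem cub_smul_mid (m t : K) (x y z : Idx p → K) :
    cub m x (t • y) z = t * cub m x y z := by
  rw [cub_comm, cub_smul_left, cub_comm m y]

theorem cub_add_right (m : K) (x y z z' : Idx p → K) :
    cub m x y (z + z') = cub m x y z + cub m x y z' := by
  rw [cub_comm', cub_add_mid, cub_comm' m x z, cub_comm' m x z']

theorem cub_smul_right (m t : K) (x y z : Idx p → K) :
    cub m x y (t • z) = t * cub m x y z := by
  rw [cub_comm', cub_smul_mid, cub_comm' m x z]

/-- `cub m x y` as a linear form. -/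
def cubLin (m : K) (x y : Idx p → K) : (Idx p → K) →ₗ[K] K where
  toFun z := cub m x y z
  map_add' := cub_add_right m x y
  map_smul' t z := cub_smul_right m t x y z

theorem sum_cub_single (m : K) (x y z : Idx p → K) :
    ∑ j, cub m x y (Pi.single j 1) * z j = cub m x y z := by
  conv_rhs => rw [show cub m x y z = cubLin m x y z from rfl, LinearMap.pi_apply_eq_sum_univ]
  refine Finset.sum_congr rfl fun j _ => ?_
  rw [smul_eq_mul, mul_comm]
  congr 2
  funext k
  simp [Pi.single_apply, eq_comm]

end Forms

variable {p : ℕ}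

theorem bil_real (s : ℕ) (x y : Idx p → ℝ) : bil (mu s) x y = qform s x y := rfl

/-- The complexification of a real vector. -/
def ofRealV {ι : Type*} (x : ι → ℝ) : ι → ℂ := fun i => (x i : ℂ)

theorem eq_ofRealV_add {ι : Type*} (z : ι → ℂ) :
    z = ofRealV (reV z) + Complex.I • ofRealV (imV z) := by
  funext i
  simp [ofRealV, reV, imV, mul_comm Complex.I]

theorem star_eq_ofRealV_add {ι : Type*} (z : ι → ℂ) :
    star z = ofRealV (reV z) + (-Complex.I) • ofRealV (imV z) := by
  funext i
  refine Complex.ext ?_ ?_ <;> simp [ofRealV, reV, imV]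

theorem cub_ofRealV (m : ℝ) (x y z : Idx p → ℝ) :
    cub (m : ℂ) (ofRealV x) (ofRealV y) (ofRealV z) = (cub m x y z : ℝ) := by
  simp [cub, bil, ofRealV]

theorem star_cub (m : ℝ) (x y z : Idx p → ℂ) :
    star (cub (m : ℂ) x y z) = cub (m : ℂ) (star x) (star y) (star z) := by
  simp [cub, bil]

/-- The lift of the tube domain to a Lagrangian cone. -/
def specialLift (m : ℝ) (z : Idx p → ℂ) : CotangentSpace (Option (Idx p)) :=
  (fun k => k.elim 1 z,
    fun k => k.elim (-cub (m : ℂ) z z z) fun j => 3 * cub (m : ℂ) z z (Pi.single j 1))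

/-- The differential of `specialLift`. -/
def specialLiftDeriv (m : ℝ) (z v : Idx p → ℂ) : CotangentSpace (Option (Idx p)) :=
  (fun k => k.elim 0 v,
    fun k => k.elim (-(3 * cub (m : ℂ) z z v)) fun j => 6 * cub (m : ℂ) z v (Pi.single j 1))

theorem differentiable_cub (m : ℂ) {f g k : (Idx p → ℂ) → Idx p → ℂ} (hf : Differentiable ℂ f)
    (hg : Differentiable ℂ g) (hk : Differentiable ℂ k) :
    Differentiable ℂ fun z => cub m (f z) (g z) (k z) := by
  have f' := differentiable_pi.1 hf
  have g' := differentiable_pi.1 hg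
  have k' := differentiable_pi.1 hk
  simp only [cub, bil]
  fun_prop

theorem differentiable_specialLift (m : ℝ) : Differentiable ℂ (specialLift (p := p) m) := by
  refine Differentiable.prodMk (differentiable_pi.2 fun k => ?_) (differentiable_pi.2 fun k => ?_)
  · rcases k with _ | k
    · exact differentiable_const _
    · exact differentiable_apply k
  · rcases k with _ | k
    · exact (differentiable_cub _ differentiable_id differentiable_id differentiable_id).neg
    · exact (differentiable_cub _ differentiable_id differentiable_id
        (differentiable_const _)).const_mul _

theorem fderiv_specialLift (m : ℝ) (z v : Idx p → ℂ) :
    fderiv ℂ (specialLift m) z v = specialLiftDeriv m z v := by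
  refine fderiv_apply_eq_of_hasDerivAt (differentiable_specialLift m z) ?_
  have h := hasDerivAt_id (0 : ℂ)
  refine HasDerivAt.prodMk (hasDerivAt_pi.2 fun k => ?_) (hasDerivAt_pi.2 fun k => ?_)
  · rcases k with _ | k
    · exact hasDerivAt_const _ _
    · exact ((h.mul_const (v k)).const_add (z k)).congr_deriv (by simp)
  · rcases k with _ | k
    · have e : (fun τ : ℂ => (-cub (m : ℂ) (z + τ • v) (z + τ • v) (z + τ • v))) = fun τ =>
          -(cub (m : ℂ) z z z + τ * (3 * cub (m : ℂ) z z v + τ * (3 * cub (m : ℂ) z v v +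
            τ * cub (m : ℂ) v v v))) := by
        funext τ
        simp only [cub_add_left, cub_add_mid, cub_add_right, cub_smul_left, cub_smul_mid,
          cub_smul_right]
        rw [cub_comm (m : ℂ) v z z, cub_comm' (m : ℂ) z v z, cub_comm (m : ℂ) v z v,
          cub_comm' (m : ℂ) v v z, cub_comm (m : ℂ) v z v]
        ring
      suffices hd : HasDerivAt (fun τ : ℂ => (-cub (m : ℂ) (z + τ • v) (z + τ • v) (z + τ • v)))
        (-(3 * cub (m : ℂ) z z v)) 0 from hd
      rw [e]
      exact ((h.fun_mul (((h.fun_mul ((h.mul_const _).const_add _))).const_add _)).const_add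
        _).fun_neg.congr_deriv (by simp)
    · have e : (fun τ : ℂ => 3 * cub (m : ℂ) (z + τ • v) (z + τ • v) (Pi.single k 1)) = fun τ =>
          3 * (cub (m : ℂ) z z (Pi.single k 1) + τ * (2 * cub (m : ℂ) z v (Pi.single k 1) +
            τ * cub (m : ℂ) v v (Pi.single k 1))) := by
        funext τ
        simp only [cub_add_left, cub_add_mid, cub_smul_left, cub_smul_mid]
        rw [cub_comm (m : ℂ) v z]
        ring
      suffices hd : HasDerivAt (fun τ : ℂ => 3 * cub (m : ℂ) (z + τ • v) (z + τ • v) (Pi.single k 1))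
        (6 * cub (m : ℂ) z v (Pi.single k 1)) 0 from hd
      rw [e]
      exact (((h.fun_mul ((h.mul_const _).const_add _)).const_add _).const_mul 3).congr_deriv
        (by simp; ring)

/-- The elements of the tangent spaces of the Lagrangian cone. -/
def coneTangent (m : ℝ) (z : Idx p → ℂ) (a : ℂ) (v : Idx p → ℂ) :
    CotangentSpace (Option (Idx p)) := a • specialLift m z + specialLiftDeriv m z v

/-- A trilinear identity with z = R + iY and its conjugate R - iY, in which `b` and `u` play the
role of conjugated quantities. All terms containing R cancel, which is the invariance of γ under
real translations. -/
theorem cub_polarization (m : ℂ) (R Y v u : Idx p → ℂ) (a b : ℂ) :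
    Complex.I * ((a * (-(b * cub m (R + (-Complex.I) • Y) (R + (-Complex.I) • Y)
        (R + (-Complex.I) • Y)) - 3 * cub m (R + (-Complex.I) • Y) (R + (-Complex.I) • Y) u) -
      (-(a * cub m (R + Complex.I • Y) (R + Complex.I • Y) (R + Complex.I • Y)) -
        3 * cub m (R + Complex.I • Y) (R + Complex.I • Y) v) * b) +
      (3 * b * (a * cub m (R + (-Complex.I) • Y) (R + (-Complex.I) • Y) (R + Complex.I • Y) +
        cub m (R + (-Complex.I) • Y) (R + (-Complex.I) • Y) v) +
      6 * (a * cub m (R + (-Complex.I) • Y) u (R + Complex.I • Y) +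
        cub m (R + (-Complex.I) • Y) u v) -
      (3 * a * (b * cub m (R + Complex.I • Y) (R + Complex.I • Y) (R + (-Complex.I) • Y) +
        cub m (R + Complex.I • Y) (R + Complex.I • Y) u) +
      6 * (b * cub m (R + Complex.I • Y) v (R + (-Complex.I) • Y) +
        cub m (R + Complex.I • Y) v u)))) =
    a * b * (8 * cub m Y Y Y) - b * (12 * Complex.I * cub m Y Y v) +
      a * (12 * Complex.I * cub m Y Y u) + 12 * cub m Y v u := by
  simp only [cub_add_left, cub_add_mid, cub_add_right, cub_smul_left, cub_smul_mid,
    cub_smul_right, cub_comm m Y R, cub_comm' m _ Y R, cub_comm' m _ v R, cub_comm' m _ u R,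
    cub_comm' m _ v Y, cub_comm' m _ u Y, cub_comm' m _ u v]
  ring_nf
  simp only [Complex.I_pow_four, Complex.I_sq, Complex.I_pow_three]
  ring

/-- The Hermitian form on the tangent space of the cone depends on z only through y = Im z. For v =
w = 0 and a = b = 1 it is 8C(y, y, y), so the potential log γ is log h(Im z) up to a constant. -/
theorem gam_coneTangent (m : ℝ) (z : Idx p → ℂ) (a b : ℂ) (v w : Idx p → ℂ) :
    gam (coneTangent m z a v) (coneTangent m z b w) =
      a * star b * (8 * cub m (imV z) (imV z) (imV z)) -
      star b * (12 * Complex.I * cub (m : ℂ) (ofRealV (imV z)) (ofRealV (imV z)) v) +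
      a * (12 * Complex.I * cub (m : ℂ) (ofRealV (imV z)) (ofRealV (imV z)) (star w)) +
      12 * cub (m : ℂ) (ofRealV (imV z)) v (star w) := by
  have hst : ∀ j : Idx p, star (Pi.single j 1 : Idx p → ℂ) = Pi.single j 1 := fun j => by
    funext k
    by_cases h : k = j
    · subst h; simp
    · simp [h]
  have h1 : ∑ j, (a * z j + v j) * star (b * (3 * cub (m : ℂ) z z (Pi.single j 1)) +
      6 * cub (m : ℂ) z w (Pi.single j 1)) =
      3 * star b * (a * cub (m : ℂ) (star z) (star z) z + cub (m : ℂ) (star z) (star z) v) +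
      6 * (a * cub (m : ℂ) (star z) (star w) z + cub (m : ℂ) (star z) (star w) v) := by
    simp only [← sum_cub_single (m : ℂ) (star z) (star z) z, ← sum_cub_single (m : ℂ) (star z) (star z) v,
      ← sum_cub_single (m : ℂ) (star z) (star w) z, ← sum_cub_single (m : ℂ) (star z) (star w) v,
      Finset.mul_sum, ← Finset.sum_add_distrib]
    refine Finset.sum_congr rfl fun j _ => ?_
    simp only [star_add, star_mul', star_cub, hst, star_ofNat]
    ring
  have h2 : ∑ j, (a * (3 * cub (m : ℂ) z z (Pi.single j 1)) + 6 * cub (m : ℂ) z v (Pi.single j 1)) *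
      star (b * z j + w j) =
      3 * a * (star b * cub (m : ℂ) z z (star z) + cub (m : ℂ) z z (star w)) +
      6 * (star b * cub (m : ℂ) z v (star z) + cub (m : ℂ) z v (star w)) := by
    simp only [← sum_cub_single (m : ℂ) z z (star z), ← sum_cub_single (m : ℂ) z z (star w),
      ← sum_cub_single (m : ℂ) z v (star z), ← sum_cub_single (m : ℂ) z v (star w),
      Finset.mul_sum, ← Finset.sum_add_distrib]
    refine Finset.sum_congr rfl fun j _ => ?_
    simp only [star_add, star_mul', Pi.star_apply]
    ring
  have h3 : gam (coneTangent m z a v) (coneTangent m z b w) = Complex.I *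
      ((a * star (-(b * cub (m : ℂ) z z z) - 3 * cub (m : ℂ) z z w) -
        (-(a * cub (m : ℂ) z z z) - 3 * cub (m : ℂ) z z v) * star b) +
      (∑ j, (a * z j + v j) * star (b * (3 * cub (m : ℂ) z z (Pi.single j 1)) +
        6 * cub (m : ℂ) z w (Pi.single j 1)) -
      ∑ j, (a * (3 * cub (m : ℂ) z z (Pi.single j 1)) + 6 * cub (m : ℂ) z v (Pi.single j 1)) *
        star (b * z j + w j))) := by
    rw [gam, symp, Fintype.sum_option, ← Finset.sum_sub_distrib]
    congr 2
    simp [coneTangent, specialLift, specialLiftDeriv]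
    ring
  have key := cub_polarization (m : ℂ) (ofRealV (reV z)) (ofRealV (imV z)) v (star w) a (star b)
  rw [← eq_ofRealV_add, ← star_eq_ofRealV_add] at key
  rw [h3, h1, h2, ← cub_ofRealV, ← key]
  simp only [star_sub, star_neg, star_mul', star_cub, star_ofNat]

end Cubic

/-! ### The Lagrangian cone and the special metric in degree three -/

section SpecialKahler

variable {p s : ℕ}

theorem logHess_pos (hs : 1 ≤ s) {z : Idx p → ℂ} (hz : z ∈ tube (orbit p s)) {v : Idx p → ℝ}
    (hv : v ≠ 0) : 0 < logHess s (imV z) v v := by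
  set x := (tubeMapInv p s z).1
  have hy : imV z = act s x (vecJB₀ p s) := by
    conv_lhs => rw [← tubeMap_tubeMapInv hs hz]
    rfl
  have hvx : v = act s x (act s (invB s x) v) := by
    rw [← act_mulB, mulB_invB, act_zero_left]
  set w := act s (invB s x) v
  have hw : w ≠ 0 := by
    intro h
    rw [h, act_zero_right] at hvx
    exact hv hvx
  rw [hy, hvx, logHess_act hs, logHess_vecJB₀ hs]
  refine lt_of_le_of_ne (Finset.sum_nonneg fun i _ => mul_self_nonneg _) (Ne.symm ?_)
  rwa [Ne, dotProduct_self_eq_zero]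

theorem cub_self (y : Idx p → ℝ) :
    cub (mu 2) y y y = mu 2 * y (Sum.inl 1) * qform 2 y y := by
  rw [cub, bil_real]
  ring

theorem cub_pos {z : Idx p → ℂ} (hz : z ∈ tube (orbit p 2)) :
    0 < cub (mu 2) (imV z) (imV z) (imV z) := by
  have h := (mem_tube_iff (by norm_num) z).1 hz
  rw [cub_self]
  exact mul_pos (mul_pos (mu_pos (by norm_num)) h.1) h.2

/-- With h(y) = C(y, y, y) this is -∂² log h computed from the trilinear form, the shape in which it
can be compared with γ. -/
theorem logHess_eq_cub {z : Idx p → ℂ} (hz : z ∈ tube (orbit p 2)) (v w : Idx p → ℝ) :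
    logHess 2 (imV z) v w =
      9 * cub (mu 2) (imV z) (imV z) v * cub (mu 2) (imV z) (imV z) w /
        cub (mu 2) (imV z) (imV z) (imV z) ^ 2 -
      6 * cub (mu 2) (imV z) v w / cub (mu 2) (imV z) (imV z) (imV z) := by
  have h := (mem_tube_iff (by norm_num) z).1 hz
  have hb : 0 < mu 2 * imV z (Sum.inl 1) := mul_pos (mu_pos (by norm_num)) h.1
  have hQ := h.2
  rw [cub_self]
  simp only [logHess, cub, bil_real]
  set y := imV z
  set b := mu 2 * y (Sum.inl 1)
  set Q := qform 2 y y
  push_cast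
  field_simp
  ring

theorem specialLift_eq_coneTangent (m : ℝ) (z : Idx p → ℂ) :
    specialLift m z = coneTangent m z 1 0 := by
  have h0 : ∀ x y : Idx p → ℂ, cub (m : ℂ) x y 0 = 0 := fun x y => by
    simpa using cub_smul_right (m : ℂ) 0 x y 0
  have h1 : ∀ x y : Idx p → ℂ, cub (m : ℂ) x 0 y = 0 := fun x y => by
    rw [cub_comm', h0]
  have : specialLiftDeriv m z (0 : Idx p → ℂ) = 0 := by
    refine Prod.ext (funext fun k => ?_) (funext fun k => ?_) <;> rcases k with _ | k <;>
      simp [specialLiftDeriv, h0, h1]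
  rw [coneTangent, this, one_smul, add_zero]

theorem specialLiftDeriv_eq_coneTangent (m : ℝ) (z v : Idx p → ℂ) :
    specialLiftDeriv m z v = coneTangent m z 0 v := by
  rw [coneTangent, zero_smul, zero_add]

theorem cub_linear_parts (m : ℝ) (y : Idx p → ℝ) (v : Idx p → ℂ) (x : Idx p → ℝ) :
    cub (m : ℂ) (ofRealV y) v (ofRealV x) =
      (cub m y (reV v) x : ℝ) + Complex.I * (cub m y (imV v) x : ℝ) := by
  conv_lhs => rw [eq_ofRealV_add v]
  rw [cub_add_mid, cub_smul_mid, cub_ofRealV, cub_ofRealV]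

theorem cub_linear_parts' (m : ℝ) (y : Idx p → ℝ) (v : Idx p → ℂ) :
    cub (m : ℂ) (ofRealV y) (ofRealV y) v =
      (cub m y y (reV v) : ℝ) + Complex.I * (cub m y y (imV v) : ℝ) := by
  rw [cub_comm', cub_linear_parts, cub_comm' m y (reV v), cub_comm' m y (imV v)]

/-- Both metrics are built from the second derivatives of log h(Im z). The constant comes from the
factors 8 and 12 in `gam_coneTangent` against 9 and 6 in `logHess_eq_cub`. -/
theorem specialMetric_specialLift {z : Idx p → ℂ} (hz : z ∈ tube (orbit p 2)) (v : Idx p → ℂ) :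
    tubeMetric (basicPoly p 2) (2 + 1) z v v =
      -(4 / 3) * specialMetric (specialLift (mu 2) z) (specialLiftDeriv (mu 2) z v) := by
  have hh := cub_pos hz
  rw [tubeMetric_eq (by norm_num) hz, logHess_eq_cub hz, logHess_eq_cub hz, specialMetric,
    specialLiftDeriv_eq_coneTangent, specialLift_eq_coneTangent, gam_coneTangent, gam_coneTangent,
    gam_coneTangent]
  have h0 : ∀ x y : Idx p → ℂ, cub (mu 2 : ℂ) x y 0 = 0 := fun x y => by
    simpa using cub_smul_right (mu 2 : ℂ) 0 x y 0
  simp only [h0, cub_comm' (mu 2 : ℂ) _ 0 _, star_zero, star_one, mul_zero, zero_mul, add_zero,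
    sub_zero, zero_add, one_mul, mul_one]
  have e1 : cub (mu 2 : ℂ) (ofRealV (imV z)) v (star v) =
      ((cub (mu 2) (imV z) (reV v) (reV v) + cub (mu 2) (imV z) (imV v) (imV v) : ℝ) : ℂ) := by
    rw [star_eq_ofRealV_add v, cub_add_right, cub_smul_right, cub_linear_parts, cub_linear_parts,
      cub_comm' _ _ (imV v) (reV v)]
    push_cast
    linear_combination (-((cub (mu 2) (imV z) (imV v) (imV v) : ℝ) : ℂ)) * Complex.I_sq
  have e2 : cub (mu 2 : ℂ) (ofRealV (imV z)) (ofRealV (imV z)) (star v) =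
      (cub (mu 2) (imV z) (imV z) (reV v) : ℝ) -
        Complex.I * (cub (mu 2) (imV z) (imV z) (imV v) : ℝ) := by
    rw [star_eq_ofRealV_add v, cub_add_right, cub_smul_right, cub_ofRealV, cub_ofRealV]
    ring
  rw [e1, e2]
  set h := cub (mu 2) (imV z) (imV z) (imV z)
  set A := cub (mu 2) (imV z) (reV v) (reV v)
  set B := cub (mu 2) (imV z) (imV v) (imV v)
  set P := cub (mu 2) (imV z) (imV z) (reV v)
  set R := cub (mu 2) (imV z) (imV z) (imV v)
  have e3 : (12 * ((A + B : ℝ) : ℂ) / (8 * (h : ℂ))).re = 12 * (A + B) / (8 * h) := by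
    rw [← Complex.ofReal_re (12 * (A + B) / (8 * h))]
    push_cast
    rfl
  have e4 : ‖12 * Complex.I * ((P : ℂ) - Complex.I * (R : ℂ)) / (8 * (h : ℂ))‖ ^ 2 =
      144 * (P ^ 2 + R ^ 2) / (64 * h ^ 2) := by
    have : 12 * Complex.I * ((P : ℂ) - Complex.I * (R : ℂ)) / (8 * (h : ℂ)) =
        ((12 * R / (8 * h) : ℝ) : ℂ) + ((12 * P / (8 * h) : ℝ) : ℂ) * Complex.I := by
      have hC : (h : ℂ) ≠ 0 := by exact_mod_cast hh.ne'
      push_cast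
      field_simp
      linear_combination (-(R : ℂ)) * Complex.I_sq
    rw [this, ← Complex.normSq_eq_norm_sq, Complex.normSq_add_mul_I]
    field_simp
    ring
  rw [e3, e4]
  push_cast
  field_simp
  ring

/-- Orthogonality to the radial direction expresses a through v. Substituting this into
orthogonality to the real directions shows that Re v and Im v lie in the kernel of `logHess`, which
is positive definite. -/
theorem eq_zero_of_gam_coneTangent {z : Idx p → ℂ} (hz : z ∈ tube (orbit p 2)) {a : ℂ}
    {v : Idx p → ℂ}
    (h : ∀ b w, gam (coneTangent (mu 2) z a v) (coneTangent (mu 2) z b w) = 0) :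
    a = 0 ∧ v = 0 := by
  have hh := cub_pos hz
  have h0 : ∀ x y : Idx p → ℂ, cub (mu 2 : ℂ) x y 0 = 0 := fun x y => by
    simpa using cub_smul_right (mu 2 : ℂ) 0 x y 0
  have h1 := h 1 0
  have h2 : ∀ x : Idx p → ℝ, gam (coneTangent (mu 2) z a v) (coneTangent (mu 2) z 0 (ofRealV x)) = 0 :=
    fun x => h 0 _
  have hst : ∀ x : Idx p → ℝ, star (ofRealV x) = ofRealV x := fun x => by
    funext i
    simp [ofRealV]
  rw [gam_coneTangent] at h1
  simp only [gam_coneTangent, hst] at h2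
  simp only [h0, star_zero, star_one, mul_zero, zero_mul, add_zero, sub_zero, zero_add, one_mul,
    mul_one] at h1 h2
  rw [cub_linear_parts'] at h1
  set y := imV z
  set H := cub (mu 2) y y y
  set P := cub (mu 2) y y (reV v)
  set R := cub (mu 2) y y (imV v)
  have ha : a = 3 / 2 * Complex.I * (P + Complex.I * R) / H := by
    have : (H : ℂ) ≠ 0 := by exact_mod_cast hh.ne'
    field_simp
    linear_combination (1 / 4) * h1
  have hz2 : ∀ x : Idx p → ℝ, logHess 2 y (reV v) x = 0 ∧ logHess 2 y (imV v) x = 0 := by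
    intro x
    have e := h2 x
    rw [ha, cub_ofRealV, cub_linear_parts] at e
    have hH : (H : ℂ) ≠ 0 := by exact_mod_cast hh.ne'
    have e' : ((H * cub (mu 2) y (reV v) x - 3 / 2 * P * cub (mu 2) y y x : ℝ) : ℂ) +
        ((H * cub (mu 2) y (imV v) x - 3 / 2 * R * cub (mu 2) y y x : ℝ) : ℂ) * Complex.I = 0 := by
      field_simp at e
      push_cast
      linear_combination (1 / 24) * e - (3 / 2 * ((cub (mu 2) y y x : ℝ) : ℂ) * (P + Complex.I * R)) * Complex.I_sq
    have er := congrArg Complex.re e'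
    have ei := congrArg Complex.im e'
    simp at er ei
    rw [logHess_eq_cub hz, logHess_eq_cub hz]
    change 9 * P * cub (mu 2) y y x / H ^ 2 - 6 * cub (mu 2) y (reV v) x / H = 0 ∧
      9 * R * cub (mu 2) y y x / H ^ 2 - 6 * cub (mu 2) y (imV v) x / H = 0
    constructor
    · field_simp
      linear_combination (-6) * er
    · field_simp
      linear_combination (-6) * ei
  have hr : reV v = 0 := by
    by_contra hne
    exact (logHess_pos (by norm_num) hz hne).ne' (hz2 _).1
  have hi : imV v = 0 := by
    by_contra hne
    exact (logHess_pos (by norm_num) hz hne).ne' (hz2 _).2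
  have hv : v = 0 := by
    rw [eq_ofRealV_add v, hr, hi]
    funext i
    simp [ofRealV]
  refine ⟨?_, hv⟩
  have hP : P = 0 := by
    change cub (mu 2) y y (reV v) = 0
    rw [hr]
    simpa using cub_smul_right (mu 2) 0 y y 0
  have hR : R = 0 := by
    change cub (mu 2) y y (imV v) = 0
    rw [hi]
    simpa using cub_smul_right (mu 2) 0 y y 0
  rw [ha, hP, hR]
  simp

/-- The cone is the graph of the differential of F(X⁰, X) = C(X, X, X)/X⁰, hence isotropic; in
coordinates this is the symmetry of C. -/
theorem symp_coneTangent (m : ℝ) (z : Idx p → ℂ) (a b : ℂ) (v w : Idx p → ℂ) :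
    symp (coneTangent m z a v) (coneTangent m z b w) = 0 := by
  have h1 : ∀ a b : ℂ, ∀ v w : Idx p → ℂ,
      ∑ j, (b * (3 * cub (m : ℂ) z z (Pi.single j 1)) +
      6 * cub (m : ℂ) z w (Pi.single j 1)) * (a * z j + v j) =
      3 * b * (a * cub (m : ℂ) z z z + cub (m : ℂ) z z v) +
      6 * (a * cub (m : ℂ) z w z + cub (m : ℂ) z w v) := fun a b v w => by
    simp only [← sum_cub_single (m : ℂ) z z z, ← sum_cub_single (m : ℂ) z z v,
      ← sum_cub_single (m : ℂ) z w z, ← sum_cub_single (m : ℂ) z w v,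
      Finset.mul_sum, ← Finset.sum_add_distrib]
    refine Finset.sum_congr rfl fun j _ => ?_
    ring
  have h3 : symp (coneTangent m z a v) (coneTangent m z b w) =
      ((a * (-(b * cub (m : ℂ) z z z) - 3 * cub (m : ℂ) z z w) -
        (-(a * cub (m : ℂ) z z z) - 3 * cub (m : ℂ) z z v) * b) +
      (∑ j, (b * (3 * cub (m : ℂ) z z (Pi.single j 1)) +
        6 * cub (m : ℂ) z w (Pi.single j 1)) * (a * z j + v j) -
      ∑ j, (a * (3 * cub (m : ℂ) z z (Pi.single j 1)) + 6 * cub (m : ℂ) z v (Pi.single j 1)) *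
        (b * z j + w j))) := by
    rw [symp, Fintype.sum_option, ← Finset.sum_sub_distrib]
    congr 1
    · simp [coneTangent, specialLift, specialLiftDeriv]
      ring
    · refine Finset.sum_congr rfl fun j _ => ?_
      simp [coneTangent, specialLift, specialLiftDeriv]
      ring
  rw [h3, h1, h1, cub_comm' (m : ℂ) z w z, cub_comm' (m : ℂ) z v z, cub_comm' (m : ℂ) z w v]
  ring

/-- The affine coordinates of a point with homogeneous coordinates `X`. -/
def affinePart (X : Option (Idx p) → ℂ) : Idx p → ℂ := fun j => (X none)⁻¹ * X (some j)

/-- The Lagrangian cone, as a graph over its projection. -/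
def coneSection (m : ℝ) (X : Option (Idx p) → ℂ) : CotangentSpace (Option (Idx p)) :=
  X none • specialLift m (affinePart X)

theorem differentiableAt_coneSection (m : ℝ) {X : Option (Idx p) → ℂ} (hX : X none ≠ 0) :
    DifferentiableAt ℂ (coneSection m) X := by
  have h0 : DifferentiableAt ℂ (fun X : Option (Idx p) → ℂ => X none) X :=
    differentiableAt_apply _ _
  have h1 : DifferentiableAt ℂ (affinePart (p := p)) X :=
    differentiableAt_pi.2 fun j => (h0.inv hX).mul (differentiableAt_apply _ _)
  exact h0.smul ((differentiable_specialLift m).differentiableAt.comp X h1)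

/-- The section is homogeneous of degree one: moving X⁰ rescales the lift, and the motion of the
affine coordinates carries a factor 1/X⁰ that the outer factor removes. -/
theorem fderiv_coneSection (m : ℝ) {X : Option (Idx p) → ℂ} (hX : X none ≠ 0)
    (a : Option (Idx p) → ℂ) : fderiv ℂ (coneSection m) X a =
      coneTangent m (affinePart X) (a none) ((fun j => a (some j)) - a none • affinePart X) := by
  refine fderiv_apply_eq_of_hasDerivAt (differentiableAt_coneSection m hX) ?_
  have c : ∀ k, HasDerivAt (fun τ : ℂ => (X + τ • a) k) (a k) 0 := fun k =>
    (((hasDerivAt_id (0 : ℂ)).mul_const (a k)).const_add (X k)).congr_deriv (by simp)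
  have hX0 : (X + (0 : ℂ) • a) none ≠ 0 := by simpa using hX
  have hζ : HasDerivAt (fun τ : ℂ => affinePart (X + τ • a))
      ((X none)⁻¹ • ((fun j => a (some j)) - a none • affinePart X)) 0 := by
    refine hasDerivAt_pi.2 fun j => ?_
    refine (((c none).fun_inv hX0).fun_mul (c (some j))).congr_deriv ?_
    simp only [zero_smul, add_zero, affinePart, Pi.smul_apply, Pi.sub_apply, smul_eq_mul]
    field_simp
    ring
  have hu : HasFDerivAt (specialLift m) (fderiv ℂ (specialLift m) (affinePart X))
      (affinePart (X + (0 : ℂ) • a)) := by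
    simpa using (differentiable_specialLift m (affinePart X)).hasFDerivAt
  refine ((c none).fun_smul (hu.comp_hasDerivAt (0 : ℂ) hζ)).congr_deriv ?_
  simp only [Function.comp_apply, zero_smul, add_zero]
  rw [map_smul, smul_smul, mul_inv_cancel₀ hX, one_smul, fderiv_specialLift, coneTangent, add_comm]

/-- The Lagrangian cone over the tube domain of degree `3`. -/
def tubeCone (p : ℕ) : Set (CotangentSpace (Option (Idx p))) :=
  {x | ∃ a : ℂ, a ≠ 0 ∧ ∃ z ∈ tube (orbit p 2), x = a • specialLift (mu 2) z}

theorem coneTangent_fst (m : ℝ) (z : Idx p → ℂ) (a : ℂ) (v : Idx p → ℂ) :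
    (coneTangent m z a v).1 = fun k => k.elim a (a • z + v) := by
  funext k
  rcases k with _ | k <;> simp [coneTangent, specialLift, specialLiftDeriv]

theorem isConnected_tube (hs : 1 ≤ s) : IsConnected (tube (orbit p s)) := by
  obtain ⟨-, ⟨y, hy⟩, hconv, -⟩ := isSiegelDomainTypeI_cone_orbit (p := p) hs
  refine ⟨⟨fun i => ⟨0, y i⟩, hy⟩, Convex.isPreconnected ?_⟩
  intro z hz w hw a b ha hb hab
  have := hconv hz hw ha hb hab
  change imV (a • z + b • w) ∈ cone (orbit p s)
  rw [imV_add, imV_smul, imV_smul]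
  exact this

theorem isLagrangianCone_tubeCone (p : ℕ) : IsLagrangianCone (tubeCone p) where
  connected := by
    have h1 : IsConnected ({0}ᶜ : Set ℂ) :=
      isConnected_compl_singleton_of_one_lt_rank (by rw [Complex.rank_real_complex]; norm_num) 0
    have h2 := (h1.prod (isConnected_tube (p := p) (s := 2) (by norm_num))).image
      (fun x : ℂ × (Idx p → ℂ) => x.1 • specialLift (mu 2) x.2)
      ((continuous_fst.smul ((differentiable_specialLift (mu 2)).continuous.comp
        continuous_snd)).continuousOn)
    convert h2 using 1
    ext x
    constructor
    · rintro ⟨a, ha, z, hz, rfl⟩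
      exact ⟨(a, z), ⟨ha, hz⟩, rfl⟩
    · rintro ⟨⟨a, z⟩, ⟨ha, hz⟩, rfl⟩
      exact ⟨a, ha, z, hz, rfl⟩
  conic t ht v hv := by
    obtain ⟨a, ha, z, hz, rfl⟩ := hv
    exact ⟨t * a, mul_ne_zero (by exact_mod_cast ht.ne') ha, z, hz, by rw [smul_smul]⟩
  chart x hx := by
    -- One chart covers the whole cone, since it is a graph over its projection to the first factor.
    let O : Set (Option (Idx p) → ℂ) := {X | X none ≠ 0 ∧ affinePart X ∈ tube (orbit p 2)}
    have hO : IsOpen O := by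
      have h0 : IsOpen {X : Option (Idx p) → ℂ | X none ≠ 0} :=
        isOpen_ne_fun (continuous_apply _) continuous_const
      have hc : ContinuousOn (affinePart (p := p)) {X | X none ≠ 0} :=
        continuousOn_pi.2 fun j => ((continuous_apply none).continuousOn.inv₀ fun X hX => hX).mul
          (continuous_apply _).continuousOn
      exact hc.isOpen_inter_preimage h0 (isOpen_tube (by norm_num))
    refine ⟨O, Set.univ, coneSection (mu 2), Prod.fst, hO, isOpen_univ, trivial,
      fun X hX => (differentiableAt_coneSection _ hX.1).differentiableWithinAt, ?_,
      continuous_fst.continuousOn, ?_, ?_⟩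
    · rw [Set.inter_univ]
      ext y
      constructor
      · rintro ⟨X, hX, rfl⟩
        exact ⟨X none, hX.1, affinePart X, hX.2, rfl⟩
      · rintro ⟨a, ha, z, hz, rfl⟩
        have hz' : affinePart (fun k : Option (Idx p) => k.elim a (a • z)) = z := by
          funext j
          simp [affinePart, ha]
        refine ⟨fun k => k.elim a (a • z), ⟨ha, ?_⟩, ?_⟩
        · rw [hz']; exact hz
        · rw [coneSection, hz']
          rfl
    · intro X hX
      funext k
      have hX1 := hX.1
      rcases k with _ | k
      · simp [coneSection, specialLift]
      · simp [coneSection, specialLift, affinePart, hX1]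
    · intro X hX
      have hfst : ∀ a, (fderiv ℂ (coneSection (mu 2)) X a).1 = a := fun a => by
        rw [fderiv_coneSection _ hX.1, coneTangent_fst]
        funext k
        rcases k with _ | k <;> simp
      have hsurj : ∀ (b : ℂ) (w : Idx p → ℂ), ∃ c, fderiv ℂ (coneSection (mu 2)) X c =
          coneTangent (mu 2) (affinePart X) b w := fun b w => by
        refine ⟨fun k => k.elim b (b • affinePart X + w), ?_⟩
        rw [fderiv_coneSection _ hX.1]
        congr 1
        funext j
        simp
      refine ⟨fun a b hab => by rw [← hfst a, ← hfst b, hab], ?_, ?_⟩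
      · intro y
        constructor
        · rintro ⟨a, rfl⟩ _ ⟨b, rfl⟩
          rw [ContinuousLinearMap.coe_coe, fderiv_coneSection _ hX.1, fderiv_coneSection _ hX.1]
          exact symp_coneTangent _ _ _ _ _ _
        · intro hy
          refine ⟨y.1, Prod.ext (hfst _) ?_⟩
          funext k
          have e1 := hy _ ⟨Pi.single k 1, rfl⟩
          -- Maximality: y and the tangent vector with the same first component are both orthogonal
          -- to the tangent space. Pairing with the lifts of the basis vectors shows that their
          -- second components agree.
          have e2 : symp (fderiv ℂ (coneSection (mu 2)) X y.1)
              (fderiv ℂ (coneSection (mu 2)) X (Pi.single k 1)) = 0 := by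
            rw [fderiv_coneSection _ hX.1, fderiv_coneSection _ hX.1]
            exact symp_coneTangent _ _ _ _ _ _
          rw [ContinuousLinearMap.coe_coe] at e1 ⊢
          simp only [symp, Finset.sum_sub_distrib, hfst, Pi.single_apply, mul_ite, mul_one,
            mul_zero, Finset.sum_ite_eq', Finset.mem_univ, if_true] at e1 e2
          exact (sub_right_injective (e2.trans e1.symm))
      · intro a ha
        have hg : ∀ b w, gam (coneTangent (mu 2) (affinePart X) (a none)
            ((fun j => a (some j)) - a none • affinePart X))
            (coneTangent (mu 2) (affinePart X) b w) = 0 := fun b w => by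
          obtain ⟨c, hc⟩ := hsurj b w
          rw [← hc, ← fderiv_coneSection _ hX.1]
          exact ha c
        obtain ⟨h1, h2⟩ := eq_zero_of_gam_coneTangent hX.2 hg
        rw [h1, zero_smul, sub_zero] at h2
        funext k
        rcases k with _ | k
        · exact h1
        · exact congrFun h2 k
  proper x hx := by
    obtain ⟨a, ha, z, hz, rfl⟩ := hx
    have hh := cub_pos hz
    have : a • specialLift (mu 2) z = coneTangent (mu 2) z a 0 := by
      rw [specialLift_eq_coneTangent]
      simp only [coneTangent, one_smul, smul_add]
      have h0 : ∀ x y : Idx p → ℂ, cub (mu 2 : ℂ) x y 0 = 0 := fun x y => by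
        simpa using cub_smul_right (mu 2 : ℂ) 0 x y 0
      have : specialLiftDeriv (mu 2) z (0 : Idx p → ℂ) = 0 := by
        refine Prod.ext (funext fun k => ?_) (funext fun k => ?_) <;> rcases k with _ | k <;>
          simp [specialLiftDeriv, h0, cub_comm' (mu 2 : ℂ) _ 0 _]
      rw [this, smul_zero]
    rw [this, gam_coneTangent]
    have h0 : ∀ x y : Idx p → ℂ, cub (mu 2 : ℂ) x y 0 = 0 := fun x y => by
      simpa using cub_smul_right (mu 2 : ℂ) 0 x y 0
    simp only [h0, star_zero, mul_zero, sub_zero, add_zero]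
    have hh' : ((cub (mu 2) (imV z) (imV z) (imV z) : ℝ) : ℂ) ≠ 0 := by exact_mod_cast hh.ne'
    exact mul_ne_zero (mul_ne_zero ha (star_ne_zero.2 ha)) (mul_ne_zero (by norm_num) hh')

theorem isSpecialKahler_tube (p : ℕ) :
    IsSpecialKahler (tube (orbit p 2)) (tubeMetric (basicPoly p 2) (2 + 1)) := by
  refine ⟨4 / 3, by norm_num, fun z₀ hz₀ => ⟨tubeCone p, tube (orbit p 2), specialLift (mu 2),
    isLagrangianCone_tubeCone p, isOpen_tube (by norm_num), hz₀, subset_rfl,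
    (differentiable_specialLift _).differentiableOn,
    fun z hz => ⟨1, one_ne_zero, z, hz, (one_smul _ _).symm⟩, ?_, ?_⟩⟩
  · intro z _ w _ a h
    have h1 : (1 : ℂ) = a * 1 := congrFun (congrArg Prod.fst h) none
    funext j
    have h2 : z j = a * w j := congrFun (congrArg Prod.fst h) (some j)
    rw [h2, show a = 1 by simpa using h1.symm, one_mul]
  · intro z hz v
    rw [fderiv_specialLift]
    exact specialMetric_specialLift hz v

end SpecialKahler

/-! ## Isometries in a frame with constant structure functions -/

section LeftFrame

variable {E : Type*} [NormedAddCommGroup E] [NormedSpace ℝ E]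

variable (E) in
/-- A frame on a vector space, with constant structure functions, and the Levi-Civita connection
of a metric with constant coefficients in this frame. -/
structure LeftFrame where
  /-- the frame -/
  P : E → E →L[ℝ] E
  /-- the dual frame -/
  Q : E → E →L[ℝ] E
  /-- the Levi-Civita connection -/
  nabla : E →L[ℝ] E →L[ℝ] E
  /-- the metric -/
  B : E →L[ℝ] E →L[ℝ] ℝ
  contDiff_P : ContDiff ℝ ∞ P
  contDiff_Q : ContDiff ℝ ∞ Q
  Q_P : ∀ x v, Q x (P x v) = v
  P_Q : ∀ x v, P x (Q x v) = v
  bracket : ∀ x u v, fderiv ℝ P x (P x u) v - fderiv ℝ P x (P x v) u =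
    P x (nabla u v - nabla v u)
  symm : ∀ u v, B u v = B v u
  pos : ∀ u, u ≠ 0 → 0 < B u u
  skew : ∀ u v w, B (nabla u v) w + B v (nabla u w) = 0

namespace LeftFrame

variable (Φ : LeftFrame E)

/-- The curvature of a left-invariant metric. -/
def curv (u v w : E) : E :=
  Φ.nabla u (Φ.nabla v w) - Φ.nabla v (Φ.nabla u w) - Φ.nabla (Φ.nabla u v - Φ.nabla v u) w

/-- The differential of a map in the frame. -/
def diffMap (σ : E → E) (x : E) : E →L[ℝ] E :=
  (Φ.Q (σ x)).comp ((fderiv ℝ σ x).comp (Φ.P x))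

/-- Isometries. -/
structure IsIsometry (σ : E → E) : Prop where
  contDiff : ContDiff ℝ ∞ σ
  isometry : ∀ x u v, Φ.B (Φ.diffMap σ x u) (Φ.diffMap σ x v) = Φ.B u v

variable {Φ} {σ : E → E}

theorem contDiff_diffMap (hσ : ContDiff ℝ ∞ σ) : ContDiff ℝ ∞ (Φ.diffMap σ) :=
  (Φ.contDiff_Q.comp hσ).clm_comp ((hσ.fderiv_right (by norm_cast)).clm_comp Φ.contDiff_P)

theorem P_diffMap (x v : E) : Φ.P (σ x) (Φ.diffMap σ x v) = fderiv ℝ σ x (Φ.P x v) :=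
  Φ.P_Q _ _

theorem hasFDerivAt_of_contDiff {F : Type*} [NormedAddCommGroup F] [NormedSpace ℝ F] {f : E → F}
    (hf : ContDiff ℝ ∞ f) (x : E) : HasFDerivAt f (fderiv ℝ f x) x :=
  (hf.differentiable (by simp) x).hasFDerivAt

theorem hasDerivAt_line {F : Type*} [NormedAddCommGroup F] [NormedSpace ℝ F] {f : E → F}
    (hf : ContDiff ℝ ∞ f) (x w : E) :
    HasDerivAt (fun τ : ℝ => f (x + τ • w)) (fderiv ℝ f x w) 0 := by
  have hl : HasDerivAt (fun τ : ℝ => x + τ • w) w 0 := by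
    simpa using ((hasDerivAt_id (0 : ℝ)).smul_const w).const_add x
  have hd' : HasFDerivAt f (fderiv ℝ f x) (x + (0 : ℝ) • w) := by
    simpa using hasFDerivAt_of_contDiff hf x
  exact hd'.comp_hasDerivAt (0 : ℝ) hl

theorem symm_snd {F : Type*} [NormedAddCommGroup F] [NormedSpace ℝ F] {f : E → F}
    (hf : ContDiff ℝ ∞ f) (x u v : E) :
    fderiv ℝ (fderiv ℝ f) x u v = fderiv ℝ (fderiv ℝ f) x v u :=
  (hf.contDiffAt.isSymmSndFDerivAt 
    (by simpa using WithTop.coe_le_coe.2 (le_top : (2 : ℕ∞) ≤ ⊤))) u v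

/-- Differentiate the relation P(σ(x)) A(x) = dσ P(x) in a frame direction and antisymmetrize. The
second derivative of σ is symmetric and drops out, leaving the structure functions of the frame. -/
theorem diffMap_bracket (hσ : ContDiff ℝ ∞ σ) (x u v : E) :
    fderiv ℝ (Φ.diffMap σ) x (Φ.P x u) v - fderiv ℝ (Φ.diffMap σ) x (Φ.P x v) u =
      Φ.diffMap σ x (Φ.nabla u v - Φ.nabla v u) -
        (Φ.nabla (Φ.diffMap σ x u) (Φ.diffMap σ x v) -
          Φ.nabla (Φ.diffMap σ x v) (Φ.diffMap σ x u)) := by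
  have hA := contDiff_diffMap (Φ := Φ) hσ
  have key : ∀ w v, fderiv ℝ (fderiv ℝ σ) x w (Φ.P x v) + fderiv ℝ σ x (fderiv ℝ Φ.P x w v) =
      fderiv ℝ Φ.P (σ x) (fderiv ℝ σ x w) (Φ.diffMap σ x v) +
        Φ.P (σ x) (fderiv ℝ (Φ.diffMap σ) x w v) := by
    intro w v
    have hl := (hasDerivAt_line (hσ.fderiv_right (m := ∞) (by norm_cast)) x w).clm_apply
      ((hasDerivAt_line Φ.contDiff_P x w).clm_apply (hasDerivAt_const (0 : ℝ) v))
    have hr := (hasDerivAt_line (Φ.contDiff_P.comp hσ) x w).clm_apply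
      ((hasDerivAt_line hA x w).clm_apply (hasDerivAt_const (0 : ℝ) v))
    have e := hl.unique (hr.congr_of_eventuallyEq (Filter.Eventually.of_forall fun τ =>
      (P_diffMap (x + τ • w) v).symm))
    have hc : fderiv ℝ (Φ.P ∘ σ) x = (fderiv ℝ Φ.P (σ x)).comp (fderiv ℝ σ x) :=
      ((hasFDerivAt_of_contDiff Φ.contDiff_P (σ x)).comp x
        (hasFDerivAt_of_contDiff hσ x)).fderiv
    simpa [hc] using e
  have e1 := key (Φ.P x u) v
  have e2 := key (Φ.P x v) u
  have h0 := symm_snd hσ x (Φ.P x u) (Φ.P x v)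
  rw [← P_diffMap] at e1 e2
  have h1 := congrArg (fderiv ℝ σ x) (Φ.bracket x u v)
  have h2 := Φ.bracket (σ x) (Φ.diffMap σ x u) (Φ.diffMap σ x v)
  rw [← P_diffMap, map_sub] at h1
  apply (Function.LeftInverse.injective (Φ.Q_P (σ x)))
  rw [map_sub, map_sub (Φ.P (σ x)) (Φ.diffMap σ x _), ← h1, ← h2]
  rw [h0] at e1
  have e3 : ∀ a b c d e f g : E, a + b = c + d → a + e = f + g →
      d - g = b - e - (c - f) := fun a b c d e f g h h' => by
    rw [← sub_eq_zero] at h h' ⊢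
    calc d - g - (b - e - (c - f)) = (a + e - (f + g)) - (a + b - (c + d)) := by abel
      _ = 0 := by rw [h, h', sub_zero]
  exact e3 _ _ _ _ _ _ _ e1 e2

theorem diffMap_skew (h : Φ.IsIsometry σ) (x w u v : E) :
    Φ.B (fderiv ℝ (Φ.diffMap σ) x w u) (Φ.diffMap σ x v) +
      Φ.B (Φ.diffMap σ x u) (fderiv ℝ (Φ.diffMap σ) x w v) = 0 := by
  have hA := contDiff_diffMap (Φ := Φ) h.contDiff
  have hu := (hasDerivAt_line hA x w).clm_apply (hasDerivAt_const (0 : ℝ) u)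
  have hv := (hasDerivAt_line hA x w).clm_apply (hasDerivAt_const (0 : ℝ) v)
  have hB := (Φ.B.hasFDerivAt.comp_hasDerivAt (0 : ℝ) hu).clm_apply hv
  have e := hB.unique ((hasDerivAt_const (0 : ℝ) (Φ.B u v)).congr_of_eventuallyEq
    (Filter.Eventually.of_forall fun τ => h.isometry (x + τ • w) u v))
  simpa using e

theorem hasDerivAt_nabla {a b : ℝ → E} {a' b' : E} {t : ℝ} (ha : HasDerivAt a a' t)
    (hb : HasDerivAt b b' t) :
    HasDerivAt (fun τ => Φ.nabla (a τ) (b τ)) (Φ.nabla a' (b t) + Φ.nabla (a t) b') t :=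
  (Φ.nabla.hasFDerivAt.comp_hasDerivAt t ha).clm_apply hb

theorem hasDerivAt_curv {a b c : ℝ → E} {a' b' c' : E} {t : ℝ} (ha : HasDerivAt a a' t)
    (hb : HasDerivAt b b' t) (hc : HasDerivAt c c' t) :
    HasDerivAt (fun τ => Φ.curv (a τ) (b τ) (c τ))
      (Φ.curv a' (b t) (c t) + Φ.curv (a t) b' (c t) + Φ.curv (a t) (b t) c') t := by
  have h1 := hasDerivAt_nabla (Φ := Φ) ha (hasDerivAt_nabla (Φ := Φ) hb hc)
  have h2 := hasDerivAt_nabla (Φ := Φ) hb (hasDerivAt_nabla (Φ := Φ) ha hc)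
  have h3 := hasDerivAt_nabla (Φ := Φ) ((hasDerivAt_nabla (Φ := Φ) ha hb).fun_sub
    (hasDerivAt_nabla (Φ := Φ) hb ha)) hc
  refine ((h1.fun_sub h2).fun_sub h3).congr_deriv ?_
  simp only [curv, map_add, map_sub, add_apply, sub_apply]
  abel

variable [FiniteDimensional ℝ E]

theorem diffMap_surjective (h : Φ.IsIsometry σ) (x : E) : Function.Surjective (Φ.diffMap σ x) := by
  have hinj : Function.Injective (Φ.diffMap σ x : E →ₗ[ℝ] E) := by
    rw [injective_iff_map_eq_zero]
    intro v hv
    by_contra hne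
    have := h.isometry x v v
    rw [show Φ.diffMap σ x v = 0 from hv, map_zero] at this
    exact (Φ.pos v hne).ne this
  exact LinearMap.injective_iff_surjective.1 hinj

/-- Isometries preserve the Levi-Civita connection. -/
theorem fderiv_diffMap (h : Φ.IsIsometry σ) (x u v : E) :
    fderiv ℝ (Φ.diffMap σ) x (Φ.P x u) v = Φ.diffMap σ x (Φ.nabla u v) -
      Φ.nabla (Φ.diffMap σ x u) (Φ.diffMap σ x v) := by
  set A := Φ.diffMap σ x with hA
  -- `C` is the failure of σ to preserve the connection. It is symmetric in u, v because the
  -- connection is torsion-free, and ⟨C(u, v), Aw⟩ is skew in v, w because σ is isometric. A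
  -- trilinear form with both properties is zero, and A is onto.
  let C : E → E → E := fun u v => fderiv ℝ (Φ.diffMap σ) x (Φ.P x u) v +
    Φ.nabla (A u) (A v) - A (Φ.nabla u v)
  have hsym : ∀ u v, C u v = C v u := fun u v => by
    have := diffMap_bracket (Φ := Φ) h.contDiff x u v
    rw [← hA, map_sub] at this
    rw [← sub_eq_zero] at this ⊢
    rw [← this]
    simp only [C]
    abel
  have hskew : ∀ u v w, Φ.B (C u v) (A w) = -Φ.B (C u w) (A v) := fun u v w => by
    have h1 := diffMap_skew h x (Φ.P x u) v w
    have h2 := Φ.skew (A u) (A v) (A w)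
    have h3 := Φ.skew u v w
    rw [← h.isometry x (Φ.nabla u v) w, ← h.isometry x v (Φ.nabla u w)] at h3
    rw [Φ.symm (A v)] at h1 h2
    rw [← hA] at h1 h3
    rw [Φ.symm (A v)] at h3
    simp only [C, map_add, map_sub, add_apply, sub_apply]
    linarith
  have hzero : ∀ u v w, Φ.B (C u v) (A w) = 0 := fun u v w => by
    have e1 := hskew u v w
    have e2 := hskew w u v
    have e3 := hskew v w u
    rw [hsym u w] at e1
    rw [hsym w v] at e2
    rw [hsym v u] at e3
    linarith
  have hC : C u v = 0 := by
    by_contra hne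
    obtain ⟨w, hw⟩ := diffMap_surjective h x (C u v)
    have := hzero u v w
    rw [hA, hw] at this
    exact (Φ.pos _ hne).ne' this
  simp only [C] at hC
  rw [← sub_eq_zero, ← hC]
  abel

/-- Isometries preserve the curvature. -/
theorem diffMap_curv (h : Φ.IsIsometry σ) (x u v w : E) :
    Φ.diffMap σ x (Φ.curv u v w) =
      Φ.curv (Φ.diffMap σ x u) (Φ.diffMap σ x v) (Φ.diffMap σ x w) := by
  have hA := contDiff_diffMap (Φ := Φ) h.contDiff
  -- The formula for the derivative of A is differentiated once more. Antisymmetrizing in u, v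
  -- removes the second derivative of A and leaves the curvature on both sides.
  have h2 : ∀ u v, fderiv ℝ (fderiv ℝ (Φ.diffMap σ)) x (Φ.P x u) (Φ.P x v) w +
      fderiv ℝ (Φ.diffMap σ) x (fderiv ℝ Φ.P x (Φ.P x u) v) w =
      (Φ.diffMap σ x (Φ.nabla u (Φ.nabla v w)) -
        Φ.nabla (Φ.diffMap σ x u) (Φ.diffMap σ x (Φ.nabla v w))) -
      (Φ.nabla (Φ.diffMap σ x (Φ.nabla u v) - Φ.nabla (Φ.diffMap σ x u) (Φ.diffMap σ x v))
          (Φ.diffMap σ x w) +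
        Φ.nabla (Φ.diffMap σ x v) (Φ.diffMap σ x (Φ.nabla u w) -
          Φ.nabla (Φ.diffMap σ x u) (Φ.diffMap σ x w))) := by
    intro u v
    have hl := ((hasDerivAt_line (hA.fderiv_right (m := ∞) (by norm_cast)) x (Φ.P x u)).clm_apply
      ((hasDerivAt_line Φ.contDiff_P x (Φ.P x u)).clm_apply
        (hasDerivAt_const (0 : ℝ) v))).clm_apply (hasDerivAt_const (0 : ℝ) w)
    have hAt := fun t => (hasDerivAt_line hA x (Φ.P x u)).clm_apply (hasDerivAt_const (0 : ℝ) t)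
    have hr := (hAt (Φ.nabla v w)).fun_sub (hasDerivAt_nabla (Φ := Φ) (hAt v) (hAt w))
    have e := hl.unique (hr.congr_of_eventuallyEq (Filter.Eventually.of_forall fun τ =>
      fderiv_diffMap h (x + τ • Φ.P x u) v w))
    simpa [fderiv_diffMap h] using e
  have e1 := h2 u v
  have e2 := h2 v u
  have h0 := congrArg (fun L : E →L[ℝ] E => L w) (symm_snd hA x (Φ.P x u) (Φ.P x v))
  have h3 := fderiv_diffMap h x (Φ.nabla u v - Φ.nabla v u) w
  rw [← Φ.bracket, map_sub, sub_apply] at h3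
  rw [h0] at e1
  have e4 : ∀ a b c d e : E, a + b = c → a + d = e → b - d = c - e := fun a b c d e h h' => by
    rw [← h, ← h']; abel
  have e5 := (e4 _ _ _ _ _ e1 e2).symm.trans h3
  rw [← sub_eq_zero] at e5 ⊢
  rw [← e5]
  simp only [curv, map_sub, sub_apply]
  abel

/-- If there is a geodesic symmetry at some point, then the curvature is parallel. -/
theorem curv_parallel_of_symmetry (h : Φ.IsIsometry σ) (x : E)
    (hx : ∀ v, Φ.diffMap σ x v = -v) (t u v w : E) :
    Φ.nabla t (Φ.curv u v w) = Φ.curv (Φ.nabla t u) v w + Φ.curv u (Φ.nabla t v) w +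
      Φ.curv u v (Φ.nabla t w) := by
  have hA := contDiff_diffMap (Φ := Φ) h.contDiff
  -- Where A = -1 its derivative in direction t is -2∇ₜ. Differentiating the invariance of the
  -- curvature at this point then gives ∇R = 0 up to the factor -2.
  have hD : ∀ v, fderiv ℝ (Φ.diffMap σ) x (Φ.P x t) v = (-2 : ℝ) • Φ.nabla t v := fun v => by
    rw [fderiv_diffMap h, hx, hx, hx, map_neg, map_neg, neg_apply]
    module
  have hAt := fun v => (hasDerivAt_line hA x (Φ.P x t)).clm_apply (hasDerivAt_const (0 : ℝ) v)
  have e := (hAt (Φ.curv u v w)).unique ((hasDerivAt_curv (Φ := Φ) (hAt u) (hAt v)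
    (hAt w)).congr_of_eventuallyEq (Filter.Eventually.of_forall fun τ =>
      diffMap_curv h (x + τ • Φ.P x t) u v w))
  simp only [hD, hx, add_zero, zero_smul, neg_zero] at e
  have hc : ∀ (a b c : ℝ) (u v w : E), Φ.curv (a • u) (b • v) (c • w) =
      (a * b * c) • Φ.curv u v w := fun a b c u v w => by
    simp only [curv, map_smul, smul_apply, map_sub,
      sub_apply, smul_sub, smul_smul]
    simp only [mul_comm, mul_left_comm]
  have h1 : Φ.curv ((-2 : ℝ) • Φ.nabla t u) (-v) (-w) = (-2 : ℝ) • Φ.curv (Φ.nabla t u) v w := by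
    rw [← neg_one_smul ℝ v, ← neg_one_smul ℝ w, hc]
    norm_num
  have h2 : Φ.curv (-u) ((-2 : ℝ) • Φ.nabla t v) (-w) = (-2 : ℝ) • Φ.curv u (Φ.nabla t v) w := by
    rw [← neg_one_smul ℝ u, ← neg_one_smul ℝ w, hc]
    norm_num
  have h3 : Φ.curv (-u) (-v) ((-2 : ℝ) • Φ.nabla t w) = (-2 : ℝ) • Φ.curv u v (Φ.nabla t w) := by
    rw [← neg_one_smul ℝ u, ← neg_one_smul ℝ v, hc]
    norm_num
  rw [h1, h2, h3, ← smul_add, ← smul_add] at e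
  exact smul_right_injective E (by norm_num : (-2 : ℝ) ≠ 0) e

end LeftFrame

end LeftFrame

/-! ## Symmetric tube domains have degree two -/

section Symmetric

variable {p : ℕ} (s : ℕ)

theorem leftLin_tubeMul (g h v : TubeModel p) :
    leftLin p s (tubeMul p s g h) v = leftLin p s g (leftLin p s h v) := by
  refine Prod.ext (idx_ext ?_ ?_ ?_) (act_mulB s _ _ _)
  · simp [leftLin]
  · simp [leftLin]
  · simp [leftLin, tubeMul, mulB, smul_smul, ← Real.exp_add]
    congr 2
    ring

theorem tubeInv_mul (g : TubeModel p) : tubeMul p s (tubeInv p s g) g = 0 :=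
  inv_mul_cancel (show TubeGroup p s from g)

theorem tubeMul_inv (g : TubeModel p) : tubeMul p s g (tubeInv p s g) = 0 :=
  mul_inv_cancel (show TubeGroup p s from g)

variable (p) in
/-- The left-invariant frame of the group acting on the tube domain, with the canonical metric. -/
def tubeFrame : LeftFrame (TubeModel p) where
  P x := (leftLin p s x).toContinuousLinearMap
  Q x := (leftLin p s (tubeInv p s x)).toContinuousLinearMap
  nabla := ((nablaU0 p s).compl₁₂ (tubeLieEquiv p s : TubeModel p →ₗ[ℝ] U0 p s)
    (tubeLieEquiv p s : TubeModel p →ₗ[ℝ] U0 p s)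
    |>.compr₂ ((tubeLieEquiv p s).symm : U0 p s →ₗ[ℝ] TubeModel p)).toContinuousBilinearMap
  B := ((metric p s).compl₁₂ (tubeLieEquiv p s : TubeModel p →ₗ[ℝ] U0 p s)
    (tubeLieEquiv p s : TubeModel p →ₗ[ℝ] U0 p s)).toContinuousBilinearMap
  contDiff_P := contDiff_clm_apply_iff.2 fun w => contDiff_leftLin s w
  contDiff_Q := contDiff_clm_apply_iff.2 fun w => (contDiff_leftLin s w).comp (contDiff_tubeInv p s)
  Q_P x v := by
    change leftLin p s (tubeInv p s x) (leftLin p s x v) = v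
    rw [← leftLin_tubeMul, tubeInv_mul, leftLin_zero]
  P_Q x v := by
    change leftLin p s x (leftLin p s (tubeInv p s x) v) = v
    rw [← leftLin_tubeMul, tubeMul_inv, leftLin_zero]
  bracket x u v := by
    have hP : ContDiff ℝ ∞ fun x : TubeModel p => (leftLin p s x).toContinuousLinearMap :=
      contDiff_clm_apply_iff.2 fun w => contDiff_leftLin s w
    -- Since left translations compose, differentiating the frame along a left-invariant direction
    -- at x is the left translate of the same derivative at the identity.
    have key : ∀ u v : TubeModel p,
        fderiv ℝ (fun x : TubeModel p => (leftLin p s x).toContinuousLinearMap) x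
          (leftLin p s x u) v = leftLin p s x
          ((vec 0 0 (((u.1 (Sum.inl 0) - mu s * u.1 (Sum.inl 1)) / 2) • tail v.1),
            rho s u.1 v.2) : TubeModel p) := fun u v => by
      have h1 := (LeftFrame.hasDerivAt_line hP x (leftLin p s x u)).clm_apply
        (hasDerivAt_const (0 : ℝ) v)
      have h2 := (leftLin p s x).toContinuousLinearMap.hasFDerivAt.comp_hasDerivAt (0 : ℝ)
        (hasDerivAt_leftLin_line s u v)
      have e := h1.unique (h2.congr_of_eventuallyEq (Filter.Eventually.of_forall fun τ => by
        change leftLin p s (x + τ • leftLin p s x u) v = leftLin p s x (leftLin p s (τ • u) v)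
        rw [← leftLin_tubeMul, tubeMul_eq, map_smul]))
      simpa using e
    refine (congrArg₂ (· - ·) (key u v) (key v u)).trans ?_
    rw [← map_sub]
    refine congrArg (leftLin p s x) ?_
    have := (isLeviCivita_nablaU0 p s).torsion_free (tubeLieEquiv p s u) (tubeLieEquiv p s v)
    refine Eq.trans ?_ (congrArg (tubeLieEquiv p s).symm this).symm
    refine Prod.ext (idx_ext ?_ ?_ ?_) rfl
    · change (0 : ℝ) - 0 = 0
      simp
    · change (0 : ℝ) - 0 = 0
      simp
    · rfl
  symm u v := (isKahlerLieAlgebra p s).symm _ _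
  pos u hu := (isKahlerLieAlgebra p s).pos _ ((tubeLieEquiv p s).map_ne_zero_iff.2 hu)
  skew u v w := (isLeviCivita_nablaU0 p s).metric _ _ _

theorem tubeFrame_nabla (u v : TubeModel p) : (tubeFrame p s).nabla u v =
    (rho s u.1 v.1 - symPart s u.1 v.1 + symPart s u.2 v.2,
      rho s u.1 v.2 - symPart s u.1 v.2 - symPart s u.2 v.1) := rfl

variable {s}

theorem tubeMetric_fderiv_tubeMap (hs : 1 ≤ s) (g v w : TubeModel p) :
    (s + 1 : ℝ) * tubeMetric (basicPoly p s) (s + 1) (tubeMap p s g)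
      (fderiv ℝ (tubeMap p s) g (leftLin p s g v)) (fderiv ℝ (tubeMap p s) g (leftLin p s g w)) =
      (tubeFrame p s).B v w := by
  rw [fderiv_tubeMap hs, fderiv_tubeMap hs, tubeMetric_eq hs (tubeMap_mem hs g)]
  change ((s : ℝ) + 1) * (1 / ((s : ℝ) + 1) *
    (logHess s (act s g.1 (vecJB₀ p s)) (act s g.1 v.1) (act s g.1 w.1) +
      logHess s (act s g.1 (vecJB₀ p s)) (-act s g.1 v.2) (-act s g.1 w.2))) =
    v.1 ⬝ᵥ w.1 + v.2 ⬝ᵥ w.2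
  rw [← act_neg, ← act_neg, logHess_act hs, logHess_act hs, logHess_vecJB₀ hs,
    logHess_vecJB₀ hs, neg_dotProduct_neg]
  field_simp

/-- The geodesic symmetry at the base point is transported to the group by the orbit map. There it
is an isometry of the left-invariant frame with differential -1 at the identity, so the curvature of
𝔲₀ is parallel, which is a purely algebraic condition. -/
theorem degree_eq_two_of_isRiemannianSymmetric (hs : 1 ≤ s) (hp : 1 ≤ p)
    (h : IsRiemannianSymmetric (tube (orbit p s)) (tubeMetric (basicPoly p s) (s + 1))) :
    s + 1 = 2 := by
  obtain ⟨σ, hmaps, hσ, -, hiso, hfix, hneg⟩ := h _ (tubeMap_mem hs 0)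
  set S : TubeModel p → TubeModel p := fun g => tubeMapInv p s (σ (tubeMap p s g)) with hS
  have hFS : ∀ g, tubeMap p s (S g) = σ (tubeMap p s g) := fun g =>
    tubeMap_tubeMapInv hs (hmaps (tubeMap_mem hs g))
  have hSd : ContDiff ℝ ∞ S := by
    rw [← contDiffOn_univ]
    exact ((contDiffOn_tubeMapInv hs).comp hσ hmaps).comp contDiff_tubeMap.contDiffOn
      fun g _ => tubeMap_mem hs g
  have hd : ∀ g v, fderiv ℝ (tubeMap p s) (S g) (fderiv ℝ S g v) =
      fderiv ℝ σ (tubeMap p s g) (fderiv ℝ (tubeMap p s) g v) := fun g v => by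
    have h1 := ((contDiff_tubeMap (p := p) (s := s)).differentiable (by simp) (S g)).hasFDerivAt.comp g
      (hSd.differentiable (by simp) g).hasFDerivAt
    have hσg : DifferentiableAt ℝ σ (tubeMap p s g) :=
      (hσ.contDiffAt ((isOpen_tube hs).mem_nhds (tubeMap_mem hs g))).differentiableAt (by simp)
    have h2 := hσg.hasFDerivAt.comp g
      ((contDiff_tubeMap (p := p) (s := s)).differentiable (by simp) g).hasFDerivAt
    have e := h1.unique (h2.congr_of_eventuallyEq (Filter.Eventually.of_forall hFS))
    exact congrArg (fun L : TubeModel p →L[ℝ] Idx p → ℂ => L v) e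
  have hA : ∀ g v, fderiv ℝ S g (leftLin p s g v) =
      leftLin p s (S g) ((tubeFrame p s).diffMap S g v) := fun g v =>
    (LeftFrame.P_diffMap (Φ := tubeFrame p s) (σ := S) g v).symm
  have hisom : (tubeFrame p s).IsIsometry S := ⟨hSd, fun g u v => by
    rw [← tubeMetric_fderiv_tubeMap hs (S g), ← hA, ← hA, hd, hd, hFS,
      hiso _ (tubeMap_mem hs g), tubeMetric_fderiv_tubeMap hs]⟩
  have hS0 : S 0 = 0 := by
    rw [hS]
    simp only [hfix, tubeMapInv_tubeMap hs]
  have hinj : ∀ v w : TubeModel p, fderiv ℝ (tubeMap p s) 0 v = fderiv ℝ (tubeMap p s) 0 w →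
      v = w := fun v w e => by
    rw [← leftLin_zero s v, ← leftLin_zero s w, fderiv_tubeMap hs, fderiv_tubeMap hs] at e
    simp only [Prod.fst_zero, act_zero_left] at e
    refine Prod.ext (funext fun i => ?_) (funext fun i => ?_)
    · exact congrArg Complex.im (congrFun e i)
    · exact neg_injective (congrArg Complex.re (congrFun e i))
  have hx : ∀ v, (tubeFrame p s).diffMap S 0 v = -v := fun v => by
    have h1 := hA 0 v
    rw [hS0, leftLin_zero, leftLin_zero] at h1
    have h2 := hd 0 v
    rw [hS0, hneg, h1, ← map_neg] at h2
    exact hinj _ _ h2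
  -- A unit vector of 𝔵⁻, available because p ≥ 1, and its image under J. The G₂-component of ∇R = 0
  -- on these vectors is μ(μ² - 1) = 0.
  let X : TubeModel p := (vec 0 0 (Pi.single ⟨0, hp⟩ 1), 0)
  let Y : TubeModel p := (0, vec 0 0 (Pi.single ⟨0, hp⟩ 1))
  have key := LeftFrame.curv_parallel_of_symmetry hisom 0 hx X X Y X
  have hm := mu_pos hs
  have := congrFun (congrArg Prod.snd key) (Sum.inl 1)
  simp [LeftFrame.curv, tubeFrame_nabla, X, Y, symPart] at this
  have h1 : mu s ^ 2 = 1 := by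
    have h3 : mu s * (mu s ^ 2 - 1) = 0 := by linarith
    have := (mul_eq_zero.1 h3).resolve_left hm.ne'
    linarith
  have h2 := mul_mu_sq hs
  rw [h1, mul_one] at h2
  have h4 : s = 1 := by exact_mod_cast h2
  rw [h4]

end Symmetric

/-! ## Light-cone coordinates -/

section LightCone

variable {p : ℕ} {R : Type*} [CommRing R]

/-- The standard bilinear form of signature `(2, p + 2)`. -/
def lform (x y : Fin 2 ⊕ Fin (p + 2) → R) : R :=
  x (Sum.inl 0) * y (Sum.inl 0) + x (Sum.inl 1) * y (Sum.inl 1) -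
    ∑ j, x (Sum.inr j) * y (Sum.inr j)

/-- The first null coordinate. -/
def lcU (x : Fin 2 ⊕ Fin (p + 2) → R) : R := x (Sum.inl 0) + x (Sum.inr 0)

/-- The second null coordinate. -/
def lcV (x : Fin 2 ⊕ Fin (p + 2) → R) : R := x (Sum.inl 0) - x (Sum.inr 0)

/-- The remaining coordinates, where `c` is a square root of `2`. -/
def lcZ (c : R) (x : Fin 2 ⊕ Fin (p + 2) → R) : Idx p → R :=
  Sum.elim ![x (Sum.inl 1) + x (Sum.inr 1), x (Sum.inl 1) - x (Sum.inr 1)]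
    fun i => c * x (Sum.inr i.succ.succ)

/-- The Lorentzian form `2 z₁ z₂ - |Z|²`, polarized. -/
def qq (z w : Idx p → R) : R :=
  z (Sum.inl 0) * w (Sum.inl 1) + z (Sum.inl 1) * w (Sum.inl 0) -
    ∑ i, z (Sum.inr i) * w (Sum.inr i)

/-- The factor 2 and an abstract square root `c` of 2 avoid denominators and allow the same identity
to be used over ℝ and over ℂ. -/
theorem two_mul_lform {c : R} (hc : c * c = 2) (x y : Fin 2 ⊕ Fin (p + 2) → R) :
    2 * lform x y = lcU x * lcV y + lcV x * lcU y + qq (lcZ c x) (lcZ c y) := by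
  have h : ∑ i : Fin p, c * x (Sum.inr i.succ.succ) * (c * y (Sum.inr i.succ.succ)) =
      2 * ∑ i : Fin p, x (Sum.inr i.succ.succ) * y (Sum.inr i.succ.succ) := by
    rw [Finset.mul_sum]
    refine Finset.sum_congr rfl fun i _ => ?_
    rw [← hc]
    ring
  simp only [lform, lcU, lcV, qq, lcZ, Sum.elim_inl, Sum.elim_inr, Matrix.cons_val_zero,
    Matrix.cons_val_one, h, Fin.sum_univ_succ (n := p + 1), Fin.sum_univ_succ (n := p),
    Fin.succ_zero_eq_one]
  ring

theorem qq_add_left (x y z : Idx p → R) : qq (x + y) z = qq x z + qq y z := by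
  simp [qq, add_mul, Finset.sum_add_distrib]
  ring

theorem qq_smul_left (t : R) (x z : Idx p → R) : qq (t • x) z = t * qq x z := by
  simp [qq, mul_sub, mul_add, Finset.mul_sum, mul_assoc]

theorem qq_comm (x y : Idx p → R) : qq x y = qq y x := by
  simp only [qq, mul_comm (x _)]
  ring

theorem qq_add_right (x y z : Idx p → R) : qq z (x + y) = qq z x + qq z y := by
  rw [qq_comm, qq_add_left, qq_comm x, qq_comm y]

theorem qq_smul_right (t : R) (x z : Idx p → R) : qq z (t • x) = t * qq z x := by
  rw [qq_comm, qq_smul_left, qq_comm x]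

theorem qform_eq_qq (x y : Idx p → ℝ) : qform 1 x y = qq x y / 2 := by
  rw [qform]
  simp [qq, mu, tail, dotProduct, mul_comm]

/-- The complexification of `qq`. -/
theorem qq_complex (a b c d : Idx p → ℝ) :
    qq (fun i => (⟨a i, b i⟩ : ℂ)) (fun i => (⟨c i, d i⟩ : ℂ)) =
      ⟨qq a c - qq b d, qq a d + qq b c⟩ := by
  apply Complex.ext <;> simp [qq, Finset.sum_sub_distrib, Finset.sum_add_distrib] <;> ring

/-- Two orthogonal vectors of the same length are not both time-like. -/
theorem qq_lorentz (x y : Idx p → ℝ) (h0 : qq x y = 0) (h1 : qq x x = qq y y) : qq x x ≤ 0 := by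
  by_contra! hpos
  simp only [qq] at h0 h1 hpos
  have hcs := Finset.sum_mul_sq_le_sq_mul_sq Finset.univ (fun i => x (Sum.inr i))
    (fun i => y (Sum.inr i))
  simp only [pow_two] at hcs
  have hx : 0 ≤ ∑ i, x (Sum.inr i) * x (Sum.inr i) :=
    Finset.sum_nonneg fun i _ => mul_self_nonneg _
  have hy : 0 ≤ ∑ i, y (Sum.inr i) * y (Sum.inr i) :=
    Finset.sum_nonneg fun i _ => mul_self_nonneg _
  generalize ∑ i, x (Sum.inr i) * x (Sum.inr i) = A at *
  generalize ∑ i, y (Sum.inr i) * y (Sum.inr i) = B at *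
  generalize ∑ i, x (Sum.inr i) * y (Sum.inr i) = C at *
  generalize x (Sum.inl 0) = x0 at *
  generalize x (Sum.inl 1) = x1 at *
  generalize y (Sum.inl 0) = y0 at *
  generalize y (Sum.inl 1) = y1 at *
  have hC : C = x0 * y1 + x1 * y0 := by linarith
  rw [hC] at hcs
  have hsq := sq_nonneg (x0 * y1 - x1 * y0)
  have hA : A = 2 * (x0 * x1) - (x0 * x1 + x1 * x0 - A) := by ring
  nlinarith [mul_pos hpos hpos, mul_nonneg hx hpos.le, mul_nonneg hy hpos.le]

/-- Columns of matrices, paired to complex vectors. -/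
def colC (a : Matrix (Fin 2 ⊕ Fin (p + 2)) (Fin 2 ⊕ Fin (p + 2)) ℝ) :
    Fin 2 ⊕ Fin (p + 2) → ℂ := fun i => ⟨a i (Sum.inl 0), a i (Sum.inl 1)⟩

local notation "η" => LieAlgebra.Orthogonal.indefiniteDiagonal (Fin 2) (Fin (p + 2)) ℝ

theorem transpose_mul_mul_apply (a b : Matrix (Fin 2 ⊕ Fin (p + 2)) (Fin 2 ⊕ Fin (p + 2)) ℝ)
    (i j : Fin 2 ⊕ Fin (p + 2)) :
    (aᵀ * η * b) i j = lform (fun k => a k i) (fun k => b k j) := by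
  rw [LieAlgebra.Orthogonal.indefiniteDiagonal, Matrix.mul_apply, Fintype.sum_sum_type]
  simp [Matrix.mul_diagonal, lform]
  ring

theorem lform_complex (a b c d : Fin 2 ⊕ Fin (p + 2) → ℝ) :
    lform (fun i => (⟨a i, b i⟩ : ℂ)) (fun i => (⟨c i, d i⟩ : ℂ)) =
      ⟨lform a c - lform b d, lform a d + lform b c⟩ := by
  apply Complex.ext <;> simp [lform, Finset.sum_sub_distrib, Finset.sum_add_distrib] <;> ring

theorem lform_colC (a b : Matrix (Fin 2 ⊕ Fin (p + 2)) (Fin 2 ⊕ Fin (p + 2)) ℝ) :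
    lform (colC a) (colC b) =
      ⟨(aᵀ * η * b) (Sum.inl 0) (Sum.inl 0) - (aᵀ * η * b) (Sum.inl 1) (Sum.inl 1),
        (aᵀ * η * b) (Sum.inl 0) (Sum.inl 1) + (aᵀ * η * b) (Sum.inl 1) (Sum.inl 0)⟩ := by
  simp only [transpose_mul_mul_apply]
  exact lform_complex _ _ _ _

theorem lform_neg_right {x y : Fin 2 ⊕ Fin (p + 2) → ℝ} : lform x (-y) = -lform x y := by
  simp [lform]
  ring

theorem lform_colC_star (a b : Matrix (Fin 2 ⊕ Fin (p + 2)) (Fin 2 ⊕ Fin (p + 2)) ℝ) :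
    lform (colC a) (star (colC b)) =
      ⟨(aᵀ * η * b) (Sum.inl 0) (Sum.inl 0) + (aᵀ * η * b) (Sum.inl 1) (Sum.inl 1),
        (aᵀ * η * b) (Sum.inl 1) (Sum.inl 0) - (aᵀ * η * b) (Sum.inl 0) (Sum.inl 1)⟩ := by
  simp only [transpose_mul_mul_apply]
  refine (lform_complex _ _ (fun k => b k (Sum.inl 0)) (-fun k => b k (Sum.inl 1))).trans ?_
  rw [lform_neg_right, lform_neg_right, sub_neg_eq_add, neg_add_eq_sub]

end LightCone

/-! ## The map onto the tube domain -/

section SymmetricMap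

attribute [local instance] Matrix.normedAddCommGroup Matrix.normedSpace

variable {p : ℕ}

local notation "η" => LieAlgebra.Orthogonal.indefiniteDiagonal (Fin 2) (Fin (p + 2)) ℝ
local notation "Mat" => Matrix (Fin 2 ⊕ Fin (p + 2)) (Fin 2 ⊕ Fin (p + 2)) ℝ

/-- A square root of `2`. -/
def sqrtTwo : ℂ := ((Real.sqrt 2 : ℝ) : ℂ)

theorem sqrtTwo_mul_self : sqrtTwo * sqrtTwo = 2 := by
  rw [sqrtTwo, ← Complex.ofReal_mul, Real.mul_self_sqrt (by norm_num)]
  norm_num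

theorem star_sqrtTwo : star sqrtTwo = sqrtTwo := Complex.conj_ofReal _

theorem lcU_star (x : Fin 2 ⊕ Fin (p + 2) → ℂ) : lcU (star x) = star (lcU x) := by
  simp [lcU]

theorem lcV_star (x : Fin 2 ⊕ Fin (p + 2) → ℂ) : lcV (star x) = star (lcV x) := by
  simp [lcV]

theorem lcZ_star (x : Fin 2 ⊕ Fin (p + 2) → ℂ) :
    lcZ sqrtTwo (star x) = star (lcZ sqrtTwo x) := by
  funext i
  rcases i with i | i
  · fin_cases i <;> simp [lcZ]
  · have := star_sqrtTwo
    simp only [lcZ, Sum.elim_inr, Pi.star_apply, star_mul', this]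

/-- The orbit map of `SO₀(2, p + 2)` into the tube domain. -/
def symMap (a : Mat) : Idx p → ℂ := (lcU (colC a))⁻¹ • lcZ sqrtTwo (colC a)

theorem lform_colC_self {a : Mat} (ha : aᵀ * η * a = η) : lform (colC a) (colC a) = 0 := by
  rw [lform_colC, ha]
  apply Complex.ext <;> simp [LieAlgebra.Orthogonal.indefiniteDiagonal]

theorem lform_colC_star_self {a : Mat} (ha : aᵀ * η * a = η) :
    lform (colC a) (star (colC a)) = 2 := by
  rw [lform_colC_star, ha]
  apply Complex.ext <;> norm_num [LieAlgebra.Orthogonal.indefiniteDiagonal]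

theorem qq_re_im (z w : Idx p → ℂ) :
    qq z w = ⟨qq (reV z) (reV w) - qq (imV z) (imV w), qq (reV z) (imV w) + qq (imV z) (reV w)⟩ :=
  qq_complex (reV z) (imV z) (reV w) (imV w)

theorem qq_re_im_star (z w : Idx p → ℂ) :
    qq z (star w) =
      ⟨qq (reV z) (reV w) + qq (imV z) (imV w), qq (imV z) (reV w) - qq (reV z) (imV w)⟩ := by
  refine (qq_complex (reV z) (imV z) (reV w) (-imV w)).trans ?_
  rw [← neg_one_smul ℝ (imV w), qq_smul_right, qq_smul_right]
  apply Complex.ext <;> simp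
  ring

/-- If the null coordinate vanished, the remaining coordinates z would satisfy qq(z, z) = 0 and
qq(z, z̄) = 4. Then Re z and Im z would be orthogonal of equal positive length, contradicting the
Lorentzian signature. -/
theorem lcU_ne_zero {a : Mat} (ha : aᵀ * η * a = η) : lcU (colC a) ≠ 0 := by
  intro h0
  have h1 := two_mul_lform sqrtTwo_mul_self (colC a) (colC a)
  have h2 := two_mul_lform sqrtTwo_mul_self (colC a) (star (colC a))
  rw [lform_colC_self ha, h0] at h1
  rw [lform_colC_star_self ha, lcU_star, lcZ_star, h0, star_zero] at h2
  set z := lcZ sqrtTwo (colC a)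
  have e1 : qq z z = 0 := by linear_combination -h1
  have e2 : qq z (star z) = 4 := by linear_combination -h2
  rw [qq_re_im] at e1
  rw [qq_re_im_star] at e2
  have e3 := congrArg Complex.re e1
  have e4 := congrArg Complex.im e1
  have e5 := congrArg Complex.re e2
  simp only [Complex.zero_re, Complex.zero_im] at e3 e4 e5
  rw [qq_comm (imV z) (reV z)] at e4
  have := qq_lorentz (reV z) (imV z) (by linarith) (by linarith)
  norm_num at e5
  linarith

theorem lcZ_colC {a : Mat} (ha : aᵀ * η * a = η) :
    lcZ sqrtTwo (colC a) = lcU (colC a) • symMap a := by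
  rw [symMap, smul_smul, mul_inv_cancel₀ (lcU_ne_zero ha), one_smul]

theorem lcV_colC {a : Mat} (ha : aᵀ * η * a = η) :
    2 * lcV (colC a) = -(lcU (colC a) * qq (symMap a) (symMap a)) := by
  have h1 := two_mul_lform sqrtTwo_mul_self (colC a) (colC a)
  rw [lform_colC_self ha, lcZ_colC ha, qq_smul_left, qq_smul_right] at h1
  apply mul_left_cancel₀ (lcU_ne_zero ha)
  linear_combination -h1

/-- Isotropy expresses V through U and z; the value 2 of the Hermitian form then becomes |U|² qq(Im
z, Im z). So Im z is time-like. -/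
theorem qq_imV_symMap {a : Mat} (ha : aᵀ * η * a = η) :
    lcU (colC a) * star (lcU (colC a)) * ((qq (imV (symMap a)) (imV (symMap a)) : ℝ) : ℂ) = 2 := by
  have h2 := two_mul_lform sqrtTwo_mul_self (colC a) (star (colC a))
  have hv := lcV_colC ha
  have hv' := congrArg star hv
  rw [lform_colC_star_self ha, lcU_star, lcV_star, lcZ_star, lcZ_colC ha, star_smul, qq_smul_left,
    qq_smul_right] at h2
  rw [qq_re_im_star, qq_comm (imV (symMap a)) (reV (symMap a)), sub_self] at h2
  rw [qq_re_im, qq_comm (imV (symMap a)) (reV (symMap a))] at hv hv'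
  set x := qq (reV (symMap a)) (reV (symMap a))
  set y := qq (imV (symMap a)) (imV (symMap a))
  set t := qq (reV (symMap a)) (imV (symMap a))
  have e1 : (⟨x - y, t + t⟩ : ℂ) = x - y + 2 * t * Complex.I := by
    apply Complex.ext <;> simp
    ring
  have e2 : star ((x : ℂ) - y + 2 * t * Complex.I) = x - y - 2 * t * Complex.I := by
    apply Complex.ext <;> simp
  have e3 : (⟨x + y, 0⟩ : ℂ) = x + y := by
    apply Complex.ext <;> simp
  simp only [star_mul', star_neg, star_ofNat, e1, e2, e3] at hv hv' h2
  linear_combination -(1 / 2 : ℂ) * h2 - (1 / 4 : ℂ) * star (lcU (colC a)) * hv -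
    (1 / 4 : ℂ) * lcU (colC a) * hv'

theorem contDiff_colC (i : Fin 2 ⊕ Fin (p + 2)) : ContDiff ℝ ∞ fun a : Mat => colC a i :=
  Complex.equivRealProdCLM.symm.contDiff.comp
    (f := fun a : Mat => (a i (Sum.inl 0), a i (Sum.inl 1)))
    (((contDiff_apply_apply ℝ ℝ i (Sum.inl 0)).prodMk (contDiff_apply_apply ℝ ℝ i (Sum.inl 1))))

theorem contDiff_lcU_colC : ContDiff ℝ ∞ fun a : Mat => lcU (colC a) :=
  (contDiff_colC _).add (contDiff_colC _)

theorem contDiff_lcZ_colC : ContDiff ℝ ∞ fun a : Mat => lcZ sqrtTwo (colC a) := by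
  refine contDiff_pi.2 fun i => ?_
  rcases i with i | i
  · fin_cases i
    · exact (contDiff_colC _).add (contDiff_colC _)
    · exact (contDiff_colC _).sub (contDiff_colC _)
  · exact contDiff_const.mul (contDiff_colC _)

theorem contDiffAt_symMap {a : Mat} (ha : lcU (colC a) ≠ 0) : ContDiffAt ℝ ∞ symMap a :=
  (contDiff_lcU_colC.contDiffAt.inv ha).smul contDiff_lcZ_colC.contDiffAt

theorem colC_add (a b : Mat) : colC (a + b) = colC a + colC b := by
  funext i
  apply Complex.ext <;> simp [colC]

theorem colC_smul (t : ℝ) (a : Mat) : colC (t • a) = (t : ℂ) • colC a := by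
  funext i
  apply Complex.ext <;> simp [colC]

theorem lcU_add (x y : Fin 2 ⊕ Fin (p + 2) → ℂ) : lcU (x + y) = lcU x + lcU y := by
  simp [lcU]
  ring

theorem lcU_smul (t : ℂ) (x : Fin 2 ⊕ Fin (p + 2) → ℂ) : lcU (t • x) = t * lcU x := by
  simp [lcU]
  ring

theorem lcZ_add (x y : Fin 2 ⊕ Fin (p + 2) → ℂ) :
    lcZ sqrtTwo (x + y) = lcZ sqrtTwo x + lcZ sqrtTwo y := by
  funext i
  rcases i with i | i
  · fin_cases i <;> simp [lcZ] <;> ring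
  · simp [lcZ]
    ring

theorem lcZ_smul (t : ℂ) (x : Fin 2 ⊕ Fin (p + 2) → ℂ) :
    lcZ sqrtTwo (t • x) = t • lcZ sqrtTwo x := by
  funext i
  rcases i with i | i
  · fin_cases i <;> simp [lcZ] <;> ring
  · simp [lcZ]
    ring

theorem hasDerivAt_ofReal_smul {E : Type*} [NormedAddCommGroup E] [NormedSpace ℂ E]
    (x y : E) : HasDerivAt (fun τ : ℝ => x + (τ : ℂ) • y) y 0 := by
  simpa using (((hasDerivAt_id (0 : ℝ)).ofReal_comp.smul_const y).const_add x)

theorem hasDerivAt_add_smul {E : Type*} [NormedAddCommGroup E] [NormedSpace ℝ E]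
    (x y : E) : HasDerivAt (fun τ : ℝ => x + τ • y) y 0 := by
  simpa using ((hasDerivAt_id (0 : ℝ)).smul_const y).const_add x

/-- Differentiation of Z = U · `symMap`. This form avoids the derivative of an inverse. -/
theorem fderiv_symMap {a : Mat} (ha : lcU (colC a) ≠ 0) (b : Mat) :
    lcZ sqrtTwo (colC b) = lcU (colC a) • fderiv ℝ symMap a b + lcU (colC b) • symMap a := by
  have hl : HasDerivAt (fun τ : ℝ => a + τ • b) b 0 :=
    hasDerivAt_add_smul a b
  have hs : HasFDerivAt symMap (fderiv ℝ symMap a) (a + (0 : ℝ) • b) := by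
    rw [zero_smul, add_zero]
    exact ((contDiffAt_symMap ha).differentiableAt (by simp)).hasFDerivAt
  have hs' := hs.comp_hasDerivAt (0 : ℝ) hl
  have hu : HasDerivAt (fun τ : ℝ => lcU (colC (a + τ • b))) (lcU (colC b)) 0 := by
    simp only [colC_add, colC_smul, lcU_add, lcU_smul]
    exact hasDerivAt_ofReal_smul _ _
  have hz : HasDerivAt (fun τ : ℝ => lcZ sqrtTwo (colC (a + τ • b))) (lcZ sqrtTwo (colC b)) 0 := by
    simp only [colC_add, colC_smul, lcZ_add, lcZ_smul]
    exact hasDerivAt_ofReal_smul _ _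
  have hne : ∀ᶠ τ : ℝ in nhds 0, lcU (colC (a + τ • b)) ≠ 0 :=
    hu.continuousAt.eventually_ne (by simpa using ha)
  have h := hz.unique ((hu.smul hs').congr_of_eventuallyEq (hne.mono fun τ hτ => by
    change _ = lcU (colC (a + τ • b)) • symMap (a + τ • b)
    rw [symMap, smul_smul, mul_inv_cancel₀ hτ, one_smul]))
  rw [Function.comp_apply, zero_smul, add_zero] at h
  exact h

/-- The Hermitian form on lifts of tangent vectors of the tube domain. -/
theorem lform_lift {a b c : Mat} (ha : aᵀ * η * a = η) (hb : lform (colC b) (colC a) = 0)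
    (hb' : lform (colC b) (star (colC a)) = 0) (hc : lform (colC c) (colC a) = 0)
    (hc' : lform (colC c) (star (colC a)) = 0) {N : ℝ}
    (hN : N = qq (imV (symMap a)) (imV (symMap a))) :
    lform (colC b) (star (colC c)) = qq (fderiv ℝ symMap a b) (star (fderiv ℝ symMap a c)) / N -
      2 * qq (fun i => (imV (symMap a) i : ℂ)) (fderiv ℝ symMap a b) *
        qq (fun i => (imV (symMap a) i : ℂ)) (star (fderiv ℝ symMap a c)) / N ^ 2 := by
  have hu := lcU_ne_zero ha
  have h1 := qq_imV_symMap ha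
  have hV := lcV_colC ha
  have hZ := lcZ_colC ha
  have hbZ := fderiv_symMap hu b
  have hcZ := fderiv_symMap hu c
  have eb := two_mul_lform sqrtTwo_mul_self (colC b) (colC a)
  have eb' := two_mul_lform sqrtTwo_mul_self (colC b) (star (colC a))
  have ec := two_mul_lform sqrtTwo_mul_self (colC c) (colC a)
  have ec' := two_mul_lform sqrtTwo_mul_self (colC c) (star (colC a))
  have e := two_mul_lform sqrtTwo_mul_self (colC b) (star (colC c))
  rw [← hN] at h1
  have hy : (fun i => (imV (symMap a) i : ℂ)) =
      (-(Complex.I / 2)) • (symMap a + (-1 : ℂ) • star (symMap a)) := by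
    funext i
    apply Complex.ext <;> simp [imV]
    ring
  have hNM : (4 * N : ℂ) = 2 * qq (symMap a) (star (symMap a)) - qq (symMap a) (symMap a) -
      qq (star (symMap a)) (star (symMap a)) := by
    have : (N : ℂ) = qq (fun i => (imV (symMap a) i : ℂ)) (fun i => (imV (symMap a) i : ℂ)) := by
      rw [hN]
      simp [qq]
    rw [this, hy]
    simp only [qq_add_left, qq_add_right, qq_smul_left, qq_smul_right,
      qq_comm (star (symMap a)) (symMap a)]
    linear_combination ((qq (symMap a) (symMap a) + qq (star (symMap a)) (star (symMap a))) -
      2 * qq (symMap a) (star (symMap a))) * Complex.I_sq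
  have ec := congrArg star ec
  have ec' := congrArg star ec'
  have hV' := congrArg star hV
  have star_qq : ∀ x y : Idx p → ℂ, star (qq x y) = qq (star x) (star y) := fun x y => by
    simp [qq]
  rw [hb] at eb
  rw [hb'] at eb'
  rw [hc] at ec
  rw [hc'] at ec'
  simp only [lcU_star, lcV_star, lcZ_star, hZ, hbZ, hcZ, star_qq, star_add, star_smul, star_mul',
    star_star, star_zero, mul_zero, star_neg, star_ofNat, qq_add_left, qq_add_right, qq_smul_left,
    qq_smul_right] at eb eb' ec ec' hV hV' e
  rw [hy]
  simp only [qq_add_left, qq_smul_left]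
  have hub : star (lcU (colC a)) ≠ 0 := star_ne_zero.2 hu
  have hN0 : (N : ℂ) ≠ 0 := fun h => by simp [h] at h1
  set z := symMap a
  set v := fderiv ℝ symMap a b
  set w := fderiv ℝ symMap a c
  simp only [qq_comm (star z) z, qq_comm (star w) z, qq_comm (star w) (star z), qq_comm v z,
    qq_comm v (star z)] at eb eb' ec ec' hV hV' hNM e
  generalize qq z z = A at *
  generalize qq (star z) (star z) = A' at *
  generalize qq z v = B at *
  generalize qq (star z) v = B' at *
  generalize qq z (star z) = M at *
  generalize qq (star z) (star w) = C at *
  generalize qq z (star w) = D at *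
  generalize qq v (star w) = E at *
  generalize star (lcU (colC a)) = u' at *
  generalize lcU (colC a) = u at *
  generalize star (lcV (colC a)) = Va' at *
  generalize lcV (colC a) = Va at *
  generalize star (lcU (colC c)) = β at *
  generalize star (lcV (colC c)) = Vc at *
  generalize lcU (colC b) = α at *
  generalize lcV (colC b) = Vb at *
  generalize lform (colC b) (star (colC c)) = H at *
  -- Orthogonality to the isotropic vector and to its conjugate determines the null coordinates `α`,
  -- `β` and `Vb`, `Vc` of the lifts. After their elimination the Hermitian form depends only on the
  -- tangent vectors of the tube.
  have k1 : u * (B' - B) + 2 * α * N = 0 := by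
    apply mul_left_cancel₀ (mul_ne_zero hu hub)
    linear_combination -u * eb' + u' * eb + (α * u * u' / 2) * hNM - (α * u / 2) * hV' +
      (α * u' / 2) * hV
  have k2 : u' * (D - C) + 2 * β * N = 0 := by
    apply mul_left_cancel₀ (mul_ne_zero hu hub)
    linear_combination -u' * ec' + u * ec + (β * u * u' / 2) * hNM - (β * u' / 2) * hV +
      (β * u / 2) * hV'
  have kb : Vb = -u * B - α * A / 2 := by
    apply mul_left_cancel₀ hu
    linear_combination -eb - α / 2 * hV
  have kc : Vc = -u' * C - β * A' / 2 := by
    apply mul_left_cancel₀ hub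
    linear_combination -ec - β / 2 * hV'
  have k3 : 2 * H = u * u' * E - 2 * α * β * N := by
    linear_combination e + α * kc + β * kb + β * k1 + α * k2 - (α * β / 2) * hNM
  have k4 : H * N ^ 2 = E * N - (B' - B) * (D - C) / 2 := by
    linear_combination (N ^ 2 / 2) * k3 + (E * N / 2) * h1 -
      (N / 4) * (2 * β * N * k1 - u * (B' - B) * k2) - (B' - B) * (D - C) / 4 * h1
  rw [eq_div_of_mul_eq (pow_ne_zero 2 hN0) k4]
  field_simp
  linear_combination (-(1 : ℂ) * (B' - B) * (D - C)) * Complex.I_sq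

end SymmetricMap

/-! ### Comparison with the trace form -/

section SymmetricMetric

attribute [local instance] Matrix.normedAddCommGroup Matrix.normedSpace

variable {p : ℕ}

local notation "η" => LieAlgebra.Orthogonal.indefiniteDiagonal (Fin 2) (Fin (p + 2)) ℝ
local notation "Mat" => Matrix (Fin 2 ⊕ Fin (p + 2)) (Fin 2 ⊕ Fin (p + 2)) ℝ

theorem qq_ofReal_left (y : Idx p → ℝ) (v : Idx p → ℂ) :
    qq (fun i => (y i : ℂ)) v = ⟨qq y (reV v), qq y (imV v)⟩ := by
  refine (qq_complex y 0 (reV v) (imV v)).trans ?_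
  have h : ∀ x : Idx p → ℝ, qq 0 x = 0 := fun x => by simp [qq]
  rw [h, h, sub_zero, add_zero]

theorem qq_ofReal_star (y : Idx p → ℝ) (v : Idx p → ℂ) :
    qq (fun i => (y i : ℂ)) (star v) = ⟨qq y (reV v), -qq y (imV v)⟩ := by
  have h := congrArg star (qq_ofReal_left y v)
  have e : star (qq (fun i => (y i : ℂ)) v) = qq (fun i => (y i : ℂ)) (star v) := by
    simp [qq]
  rw [e] at h
  exact h

theorem tubeMetric_eq_qq {z : Idx p → ℂ} (hz : z ∈ tube (orbit p 1)) (v w : Idx p → ℂ) :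
    tubeMetric (basicPoly p 1) (1 + 1) z v w =
      -(qq v (star w) / ((qq (imV z) (imV z) : ℝ) : ℂ) -
      2 * qq (fun i => (imV z i : ℂ)) v * qq (fun i => (imV z i : ℂ)) (star w) /
        ((qq (imV z) (imV z) : ℝ) : ℂ) ^ 2).re := by
  have hQ : qq (imV z) (imV z) ≠ 0 := by
    have := ((mem_tube_iff le_rfl z).1 hz).2
    rw [qform_eq_qq] at this
    exact fun h => by simp [h] at this
  rw [tubeMetric_eq le_rfl hz, qq_re_im_star, qq_ofReal_left, qq_ofReal_star, ← Complex.ofReal_pow]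
  simp only [logHess, qform_eq_qq, Complex.sub_re, Complex.div_ofReal_re, Complex.mul_re,
    Complex.mul_im, Complex.re_ofNat, Complex.im_ofNat, Nat.cast_one, sub_self]
  field_simp
  ring

theorem mem_so'_iff (ξ : Mat) : ξ ∈ LieAlgebra.Orthogonal.so' (Fin 2) (Fin (p + 2)) ℝ ↔
    ξᵀ * η = η * (-ξ) := by
  rw [LieAlgebra.Orthogonal.so', mem_skewAdjointMatricesLieSubalgebra,
    mem_skewAdjointMatricesSubmodule]
  rfl

theorem so'_symm_blocks {ξ : Mat} (hξ : ξ ∈ LieAlgebra.Orthogonal.so' (Fin 2) (Fin (p + 2)) ℝ)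
    (h : ξᵀ = ξ) : (∀ i j, ξ (Sum.inl i) (Sum.inl j) = 0) ∧
      ∀ i j, ξ (Sum.inr i) (Sum.inr j) = 0 := by
  rw [mem_so'_iff, h, LieAlgebra.Orthogonal.indefiniteDiagonal] at hξ
  constructor
  · intro i j
    have := congrFun (congrFun hξ (Sum.inl i)) (Sum.inl j)
    rw [Matrix.mul_diagonal, Matrix.diagonal_mul] at this
    simp at this
    linarith
  · intro i j
    have := congrFun (congrFun hξ (Sum.inr i)) (Sum.inr j)
    rw [Matrix.mul_diagonal, Matrix.diagonal_mul] at this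
    simp at this
    linarith

/-- Symmetric elements of so(2, p+2) have zero diagonal blocks, so the first two columns of aξ are
orthogonal to those of a, as `lform_lift` requires. The Hermitian form then sums one off-diagonal
block, which is half the trace up to sign. -/
theorem tubeMetric_fderiv_symMap {a ξ ζ : Mat} (ha : aᵀ * η * a = η)
    (haU : symMap a ∈ tube (orbit p 1))
    (hξ : ξ ∈ LieAlgebra.Orthogonal.so' (Fin 2) (Fin (p + 2)) ℝ)
    (hζ : ζ ∈ LieAlgebra.Orthogonal.so' (Fin 2) (Fin (p + 2)) ℝ) (hξ' : ξᵀ = ξ) (hζ' : ζᵀ = ζ) :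
    tubeMetric (basicPoly p 1) (1 + 1) (symMap a) (fderiv ℝ symMap a (a * ξ))
      (fderiv ℝ symMap a (a * ζ)) = 1 / 2 * (ξ * ζ).trace := by
  have hM1 : ∀ ξ : Mat, ξ ∈ LieAlgebra.Orthogonal.so' (Fin 2) (Fin (p + 2)) ℝ → ξᵀ = ξ →
      ∀ i j, ((a * ξ)ᵀ * η * a) (Sum.inl i) (Sum.inl j) = 0 := fun ξ hξ h i j => by
    rw [Matrix.transpose_mul, h, Matrix.mul_assoc, Matrix.mul_assoc, ← Matrix.mul_assoc aᵀ, ha,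
      LieAlgebra.Orthogonal.indefiniteDiagonal, Matrix.mul_diagonal, (so'_symm_blocks hξ h).1,
      zero_mul]
  have hM2 : ∀ i, ((a * ξ)ᵀ * η * (a * ζ)) (Sum.inl i) (Sum.inl i) =
      -∑ k, ξ (Sum.inl i) (Sum.inr k) * ζ (Sum.inr k) (Sum.inl i) := fun i => by
    have e : (a * ξ)ᵀ * η * (a * ζ) = ξ * η * ζ := by
      rw [Matrix.transpose_mul, hξ', Matrix.mul_assoc, Matrix.mul_assoc, ← Matrix.mul_assoc η,
        ← Matrix.mul_assoc aᵀ, ← Matrix.mul_assoc aᵀ, ha, Matrix.mul_assoc]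
    rw [e, Matrix.mul_apply, Fintype.sum_sum_type]
    simp [LieAlgebra.Orthogonal.indefiniteDiagonal, Matrix.mul_diagonal, (so'_symm_blocks hξ hξ').1]
  have hz : ∀ ξ : Mat, ξ ∈ LieAlgebra.Orthogonal.so' (Fin 2) (Fin (p + 2)) ℝ → ξᵀ = ξ →
      lform (colC (a * ξ)) (colC a) = 0 ∧ lform (colC (a * ξ)) (star (colC a)) = 0 :=
    fun ξ hξ h => by
      rw [lform_colC, lform_colC_star, hM1 ξ hξ h, hM1 ξ hξ h, hM1 ξ hξ h, hM1 ξ hξ h]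
      constructor <;> apply Complex.ext <;> simp
  rw [tubeMetric_eq_qq haU, ← lform_lift ha (hz ξ hξ hξ').1 (hz ξ hξ hξ').2 (hz ζ hζ hζ').1
    (hz ζ hζ hζ').2 rfl, lform_colC_star]
  simp only [hM2]
  have hsym : ∀ i j, ξ i j = ξ j i := fun i j => congrFun (congrFun hξ' j) i
  have hsym' : ∀ i j, ζ i j = ζ j i := fun i j => congrFun (congrFun hζ' j) i
  have h1 := so'_symm_blocks hξ hξ'
  simp only [Matrix.trace, Matrix.diag, Matrix.mul_apply, Fintype.sum_sum_type, h1.1, h1.2,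
    zero_mul, Finset.sum_const_zero, zero_add, add_zero]
  rw [Finset.sum_comm (s := (Finset.univ : Finset (Fin (p + 2))))]
  simp only [hsym (Sum.inr _) (Sum.inl _), hsym' (Sum.inl _) (Sum.inr _), Fin.sum_univ_two]
  ring

end SymmetricMetric

/-! ### The group of the tube inside SO₀(2, p+2) -/

section SymmetricSpace

attribute [local instance] Matrix.normedAddCommGroup Matrix.normedSpace

variable {p : ℕ}

local notation "η" => LieAlgebra.Orthogonal.indefiniteDiagonal (Fin 2) (Fin (p + 2)) ℝ
local notation "Mat" => Matrix (Fin 2 ⊕ Fin (p + 2)) (Fin 2 ⊕ Fin (p + 2)) ℝ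

/-- The vector with given light-cone coordinates. -/
def invLC (u v : ℝ) (z : Idx p → ℝ) : Fin 2 ⊕ Fin (p + 2) → ℝ :=
  Sum.elim ![(u + v) / 2, (z (Sum.inl 0) + z (Sum.inl 1)) / 2]
    (Fin.cons ((u - v) / 2) (Fin.cons ((z (Sum.inl 0) - z (Sum.inl 1)) / 2)
      fun i => z (Sum.inr i) / Real.sqrt 2))

@[simp] theorem lcU_invLC (u v : ℝ) (z : Idx p → ℝ) : lcU (invLC u v z) = u := by
  simp [lcU, invLC]
  ring

@[simp] theorem lcV_invLC (u v : ℝ) (z : Idx p → ℝ) : lcV (invLC u v z) = v := by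
  simp [lcV, invLC]
  ring

theorem invLC_inr_one (u v : ℝ) (z : Idx p → ℝ) :
    invLC u v z (Sum.inr 1) = (z (Sum.inl 0) - z (Sum.inl 1)) / 2 := rfl

@[simp] theorem lcZ_invLC (u v : ℝ) (z : Idx p → ℝ) : lcZ (Real.sqrt 2) (invLC u v z) = z := by
  have h2 : Real.sqrt 2 ≠ 0 := by positivity
  refine idx_ext ?_ ?_ ?_
  · simp only [lcZ, Sum.elim_inl, Matrix.cons_val_zero, invLC_inr_one]
    simp [invLC]
    ring
  · simp only [lcZ, Sum.elim_inl, Matrix.cons_val_one, invLC_inr_one]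
    simp [invLC]
    ring
  · funext i
    simp only [lcZ, Sum.elim_inr, tail_apply]
    simp only [invLC, Sum.elim_inr, Fin.cons_succ]
    field_simp

theorem invLC_lc (x : Fin 2 ⊕ Fin (p + 2) → ℝ) :
    invLC (lcU x) (lcV x) (lcZ (Real.sqrt 2) x) = x := by
  have h2 : Real.sqrt 2 ≠ 0 := by positivity
  funext i
  rcases i with i | i
  · fin_cases i <;> simp [invLC, lcU, lcV, lcZ]
  · refine Fin.cases ?_ (fun i => Fin.cases ?_ (fun i => ?_) i) i
    · simp [invLC, lcU, lcV]
    · simp [invLC, lcZ]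
    · simp only [invLC, lcZ, Sum.elim_inr, Fin.cons_succ]
      field_simp

theorem lc_ext {x y : Fin 2 ⊕ Fin (p + 2) → ℂ} (hU : lcU x = lcU y) (hV : lcV x = lcV y)
    (hZ : lcZ sqrtTwo x = lcZ sqrtTwo y) : x = y := by
  have h2 : sqrtTwo ≠ 0 := fun h => by
    have := sqrtTwo_mul_self
    rw [h] at this
    norm_num at this
  simp only [lcU] at hU
  simp only [lcV] at hV
  have h0 := congrFun hZ (Sum.inl 0)
  have h1 := congrFun hZ (Sum.inl 1)
  simp only [lcZ, Sum.elim_inl, Matrix.cons_val_zero, Matrix.cons_val_one] at h0 h1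
  funext i
  rcases i with i | i
  · fin_cases i
    · simp only [Fin.zero_eta]
      linear_combination (hU + hV) / 2
    · simp only [Fin.mk_one]
      linear_combination (h0 + h1) / 2
  · refine Fin.cases ?_ (fun i => Fin.cases ?_ (fun i => ?_) i) i
    · linear_combination (hU - hV) / 2
    · rw [Fin.succ_zero_eq_one]
      linear_combination (h0 - h1) / 2
    · exact mul_left_cancel₀ h2 (congrFun hZ (Sum.inr i))

/-- The scaling factor of the action on the tube domain. -/
def tubeScale (g : TubeModel p) : ℝ := Real.exp ((g.1 (Sum.inl 0) + g.1 (Sum.inl 1)) / 2)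

theorem qq_act (x y z : Idx p → ℝ) : qq (act 1 x y) (act 1 x z) =
    Real.exp (x (Sum.inl 0) + x (Sum.inl 1)) * qq y z := by
  have h := qform_act 1 x y z
  rw [qform_eq_qq, qform_eq_qq, show mu 1 = 1 by simp [mu], one_mul] at h
  linarith

/-- The action of the group of the tube domain in light-cone coordinates. -/
def tubeLin (g : TubeModel p) (x : Fin 2 ⊕ Fin (p + 2) → ℝ) : Fin 2 ⊕ Fin (p + 2) → ℝ :=
  invLC ((tubeScale g)⁻¹ * lcU x)
    (tubeScale g * lcV x + qq ((tubeScale g)⁻¹ • act 1 g.1 (lcZ (Real.sqrt 2) x)) g.2 -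
      (tubeScale g)⁻¹ * lcU x * qq g.2 g.2 / 2)
    ((tubeScale g)⁻¹ • act 1 g.1 (lcZ (Real.sqrt 2) x) - ((tubeScale g)⁻¹ * lcU x) • g.2)

/-- For s = 1 the action on the cone is conformal with factor `tubeScale g` squared, so dividing by
`tubeScale g` gives an isometry of the Lorentzian part. Translations act as parabolic
transformations, whose V-component is chosen so that the form is preserved. -/
theorem lform_tubeLin (g : TubeModel p) (x y : Fin 2 ⊕ Fin (p + 2) → ℝ) :
    lform (tubeLin g x) (tubeLin g y) = lform x y := by
  have h2 : Real.sqrt 2 * Real.sqrt 2 = 2 := Real.mul_self_sqrt (by norm_num)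
  have e1 := two_mul_lform h2 (tubeLin g x) (tubeLin g y)
  have e2 := two_mul_lform h2 x y
  have hs : tubeScale g ≠ 0 := (Real.exp_pos _).ne'
  have hs2 : Real.exp (g.1 (Sum.inl 0) + g.1 (Sum.inl 1)) = tubeScale g * tubeScale g := by
    rw [tubeScale, ← Real.exp_add]
    congr 1
    ring
  simp only [tubeLin, lcU_invLC, lcV_invLC, lcZ_invLC, sub_eq_add_neg, ← neg_smul] at e1
  simp only [qq_add_left, qq_add_right, qq_smul_left, qq_smul_right, qq_act, hs2,
    qq_comm g.2 (act 1 _ _)] at e1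
  have e3 : 2 * lform (tubeLin g x) (tubeLin g y) = 2 * lform x y := by
    simp only [tubeLin, sub_eq_add_neg, ← neg_smul, qq_smul_left]
    rw [e1, e2]
    field_simp
    ring
  linarith

theorem tubeLin_zero (x : Fin 2 ⊕ Fin (p + 2) → ℝ) : tubeLin 0 x = x := by
  have h : ∀ x : Idx p → ℝ, qq x 0 = 0 := fun x => by simp [qq]
  conv_rhs => rw [← invLC_lc x]
  simp [tubeLin, tubeScale, act_zero_left, h]

/-- The matrix of `tubeLin g`. -/
def tubeMat (g : TubeModel p) : Mat := Matrix.of fun i j => tubeLin g (Pi.single j 1) i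

theorem tubeMat_zero : tubeMat (0 : TubeModel p) = 1 := by
  ext i j
  simp [tubeMat, tubeLin_zero, Matrix.one_apply, Pi.single_apply]

theorem transpose_tubeMat (g : TubeModel p) : (tubeMat g)ᵀ * η * tubeMat g = η := by
  ext i j
  rw [transpose_mul_mul_apply]
  refine (lform_tubeLin g (Pi.single i 1) (Pi.single j 1)).trans ?_
  have h := transpose_mul_mul_apply (p := p) 1 1 i j
  rw [Matrix.transpose_one, Matrix.one_mul, Matrix.mul_one] at h
  rw [h]
  congr 1 <;> funext k <;> simp [Matrix.one_apply, Pi.single_apply]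

theorem continuous_invLC {X : Type*} [TopologicalSpace X] {u v : X → ℝ} {z : X → Idx p → ℝ}
    (hu : Continuous u) (hv : Continuous v) (hz : Continuous z) :
    Continuous fun x => invLC (u x) (v x) (z x) := by
  have hz' := continuous_pi_iff.1 hz
  refine continuous_pi fun i => ?_
  rcases i with i | i
  · fin_cases i
    · exact (hu.add hv).div_const 2
    · exact ((hz' _).add (hz' _)).div_const 2
  · refine Fin.cases ?_ (fun i => Fin.cases ?_ (fun i => ?_) i) i
    · exact (hu.sub hv).div_const 2
    · exact ((hz' _).sub (hz' _)).div_const 2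
    · exact (hz' _).div_const _

theorem continuous_tubeMat : Continuous (tubeMat (p := p)) := by
  have hact : ∀ x : Idx p → ℝ, Continuous fun g : TubeModel p => act 1 g.1 x := fun x =>
    (contDiff_act (n := 0) 1 (by fun_prop) contDiff_const).continuous
  have hs : Continuous (tubeScale (p := p)) := by
    unfold tubeScale
    fun_prop
  have hs' : Continuous fun g : TubeModel p => (tubeScale g)⁻¹ :=
    hs.inv₀ fun g => (Real.exp_pos _).ne'
  have hqq : ∀ {f h : TubeModel p → Idx p → ℝ}, Continuous f → Continuous h →
      Continuous fun g => qq (f g) (h g) := fun hf hh => by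
    unfold qq
    fun_prop
  refine continuous_matrix fun i j => continuous_apply i |>.comp ?_
  refine continuous_invLC (hs'.mul continuous_const) (((hs.mul continuous_const).add
    (hqq (hs'.smul (hact _)) continuous_snd)).sub (((hs'.mul continuous_const).mul
    (hqq continuous_snd continuous_snd)).div_const 2)) ((hs'.smul (hact _)).sub
    ((hs'.mul continuous_const).smul continuous_snd))

theorem det_sq {a : Mat} (ha : aᵀ * η * a = η) : a.det * a.det = 1 := by
  have hη : (η).det ≠ 0 := by
    rw [LieAlgebra.Orthogonal.indefiniteDiagonal, Matrix.det_diagonal, Finset.prod_ne_zero_iff]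
    rintro (i | i) - <;> simp
  have h := congrArg Matrix.det ha
  rw [Matrix.det_mul, Matrix.det_mul, Matrix.det_transpose] at h
  apply mul_left_cancel₀ hη
  linear_combination h

/-- The determinant has square 1 and depends continuously on a point of a vector space, so it keeps
its value at the identity. -/
theorem det_tubeMat (g : TubeModel p) : (tubeMat g).det = 1 := by
  have h := det_sq (transpose_tubeMat g)
  by_contra hne
  have h1 : (tubeMat g).det = -1 := (mul_self_eq_one_iff.1 h).resolve_left hne
  obtain ⟨k, hk⟩ := mem_range_of_exists_le_of_exists_ge (c := 0)
    (f := fun g : TubeModel p => (tubeMat g).det) continuous_tubeMat.matrix_det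
    ⟨g, by rw [h1]; norm_num⟩ ⟨0, by rw [tubeMat_zero, Matrix.det_one]; norm_num⟩
  have h2 := det_sq (transpose_tubeMat k)
  simp only at hk
  rw [hk] at h2
  norm_num at h2

theorem one_mem_SO : (1 : Mat) ∈ SO 2 (p + 2) := by
  refine ⟨?_, Matrix.det_one⟩
  rw [Matrix.transpose_one, Matrix.one_mul, Matrix.mul_one]

theorem tubeMat_mem_SO₀ (g : TubeModel p) : tubeMat g ∈ SO₀ 2 (p + 2) := by
  have h : Set.range (tubeMat (p := p)) ⊆ connectedComponentIn (SO 2 (p + 2)) 1 :=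
    (isPreconnected_range continuous_tubeMat).subset_connectedComponentIn
      ⟨0, tubeMat_zero⟩ (by
        rintro _ ⟨g, rfl⟩
        exact ⟨transpose_tubeMat g, det_tubeMat g⟩)
  exact h ⟨g, rfl⟩

theorem mem_SO_of_mem_SO₀ {a : Mat} (ha : a ∈ SO₀ 2 (p + 2)) : aᵀ * η * a = η ∧ a.det = 1 :=
  connectedComponentIn_subset (SO 2 (p + 2)) 1 ha

theorem lcU_mk (a b : Fin 2 ⊕ Fin (p + 2) → ℝ) :
    lcU (fun i => (⟨a i, b i⟩ : ℂ)) = ⟨lcU a, lcU b⟩ := rfl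

theorem lcZ_mk (a b : Fin 2 ⊕ Fin (p + 2) → ℝ) (i : Idx p) :
    lcZ sqrtTwo (fun i => (⟨a i, b i⟩ : ℂ)) i =
      ⟨lcZ (Real.sqrt 2) a i, lcZ (Real.sqrt 2) b i⟩ := by
  rcases i with i | i
  · fin_cases i <;> rfl
  · apply Complex.ext <;> simp [lcZ, sqrtTwo]

/-- The base point corresponds to the first two standard basis vectors. As the tube group already
acts transitively, this yields surjectivity of `symMap`. -/
theorem symMap_tubeMat (g : TubeModel p) : symMap (tubeMat g) = tubeMap p 1 g := by
  have h0 : lcZ (Real.sqrt 2) (Pi.single (Sum.inl 0) 1 : Fin 2 ⊕ Fin (p + 2) → ℝ) = 0 := by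
    refine idx_ext ?_ ?_ ?_
    · simp [lcZ]
    · simp [lcZ]
    · funext i
      simp [lcZ, tail]
  have h1 : lcZ (Real.sqrt 2) (Pi.single (Sum.inl 1) 1 : Fin 2 ⊕ Fin (p + 2) → ℝ) =
      vecJB₀ p 1 := by
    rw [vecJB₀_eq]
    refine idx_ext ?_ ?_ ?_
    · simp [lcZ]
    · simp [lcZ, mu]
    · funext i
      simp [lcZ, tail]
  have hu0 : lcU (Pi.single (Sum.inl 0) 1 : Fin 2 ⊕ Fin (p + 2) → ℝ) = 1 := by simp [lcU]
  have hu1 : lcU (Pi.single (Sum.inl 1) 1 : Fin 2 ⊕ Fin (p + 2) → ℝ) = 0 := by simp [lcU]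
  have hs : tubeScale g ≠ 0 := (Real.exp_pos _).ne'
  have hU : lcU (colC (tubeMat g)) = ((tubeScale g)⁻¹ : ℝ) := by
    refine (lcU_mk (tubeLin g (Pi.single (Sum.inl 0) 1)) (tubeLin g (Pi.single (Sum.inl 1) 1))).trans ?_
    rw [tubeLin, tubeLin, lcU_invLC, lcU_invLC, hu0, hu1]
    apply Complex.ext <;> simp
  funext i
  have hZ : lcZ sqrtTwo (colC (tubeMat g)) i =
      ⟨-((tubeScale g)⁻¹ * g.2 i), (tubeScale g)⁻¹ * act 1 g.1 (vecJB₀ p 1) i⟩ := by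
    refine (lcZ_mk (tubeLin g (Pi.single (Sum.inl 0) 1))
      (tubeLin g (Pi.single (Sum.inl 1) 1)) i).trans ?_
    rw [tubeLin, tubeLin, lcZ_invLC, lcZ_invLC, hu0, hu1, h0, h1, act_zero_right]
    apply Complex.ext <;> simp
  rw [symMap, Pi.smul_apply, hZ, hU, tubeMap, ← Complex.ofReal_inv, inv_inv]
  apply Complex.ext <;> simp <;> field_simp

theorem continuousOn_symMap_SO₀ : ContinuousOn symMap (SO₀ 2 (p + 2)) := fun _ ha =>
  (contDiffAt_symMap (lcU_ne_zero (mem_SO_of_mem_SO₀ ha).1)).continuousAt.continuousWithinAt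

theorem qq_imV_symMap_pos {a : Mat} (ha : aᵀ * η * a = η) :
    0 < qq (imV (symMap a)) (imV (symMap a)) := by
  have h := qq_imV_symMap ha
  have e : lcU (colC a) * star (lcU (colC a)) = ((Complex.normSq (lcU (colC a)) : ℝ) : ℂ) :=
    Complex.mul_conj _
  rw [e, ← Complex.ofReal_mul] at h
  have h' : Complex.normSq (lcU (colC a)) * qq (imV (symMap a)) (imV (symMap a)) = 2 := by
    exact_mod_cast h
  exact pos_of_mul_pos_right (by rw [h']; norm_num) (Complex.normSq_nonneg _)

/-- The imaginary part is time-like for every matrix of the group. Its a₂-coordinate cannot vanish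
then, and it is positive at the identity, so connectedness of SO₀(2, p+2) selects the forward cone.
-/
theorem symMap_mem {a : Mat} (ha : a ∈ SO₀ 2 (p + 2)) : symMap a ∈ tube (orbit p 1) := by
  rw [mem_tube_iff le_rfl, qform_eq_qq]
  refine ⟨?_, by have := qq_imV_symMap_pos (mem_SO_of_mem_SO₀ ha).1; linarith⟩
  have h1 : 0 < imV (symMap (1 : Mat)) (Sum.inl 1) := by
    rw [← tubeMat_zero, symMap_tubeMat]
    exact ((mem_tube_iff le_rfl _).1 (tubeMap_mem le_rfl 0)).1
  by_contra! hle
  have hc : ContinuousOn (fun a : Mat => imV (symMap a) (Sum.inl 1)) (SO₀ 2 (p + 2)) :=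
    ((continuous_apply _).comp (contDiff_imV (n := 0)).continuous).comp_continuousOn
      continuousOn_symMap_SO₀
  obtain ⟨b, hb, hb0⟩ := isPreconnected_connectedComponentIn.intermediate_value ha
    (mem_connectedComponentIn one_mem_SO) hc ⟨hle, h1.le⟩
  have hpos := qq_imV_symMap_pos (mem_SO_of_mem_SO₀ hb).1
  simp only at hb0
  rw [qq, hb0] at hpos
  have : 0 ≤ ∑ i, imV (symMap b) (Sum.inr i) * imV (symMap b) (Sum.inr i) :=
    Finset.sum_nonneg fun i _ => mul_self_nonneg _
  linarith

end SymmetricSpace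

/-! ### The fibres are the cosets of SO(2) × SO(p + 2) -/

section SymmetricFibres

attribute [local instance] Matrix.normedAddCommGroup Matrix.normedSpace

variable {p : ℕ}

local notation "η" => LieAlgebra.Orthogonal.indefiniteDiagonal (Fin 2) (Fin (p + 2)) ℝ
local notation "Mat" => Matrix (Fin 2 ⊕ Fin (p + 2)) (Fin 2 ⊕ Fin (p + 2)) ℝ

theorem indefiniteDiagonal_eq_fromBlocks : η = Matrix.fromBlocks 1 0 0 (-1) := by
  rw [← Matrix.diagonal_one, ← Matrix.diagonal_one, Matrix.diagonal_neg, Matrix.fromBlocks_diagonal]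
  rfl

theorem indefiniteDiagonal_mul_self : η * η = 1 := by
  rw [indefiniteDiagonal_eq_fromBlocks, Matrix.fromBlocks_multiply]
  simp

theorem rotation_of_mem {A : Matrix (Fin 2) (Fin 2) ℝ}
    (hA : A ∈ Matrix.specialOrthogonalGroup (Fin 2) ℝ) : A 1 1 = A 0 0 ∧ A 1 0 = -A 0 1 ∧
      A 0 0 ^ 2 + A 0 1 ^ 2 = 1 := by
  obtain ⟨h1, h2⟩ := Matrix.mem_specialOrthogonalGroup_iff.1 hA
  rw [Matrix.mem_orthogonalGroup_iff] at h1
  have e : Aᵀ = A.adjugate := by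
    rw [← Matrix.mul_one A.adjugate, ← h1, ← Matrix.mul_assoc, Matrix.adjugate_mul, h2, one_smul,
      Matrix.one_mul]
  rw [Matrix.adjugate_fin_two] at e
  have e0 := congrFun (congrFun e 0) 0
  have e1 := congrFun (congrFun e 0) 1
  simp at e0 e1
  refine ⟨e0.symm, e1, ?_⟩
  have := congrFun (congrFun h1 0) 0
  simp [Matrix.mul_apply, Fin.sum_univ_two] at this
  linarith

/-- A rotation of the first two columns multiplies the complex vector by a nonzero number, which
disappears in affine coordinates. -/
theorem symMap_mul_fromBlocks (a : Mat) {A : Matrix (Fin 2) (Fin 2) ℝ}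
    (hA : A ∈ Matrix.specialOrthogonalGroup (Fin 2) ℝ) (D : Matrix (Fin (p + 2)) (Fin (p + 2)) ℝ) :
    symMap (a * Matrix.fromBlocks A 0 0 D) = symMap a := by
  obtain ⟨h1, h2, h3⟩ := rotation_of_mem hA
  have hc : colC (a * Matrix.fromBlocks A 0 0 D) = (⟨A 0 0, A 0 1⟩ : ℂ) • colC a := by
    funext i
    apply Complex.ext <;>
      simp [colC, Matrix.mul_apply, Fintype.sum_sum_type, Fin.sum_univ_two, h1, h2] <;> ring
  have hne : (⟨A 0 0, A 0 1⟩ : ℂ) ≠ 0 := fun h => by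
    have e0 := congrArg Complex.re h
    have e1 := congrArg Complex.im h
    simp only [Complex.zero_re, Complex.zero_im] at e0 e1
    rw [e0, e1] at h3
    norm_num at h3
  rw [symMap, symMap, hc, lcU_smul, lcZ_smul, smul_smul, mul_inv, mul_comm _ (lcU (colC a))⁻¹,
    mul_assoc, inv_mul_cancel₀ hne, mul_one]

/-- Equal affine coordinates mean proportional isotropic vectors. So a⁻¹b maps the first coordinate
plane to itself, and since it preserves the indefinite form it is block diagonal. -/
theorem exists_of_symMap_eq {a b : Mat} (ha : aᵀ * η * a = η ∧ a.det = 1)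
    (hb : bᵀ * η * b = η ∧ b.det = 1) (h : symMap a = symMap b) :
    ∃ A ∈ Matrix.specialOrthogonalGroup (Fin 2) ℝ,
      ∃ D ∈ Matrix.specialOrthogonalGroup (Fin (p + 2)) ℝ, b = a * Matrix.fromBlocks A 0 0 D := by
  have hua := lcU_ne_zero ha.1
  set c := lcU (colC b) / lcU (colC a) with hc
  have hcol : colC b = c • colC a := by
    have e : lcU (colC b) = c * lcU (colC a) := by
      rw [hc, div_mul_cancel₀ _ hua]
    refine lc_ext ?_ ?_ ?_
    · rw [lcU_smul, e]
    · have h1 := lcV_colC ha.1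
      have h2 := lcV_colC hb.1
      have e2 : lcV (c • colC a) = c * lcV (colC a) := by
        simp [lcV]
        ring
      rw [e2]
      rw [← h, e] at h2
      linear_combination h2 / 2 - c * h1 / 2
    · rw [lcZ_smul, lcZ_colC ha.1, lcZ_colC hb.1, ← h, smul_smul, e]
  have hinv : η * aᵀ * η * a = 1 := by
    rw [Matrix.mul_assoc, Matrix.mul_assoc, ← Matrix.mul_assoc aᵀ, ha.1, indefiniteDiagonal_mul_self]
  have hinv' : a * (η * aᵀ * η) = 1 := mul_eq_one_comm.1 hinv
  set m := η * aᵀ * η with hm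
  set g := m * b with hg
  have hag : b = a * g := by rw [hg, ← Matrix.mul_assoc, hinv', Matrix.one_mul]
  have hcolmul : ∀ x : Mat, colC (m * x) = (m.map fun t : ℝ => (t : ℂ)) *ᵥ colC x := fun x => by
    funext i
    apply Complex.ext <;> simp [colC, Matrix.mul_apply, Matrix.mulVec, dotProduct]
  have hgcol : colC g = c • colC 1 := by
    rw [hg, hcolmul, hcol, Matrix.mulVec_smul, ← hcolmul, hinv]
  have hgη : gᵀ * η * g = η := by
    have := hb.1
    rw [hag, Matrix.transpose_mul, Matrix.mul_assoc, Matrix.mul_assoc, ← Matrix.mul_assoc η,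
      ← Matrix.mul_assoc aᵀ, ← Matrix.mul_assoc aᵀ, ha.1, ← Matrix.mul_assoc] at this
    exact this
  have hgdet : g.det = 1 := by
    have := hb.2
    rwa [hag, Matrix.det_mul, ha.2, one_mul] at this
  set A := g.toBlocks₁₁
  set B := g.toBlocks₁₂
  set D := g.toBlocks₂₂
  have hC : g.toBlocks₂₁ = 0 := by
    ext i j
    have h0 := congrFun hgcol (Sum.inr i)
    have r0 := congrArg Complex.re h0
    have i0 := congrArg Complex.im h0
    simp [colC] at r0 i0
    fin_cases j
    · exact r0
    · exact i0
  have hgb : g = Matrix.fromBlocks A B 0 D := by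
    rw [← hC]
    exact (Matrix.fromBlocks_toBlocks g).symm
  rw [hgb, indefiniteDiagonal_eq_fromBlocks, Matrix.fromBlocks_transpose,
    Matrix.fromBlocks_multiply, Matrix.fromBlocks_multiply, Matrix.fromBlocks_inj] at hgη
  simp only [Matrix.mul_one, Matrix.mul_zero, Matrix.transpose_zero, Matrix.zero_mul, add_zero,
    zero_add, Matrix.mul_neg, Matrix.neg_mul, neg_zero] at hgη
  obtain ⟨e1, e2, -, e4⟩ := hgη
  have hAA : A * Aᵀ = 1 := mul_eq_one_comm.1 e1
  have hB : B = 0 := by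
    rw [← Matrix.one_mul B, ← hAA, Matrix.mul_assoc, e2, Matrix.mul_zero]
  rw [hB, Matrix.mul_zero, zero_add, neg_inj] at e4
  -- The upper block is multiplication by the complex number `c`, so its determinant is |c|², which
  -- is 1 by orthogonality. The determinant of `D` then follows from that of `g`.
  have hA : A.det = 1 := by
    have h0 := congrFun hgcol (Sum.inl 0)
    have h1 := congrFun hgcol (Sum.inl 1)
    have r0 := congrArg Complex.re h0
    have i0 := congrArg Complex.im h0
    have r1 := congrArg Complex.re h1
    have i1 := congrArg Complex.im h1
    simp [colC] at r0 i0 r1 i1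
    have e5 := congrFun (congrFun e1 0) 0
    simp [Matrix.mul_apply, Fin.sum_univ_two, A, Matrix.toBlocks₁₁] at e5
    rw [Matrix.det_fin_two]
    simp only [A, Matrix.toBlocks₁₁, Matrix.of_apply, r0, i0, r1, i1] at e5 ⊢
    linarith
  refine ⟨A, Matrix.mem_specialOrthogonalGroup_iff.2 ⟨(Matrix.mem_orthogonalGroup_iff' _ _).2 e1, hA⟩, D,
    Matrix.mem_specialOrthogonalGroup_iff.2 ⟨(Matrix.mem_orthogonalGroup_iff' _ _).2 e4, ?_⟩, ?_⟩
  · rw [hgb, Matrix.det_fromBlocks_zero₂₁, hA, one_mul] at hgdet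
    exact hgdet
  · rw [hag, hgb, hB]

theorem isIsometricToSymmetricSpace_tube (p : ℕ) : IsIsometricToSymmetricSpace 2 (p + 2)
    (tube (orbit p 1)) (tubeMetric (basicPoly p 1) (1 + 1)) := by
  refine ⟨1 / 2, {a | lcU (colC a) ≠ 0}, symMap, by norm_num, ?_, ?_, ?_, ?_, ?_, ?_⟩
  · exact isOpen_ne_fun (contDiff_lcU_colC (p := p)).continuous continuous_const
  · exact fun a ha => lcU_ne_zero (mem_SO_of_mem_SO₀ ha).1
  · exact fun a ha => (contDiffAt_symMap ha).contDiffWithinAt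
  · refine Set.Subset.antisymm ?_ fun z hz => ?_
    · rintro _ ⟨a, ha, rfl⟩
      exact symMap_mem ha
    · exact ⟨tubeMat (tubeMapInv p 1 z), tubeMat_mem_SO₀ _, by
        rw [symMap_tubeMat, tubeMap_tubeMapInv le_rfl hz]⟩
  · intro a ha b hb
    refine ⟨exists_of_symMap_eq (mem_SO_of_mem_SO₀ ha) (mem_SO_of_mem_SO₀ hb), ?_⟩
    rintro ⟨A, hA, D, -, rfl⟩
    exact (symMap_mul_fromBlocks a hA D).symm
  · intro a ha ξ hξ ζ hζ hξ' hζ'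
    exact tubeMetric_fderiv_symMap (mem_SO_of_mem_SO₀ ha).1 (symMap_mem ha) hξ hζ hξ' hζ'

end SymmetricFibres

/-! ## The Alekseevskian Lie algebra of `T(p)` -/

section Alekseevsky

/-- The vector space `l = f₀ + u₀ + ũ`. The coordinates `h, g` belong to the key algebra `f₀`, the
coordinates `x, r` to `u₀ = b + J b`, and the coordinates `k, v, n, y` to the symplectic vector
space `ũ`. Here the coordinates with index `b` are such that the corresponding basis vectors have
length `√2`. -/
@[ext]
structure AlekT (p : ℕ) where
  /-- coordinate in `f₀` -/
  h : ℝ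
  /-- coordinate in `f₀` -/
  g : ℝ
  /-- coordinate in `b` -/
  xa : ℝ
  /-- coordinate in `b` -/
  xb : ℝ
  /-- component in `b` -/
  xX : Fin p → ℝ
  /-- coordinate in `J b` -/
  ra : ℝ
  /-- coordinate in `J b` -/
  rb : ℝ
  /-- component in `J b` -/
  rX : Fin p → ℝ
  /-- coordinate in `ũ` -/
  k : ℝ
  /-- coordinate in `ũ` -/
  va : ℝ
  /-- coordinate in `ũ` -/
  vb : ℝ
  /-- component in `ũ` -/
  vX : Fin p → ℝ
  /-- coordinate in `ũ` -/
  n : ℝ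
  /-- coordinate in `ũ` -/
  ya : ℝ
  /-- coordinate in `ũ` -/
  yb : ℝ
  /-- component in `ũ` -/
  yX : Fin p → ℝ

namespace AlekT

variable {p : ℕ}

@[simps]
instance : Add (AlekT p) := ⟨fun u w =>
    ⟨u.h + w.h, u.g + w.g, u.xa + w.xa, u.xb + w.xb, u.xX + w.xX, u.ra + w.ra, u.rb + w.rb,
      u.rX + w.rX, u.k + w.k, u.va + w.va, u.vb + w.vb, u.vX + w.vX, u.n + w.n, u.ya + w.ya,
      u.yb + w.yb, u.yX + w.yX⟩⟩

@[simps]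
instance : Neg (AlekT p) := ⟨fun u =>
    ⟨-u.h, -u.g, -u.xa, -u.xb, -u.xX, -u.ra, -u.rb, -u.rX, -u.k, -u.va, -u.vb, -u.vX, -u.n, -u.ya,
      -u.yb, -u.yX⟩⟩

@[simps]
instance : Sub (AlekT p) := ⟨fun u w =>
    ⟨u.h - w.h, u.g - w.g, u.xa - w.xa, u.xb - w.xb, u.xX - w.xX, u.ra - w.ra, u.rb - w.rb,
      u.rX - w.rX, u.k - w.k, u.va - w.va, u.vb - w.vb, u.vX - w.vX, u.n - w.n, u.ya - w.ya,
      u.yb - w.yb, u.yX - w.yX⟩⟩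

@[simps]
instance : Zero (AlekT p) := ⟨
    ⟨0, 0, 0, 0, 0, 0, 0, 0, 0, 0, 0, 0, 0, 0, 0, 0⟩⟩

@[simps]
instance : SMul ℝ (AlekT p) := ⟨fun t u =>
    ⟨t * u.h, t * u.g, t * u.xa, t * u.xb, t • u.xX, t * u.ra, t * u.rb, t • u.rX, t * u.k,
      t * u.va, t * u.vb, t • u.vX, t * u.n, t * u.ya, t * u.yb, t • u.yX⟩⟩

@[simp] theorem xX_add (u w : AlekT p) : (u + w).xX = u.xX + w.xX := rfl
@[simp] theorem rX_add (u w : AlekT p) : (u + w).rX = u.rX + w.rX := rfl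
@[simp] theorem vX_add (u w : AlekT p) : (u + w).vX = u.vX + w.vX := rfl
@[simp] theorem yX_add (u w : AlekT p) : (u + w).yX = u.yX + w.yX := rfl
@[simp] theorem xX_neg (u : AlekT p) : (-u).xX = -u.xX := rfl
@[simp] theorem rX_neg (u : AlekT p) : (-u).rX = -u.rX := rfl
@[simp] theorem vX_neg (u : AlekT p) : (-u).vX = -u.vX := rfl
@[simp] theorem yX_neg (u : AlekT p) : (-u).yX = -u.yX := rfl
@[simp] theorem xX_sub (u w : AlekT p) : (u - w).xX = u.xX - w.xX := rfl
@[simp] theorem rX_sub (u w : AlekT p) : (u - w).rX = u.rX - w.rX := rfl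
@[simp] theorem vX_sub (u w : AlekT p) : (u - w).vX = u.vX - w.vX := rfl
@[simp] theorem yX_sub (u w : AlekT p) : (u - w).yX = u.yX - w.yX := rfl
@[simp] theorem xX_zero : (0 : AlekT p).xX = 0 := rfl
@[simp] theorem rX_zero : (0 : AlekT p).rX = 0 := rfl
@[simp] theorem vX_zero : (0 : AlekT p).vX = 0 := rfl
@[simp] theorem yX_zero : (0 : AlekT p).yX = 0 := rfl
@[simp] theorem xX_smul (t : ℝ) (u : AlekT p) : (t • u).xX = t • u.xX := rfl
@[simp] theorem rX_smul (t : ℝ) (u : AlekT p) : (t • u).rX = t • u.rX := rfl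
@[simp] theorem vX_smul (t : ℝ) (u : AlekT p) : (t • u).vX = t • u.vX := rfl
@[simp] theorem yX_smul (t : ℝ) (u : AlekT p) : (t • u).yX = t • u.yX := rfl

instance : AddCommGroup (AlekT p) where
  add_assoc u v w := by ext1 <;> simp [add_assoc]
  zero_add u := by ext1 <;> simp
  add_zero u := by ext1 <;> simp
  add_comm u v := by ext1 <;> simp [add_comm]
  neg_add_cancel u := by ext1 <;> simp
  sub_eq_add_neg u v := by ext1 <;> simp [sub_eq_add_neg]
  nsmul := nsmulRec
  zsmul := zsmulRec

instance : Module ℝ (AlekT p) where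
  one_smul u := by ext1 <;> simp
  mul_smul s t u := by ext1 <;> simp [mul_assoc, mul_smul]
  smul_zero t := by ext1 <;> simp
  smul_add t u v := by ext1 <;> simp [mul_add]
  add_smul s t u := by ext1 <;> simp [add_mul, add_smul]
  zero_smul u := by ext1 <;> simp

/-- The coordinates, as a linear map. -/
def coords : AlekT p →ₗ[ℝ] (Fin 12 → ℝ) × (Fin 4 → Fin p → ℝ) where
  toFun u := (![u.h, u.g, u.xa, u.xb, u.ra, u.rb, u.k, u.va, u.vb, u.n, u.ya, u.yb],
    ![u.xX, u.rX, u.vX, u.yX])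
  map_add' u v := by simp
  map_smul' t u := by simp

instance : Module.Finite ℝ (AlekT p) :=
  Module.Finite.of_injective coords fun u w e => by
    simp only [coords, LinearMap.coe_mk, AddHom.coe_mk, Prod.mk.injEq] at e
    obtain ⟨e1, e2⟩ := e
    have f := congrFun e1
    have f2 := congrFun e2
    exact AlekT.ext (f 0) (f 1) (f 2) (f 3) (f2 0) (f 4) (f 5) (f2 1) (f 6) (f 7) (f 8) (f2 2)
      (f 9) (f 10) (f 11) (f2 3)

/-- The Lie bracket of `l`. -/
@[simps]
instance : Bracket (AlekT p) (AlekT p) where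
  bracket u w :=
    { h := 0
      g := u.h * w.g - w.h * u.g + (u.k * w.n + (u.va * w.ya + 2 * (u.vb * w.yb) + u.vX ⬝ᵥ w.yX)) -
        (w.k * u.n + (w.va * u.ya + 2 * (w.vb * u.yb) + w.vX ⬝ᵥ u.yX))
      xa := 0
      xb := 0
      xX := ((u.xa - u.xb) / 2) • w.xX - ((w.xa - w.xb) / 2) • u.xX
      ra := u.xa * w.ra + u.xX ⬝ᵥ w.rX - (w.xa * u.ra + w.xX ⬝ᵥ u.rX)
      rb := u.xb * w.rb - w.xb * u.rb
      rX := ((u.xa + u.xb) / 2) • w.rX + w.rb • u.xX - (((w.xa + w.xb) / 2) • u.rX + u.rb • w.xX)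
      k := (u.h / 2 - (u.xa + 2 * u.xb) / 2) * w.k - (w.h / 2 - (w.xa + 2 * w.xb) / 2) * u.k
      va := (u.h / 2 - (u.xa + 2 * u.xb) / 2) * w.va + (u.xa * w.va + u.xX ⬝ᵥ w.vX) + w.k * u.ra -
        ((w.h / 2 - (w.xa + 2 * w.xb) / 2) * u.va + (w.xa * u.va + w.xX ⬝ᵥ u.vX) + u.k * w.ra)
      vb := (u.h / 2 - (u.xa + 2 * u.xb) / 2) * w.vb + u.xb * w.vb + w.k * u.rb -
        ((w.h / 2 - (w.xa + 2 * w.xb) / 2) * u.vb + w.xb * u.vb + u.k * w.rb)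
      vX := (u.h / 2 - (u.xa + 2 * u.xb) / 2) • w.vX + (((u.xa + u.xb) / 2) • w.vX + w.vb • u.xX) +
          w.k • u.rX -
        ((w.h / 2 - (w.xa + 2 * w.xb) / 2) • u.vX + (((w.xa + w.xb) / 2) • u.vX + u.vb • w.xX) +
          u.k • w.rX)
      n := (u.h / 2 + (u.xa + 2 * u.xb) / 2) * w.n -
          (w.ya * u.ra + 2 * (w.yb * u.rb) + w.yX ⬝ᵥ u.rX) -
        ((w.h / 2 + (w.xa + 2 * w.xb) / 2) * u.n -
          (u.ya * w.ra + 2 * (u.yb * w.rb) + u.yX ⬝ᵥ w.rX))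
      ya := (u.h / 2 + (u.xa + 2 * u.xb) / 2) * w.ya - u.xa * w.ya + 2 * (w.vb * u.rb) -
        ((w.h / 2 + (w.xa + 2 * w.xb) / 2) * u.ya - w.xa * u.ya + 2 * (u.vb * w.rb))
      yb := (u.h / 2 + (u.xa + 2 * u.xb) / 2) * w.yb - (u.xb * w.yb + (u.xX ⬝ᵥ w.yX) / 2) +
          (w.va * u.rb + u.ra * w.vb - (w.vX ⬝ᵥ u.rX) / 2) -
        ((w.h / 2 + (w.xa + 2 * w.xb) / 2) * u.yb - (w.xb * u.yb + (w.xX ⬝ᵥ u.yX) / 2) +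
          (u.va * w.rb + w.ra * u.vb - (u.vX ⬝ᵥ w.rX) / 2))
      yX := (u.h / 2 + (u.xa + 2 * u.xb) / 2) • w.yX -
          (w.ya • u.xX + ((u.xa + u.xb) / 2) • w.yX) - (w.vb • u.rX + u.rb • w.vX) -
        ((w.h / 2 + (w.xa + 2 * w.xb) / 2) • u.yX -
          (u.ya • w.xX + ((w.xa + w.xb) / 2) • u.yX) - (u.vb • w.rX + w.rb • u.vX)) }

@[simp] theorem lie_xX (u w : AlekT p) : (⁅u, w⁆ : AlekT p).xX =
    ((u.xa - u.xb) / 2) • w.xX - ((w.xa - w.xb) / 2) • u.xX := rfl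
@[simp] theorem lie_rX (u w : AlekT p) : (⁅u, w⁆ : AlekT p).rX =
    ((u.xa + u.xb) / 2) • w.rX + w.rb • u.xX -
      (((w.xa + w.xb) / 2) • u.rX + u.rb • w.xX) := rfl
@[simp] theorem lie_vX (u w : AlekT p) : (⁅u, w⁆ : AlekT p).vX =
    (u.h / 2 - (u.xa + 2 * u.xb) / 2) • w.vX + (((u.xa + u.xb) / 2) • w.vX + w.vb • u.xX) +
      w.k • u.rX -
    ((w.h / 2 - (w.xa + 2 * w.xb) / 2) • u.vX + (((w.xa + w.xb) / 2) • u.vX + u.vb • w.xX) +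
      u.k • w.rX) := rfl
@[simp] theorem lie_yX (u w : AlekT p) : (⁅u, w⁆ : AlekT p).yX =
    (u.h / 2 + (u.xa + 2 * u.xb) / 2) • w.yX -
      (w.ya • u.xX + ((u.xa + u.xb) / 2) • w.yX) - (w.vb • u.rX + u.rb • w.vX) -
    ((w.h / 2 + (w.xa + 2 * w.xb) / 2) • u.yX -
      (u.ya • w.xX + ((w.xa + w.xb) / 2) • u.yX) - (u.vb • w.rX + w.rb • u.vX)) := rfl

set_option maxHeartbeats 4000000 in
-- Conceptually, 𝔲₀ acts on 𝔲̃ by a symplectic representation: J𝔟 maps the k-line to the v-space,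
-- then by the polarized cubic form to the y-space, then by the scalar product to the n-line. H₀
-- acts by 1/2, and the brackets within 𝔲̃ are the symplectic form times G₀, a Heisenberg extension.
theorem jacobi (u v w : AlekT p) : ⁅u, (⁅v, w⁆ : AlekT p)⁆ =
    ⁅(⁅u, v⁆ : AlekT p), w⁆ + ⁅v, (⁅u, w⁆ : AlekT p)⁆ := by
  ext1 <;> simp [dotProduct_comm] <;> first | ring1 | module

instance : LieRing (AlekT p) where
  add_lie u v w := by ext1 <;> simp <;> first | ring1 | module
  lie_add u v w := by ext1 <;> simp <;> first | ring1 | module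
  lie_self u := by ext1 <;> simp
  leibniz_lie := jacobi

instance : LieAlgebra ℝ (AlekT p) where
  lie_smul t u v := by ext1 <;> simp <;> first | ring1 | module

end AlekT

end Alekseevsky

/-! ### Scalar product, Levi-Civita connection and quaternionic structure of 𝔩 -/

section AlekseevskyMetric

namespace AlekT

variable {p : ℕ}

variable (p) in
/-- The scalar product of `l`. -/
def form : LinearMap.BilinForm ℝ (AlekT p) :=
  LinearMap.mk₂ ℝ (fun u w => u.h * w.h + u.g * w.g + u.xa * w.xa + 2 * (u.xb * w.xb) +
      u.xX ⬝ᵥ w.xX + u.ra * w.ra + 2 * (u.rb * w.rb) + u.rX ⬝ᵥ w.rX + u.k * w.k + u.va * w.va +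
      2 * (u.vb * w.vb) + u.vX ⬝ᵥ w.vX + u.n * w.n + u.ya * w.ya + 2 * (u.yb * w.yb) +
      u.yX ⬝ᵥ w.yX)
    (fun u v w => by simp; ring) (fun t u v => by simp; ring) (fun u v w => by simp; ring)
    (fun t u v => by simp; ring)

theorem form_apply (u w : AlekT p) : form p u w =
    u.h * w.h + u.g * w.g + u.xa * w.xa + 2 * (u.xb * w.xb) +
      u.xX ⬝ᵥ w.xX + u.ra * w.ra + 2 * (u.rb * w.rb) + u.rX ⬝ᵥ w.rX + u.k * w.k + u.va * w.va +
      2 * (u.vb * w.vb) + u.vX ⬝ᵥ w.vX + u.n * w.n + u.ya * w.ya + 2 * (u.yb * w.yb) +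
      u.yX ⬝ᵥ w.yX := rfl

/-- The adjoint of `ad u` applied to `w`. -/
@[simps]
def adT (u w : AlekT p) : AlekT p where
  h := -(u.g * w.g) - (w.k * u.k + (w.va * u.va + 2 * (w.vb * u.vb) + w.vX ⬝ᵥ u.vX) + w.n * u.n +
    (w.ya * u.ya + 2 * (w.yb * u.yb) + w.yX ⬝ᵥ u.yX)) / 2
  g := u.h * w.g
  xa := -((w.xX ⬝ᵥ u.xX) / 2) - (w.ra * u.ra + (w.rX ⬝ᵥ u.rX) / 2) +
    (w.k * u.k + (w.va * u.va + 2 * (w.vb * u.vb) + w.vX ⬝ᵥ u.vX) - w.n * u.n -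
    (w.ya * u.ya + 2 * (w.yb * u.yb) + w.yX ⬝ᵥ u.yX)) / 2 - (w.va * u.va + (w.vX ⬝ᵥ u.vX) / 2) +
    (w.ya * u.ya + (w.yX ⬝ᵥ u.yX) / 2)
  xb := (w.xX ⬝ᵥ u.xX) / 4 - (w.rb * u.rb + (w.rX ⬝ᵥ u.rX) / 4) +
    (w.k * u.k + (w.va * u.va + 2 * (w.vb * u.vb) + w.vX ⬝ᵥ u.vX) - w.n * u.n -
    (w.ya * u.ya + 2 * (w.yb * u.yb) + w.yX ⬝ᵥ u.yX)) / 2 - (w.vb * u.vb + (w.vX ⬝ᵥ u.vX) / 4) +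
    (w.yb * u.yb + (w.yX ⬝ᵥ u.yX) / 4)
  xX := ((u.xa - u.xb) / 2) • w.xX - (w.ra • u.rX + u.rb • w.rX) - (w.va • u.vX + u.vb • w.vX) +
    (u.ya • w.yX + w.yb • u.yX)
  ra := u.xa * w.ra - u.k * w.va + w.n * u.ya - 2 * (w.yb * u.vb)
  rb := u.xb * w.rb + (u.xX ⬝ᵥ w.rX) / 2 - u.k * w.vb + w.n * u.yb -
    (w.ya * u.vb + u.va * w.yb - (w.yX ⬝ᵥ u.vX) / 2)
  rX := w.ra • u.xX + ((u.xa + u.xb) / 2) • w.rX - u.k • w.vX + w.n • u.yX +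
    (w.yb • u.vX + u.vb • w.yX)
  k := -(w.g * u.n) + (u.h / 2 - (u.xa + 2 * u.xb) / 2) * w.k +
    (u.ra * w.va + 2 * (u.rb * w.vb) + u.rX ⬝ᵥ w.vX)
  va := -(w.g * u.ya) + u.xa * w.va + (u.h / 2 - (u.xa + 2 * u.xb) / 2) * w.va +
    2 * (w.yb * u.rb)
  vb := -(w.g * u.yb) + (u.xb * w.vb + (u.xX ⬝ᵥ w.vX) / 2) +
    (u.h / 2 - (u.xa + 2 * u.xb) / 2) * w.vb + (w.ya * u.rb + u.ra * w.yb - (w.yX ⬝ᵥ u.rX) / 2)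
  vX := -(w.g • u.yX) + (w.va • u.xX + ((u.xa + u.xb) / 2) • w.vX) +
    (u.h / 2 - (u.xa + 2 * u.xb) / 2) • w.vX - (w.yb • u.rX + u.rb • w.yX)
  n := w.g * u.k + (u.h / 2 + (u.xa + 2 * u.xb) / 2) * w.n
  ya := w.g * u.va - (u.xa * w.ya + u.xX ⬝ᵥ w.yX) +
    (u.h / 2 + (u.xa + 2 * u.xb) / 2) * w.ya - w.n * u.ra
  yb := w.g * u.vb - u.xb * w.yb + (u.h / 2 + (u.xa + 2 * u.xb) / 2) * w.yb - w.n * u.rb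
  yX := w.g • u.vX - (((u.xa + u.xb) / 2) • w.yX + w.yb • u.xX) +
    (u.h / 2 + (u.xa + 2 * u.xb) / 2) • w.yX - w.n • u.rX

@[simp] theorem xX_adT (u w : AlekT p) : (adT u w).xX =
    ((u.xa - u.xb) / 2) • w.xX - (w.ra • u.rX + u.rb • w.rX) - (w.va • u.vX + u.vb • w.vX) +
    (u.ya • w.yX + w.yb • u.yX) := rfl
@[simp] theorem rX_adT (u w : AlekT p) : (adT u w).rX =
    w.ra • u.xX + ((u.xa + u.xb) / 2) • w.rX - u.k • w.vX + w.n • u.yX +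
    (w.yb • u.vX + u.vb • w.yX) := rfl
@[simp] theorem vX_adT (u w : AlekT p) : (adT u w).vX =
    -(w.g • u.yX) + (w.va • u.xX + ((u.xa + u.xb) / 2) • w.vX) +
    (u.h / 2 - (u.xa + 2 * u.xb) / 2) • w.vX - (w.yb • u.rX + u.rb • w.yX) := rfl
@[simp] theorem yX_adT (u w : AlekT p) : (adT u w).yX =
    w.g • u.vX - (((u.xa + u.xb) / 2) • w.yX + w.yb • u.xX) +
    (u.h / 2 + (u.xa + 2 * u.xb) / 2) • w.yX - w.n • u.rX := rfl

theorem form_comm (u w : AlekT p) : form p u w = form p w u := by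
  simp [form_apply, dotProduct_comm, mul_comm]

/-- An explicit transpose of ad u turns the Koszul formula into a closed expression for the
connection. -/
theorem form_adT (u v w : AlekT p) : form p (adT u v) w = form p v ⁅u, w⁆ := by
  simp [form_apply, dotProduct_comm]
  ring

theorem adT_add_left (u v w : AlekT p) : adT (u + v) w = adT u w + adT v w := by
  ext1 <;> simp <;> first | ring1 | module

theorem adT_add_right (u v w : AlekT p) : adT u (v + w) = adT u v + adT u w := by
  ext1 <;> simp <;> first | ring1 | module

theorem adT_smul_left (t : ℝ) (u w : AlekT p) : adT (t • u) w = t • adT u w := by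
  ext1 <;> simp <;> first | ring1 | module

theorem adT_smul_right (t : ℝ) (u w : AlekT p) : adT u (t • w) = t • adT u w := by
  ext1 <;> simp <;> first | ring1 | module

variable (p) in
/-- The Levi-Civita connection of `l`. -/
def nabla : AlekT p →ₗ[ℝ] AlekT p →ₗ[ℝ] AlekT p :=
  LinearMap.mk₂ ℝ (fun u w => (1 / 2 : ℝ) • (⁅u, w⁆ - adT u w - adT w u))
    (fun u v w => by rw [add_lie, adT_add_left, adT_add_right]; module)
    (fun t u v => by rw [smul_lie, adT_smul_left, adT_smul_right]; module)
    (fun u v w => by rw [lie_add, adT_add_left, adT_add_right]; module)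
    (fun t u v => by rw [lie_smul, adT_smul_left, adT_smul_right]; module)

theorem nabla_apply (u w : AlekT p) :
    nabla p u w = (1 / 2 : ℝ) • (⁅u, w⁆ - adT u w - adT w u) := rfl

/-- The Koszul formula 2∇ᵤw = [u, w] - (ad u)ᵀw - (ad w)ᵀu: the transposes enter symmetrically and
cancel in the torsion, and skewness follows by moving them across the scalar product. -/
theorem isLeviCivita_nabla : IsLeviCivita (form p) (nabla p) where
  torsion_free u w := by
    rw [nabla_apply, nabla_apply, ← lie_skew u w]
    module
  metric u v w := by
    rw [form_comm v]
    simp only [nabla_apply, map_smul, map_sub, LinearMap.smul_apply, LinearMap.sub_apply,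
      form_adT, smul_eq_mul]
    rw [form_comm _ w, form_comm _ v, ← lie_skew v w, map_neg]
    ring

variable (p) in
/-- The first complex structure. -/
def J₁ : AlekT p →ₗ[ℝ] AlekT p where
  toFun u :=
    { h := -u.g
      g := u.h
      xa := -u.ra
      xb := -u.rb
      xX := -u.rX
      ra := u.xa
      rb := u.xb
      rX := u.xX
      k := (u.va + 2 * u.vb + u.n) / 2 - u.n
      va := -u.ya - (u.k - u.ya - 2 * u.yb) / 2
      vb := -u.yb - (u.k - u.ya - 2 * u.yb) / 2
      vX := -u.yX
      n := u.k - (u.k - u.ya - 2 * u.yb) / 2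
      ya := u.va - (u.va + 2 * u.vb + u.n) / 2
      yb := u.vb - (u.va + 2 * u.vb + u.n) / 2
      yX := u.vX }
  map_add' u v := by ext1 <;> simp <;> ring1
  map_smul' t u := by ext1 <;> simp <;> ring1

variable (p) in
/-- The second complex structure. -/
def J₂ : AlekT p →ₗ[ℝ] AlekT p where
  toFun u :=
    { h := (u.va + 2 * u.vb + u.n) / 2
      g := (-u.k + u.ya + 2 * u.yb) / 2
      xa := -u.vb + u.va / 2 + u.n / 2
      xb := -(u.va / 2) + u.n / 2
      xX := u.vX
      ra := u.k / 2 + u.yb - u.ya / 2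
      rb := u.k / 2 + u.ya / 2
      rX := -u.yX
      k := (u.g - u.ra - 2 * u.rb) / 2
      va := -(u.h / 2) + u.xb - u.xa / 2
      vb := -(u.h / 2) + u.xa / 2
      vX := -u.xX
      n := -((u.h + u.xa + 2 * u.xb) / 2)
      ya := -(u.g / 2) - u.rb + u.ra / 2
      yb := -(u.g / 2) - u.ra / 2
      yX := u.rX }
  map_add' u v := by ext1 <;> simp <;> ring1
  map_smul' t u := by ext1 <;> simp <;> ring1

end AlekT

end AlekseevskyMetric

/-! ### Covariant derivatives of the complex structures -/

section AlekseevskyParallel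

namespace AlekT

variable {p : ℕ}

theorem J₁_J₁ (u : AlekT p) : J₁ p (J₁ p u) = -u := by
  ext1 <;> simp [J₁] <;> ring1

theorem J₂_J₂ (u : AlekT p) : J₂ p (J₂ p u) = -u := by
  ext1 <;> simp [J₂] <;> ring1

theorem J₂_J₁ (u : AlekT p) : J₂ p (J₁ p u) = -J₁ p (J₂ p u) := by
  ext1 <;> simp [J₁, J₂] <;> ring1

theorem form_J₁ (u w : AlekT p) : form p (J₁ p u) (J₁ p w) = form p u w := by
  simp [form_apply, J₁]
  ring

theorem form_J₂ (u w : AlekT p) : form p (J₂ p u) (J₂ p w) = form p u w := by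
  simp [form_apply, J₂]
  ring

set_option maxHeartbeats 4000000 in
-- The coefficients, linear in u, are connection forms of the bundle spanned by J₁, J₂ and J₃ =
-- J₁J₂. They involve only the 𝔲̃-component of u, which reflects that 𝔲 is Kähler for J₁.
theorem nabla_J₁ (u w : AlekT p) : nabla p u (J₁ p w) = J₁ p (nabla p u w) +
    ((u.k - u.ya - 2 * u.yb) / 2) • J₂ p w - ((u.va + 2 * u.vb + u.n) / 2) • J₁ p (J₂ p w) := by
  ext1 <;> simp [nabla_apply, J₁, J₂, dotProduct_comm] <;> first | ring1 | module

set_option maxHeartbeats 4000000 in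
theorem nabla_J₂ (u w : AlekT p) : nabla p u (J₂ p w) = J₂ p (nabla p u w) -
    ((u.k - u.ya - 2 * u.yb) / 2) • J₁ p w - ((u.g + u.ra + 2 * u.rb) / 2) • J₁ p (J₂ p w) := by
  ext1 <;> simp [nabla_apply, J₁, J₂, dotProduct_comm] <;> first | ring1 | module

end AlekT

end AlekseevskyParallel

/-! ### Solvability and real eigenvalues -/

section AlekseevskySubalgebra

/-- An endomorphism that is triangular for a family of coordinates has only real eigenvalues. -/
theorem splits_charpoly_of_flag {V : Type*} [AddCommGroup V] [Module ℝ V]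
    [Module.Finite ℝ V] (f : Module.End ℝ V) (n : ℕ) (K : ℕ → V → Prop) (c : ℕ → ℝ)
    (hadd : ∀ i v w (t : ℝ), K i v → K i w → K i (v + t • w))
    (hstep : ∀ i < n, ∀ v, (∀ j < i, K j v) → K i (f v - c i • v))
    (hzero : ∀ v, (∀ j < n, K j v) → v = 0) : f.charpoly.Splits := by
  refine splits_charpoly_of_list f ((List.range n).map c) fun v => hzero _ ?_
  have key : ∀ k ≤ n, ∀ j < k,
      K j (((List.range k).map c).foldl (fun v c => f v - c • v) v) := by
    intro k
    induction k with
    | zero => exact fun _ j hj => absurd hj (Nat.not_lt_zero j)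
    | succ k ih =>
      intro hk j hj
      have ih' := ih (by omega)
      rw [List.range_succ, List.map_append, List.foldl_append]
      simp only [List.map_cons, List.map_nil, List.foldl_cons, List.foldl_nil]
      generalize ((List.range k).map c).foldl (fun v c => f v - c • v) v = w at *
      rcases Nat.lt_succ_iff_lt_or_eq.1 hj with h | rfl
      -- A later factor preserves the earlier conditions because f - cₖ = (f - cⱼ) + (cⱼ - cₖ).
      · have h1 := hstep j (by omega) w fun i hi => ih' i (by omega)
        have h2 := hadd j _ _ (c j - c k) h1 (ih' j h)
        rw [sub_smul] at h2
        rwa [sub_add_sub_cancel] at h2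
      · exact hstep j (by omega) w ih'
  exact key n le_rfl

namespace AlekT

variable {p : ℕ}

theorem isSolvable : LieAlgebra.IsSolvable (AlekT p) := by
  -- The chain removes in turn span {H₀, H₁, H₂}, the space 𝔵⁻ together with nothing from G₀ or J𝔟,
  -- then J𝔟, then 𝔲̃. The third member is the Heisenberg algebra spanned by 𝔲̃ and G₀, whose
  -- brackets lie in ℝG₀.
  let S : ℕ → Submodule ℝ (AlekT p) := fun k =>
    match k with
    | 0 => ⊤
    | 1 =>
      { carrier := {u | u.h = 0 ∧ u.xa = 0 ∧ u.xb = 0}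
        add_mem' := fun {u v} hu hv => by
          simp only [Set.mem_ofPred_eq] at hu hv ⊢
          simp [hu, hv]
        zero_mem' := by simp
        smul_mem' := fun t u hu => by
          simp only [Set.mem_ofPred_eq] at hu ⊢
          simp [hu] }
    | 2 =>
      { carrier := {u | u.h = 0 ∧ u.xa = 0 ∧ u.xb = 0 ∧ u.xX = 0}
        add_mem' := fun {u v} hu hv => by
          simp only [Set.mem_ofPred_eq] at hu hv ⊢
          simp [hu, hv]
        zero_mem' := by simp
        smul_mem' := fun t u hu => by
          simp only [Set.mem_ofPred_eq] at hu ⊢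
          simp [hu] }
    | 3 =>
      { carrier := {u | u.h = 0 ∧ u.xa = 0 ∧ u.xb = 0 ∧ u.xX = 0 ∧ u.ra = 0 ∧ u.rb = 0 ∧ u.rX = 0}
        add_mem' := fun {u v} hu hv => by
          simp only [Set.mem_ofPred_eq] at hu hv ⊢
          simp [hu, hv]
        zero_mem' := by simp
        smul_mem' := fun t u hu => by
          simp only [Set.mem_ofPred_eq] at hu ⊢
          simp [hu] }
    | 4 => Submodule.span ℝ {⟨0, 1, 0, 0, 0, 0, 0, 0, 0, 0, 0, 0, 0, 0, 0, 0⟩}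
    | _ => ⊥
  refine isSolvable_of_chain S rfl ?_ 5 rfl
  rintro (_ | _ | _ | _ | _ | k) u hu v hv
  · exact ⟨rfl, rfl, rfl⟩
  · obtain ⟨-, h2, h3⟩ := hu
    obtain ⟨-, h2', h3'⟩ := hv
    exact ⟨rfl, rfl, rfl, by simp [h2, h3, h2', h3']⟩
  · obtain ⟨-, h2, h3, h4⟩ := hu
    obtain ⟨-, h2', h3', h4'⟩ := hv
    refine ⟨rfl, rfl, rfl, ?_, ?_, ?_, ?_⟩ <;> simp [h2, h3, h4, h2', h3', h4']
  · obtain ⟨h1, h2, h3, h4, h5, h6, h7⟩ := hu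
    obtain ⟨h1', h2', h3', h4', h5', h6', h7'⟩ := hv
    refine Submodule.mem_span_singleton.2 ⟨(⁅u, v⁆ : AlekT p).g, ?_⟩
    ext1 <;> simp [h1, h2, h3, h4, h5, h6, h7, h1', h2', h3', h4', h5', h6', h7']
  · obtain ⟨s, rfl⟩ := Submodule.mem_span_singleton.1 hu
    obtain ⟨t, rfl⟩ := Submodule.mem_span_singleton.1 hv
    rw [smul_lie, lie_smul, lie_self, smul_zero, smul_zero]
    exact zero_mem _
  · have hu' : u = 0 := hu
    rw [hu', zero_lie]
    exact zero_mem _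

/-- The successive coordinates for which `ad u` is triangular. -/
def weightCoord (i : ℕ) (v : AlekT p) : Prop :=
  match i with
  | 0 => v.h = 0 ∧ v.xa = 0 ∧ v.xb = 0
  | 1 => v.xX = 0
  | 2 => v.rb = 0
  | 3 => v.rX = 0
  | 4 => v.ra = 0
  | 5 => v.k = 0
  | 6 => v.vb = 0
  | 7 => v.vX = 0
  | 8 => v.va = 0
  | 9 => v.ya = 0
  | 10 => v.yX = 0
  | 11 => v.yb = 0
  | 12 => v.n = 0
  | 13 => v.g = 0
  | _ => True

/-- The eigenvalues of `ad u`. -/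
def weight (u : AlekT p) (i : ℕ) : ℝ :=
  match i with
  | 0 => 0
  | 1 => (u.xa - u.xb) / 2
  | 2 => u.xb
  | 3 => (u.xa + u.xb) / 2
  | 4 => u.xa
  | 5 => u.h / 2 - (u.xa + 2 * u.xb) / 2
  | 6 => u.h / 2 - (u.xa + 2 * u.xb) / 2 + u.xb
  | 7 => u.h / 2 - (u.xa + 2 * u.xb) / 2 + (u.xa + u.xb) / 2
  | 8 => u.h / 2 - (u.xa + 2 * u.xb) / 2 + u.xa
  | 9 => u.h / 2 + (u.xa + 2 * u.xb) / 2 - u.xa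
  | 10 => u.h / 2 + (u.xa + 2 * u.xb) / 2 - (u.xa + u.xb) / 2
  | 11 => u.h / 2 + (u.xa + 2 * u.xb) / 2 - u.xb
  | 12 => u.h / 2 + (u.xa + 2 * u.xb) / 2
  | 13 => u.h
  | _ => 0

theorem splits_charpoly_ad (u : AlekT p) : (LieAlgebra.ad ℝ (AlekT p) u).charpoly.Splits := by
  refine splits_charpoly_of_flag _ 14 weightCoord (weight u) ?_ ?_ ?_
  · rintro (_ | _ | _ | _ | _ | _ | _ | _ | _ | _ | _ | _ | _ | _ | i) v w t hv hw <;>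
      simp_all [weightCoord]
  · rintro i hi v h
    interval_cases i <;>
      simp only [Nat.forall_lt_succ_right, Nat.not_lt_zero, IsEmpty.forall_iff, implies_true,
        weightCoord, true_and] at h <;>
      simp [weightCoord, weight, h] <;> first | ring1 | module
  · intro v h
    simp only [Nat.forall_lt_succ_right, Nat.not_lt_zero, IsEmpty.forall_iff, implies_true,
      weightCoord, true_and] at h
    ext1 <;> simp [h]

theorem isSplittableSolvable : IsSplittableSolvable (AlekT p) :=
  ⟨isSolvable, splits_charpoly_ad⟩

end AlekT

end AlekseevskySubalgebra

/-! ### The embedding of 𝔲₀(p, 2) as special Kähler subalgebra -/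

section SpecialKahlerSubalgebra

namespace AlekT

variable {p : ℕ}

theorem form_pos (u : AlekT p) (hu : u ≠ 0) : 0 < form p u u := by
  have hd : ∀ X : Fin p → ℝ, 0 ≤ X ⬝ᵥ X := fun X => by
    simpa using dotProduct_star_self_nonneg X
  have h0 : ∀ a : ℝ, 0 ≤ a * a := mul_self_nonneg
  rw [form_apply]
  by_contra! hle
  have hz : ∀ X : Fin p → ℝ, X ⬝ᵥ X ≤ 0 → X = 0 := fun X hX =>
    dotProduct_self_eq_zero.1 (le_antisymm hX (hd X))
  have hs : ∀ a : ℝ, a * a ≤ 0 → a = 0 := fun a ha =>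
    mul_self_eq_zero.1 (le_antisymm ha (h0 a))
  have h1 := h0 u.h
  have h2 := h0 u.g
  have h3 := h0 u.xa
  have h4 := h0 u.xb
  have h5 := hd u.xX
  have h6 := h0 u.ra
  have h7 := h0 u.rb
  have h8 := hd u.rX
  have h9 := h0 u.k
  have h10 := h0 u.va
  have h11 := h0 u.vb
  have h12 := hd u.vX
  have h13 := h0 u.n
  have h14 := h0 u.ya
  have h15 := h0 u.yb
  have h16 := hd u.yX
  refine hu ?_
  ext1 <;> first | exact hs _ (by linarith) | exact hz _ (by linarith)

theorem isAlekseevskian : IsAlekseevskian (form p) (J₁ p) (J₂ p) (J₁ p ∘ₗ J₂ p) where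
  symm := form_comm
  pos := form_pos
  sq₁ := J₁_J₁
  sq₂ := J₂_J₂
  mul₁₂ _ := rfl
  mul₂₁ := J₂_J₁
  orth₁ := form_J₁
  orth₂ := form_J₂
  parallel := by
    refine ⟨nabla p, isLeviCivita_nabla, fun u K hK => ?_⟩
    have key : ∀ a b c : ℝ, nabla p u ∘ₗ K - K ∘ₗ nabla p u =
        a • J₁ p + b • J₂ p + c • (J₁ p ∘ₗ J₂ p) →
        nabla p u ∘ₗ K - K ∘ₗ nabla p u ∈
          Submodule.span ℝ {J₁ p, J₂ p, J₁ p ∘ₗ J₂ p} := fun a b c h => by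
      rw [h]
      refine add_mem (add_mem ?_ ?_) ?_ <;>
        exact Submodule.smul_mem _ _ (Submodule.subset_span (by simp))
    rcases hK with rfl | rfl | rfl
    · refine key 0 ((u.k - u.ya - 2 * u.yb) / 2) (-((u.va + 2 * u.vb + u.n) / 2)) ?_
      refine LinearMap.ext fun w => ?_
      simp only [LinearMap.sub_apply, LinearMap.comp_apply, LinearMap.add_apply,
        LinearMap.smul_apply, nabla_J₁]
      module
    · refine key (-((u.k - u.ya - 2 * u.yb) / 2)) 0 (-((u.g + u.ra + 2 * u.rb) / 2)) ?_
      refine LinearMap.ext fun w => ?_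
      simp only [LinearMap.sub_apply, LinearMap.comp_apply, LinearMap.add_apply,
        LinearMap.smul_apply, nabla_J₂]
      module
    -- The derivative of J₁J₂ follows from those of J₁ and J₂ by the product rule, so no further
    -- computation in coordinates is needed.
    · refine key ((u.va + 2 * u.vb + u.n) / 2) ((u.g + u.ra + 2 * u.rb) / 2) 0 ?_
      refine LinearMap.ext fun w => ?_
      simp only [LinearMap.sub_apply, LinearMap.comp_apply, LinearMap.add_apply,
        LinearMap.smul_apply, nabla_J₁, nabla_J₂, map_sub, map_smul, map_neg, J₁_J₁, J₂_J₂]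
      module
  splittable := isSplittableSolvable
  nonabelian := by
    refine ⟨⟨1, 0, 0, 0, 0, 0, 0, 0, 0, 0, 0, 0, 0, 0, 0, 0⟩,
      ⟨0, 1, 0, 0, 0, 0, 0, 0, 0, 0, 0, 0, 0, 0, 0, 0⟩, fun h => ?_⟩
    simpa using congrArg g h

/-- The embedding of `u₀(p, 2)` into `l`. -/
@[simps]
def ofU0Fun (u : U0 p 2) : AlekT p where
  h := 0
  g := 0
  xa := u.1 (Sum.inl 0)
  xb := mu 2 * u.1 (Sum.inl 1)
  xX := tail u.1
  ra := u.2 (Sum.inl 0)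
  rb := mu 2 * u.2 (Sum.inl 1)
  rX := tail u.2
  k := 0
  va := 0
  vb := 0
  vX := 0
  n := 0
  ya := 0
  yb := 0
  yX := 0

@[simp] theorem xX_ofU0Fun (u : U0 p 2) : (ofU0Fun u).xX = tail u.1 := rfl
@[simp] theorem rX_ofU0Fun (u : U0 p 2) : (ofU0Fun u).rX = tail u.2 := rfl
@[simp] theorem vX_ofU0Fun (u : U0 p 2) : (ofU0Fun u).vX = 0 := rfl
@[simp] theorem yX_ofU0Fun (u : U0 p 2) : (ofU0Fun u).yX = 0 := rfl

variable (p) in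
/-- The embedding of `u₀(p, 2)` into `l`, as a homomorphism of Lie algebras. -/
def ofU0 : U0 p 2 →ₗ⁅ℝ⁆ AlekT p where
  toFun := ofU0Fun
  map_add' u w := by ext1 <;> simp [mul_add]
  map_smul' t u := by ext1 <;> simp [mul_left_comm]
  map_lie' {u w} := by
    ext1 <;> simp [dotProduct_comm]; ring1

theorem ofU0_apply (u : U0 p 2) : ofU0 p u = ofU0Fun u := rfl

variable (p) in
/-- The unit vector `H₀` in the key algebra `f₀`. -/
@[simps]
def genH₀ : AlekT p where
  h := 1
  g := 0
  xa := 0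
  xb := 0
  xX := 0
  ra := 0
  rb := 0
  rX := 0
  k := 0
  va := 0
  vb := 0
  vX := 0
  n := 0
  ya := 0
  yb := 0
  yX := 0

@[simp] theorem xX_genH₀ : (genH₀ p).xX = 0 := rfl
@[simp] theorem rX_genH₀ : (genH₀ p).rX = 0 := rfl
@[simp] theorem vX_genH₀ : (genH₀ p).vX = 0 := rfl
@[simp] theorem yX_genH₀ : (genH₀ p).yX = 0 := rfl

variable (p) in
/-- The Kähler subalgebra `u = f₀ ⊕ u₀` of `l`. -/
def subU : Submodule ℝ (AlekT p) where
  carrier := {u | u.k = 0 ∧ u.va = 0 ∧ u.vb = 0 ∧ u.vX = 0 ∧ u.n = 0 ∧ u.ya = 0 ∧ u.yb = 0 ∧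
    u.yX = 0}
  add_mem' {u w} hu hw := by
    simp only [Set.mem_ofPred_eq] at hu hw ⊢
    simp [hu, hw]
  zero_mem' := by simp
  smul_mem' t u hu := by
    simp only [Set.mem_ofPred_eq] at hu ⊢
    simp [hu]

theorem mem_subU {u : AlekT p} : u ∈ subU p ↔ u.k = 0 ∧ u.va = 0 ∧ u.vb = 0 ∧ u.vX = 0 ∧
    u.n = 0 ∧ u.ya = 0 ∧ u.yb = 0 ∧ u.yX = 0 := Iff.rfl

theorem mem_map_J₂_subU {u : AlekT p} : u ∈ (subU p).map (J₂ p) ↔ u.h = 0 ∧ u.g = 0 ∧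
    u.xa = 0 ∧ u.xb = 0 ∧ u.xX = 0 ∧ u.ra = 0 ∧ u.rb = 0 ∧ u.rX = 0 := by
  constructor
  · rintro ⟨w, hw, rfl⟩
    obtain ⟨h1, h2, h3, h4, h5, h6, h7, h8⟩ := mem_subU.1 hw
    simp [J₂, h1, h2, h3, h4, h5, h6, h7, h8]
  · rintro ⟨h1, h2, h3, h4, h5, h6, h7, h8⟩
    refine ⟨-J₂ p u, mem_subU.2 ?_, by rw [map_neg, J₂_J₂, neg_neg]⟩
    simp [J₂, h1, h2, h3, h4, h5, h6, h7, h8]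

theorem subU_eq_span :
    subU p = Submodule.span ℝ ({genH₀ p, J₁ p (genH₀ p)} ∪ Set.range (ofU0 p)) := by
  have hmu : mu 2 ≠ 0 := fun h => by simpa [h] using mul_mu_sq (s := 2) (by norm_num)
  refine le_antisymm (fun u hu => ?_) (Submodule.span_le.2 ?_)
  · obtain ⟨h1, h2, h3, h4, h5, h6, h7, h8⟩ := mem_subU.1 hu
    have : u = u.h • genH₀ p + u.g • J₁ p (genH₀ p) +
        ofU0 p (mkU0 p 2 (vec u.xa ((mu 2)⁻¹ * u.xb) u.xX) (vec u.ra ((mu 2)⁻¹ * u.rb) u.rX)) := by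
      ext1 <;> simp [ofU0_apply, J₁, *]
    rw [this]
    refine add_mem (add_mem ?_ ?_) ?_
    · exact Submodule.smul_mem _ _ (Submodule.subset_span (by simp))
    · exact Submodule.smul_mem _ _ (Submodule.subset_span (by simp))
    · exact Submodule.subset_span (by simp)
  · rintro _ ((rfl | rfl) | ⟨w, rfl⟩) <;>
      simp [mem_subU, J₁, ofU0_apply]

/-- The coordinates with index b are μ times the orthonormal ones. Their weight 2 in the form is
compensated by 2μ² = 1. -/
theorem form_ofU0 (u w : U0 p 2) : form p (ofU0 p u) (ofU0 p w) = metric p 2 u w := by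
  have h := mul_mu_sq (s := 2) (by norm_num)
  push_cast at h
  simp [form_apply, ofU0_apply, metric_apply, dotProduct_idx]
  linear_combination (u.1 (Sum.inl 1) * w.1 (Sum.inl 1) + u.2 (Sum.inl 1) * w.2 (Sum.inl 1)) * h

end AlekT

open AlekT in
theorem isSpecialKahlerSubalgebra (p : ℕ) :
    IsSpecialKahlerSubalgebra (metric p 2) (complexStructure p 2) := by
  refine ⟨AlekT p, inferInstance, inferInstance, inferInstance, form p, J₁ p, J₂ p,
    J₁ p ∘ₗ J₂ p, ofU0 p, genH₀ p, subU p, isAlekseevskian, ?_, fun u => ⟨?_, ?_, ?_, ?_⟩,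
    form_ofU0, fun u => ?_, subU_eq_span, ?_, fun u hu w hw => ?_, fun u hu w hw => ?_,
    fun u hu w hw => ?_⟩
  · exact {
      root_pos := one_pos
      unit := by simp [form_apply]
      orth := by simp
      invariant := by simp
      key := by ext1 <;> simp [J₁]
      ad_H := by simp
      ad_G := by simp
      bracket := by simp }
  · simp [form_apply, ofU0_apply]
  · simp [form_apply, ofU0_apply, J₁]
  · ext1 <;> simp [ofU0_apply]
  · ext1 <;> simp [ofU0_apply, J₁]
  · ext1 <;> simp [ofU0_apply, J₁]
  · refine eq_top_iff.2 fun u _ => ?_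
    have : u = ⟨u.h, u.g, u.xa, u.xb, u.xX, u.ra, u.rb, u.rX, 0, 0, 0, 0, 0, 0, 0, 0⟩ +
        ⟨0, 0, 0, 0, 0, 0, 0, 0, u.k, u.va, u.vb, u.vX, u.n, u.ya, u.yb, u.yX⟩ := by
      ext1 <;> simp
    rw [this]
    exact Submodule.add_mem_sup (mem_subU.2 (by simp)) (mem_map_J₂_subU.2 (by simp))
  all_goals
    obtain ⟨h1, h2, h3, h4, h5, h6, h7, h8⟩ := mem_subU.1 hu
    obtain ⟨k1, k2, k3, k4, k5, k6, k7, k8⟩ := mem_subU.1 hw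
  · simp [form_apply, J₂, *]
  · rw [mem_map_J₂_subU]
    simp [J₂, *]
  · rw [mem_subU]
    simp [J₂, *]

end SpecialKahlerSubalgebra

end SpecialGeometry

end

open SpecialGeometry
theorem mainTheorem8 (p s : ℕ) (hs : 1 ≤ s) :
    -- the algebra and its decompositions
    IsRankTwoSum (metric p s) (complexStructure p s) p 1 (1 / Real.sqrt s)
      (genH p s 0) (genH p s 1) (xMinus p s) ∧
    IsTypeIDecomposition (metric p s) (complexStructure p s)
      (algB p s) (algB₀ p s) (vecB₀ p s) ∧
    -- normal J-algebra of degree `s + 1`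
    IsNormalJAlgebra (metric p s) (complexStructure p s) ∧
    IsOfDegree (metric p s) (complexStructure p s) (s + 1) ∧
    -- invariance of the polynomial
    (∀ u ∈ algB₀ p s, ∀ y, polyDeriv (basicPoly p s) y (adJB p s u *ᵥ y) = 0) ∧
    -- the orbit is a homogeneous Riemannian hypersurface of constant negative curvature
    IsRiemannianHypersurface (basicPoly p s) (s + 1) (orbit p s) ∧
    IsHomogeneousHypersurface (basicPoly p s) (orbit p s) ∧
    (∃ κ : ℝ, κ < 0 ∧
      HypersurfaceHasConstantCurvature (basicPoly p s) (s + 1) (orbit p s) κ) ∧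
    -- the Iwasawa algebra and the Iwasawa group
    (∃ φ : iwasawaAlgebra p ≃ₗ⁅ℝ⁆ algB₀ p s, IwasawaActsSimplyTransitively p s φ) ∧
    -- the associated Siegel domain
    IsSiegelDomainTypeI (cone (orbit p s)) ∧
    (∃ c : ℝ, 0 < c ∧ IsKahlerLieAlgebraFor (metric p s) (complexStructure p s)
      (tube (orbit p s)) fun z v w => c * tubeMetric (basicPoly p s) (s + 1) z v w) ∧
    (1 ≤ p → IsRiemannianSymmetric (tube (orbit p s)) (tubeMetric (basicPoly p s) (s + 1)) →
      s + 1 = 2) ∧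
    (s + 1 = 2 → IsIsometricToSymmetricSpace 2 (p + 2) (tube (orbit p s))
      (tubeMetric (basicPoly p s) (s + 1))) ∧
    -- the cubic case
    (s + 1 = 3 → IsSpecialKahler (tube (orbit p s)) (tubeMetric (basicPoly p s) (s + 1)) ∧
      IsSpecialKahlerSubalgebra (metric p s) (complexStructure p s)) := by
  have hK := isKahlerLieAlgebraFor_tube p hs
  refine ⟨isRankTwoSum p s hs, isTypeIDecomposition p s hs, isNormalJAlgebra p s hs,
    ⟨Idx p, inferInstance, inferInstance, basicPoly p s, orbit p s, hK.choose,
      hK.choose_spec.1, isRiemannianHypersurface_orbit hs, isHomogeneousHypersurface_orbit hs,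
      hK.choose_spec.2⟩,
    fun u hu y => polyDeriv_basicPoly_adJB hs u hu y, isRiemannianHypersurface_orbit hs,
    isHomogeneousHypersurface_orbit hs,
    ⟨_, by have : (0 : ℝ) < s := by exact_mod_cast hs
           rw [neg_lt_zero]; positivity, hypersurfaceHasConstantCurvature_orbit hs⟩,
    ⟨iwasawaEquiv hs, iwasawaActs hs⟩, isSiegelDomainTypeI_cone_orbit hs, hK,
    fun hp hsym => degree_eq_two_of_isRiemannianSymmetric hs hp hsym, fun h => ?_, fun h => ?_⟩
  · obtain rfl : s = 1 := by omega
    exact isIsometricToSymmetricSpace_tube p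
  · obtain rfl : s = 2 := by omega
    exact ⟨isSpecialKahler_tube p, isSpecialKahlerSubalgebra p⟩
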